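/- **Setting.** Let $n\ge 2$ and let $C_O=\{y^0=r\}\subset\mathbf R^{n+1}$, $r=|y|=(\sum_{i=1}^n (y^i)^2)^{1/2}$, be the Minkowskian light cone, parametrised by $y=(y^1,\dots,y^n)\in\mathbf R^n$; for $T>0$ let $C_O^T$ denote its part $0<r<T$. Use adapted null coordinates $x^0=r-y^0$, $x^1=r$, and $x^A$ ($A=2,\dots,n$) arbitrary local coordinates on the unit sphere $S^{n-1}$, with round metric $s_{AB}dx^Adx^B$. On the cone consider a quadratic form $$\overline g_{00}(dx^0)^2+2\nu_0dx^0dx^1+2\nu_Adx^0dx^A+\overline g_{AB}dx^Adx^B ,$$ where $\tilde g=\overline g_{AB}dx^Adx^B$ is degenerate exactly in the direction $\partial_1$ of the null rays and $(\overline g_{AB})$ is positive definite. Put $\nu^0=1/\nu_0$, $\nu^A=\overline g^{AB}\nu_B$, $\overline g^{11}=(\nu^0)^2(-\overline g_{00}+\nu^A\nu_A)$, $\chi_A{}^B=\frac12\overline g^{BC}\partial_1\overline g_{AC}$, $\tau=\chi_A{}^A$, $\sigma_A{}^B=\chi_A{}^B-\frac{\tau}{n-1}\delta_A^B$, $|\sigma|^2=\sigma_A{}^B\sigma_B{}^A$;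 let $\tilde\nabla,\tilde\Gamma^A_{BC},\tilde R$ be the Levi-Civita connection, Christoffel symbols and scalar curvature of the $r$-dependent metric $\overline g_{AB}$, and $S^A_{BC}$ the Christoffel symbols of $s_{AB}$. For the Minkowski target metric set $\overline W^0=\overline W^1=-r\,\overline g^{AB}s_{AB}$, $\overline W_1=\nu_0\overline W^0$, $\overline W^A=-\frac2r\nu^0\nu^A+\overline g^{BC}S^A_{BC}$, and $$\xi_A=-2\nu^0\partial_1\nu_A+4\nu^0\nu_B\chi_A{}^B+\nu^0\nu_A\overline W_1+\overline g_{AB}\overline W^B-\overline g_{AB}\overline g^{CD}\tilde\Gamma^B_{CD}.$$ The *vacuum Einstein wave-map gauge constraints* are, in all local coordinates $x^A$, the equations $\mathcal C_1=0$, $\mathcal C_A=0$, $\mathcal C_0=0$, where $$\mathcal C_1=-\partial_1\tau+\big(\nu^0\partial_1\nu_0-\tfrac12(\overline W_1+\tau)\big)\tau-|\sigma|^2-\tfrac{\tau^2}{n-1},$$ $$\mathcal C_A=-\tfrac12(\partial_1\xi_A+\tau\xi_A)+\tilde\nabla_B\chi_A{}^B-\tfrac12\partial_A(\tau-\overline W_1+2\nu^0\partial_1\nu_0),$$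 $$-2\nu^0\mathcal C_0=2(\partial_1+\hat\kappa)^2\overline g^{11}+3\tau(\partial_1+\hat\kappa)\overline g^{11}+(\partial_1\tau+\tau^2)\overline g^{11}+2(\partial_1+\hat\kappa+\tau)\overline W^1+\tilde R-\tfrac12\overline g^{AB}\xi_A\xi_B+\overline g^{AB}\tilde\nabla_A\xi_B,$$ with $\hat\kappa=\nu^0\partial_1\nu_0-\frac12(\overline W_1+\tau)$. **Admissibility.** Fix an integer $p\ge1$ ($p=2$ is the behaviour in normal coordinates at the vertex), and $k\in\{2,3,\dots,\infty\}$. A function or a tensor field on $C_O^T$ (given by its components in the coordinates $y$) is *of class $(N,q)$* if it is $C^N$ on $C_O^T$ and its $y$-derivatives of each order $m\le N$ are $O(r^{q-m})$ as $r\to0$. A degenerate form $\tilde g$ as above is *$N$-admissible* if $\tilde g-r^2s_{AB}dx^Adx^B$ is of class $(N,p)$ (so $\overline g_{AB}=r^2(s_{AB}+O(r^p))$, with corresponding derivative estimates). Coefficients $(\nu_0,\nu_A,\overline g_{00})$ are *admissible* if $\nu_0>0$ and $\nu_0-1$, $\nu_Adx^A$, $\overline g_{00}+1$ are of class $(k,p)$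 (so $\nu_0=1+O(r^p)$, $\nu_A=O(r^{p+1})$, $\overline g_{00}=-1+O(r^p)$). The *vertex limits* are, along each null ray as $r\to 0$, $\nu_0\to1$, $r^{-1}\nu_A\to0$, $\overline g_{00}\to-1$, $r^{-2}\overline g_{AB}\to s_{AB}$. **Theorem.** Let $T_0>0$. 1. Let $\tilde g$ be a $(k+4)$-admissible degenerate form on $C_O^{T_0}$. There are $T\in(0,T_0]$ and admissible coefficients $\nu_0,\nu_A,\overline g_{00}$ on $C_O^T$ satisfying the three constraints. They are unique, on every $C_O^{T'}$ with $0<T'\le T$, among $C^2$ coefficients with the vertex limits: $\nu_0$ (nonvanishing) is determined by $\mathcal C_1=0$; then $\nu_A$ by $\mathcal C_A=0$; then $\overline g_{00}$ by $\mathcal C_0=0$. 2. Let $\gamma$ be a degenerate form on $C_O^{T_0}$ which is pointwise a positive multiple of a $(k+5)$-admissible form, and let $\kappa$ be a function of class $(k+4,p-1)$ on $C_O^{T_0}$. There are $T\in(0,T_0]$, a $(k+4)$-admissible form $\tilde g$ conformal to $\gamma$ on $C_O^T$, and admissible coefficients $\nu_0,\nu_A,\overline g_{00}$ on $C_O^T$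 satisfying the three constraints and $$\partial_1\nu_0=\tfrac12(\overline W_1+\tau)\nu_0+\kappa\nu_0 .$$ On every $C_O^{T'}$ with $0<T'\le T$, the pair $(\tilde g,\nu_0)$ is determined by this equation, $\mathcal C_1=0$, the conformal class of $\gamma$ and the vertex limits: it is the only pair of $C^2$ fields with $\tilde g$ conformal to $\gamma$ (or to any form conformal to $\gamma$), $\nu_0$ nonvanishing, which has these properties. Then $\nu_A$ and $\overline g_{00}$ are determined, uniquely among $C^2$ fields with the vertex limits, by $\mathcal C_A=0$ and $\mathcal C_0=0$ as in part 1. -/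

import Mathlib

open Set Filter Topology Asymptotics
open scoped ContDiff

/-!
# The wave-map gauge constraints on a light cone (Minkowski target, vacuum)

The cone `C_O = {y⁰ = r}` in `ℝ^{n+1}` is parametrised by the spatial coordinates
`y = (y¹,…,yⁿ) ∈ ℝⁿ`, so that `r = ‖y‖`, the vertex is `y = 0`, and the null rays are
`r ↦ r • θ` with `‖θ‖ = 1`.  In adapted null coordinates `x⁰ = r - y⁰`, `x¹ = r`, `x^A` (local
coordinates on the unit sphere) the trace on the cone of the spacetime metric reads
`g₀₀ (dx⁰)² + 2 ν₀ dx⁰ dx¹ + 2 ν_A dx⁰ dx^A + g_{AB} dx^A dx^B`.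
-/

noncomputable section

namespace LightCone

/-- Euclidean space `ℝⁿ`. -/
abbrev Euc (n : ℕ) : Type := EuclideanSpace ℝ (Fin n)

/-! ### Operators in adapted null coordinates

Below, `d = n - 1` is the dimension of the sphere, and a field is a function of `r = x¹` and of the
angular coordinates `x = (x^A)`. -/

section Coordinates

/-- Scalar functions of `(r, x^A)`. -/
abbrev Fld (d : ℕ) : Type := ℝ → Euc d → ℝ

variable {d : ℕ}

/-- `∂₁ = ∂/∂r`. -/
def pr (f : Fld d) : Fld d := fun r x => deriv (fun ρ => f ρ x) r

/-- `∂_A = ∂/∂x^A`. -/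
def pa (A : Fin d) (f : Fld d) : Fld d :=
  fun r x => fderiv ℝ (f r) x (EuclideanSpace.single A 1)

/-- The inverse matrix `g^{AB}` of `g_{AB}`. -/
def gInv (g : Fin d → Fin d → Fld d) (A B : Fin d) : Fld d :=
  fun r x => (Matrix.of fun C D => g C D r x)⁻¹ A B

/-- The Christoffel symbols `Γ^C_{AB}` of the `r`-dependent metric `g_{AB}`. -/
def christoffel (g : Fin d → Fin d → Fld d) (C A B : Fin d) : Fld d := fun r x =>
  (1 / 2) * ∑ D, gInv g C D r x * (pa A (g B D) r x + pa B (g A D) r x - pa D (g A B) r x)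

/-- The Ricci tensor of the `r`-dependent metric `g_{AB}`. -/
def ricci (g : Fin d → Fin d → Fld d) (A B : Fin d) : Fld d := fun r x =>
  ∑ C, pa C (christoffel g C A B) r x - ∑ C, pa A (christoffel g C B C) r x
    + ∑ C, ∑ D, (christoffel g C A B r x * christoffel g D C D r x
      - christoffel g C A D r x * christoffel g D B C r x)

/-- The scalar curvature of the `r`-dependent metric `g_{AB}`. -/
def scalarCurvature (g : Fin d → Fin d → Fld d) : Fld d := fun r x =>
  ∑ A, ∑ B, gInv g A B r x * ricci g A B r x

/-- The null second fundamental form `χ_A^B = ½ g^{BC} ∂₁ g_{AC}`. -/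
def chi (g : Fin d → Fin d → Fld d) (A B : Fin d) : Fld d := fun r x =>
  (1 / 2) * ∑ C, gInv g B C r x * pr (g A C) r x

/-- The expansion `τ = χ_A^A`. -/
def tau (g : Fin d → Fin d → Fld d) : Fld d := fun r x => ∑ A, chi g A A r x

/-- The shear `σ_A^B = χ_A^B - τ δ_A^B / (n - 1)`. -/
def sigma (g : Fin d → Fin d → Fld d) (A B : Fin d) : Fld d := fun r x =>
  chi g A B r x - (if A = B then tau g r x / d else 0)

/-- `|σ|² = σ_A^B σ_B^A`. -/
def sigmaSq (g : Fin d → Fin d → Fld d) : Fld d := fun r x =>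
  ∑ A, ∑ B, sigma g A B r x * sigma g B A r x

/-- The divergence `∇_B χ_A^B`. -/
def divChi (g : Fin d → Fin d → Fld d) (A : Fin d) : Fld d := fun r x =>
  ∑ B, (pa B (chi g A B) r x + ∑ C, (christoffel g B B C r x * chi g A C r x
    - christoffel g C B A r x * chi g C B r x))

/-- `ν^A = g^{AB} ν_B`. -/
def nuUp (g : Fin d → Fin d → Fld d) (ν : Fin d → Fld d) (A : Fin d) : Fld d := fun r x =>
  ∑ B, gInv g A B r x * ν B r x

/-- The component `g^{11} = (ν^0)² (-g₀₀ + ν^A ν_A)` of the inverse spacetime metric, with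
`ν^0 = 1 / ν₀`. -/
def gInv11 (g : Fin d → Fin d → Fld d) (ν₀ : Fld d) (ν : Fin d → Fld d) (g₀₀ : Fld d) :
    Fld d := fun r x =>
  (1 / ν₀ r x) ^ 2 * (- g₀₀ r x + ∑ A, nuUp g ν A r x * ν A r x)

/-- The wave-map gauge components `W^0 = W^1 = - r g^{AB} s_{AB}`, for the Minkowski target
(`W^λ = g^{αβ} Γ̂^λ_{αβ}` with `Γ̂` the Christoffel symbols of the Minkowski metric). -/
def Wzero (s g : Fin d → Fin d → Fld d) : Fld d := fun r x =>
  - r * ∑ A, ∑ B, gInv g A B r x * s A B r x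

/-- `W_1 = ν₀ W^0`. -/
def Wone (s g : Fin d → Fin d → Fld d) (ν₀ : Fld d) : Fld d := fun r x =>
  ν₀ r x * Wzero s g r x

/-- The wave-map gauge components `W^A = - (2/r) ν^0 ν^A + g^{BC} S^A_{BC}`, where `S` are the
Christoffel symbols of the round metric `s`. -/
def Wang (s g : Fin d → Fin d → Fld d) (ν₀ : Fld d) (ν : Fin d → Fld d) (A : Fin d) : Fld d :=
  fun r x => - (2 / r) * (1 / ν₀ r x) * nuUp g ν A r x
    + ∑ B, ∑ C, gInv g B C r x * christoffel s A B C r x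

/-- The vector
`ξ_A = - 2 ν^0 ∂₁ν_A + 4 ν^0 ν_B χ_A^B + ν^0 ν_A W_1 + g_{AB} W^B - g_{AB} g^{CD} Γ̃^B_{CD}`. -/
def xi (s g : Fin d → Fin d → Fld d) (ν₀ : Fld d) (ν : Fin d → Fld d) (A : Fin d) : Fld d :=
  fun r x => - 2 * (1 / ν₀ r x) * pr (ν A) r x
    + 4 * (1 / ν₀ r x) * ∑ B, ν B r x * chi g A B r x
    + (1 / ν₀ r x) * ν A r x * Wone s g ν₀ r x
    + ∑ B, g A B r x * Wang s g ν₀ ν B r x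
    - ∑ B, g A B r x * ∑ C, ∑ D, gInv g C D r x * christoffel g B C D r x

/-- `ν^0 ∂₁ν₀ - ½ (W_1 + τ)`. -/
def kappaOf (s g : Fin d → Fin d → Fld d) (ν₀ : Fld d) : Fld d := fun r x =>
  (1 / ν₀ r x) * pr ν₀ r x - (1 / 2) * (Wone s g ν₀ r x + tau g r x)

/-- The constraint operator `𝒞₁`. -/
def C1 (s g : Fin d → Fin d → Fld d) (ν₀ : Fld d) : Fld d := fun r x =>
  - pr (tau g) r x
    + ((1 / ν₀ r x) * pr ν₀ r x - (1 / 2) * (Wone s g ν₀ r x + tau g r x)) * tau g r x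
    - sigmaSq g r x - tau g r x ^ 2 / d

/-- The constraint operator `𝒞_A`. -/
def CA (s g : Fin d → Fin d → Fld d) (ν₀ : Fld d) (ν : Fin d → Fld d) (A : Fin d) : Fld d :=
  fun r x => - (1 / 2) * (pr (xi s g ν₀ ν A) r x + tau g r x * xi s g ν₀ ν A r x)
    + divChi g A r x
    - (1 / 2) * pa A (fun r' x' => tau g r' x' - Wone s g ν₀ r' x'
        + 2 * (1 / ν₀ r' x') * pr ν₀ r' x') r x

/-- The operator `f ↦ (∂₁ + κ) f`, with `κ = ν^0 ∂₁ν₀ - ½ (W_1 + τ)`. -/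
def prk (s g : Fin d → Fin d → Fld d) (ν₀ f : Fld d) : Fld d := fun r x =>
  pr f r x + kappaOf s g ν₀ r x * f r x

/-- The constraint operator `𝒞₀` in vacuum (reduced by means of the other constraints), given by
`-2 ν^0 𝒞₀ = 2 (∂₁+κ)² g^{11} + 3 τ (∂₁+κ) g^{11} + (∂₁τ + τ²) g^{11} + 2 (∂₁+κ+τ) W^1
  + R̃ - ½ g^{AB} ξ_A ξ_B + g^{AB} ∇_A ξ_B`. -/
def C0 (s g : Fin d → Fin d → Fld d) (ν₀ : Fld d) (ν : Fin d → Fld d) (g₀₀ : Fld d) : Fld d :=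
  fun r x => - (ν₀ r x / 2) *
    (2 * prk s g ν₀ (prk s g ν₀ (gInv11 g ν₀ ν g₀₀)) r x
    + 3 * tau g r x * prk s g ν₀ (gInv11 g ν₀ ν g₀₀) r x
    + (pr (tau g) r x + tau g r x ^ 2) * gInv11 g ν₀ ν g₀₀ r x
    + 2 * (prk s g ν₀ (Wzero s g) r x + tau g r x * Wzero s g r x)
    + scalarCurvature g r x
    - (1 / 2) * ∑ A, ∑ B, gInv g A B r x * xi s g ν₀ ν A r x * xi s g ν₀ ν B r x
    + ∑ A, ∑ B, gInv g A B r x * (pa A (xi s g ν₀ ν B) r x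
        - ∑ C, christoffel g C A B r x * xi s g ν₀ ν C r x))

end Coordinates

/-! ### Fields on the cone and their components -/

/-- The set `{0 < r < T}` of the cone (without its vertex), in the coordinates `y`. -/
def coneRegion (n : ℕ) (T : ℝ) : Set (Euc n) := {y | 0 < ‖y‖ ∧ ‖y‖ < T}

/-- Local coordinates `x^A` on the unit sphere `S^{n-1} ⊆ ℝⁿ`: an injective smooth immersion `Θ`
of an open set `U ⊆ ℝ^{n-1}` into the sphere. -/
structure SpherePatch (n : ℕ) where
  U : Set (Euc (n - 1))
  isOpen_U : IsOpen U
  Θ : Euc (n - 1) → Euc n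
  contDiffOn : ContDiffOn ℝ ∞ Θ U
  norm_eq_one : ∀ x ∈ U, ‖Θ x‖ = 1
  injOn : InjOn Θ U
  immersion : ∀ x ∈ U, Function.Injective (fderiv ℝ Θ x)

/-- Fields of bilinear forms on (the tangent spaces of) the cone, in the coordinates `y`. -/
abbrev FormField (n : ℕ) : Type := Euc n → (Euc n →L[ℝ] Euc n →L[ℝ] ℝ)

/-- Fields of one-forms on the cone, in the coordinates `y`. -/
abbrev CovectorField (n : ℕ) : Type := Euc n → (Euc n →L[ℝ] ℝ)

namespace SpherePatch

variable {n : ℕ} (P : SpherePatch n)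

/-- `∂Θ/∂x^A`. -/
def dΘ (x : Euc (n - 1)) (A : Fin (n - 1)) : Euc n :=
  fderiv ℝ P.Θ x (EuclideanSpace.single A 1)

/-- The coefficients `s_{AB}` of the round metric of the unit sphere. -/
def round (A B : Fin (n - 1)) : Fld (n - 1) := fun _ x => inner ℝ (P.dΘ x A) (P.dΘ x B)

/-- The expression of a function on the cone in the coordinates `(r, x^A)`. -/
def scalar (f : Euc n → ℝ) : Fld (n - 1) := fun r x => f (r • P.Θ x)

/-- The components `ν_A = ν(∂_A)`, where `∂_A = r ∂Θ/∂x^A` at the point `y = r Θ(x)`. -/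
def covector (ν : CovectorField n) (A : Fin (n - 1)) : Fld (n - 1) :=
  fun r x => ν (r • P.Θ x) (r • P.dΘ x A)

/-- The components `g_{AB} = G(∂_A, ∂_B)`. -/
def form (G : FormField n) (A B : Fin (n - 1)) : Fld (n - 1) :=
  fun r x => G (r • P.Θ x) (r • P.dΘ x A) (r • P.dΘ x B)

end SpherePatch

/-! ### The vacuum wave-map gauge constraints on `{0 < r < T}` -/

variable {n : ℕ}

/-- `𝒞₁ = 0`. -/
def FirstConstraint (T : ℝ) (G : FormField n) (ν₀ : Euc n → ℝ) : Prop :=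
  ∀ P : SpherePatch n, ∀ r ∈ Ioo 0 T, ∀ x ∈ P.U,
    C1 P.round (P.form G) (P.scalar ν₀) r x = 0

/-- `𝒞_A = 0`. -/
def SecondConstraint (T : ℝ) (G : FormField n) (ν₀ : Euc n → ℝ) (ν : CovectorField n) : Prop :=
  ∀ P : SpherePatch n, ∀ r ∈ Ioo 0 T, ∀ x ∈ P.U, ∀ A : Fin (n - 1),
    CA P.round (P.form G) (P.scalar ν₀) (P.covector ν) A r x = 0

/-- `𝒞₀ = 0`. -/
def ThirdConstraint (T : ℝ) (G : FormField n) (ν₀ : Euc n → ℝ) (ν : CovectorField n)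
    (g₀₀ : Euc n → ℝ) : Prop :=
  ∀ P : SpherePatch n, ∀ r ∈ Ioo 0 T, ∀ x ∈ P.U,
    C0 P.round (P.form G) (P.scalar ν₀) (P.covector ν) (P.scalar g₀₀) r x = 0

/-- The equation `∂₁ν₀ = ½ (W_1 + τ) ν₀ + κ ν₀` linking `ν₀` to `κ`. -/
def NuZeroEquation (T : ℝ) (G : FormField n) (κ ν₀ : Euc n → ℝ) : Prop :=
  ∀ P : SpherePatch n, ∀ r ∈ Ioo 0 T, ∀ x ∈ P.U,
    pr (P.scalar ν₀) r x
      = (1 / 2) * (Wone P.round (P.form G) (P.scalar ν₀) r x + tau (P.form G) r x)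
          * P.scalar ν₀ r x
        + P.scalar κ r x * P.scalar ν₀ r x

/-! ### Degenerate forms, admissibility, vertex limits -/

/-- `G` is, at each point with `0 < r < T`, a symmetric positive semidefinite form whose kernel is
exactly the direction `∂₁ = y / r` of the null ray, i.e. `G = g_{AB} dx^A dx^B` with `g_{AB}`
positive definite. -/
def IsDegenerateForm (T : ℝ) (G : FormField n) : Prop :=
  ∀ y ∈ coneRegion n T, (∀ v w, G y v w = G y w v) ∧ (∀ v, G y y v = 0) ∧
    ∀ v, (∀ c : ℝ, v ≠ c • y) → 0 < G y v v

/-- The Euclidean inner product as a continuous bilinear form. -/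
def euclideanForm (n : ℕ) : Euc n →L[ℝ] Euc n →L[ℝ] ℝ :=
  (isBoundedBilinearMap_inner (𝕜 := ℝ) (E := Euc n)).toContinuousLinearMap

/-- The form `r² s_{AB} dx^A dx^B` induced on the cone by the Minkowski metric:
`(v, w) ↦ ⟪v, w⟫ - ⟪y, v⟫ ⟪y, w⟫ / r²`. -/
def roundForm (n : ℕ) : FormField n := fun y =>
  euclideanForm n - (‖y‖ ^ 2)⁻¹ • (euclideanForm n y).smulRight (euclideanForm n y)

theorem roundForm_apply (n : ℕ) (y v w : Euc n) :
    roundForm n y v w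
      = inner ℝ v w - (‖y‖ ^ 2)⁻¹ * (inner ℝ y v * inner ℝ y w) := by
  simp [roundForm, euclideanForm]

/-- `f` is of class `C^N` for `0 < r < T`, and its derivatives of order `m ≤ N` with respect to
the coordinates `y` are `O(r^(q - m))` at the vertex. -/
def VertexClass {F : Type*} [NormedAddCommGroup F] [NormedSpace ℝ F] (N : ℕ∞) (q : ℤ) (T : ℝ)
    (f : Euc n → F) : Prop :=
  ContDiffOn ℝ N f (coneRegion n T) ∧
    ∀ m : ℕ, (m : ℕ∞) ≤ N →
      (fun y => iteratedFDeriv ℝ m f y) =O[𝓝[≠] 0] fun y => ‖y‖ ^ (q - (m : ℤ))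

/-- Admissible degenerate quadratic forms on the cone; in adapted coordinates the vertex
condition says `∂_r^i ∂_{x}^α (g_{AB} - r² s_{AB}) = O(r^(p + 2 - i))` for `i + |α| ≤ N`. -/
def IsAdmissibleForm (N : ℕ∞) (p : ℕ) (T : ℝ) (G : FormField n) : Prop :=
  IsDegenerateForm T G ∧ VertexClass N p T (fun y => G y - roundForm n y)

/-- Pointwise conformality on `{0 < r < T}`. -/
def Conformal (T : ℝ) (G G' : FormField n) : Prop :=
  ∀ y ∈ coneRegion n T, ∃ c : ℝ, 0 < c ∧ G' y = c • G y

/-- Admissibility of a form that matters only through its conformal class: some conformal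
multiple is admissible. -/
def IsConformallyAdmissible (N : ℕ∞) (p : ℕ) (T : ℝ) (γ : FormField n) : Prop :=
  ∃ G : FormField n, IsAdmissibleForm N p T G ∧ Conformal T γ G

/-- The coefficients `ν₀`, `ν = ν_A dx^A`, `g₀₀` are of class `C^k` for `0 < r < T`, with
`ν₀ > 0` and, at the vertex, `ν₀ = 1 + O(r^p)`, `ν_A = O(r^(p+1))`, `g₀₀ = -1 + O(r^p)`, with
the corresponding behaviour of the derivatives. -/
structure IsAdmissibleCoefficients (k : ℕ∞) (p : ℕ) (T : ℝ) (ν₀ : Euc n → ℝ)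
    (ν : CovectorField n) (g₀₀ : Euc n → ℝ) : Prop where
  nuZero_pos : ∀ y ∈ coneRegion n T, 0 < ν₀ y
  nuZero : VertexClass k p T (fun y => ν₀ y - 1)
  nu_radial : ∀ y ∈ coneRegion n T, ν y y = 0
  nu : VertexClass k p T ν
  gZeroZero : VertexClass k p T (fun y => g₀₀ y + 1)

/-- Degenerate forms of class `C²` with `lim r⁻² g_{AB} = s_{AB}` at the vertex, along each ray. -/
structure FormLimit (T : ℝ) (G : FormField n) : Prop where
  degenerate : IsDegenerateForm T G
  contDiffOn : ContDiffOn ℝ 2 G (coneRegion n T)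
  tendsto : ∀ θ : Euc n, ‖θ‖ = 1 →
    Tendsto (fun r : ℝ => G (r • θ) - roundForm n (r • θ)) (𝓝[>] 0) (𝓝 0)

/-- Nonvanishing `ν₀` of class `C²` with `lim ν₀ = 1` at the vertex, along each ray. -/
structure NuZeroLimit (T : ℝ) (ν₀ : Euc n → ℝ) : Prop where
  ne_zero : ∀ y ∈ coneRegion n T, ν₀ y ≠ 0
  contDiffOn : ContDiffOn ℝ 2 ν₀ (coneRegion n T)
  tendsto : ∀ θ : Euc n, ‖θ‖ = 1 → Tendsto (fun r : ℝ => ν₀ (r • θ)) (𝓝[>] 0) (𝓝 1)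

/-- One-forms `ν_A dx^A` of class `C²` with `lim r⁻¹ ν_A = 0` at the vertex, along each ray. -/
structure NuLimit (T : ℝ) (ν : CovectorField n) : Prop where
  radial : ∀ y ∈ coneRegion n T, ν y y = 0
  contDiffOn : ContDiffOn ℝ 2 ν (coneRegion n T)
  tendsto : ∀ θ : Euc n, ‖θ‖ = 1 → Tendsto (fun r : ℝ => ν (r • θ)) (𝓝[>] 0) (𝓝 0)

/-- Functions `g₀₀` of class `C²` with `lim g₀₀ = -1` at the vertex, along each ray. -/
structure GZeroZeroLimit (T : ℝ) (g₀₀ : Euc n → ℝ) : Prop where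
  contDiffOn : ContDiffOn ℝ 2 g₀₀ (coneRegion n T)
  tendsto : ∀ θ : Euc n, ‖θ‖ = 1 → Tendsto (fun r : ℝ => g₀₀ (r • θ)) (𝓝[>] 0) (𝓝 (-1))

/-- For given `G`, `ν₀`, the second constraint and the vertex limit determine `ν`, and then the
third constraint and the vertex limit determine `g₀₀` (on all `{0 < r < T'}` with `T' ≤ T`). -/
def DetermineNuAndGZeroZero (T : ℝ) (G : FormField n) (ν₀ : Euc n → ℝ) (ν : CovectorField n)
    (g₀₀ : Euc n → ℝ) : Prop :=
  ∀ T' : ℝ, 0 < T' → T' ≤ T →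
    (∀ ν' : CovectorField n, NuLimit T' ν' → SecondConstraint T' G ν₀ ν' →
      EqOn ν' ν (coneRegion n T')) ∧
    (∀ g₀₀' : Euc n → ℝ, GZeroZeroLimit T' g₀₀' → ThirdConstraint T' G ν₀ ν g₀₀' →
      EqOn g₀₀' g₀₀ (coneRegion n T'))

end LightCone

end

/-! The constraints form a hierarchy of ordinary differential equations along the null rays,
singular at the vertex. Written for tensor fields on the punctured ball in the coordinates y, with
the Euler operator `rad` = r ∂_r in place of ∂₁, they reduce to linear equations (rad + a + b) v =
f, where a ≥ 0 is a constant and b is of class (N, p), hence vanishes at the vertex. The operator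
rad + a is inverted by `radInt a f` (y) = ∫₀¹ t^(a-1) f(ty) dt, which preserves the class (N, q) as
soon as a + q > 0; the term b is removed by the integrating factor exp(radInt 0 b). This is
`VertexClass.exists_solution`.

To leave local coordinates, the degenerate form G is completed to the nondegenerate form `gHat G` =
G + dr². Its inverse minus the radial part is the cometric, and contractions over a coordinate frame
become traces over the fixed basis of ℝⁿ (`IsFrame.sum_eq_trace`). The Gauss formula
`SpherePatch.sum_christoffel` replaces the Christoffel symbols of every patch by one tensor, `zTen`.
Each constraint then becomes one tensor equation on the cone: `firstConstraint_iff`,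
`secondConstraint_iff`, `thirdConstraint_iff`.

The hierarchy is as follows. 𝒞₁ is algebraic in `kHat` = r(ν⁰∂₁ν₀ - ½(W₁ + τ)) and prescribes its
value `alp`; this is a linear equation for 1/ν₀, with a = (n-1)/2. 𝒞_A is a linear equation for ξ
with a = n, and the definition of ξ is a linear equation for the vector ν^A∂_A with a = (n-1)/2. The
operator of 𝒞₀ factors as 2(∂₁ + κ̂ + τ)[(∂₁ + κ̂ + τ/2) g^{11} + W^1], so the bracket is found with
a = n - 2 and then g^{11} with a = (n-1)/2.

Uniqueness is proved ray by ray. A difference of solutions of a homogeneous equation is r^(-a)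
exp(-β) c with β → 0, so it vanishes if it tends to 0. No limit is assumed for the intermediate
unknowns, namely ξ and the bracket, which contain derivatives. But if the constant c of their
difference were not zero, it would give the next equation a source bounded away from zero, and then
the next difference could not tend to 0 (`ray_no_positive_source`, `ray_source_eq_zero`).

For a prescribed conformal class, put G = ζ² G₀. With `kHat` = rκ prescribed, 𝒞₁ is the Raychaudhuri
equation, a Riccati equation for the expansion. Its linearisation is a system with a regular
singularity, written as an integral equation φ = 1 - J₀(c J₁(e φ)) along the segments to the vertex.
It is solved for all y at once in the Banach space of continuous paths, where the operator is of
class (N, p) in y, hence small near the vertex, and inversion is smooth (`exists_linear_system`).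
The construction for a prescribed form, applied to G, then returns `kHat` = rκ. Two solutions in the
same conformal class differ by a factor whose square root satisfies a linear equation, and the
source argument shows that the factor is 1 (`conformal_factor_eq_one`). -/

set_option maxSynthPendingDepth 5

/-! ### The weighted classes (N, q) at the vertex and their calculus -/

namespace LightCone

variable {n : ℕ} {F F' F'' : Type} [NormedAddCommGroup F] [NormedSpace ℝ F]
  [NormedAddCommGroup F'] [NormedSpace ℝ F'] [NormedAddCommGroup F''] [NormedSpace ℝ F'']
  {N : ℕ∞} {q q' : ℤ} {T T' : ℝ}

theorem isOpen_coneRegion (n : ℕ) (T : ℝ) : IsOpen (coneRegion n T) :=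
  (isOpen_lt continuous_const continuous_norm).inter (isOpen_lt continuous_norm continuous_const)

theorem coneRegion_mono (h : T' ≤ T) : coneRegion n T' ⊆ coneRegion n T :=
  fun _ hy => ⟨hy.1, hy.2.trans_le h⟩

theorem eventually_mem_coneRegion (hT : 0 < T) : ∀ᶠ y in 𝓝[≠] (0 : Euc n), y ∈ coneRegion n T := by
  have h1 : ∀ᶠ y in 𝓝[≠] (0 : Euc n), y ∈ Metric.ball (0 : Euc n) T :=
    mem_nhdsWithin_of_mem_nhds (Metric.ball_mem_nhds _ hT)
  filter_upwards [h1, self_mem_nhdsWithin] with y hy hy0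
  exact ⟨norm_pos_iff.2 hy0, by simpa using hy⟩

theorem ne_zero_of_mem {y : Euc n} (hy : y ∈ coneRegion n T) : y ≠ 0 := norm_pos_iff.1 hy.1

theorem smul_mem_coneRegion {y : Euc n} (hy : y ∈ coneRegion n T) {t : ℝ} (ht : 0 < t)
    (ht1 : t ≤ 1) : t • y ∈ coneRegion n T := by
  have h1 := hy.1
  have h2 := hy.2
  refine ⟨by rw [norm_smul, Real.norm_of_nonneg ht.le]; positivity, ?_⟩
  rw [norm_smul, Real.norm_of_nonneg ht.le]
  nlinarith

theorem zpow_isBigO_zpow (h : q' ≤ q) :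
    (fun y : Euc n => ‖y‖ ^ q) =O[𝓝[≠] 0] fun y => ‖y‖ ^ q' := by
  refine IsBigO.of_bound 1 ?_
  filter_upwards [eventually_mem_coneRegion (n := n) one_pos] with y hy
  rw [one_mul, Real.norm_of_nonneg (zpow_nonneg hy.1.le _),
    Real.norm_of_nonneg (zpow_nonneg hy.1.le _)]
  exact zpow_le_zpow_right_of_le_one₀ hy.1 hy.2.le h

namespace VertexClass

theorem mono_order {N' : ℕ∞} {f : Euc n → F} (h : VertexClass N q T f) (hN : N' ≤ N) :
    VertexClass N' q T f :=
  ⟨h.1.of_le (mod_cast hN), fun m hm => h.2 m (hm.trans hN)⟩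

theorem mono_weight {f : Euc n → F} (h : VertexClass N q T f) (hq : q' ≤ q) :
    VertexClass N q' T f :=
  ⟨h.1, fun m hm => (h.2 m hm).trans (zpow_isBigO_zpow (by omega))⟩

theorem mono_radius {f : Euc n → F} (h : VertexClass N q T f) (hT : T' ≤ T) :
    VertexClass N q T' f :=
  ⟨h.1.mono (coneRegion_mono hT), h.2⟩

theorem isBigO {f : Euc n → F} (h : VertexClass N q T f) :
    f =O[𝓝[≠] 0] fun y => ‖y‖ ^ q := by
  have := h.2 0 (by simp)
  rw [← isBigO_norm_left] at this ⊢
  simpa [norm_iteratedFDeriv_zero] using this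

/-- Reduces N = ∞ to finite orders, on which the inductions run. -/
theorem of_forall_nat {f : Euc n → F} (h : ∀ m : ℕ, (m : ℕ∞) ≤ N → VertexClass m q T f) :
    VertexClass N q T f :=
  ⟨contDiffOn_iff_forall_nat_le.2 fun m hm => (h m hm).1, fun m hm => (h m hm).2 m le_rfl⟩

theorem zero_order {f : Euc n → F} (hc : ContinuousOn f (coneRegion n T))
    (h0 : f =O[𝓝[≠] 0] fun y => ‖y‖ ^ q) : VertexClass 0 q T f := by
  refine ⟨by simpa using hc, fun m hm => ?_⟩
  have : m = 0 := by simpa using hm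
  subst this
  rw [← isBigO_norm_left] at h0 ⊢
  simpa [norm_iteratedFDeriv_zero] using h0

theorem continuousOn {f : Euc n → F} (h : VertexClass N q T f) :
    ContinuousOn f (coneRegion n T) := h.1.continuousOn

theorem fderiv {f : Euc n → F} (h : VertexClass (N + 1) q T f) :
    VertexClass N (q - 1) T (fderiv ℝ f) := by
  refine ⟨?_, fun m hm => ?_⟩
  · have := h.1
    push_cast at this
    exact ((contDiffOn_succ_iff_fderiv_of_isOpen (isOpen_coneRegion n T)).1 this).2.2
  · have := h.2 (m + 1) (by push_cast; gcongr)
    rw [← isBigO_norm_left] at this ⊢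
    simp only [norm_iteratedFDeriv_fderiv]
    convert this using 3
    push_cast; ring

theorem differentiableAt {f : Euc n → F} (h : VertexClass N q T f) (hN : 1 ≤ N) {y : Euc n}
    (hy : y ∈ coneRegion n T) : DifferentiableAt ℝ f y :=
  (h.1.differentiableOn (by
    intro h0
    have : N = 0 := by exact_mod_cast h0
    simp [this] at hN)).differentiableAt ((isOpen_coneRegion n T).mem_nhds hy)

/-- Membership can be checked one derivative at a time, with only an order zero bound on `f` itself.
The inductions on the order rest on this converse of `fderiv`. -/
theorem of_fderiv {f : Euc n → F} (hd : ∀ y ∈ coneRegion n T, DifferentiableAt ℝ f y)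
    (h0 : f =O[𝓝[≠] 0] fun y => ‖y‖ ^ q) (h : VertexClass N (q - 1) T (_root_.fderiv ℝ f)) :
    VertexClass (N + 1) q T f := by
  refine ⟨?_, fun m hm => ?_⟩
  · push_cast
    rw [contDiffOn_succ_iff_fderiv_of_isOpen (isOpen_coneRegion n T)]
    refine ⟨fun y hy => (hd y hy).differentiableWithinAt, by simp, h.1⟩
  · rcases m with _ | m
    · rw [← isBigO_norm_left] at h0 ⊢
      simpa [norm_iteratedFDeriv_zero] using h0
    · have := h.2 m (by
        push_cast at hm
        exact (ENat.add_le_add_iff_right (by simp)).1 hm)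
      rw [← isBigO_norm_left] at this ⊢
      simp only [norm_iteratedFDeriv_fderiv] at this
      convert this using 3
      push_cast; ring

/-- Positivity of T matters: the bounds concern the germ at the vertex, on which an empty cone gives
no information. -/
theorem congr {f g : Euc n → F} (h : VertexClass N q T f) (hT : 0 < T)
    (hfg : EqOn g f (coneRegion n T)) : VertexClass N q T g := by
  refine ⟨h.1.congr hfg, fun m hm => (h.2 m hm).congr' ?_ EventuallyEq.rfl⟩
  filter_upwards [eventually_mem_coneRegion hT] with y hy
  exact (EventuallyEq.iteratedFDeriv ℝ (hfg.eventuallyEq_of_mem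
    ((isOpen_coneRegion n T).mem_nhds hy)) m).eq_of_nhds.symm

theorem clm (L : F →L[ℝ] F') {f : Euc n → F} (h : VertexClass N q T f) (hT : 0 < T) :
    VertexClass N q T (fun y => L (f y)) := by
  refine ⟨L.contDiff.comp_contDiffOn h.1, fun m hm => ?_⟩
  refine IsBigO.trans ?_ (h.2 m hm)
  refine IsBigO.of_bound ‖L‖ ?_
  filter_upwards [eventually_mem_coneRegion hT] with y hy
  have : ContDiffAt ℝ m f y := (h.1.contDiffAt ((isOpen_coneRegion n T).mem_nhds hy)).of_le
    (mod_cast hm)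
  exact L.norm_iteratedFDeriv_comp_left this le_rfl

/-- Leibniz rule: with i derivatives on f and m - i on g the weights add up to q + q' - m, whatever
i is. All products, contractions and compositions of linear maps below are instances. -/
theorem bilin (B : F →L[ℝ] F' →L[ℝ] F'') {f : Euc n → F} {g : Euc n → F'}
    (hf : VertexClass N q T f) (hg : VertexClass N q' T g) (hT : 0 < T) :
    VertexClass N (q + q') T (fun y => B (f y) (g y)) := by
  refine ⟨B.isBoundedBilinearMap.contDiff.comp_contDiffOn (hf.1.prodMk hg.1), fun m hm => ?_⟩
  have key : (fun y => ‖B‖ * ∑ i ∈ Finset.range (m + 1), (m.choose i : ℝ) *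
      ‖iteratedFDeriv ℝ i f y‖ * ‖iteratedFDeriv ℝ (m - i) g y‖) =O[𝓝[≠] 0]
        fun y : Euc n => ‖y‖ ^ (q + q' - (m : ℤ)) := by
    refine IsBigO.const_mul_left (?_ : _) _
    refine IsBigO.fun_sum fun i hi => ?_
    have him : i ≤ m := by simpa [Nat.lt_succ_iff] using hi
    have h1 := (hf.2 i (le_trans (by exact_mod_cast him) hm)).norm_left.const_mul_left
      (m.choose i : ℝ)
    have h2 := (hg.2 (m - i) (le_trans (by exact_mod_cast Nat.sub_le m i) hm)).norm_left
    refine (h1.mul h2).congr' EventuallyEq.rfl ?_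
    filter_upwards [self_mem_nhdsWithin] with y hy
    rw [← zpow_add₀ (norm_ne_zero_iff.2 hy)]
    congr 1
    push_cast [Nat.cast_sub him]; ring
  refine IsBigO.trans ?_ key
  refine IsBigO.of_bound 1 ?_
  filter_upwards [eventually_mem_coneRegion hT] with y hy
  have ho := isOpen_coneRegion n T
  have := B.norm_iteratedFDerivWithin_le_of_bilinear hf.1 hg.1 ho.uniqueDiffOn hy
    (n := m) (mod_cast hm)
  simp only [iteratedFDerivWithin_of_isOpen _ ho hy] at this
  rw [one_mul]
  exact this.trans (le_abs_self _)

theorem add {f g : Euc n → F} (hf : VertexClass N q T f) (hg : VertexClass N q T g) (hT : 0 < T) :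
    VertexClass N q T (fun y => f y + g y) := by
  refine ⟨hf.1.add hg.1, fun m hm => ?_⟩
  refine ((hf.2 m hm).add (hg.2 m hm)).congr' ?_ EventuallyEq.rfl
  filter_upwards [eventually_mem_coneRegion hT] with y hy
  have ho := (isOpen_coneRegion n T).mem_nhds hy
  have h1 : ContDiffAt ℝ m f y := (hf.1.contDiffAt ho).of_le (mod_cast hm)
  have h2 : ContDiffAt ℝ m g y := (hg.1.contDiffAt ho).of_le (mod_cast hm)
  exact (fun_iteratedFDeriv_add_apply h1 h2).symm

theorem neg {f : Euc n → F} (hf : VertexClass N q T f) (hT : 0 < T) :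
    VertexClass N q T (fun y => - f y) := by
  simpa using hf.clm (-ContinuousLinearMap.id ℝ F) hT

theorem sub {f g : Euc n → F} (hf : VertexClass N q T f) (hg : VertexClass N q T g) (hT : 0 < T) :
    VertexClass N q T (fun y => f y - g y) := by
  simpa [sub_eq_add_neg] using hf.add (hg.neg hT) hT

theorem const_smul {f : Euc n → F} (c : ℝ) (hf : VertexClass N q T f) (hT : 0 < T) :
    VertexClass N q T (fun y => c • f y) := by
  simpa using hf.clm (c • ContinuousLinearMap.id ℝ F) hT

theorem const (c : F) : VertexClass N 0 T (fun _ : Euc n => c) := by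
  refine ⟨contDiffOn_const, fun m hm => ?_⟩
  rcases m with _ | m
  · refine IsBigO.of_bound ‖c‖ (Eventually.of_forall fun y => ?_)
    simp
  · have : iteratedFDeriv ℝ (m + 1) (fun _ : Euc n => c) = 0 :=
      iteratedFDeriv_const_of_ne (by omega) c
    simp only [this]
    exact isBigO_zero _ _

theorem zero : VertexClass N q T (fun _ : Euc n => (0 : F)) := by
  refine ⟨contDiffOn_const, fun m hm => ?_⟩
  have : iteratedFDeriv ℝ m (fun _ : Euc n => (0 : F)) = 0 := by
    exact iteratedFDeriv_fun_zero
  simp only [this]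
  exact isBigO_zero _ _

theorem sum {ι : Type*} (s : Finset ι) {f : ι → Euc n → F}
    (hf : ∀ i ∈ s, VertexClass N q T (f i)) (hT : 0 < T) :
    VertexClass N q T (fun y => ∑ i ∈ s, f i y) := by
  classical
  induction s using Finset.induction_on with
  | empty => simpa using zero
  | insert a s ha ih =>
    simp only [Finset.sum_insert ha]
    exact (hf a (by simp)).add (ih fun i hi => hf i (by simp [hi])) hT

theorem clm_apply {f : Euc n → F →L[ℝ] F'} {g : Euc n → F} (hf : VertexClass N q T f)
    (hg : VertexClass N q' T g) (hT : 0 < T) :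
    VertexClass N (q + q') T (fun y => f y (g y)) :=
  bilin (ContinuousLinearMap.id ℝ (F →L[ℝ] F')) hf hg hT

theorem clm_comp {f : Euc n → F' →L[ℝ] F''} {g : Euc n → F →L[ℝ] F'} (hf : VertexClass N q T f)
    (hg : VertexClass N q' T g) (hT : 0 < T) :
    VertexClass N (q + q') T (fun y => (f y).comp (g y)) :=
  bilin (ContinuousLinearMap.compL ℝ F F' F'') hf hg hT

theorem smul {f : Euc n → ℝ} {g : Euc n → F} (hf : VertexClass N q T f)
    (hg : VertexClass N q' T g) (hT : 0 < T) :
    VertexClass N (q + q') T (fun y => f y • g y) :=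
  bilin (ContinuousLinearMap.lsmul ℝ ℝ) hf hg hT

theorem mul {f g : Euc n → ℝ} (hf : VertexClass N q T f)
    (hg : VertexClass N q' T g) (hT : 0 < T) :
    VertexClass N (q + q') T (fun y => f y * g y) :=
  smul hf hg hT

theorem id : VertexClass N 1 T (fun y : Euc n => y) := by
  refine mono_order (N := ⊤) ?_ le_top
  refine of_fderiv (N := ⊤) (fun y _ => differentiableAt_id) ?_ ?_
  · refine IsBigO.of_bound 1 (Eventually.of_forall fun y => by simp)
  · have : _root_.fderiv ℝ (fun y : Euc n => y) = fun _ => ContinuousLinearMap.id ℝ (Euc n) := by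
      ext1 y; exact fderiv_fun_id
    rw [this]
    exact const _

theorem norm_sq (hT : 0 < T) : VertexClass N 2 T (fun y : Euc n => ‖y‖ ^ 2) := by
  have := bilin (innerSL ℝ) (id (n := n) (N := N) (T := T)) id hT
  exact this.congr hT fun y _ => (real_inner_self_eq_norm_sq y).symm

/-- The derivative of 1/r is -r⁻³ ⟨y, ·⟩, again a product of factors 1/r and y, so the product rule
closes an induction on the order. -/
theorem inv_norm (hT : 0 < T) : VertexClass N (-1) T (fun y : Euc n => ‖y‖⁻¹) := by
  have key : ∀ m : ℕ, VertexClass m (-1) T (fun y : Euc n => ‖y‖⁻¹) := by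
    have hO : (fun y : Euc n => ‖y‖⁻¹) =O[𝓝[≠] 0] fun y => ‖y‖ ^ (-1 : ℤ) := by
      simpa using isBigO_refl _ _
    have hd : ∀ y : Euc n, y ≠ 0 → HasFDerivAt (fun y : Euc n => ‖y‖⁻¹)
        (-(‖y‖⁻¹ * (‖y‖⁻¹ * ‖y‖⁻¹)) • innerSL ℝ y) y := by
      intro y hy
      have h0 : ‖y‖ ≠ 0 := norm_ne_zero_iff.2 hy
      have h1 : HasFDerivAt (fun y : Euc n => ‖y‖ ^ 2) (2 • innerSL ℝ y) y :=
        (hasStrictFDerivAt_norm_sq y).hasFDerivAt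
      have h2 := h1.sqrt (by positivity)
      simp only [Real.sqrt_sq (norm_nonneg _)] at h2
      have h3 := (hasDerivAt_inv h0).comp_hasFDerivAt y h2
      refine h3.congr_fderiv ?_
      ext v
      simp
      field_simp
    intro m
    induction m with
    | zero =>
      exact zero_order (fun y hy => (hd y (ne_zero_of_mem hy)).continuousAt.continuousWithinAt) hO
    | succ m ih =>
      push_cast
      refine of_fderiv (fun y hy => (hd y (ne_zero_of_mem hy)).differentiableAt) hO ?_
      have h1 : VertexClass m (-1 - 1) T
          (fun y : Euc n => -((‖y‖⁻¹ * (‖y‖⁻¹ * ‖y‖⁻¹)) • innerSL ℝ y)) :=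
        ((smul (mul ih (mul ih ih hT) hT) (clm (innerSL ℝ) id hT) hT).neg hT).mono_weight
          (by norm_num)
      refine h1.congr hT fun y hy => ?_
      simpa using (hd y (ne_zero_of_mem hy)).fderiv
  exact of_forall_nat fun m _ => key m

theorem norm (hT : 0 < T) : VertexClass N 1 T (fun y : Euc n => ‖y‖) := by
  refine ((norm_sq hT).mul (inv_norm hT) hT).congr hT fun y hy => ?_
  have := hy.1.ne'
  simp only
  field_simp

/-- Composition with a map that is smooth near the vertex value. -/
theorem comp_sub_const {p : ℕ} (hT : 0 < T) {U : Set F} (hU : IsOpen U) {c : F}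
    (hc : c ∈ U) (hp : 1 ≤ p) {f : Euc n → F} (hf : VertexClass N p T (fun y => f y - c))
    (hfU : MapsTo f (coneRegion n T) U) {Φ : F → F'} (hΦ : ContDiffOn ℝ ∞ Φ U) :
    VertexClass N p T (fun y => Φ (f y) - Φ c) := by
  refine of_forall_nat fun m hm => ?_
  replace hf := hf.mono_order hm
  clear hm
  -- The target space varies because the chain rule replaces Φ by its derivative, whose values are
  -- linear maps.
  induction m generalizing F' with
  | zero =>
    refine zero_order ?_ ?_
    · have : ContinuousOn f (coneRegion n T) := by
        refine (hf.continuousOn.add (continuousOn_const (c := c))).congr fun y _ => ?_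
        simp
      exact (hΦ.continuousOn.comp this hfU).sub continuousOn_const
    · have h1 : Tendsto f (𝓝[≠] 0) (𝓝 c) := by
        have h2 : Tendsto (fun y : Euc n => ‖y‖ ^ (p : ℤ)) (𝓝[≠] 0) (𝓝 0) := by
          have : Continuous (fun y : Euc n => ‖y‖ ^ p) := by fun_prop
          have := (this.tendsto 0).mono_left (nhdsWithin_le_nhds (s := {0}ᶜ))
          simpa [show p ≠ 0 by omega] using this
        simpa using (hf.isBigO.trans_tendsto h2).add_const c
      have h3 := (hΦ.contDiffAt (hU.mem_nhds hc)).differentiableAt (by simp)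
      exact (h3.isBigO_sub.comp_tendsto h1).trans hf.isBigO
  | succ m ih =>
    push_cast
    have hf' : VertexClass m p T (fun y => f y - c) := hf.mono_order (by simp)
    have h0 := ih hΦ hf'
    have hdf : ∀ y ∈ coneRegion n T, DifferentiableAt ℝ f y := fun y hy => by
      simpa using (hf.differentiableAt (by simp) hy).add_const c
    have hd : ∀ y ∈ coneRegion n T, HasFDerivAt (fun y => Φ (f y) - Φ c)
        ((_root_.fderiv ℝ Φ (f y)).comp (_root_.fderiv ℝ f y)) y := fun y hy =>
      (((hΦ.contDiffAt (hU.mem_nhds (hfU hy))).differentiableAt (by simp)).hasFDerivAt.comp y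
        (hdf y hy).hasFDerivAt).sub_const _
    refine of_fderiv (fun y hy => (hd y hy).differentiableAt) h0.isBigO ?_
    have h1 := ih (Φ := _root_.fderiv ℝ Φ) (hΦ.fderiv_of_isOpen hU (by simp)) hf'
    have h2 : VertexClass m 0 T (fun y => _root_.fderiv ℝ Φ (f y)) := by
      simpa using (h1.mono_weight (by omega : (0 : ℤ) ≤ p)).add (const (_root_.fderiv ℝ Φ c)) hT
    have h3 := VertexClass.fderiv (N := m) (f := fun y => f y - c) (by simpa using hf)
    refine ((h2.clm_comp h3 hT).mono_weight (by omega)).congr hT fun y hy => ?_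
    simp only [(hd y hy).fderiv, fderiv_sub_const]

theorem comp {p : ℕ} (hT : 0 < T) {U : Set F} (hU : IsOpen U) {c : F}
    (hc : c ∈ U) (hp : 1 ≤ p) {f : Euc n → F} (hf : VertexClass N p T (fun y => f y - c))
    (hfU : MapsTo f (coneRegion n T) U) {Φ : F → F'} (hΦ : ContDiffOn ℝ ∞ Φ U) :
    VertexClass N 0 T (fun y => Φ (f y)) := by
  simpa using ((comp_sub_const hT hU hc hp hf hfU hΦ).mono_weight
    (by omega : (0 : ℤ) ≤ p)).add (const (Φ c)) hT

end VertexClass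

/-- The radial derivative `r ∂_r`. -/
noncomputable def rad (f : Euc n → F) (y : Euc n) : F := fderiv ℝ f y y

theorem VertexClass.rad {f : Euc n → F} (h : VertexClass (N + 1) q T f) (hT : 0 < T) :
    VertexClass N q T (rad f) :=
  (h.fderiv.clm_apply VertexClass.id hT).mono_weight (by omega)

theorem VertexClass.tendsto_zero {p : ℕ} (hp : 1 ≤ p) {f : Euc n → F} (h : VertexClass N p T f) :
    Tendsto f (𝓝[≠] 0) (𝓝 0) := by
  refine h.isBigO.trans_tendsto ?_
  have : Continuous (fun y : Euc n => ‖y‖ ^ p) := by fun_prop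
  have := (this.tendsto 0).mono_left (nhdsWithin_le_nhds (s := {0}ᶜ))
  simpa [show p ≠ 0 by omega] using this

theorem tendsto_ray {θ : Euc n} (hθ : ‖θ‖ = 1) :
    Tendsto (fun r : ℝ => r • θ) (𝓝[>] 0) (𝓝[≠] 0) := by
  refine tendsto_nhdsWithin_iff.2 ⟨?_, ?_⟩
  · have : Continuous (fun r : ℝ => r • θ) := by fun_prop
    simpa using (this.tendsto 0).mono_left nhdsWithin_le_nhds
  · filter_upwards [self_mem_nhdsWithin] with r hr
    have : θ ≠ 0 := by rintro rfl; simp at hθ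
    exact smul_ne_zero (ne_of_gt hr) this

theorem ray_mem {θ : Euc n} (hθ : ‖θ‖ = 1) {r : ℝ} (hr : r ∈ Ioo 0 T) :
    r • θ ∈ coneRegion n T := by
  have : ‖r • θ‖ = r := by rw [norm_smul, hθ, Real.norm_of_nonneg hr.1.le, mul_one]
  exact ⟨by rw [this]; exact hr.1, by rw [this]; exact hr.2⟩

theorem hasDerivAt_ray {f : Euc n → F} {θ : Euc n} {r : ℝ} (hr : r ≠ 0)
    (hf : DifferentiableAt ℝ f (r • θ)) :
    HasDerivAt (fun ρ : ℝ => f (ρ • θ)) (r⁻¹ • rad f (r • θ)) r := by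
  have h1 : HasDerivAt (fun ρ : ℝ => ρ • θ) θ r := by
    simpa using (hasDerivAt_id r).smul_const θ
  refine (hf.hasFDerivAt.comp_hasDerivAt r h1).congr_deriv ?_
  rw [rad, map_smul, smul_smul, inv_mul_cancel₀ hr, one_smul]

end LightCone

/-! ### Inversion of the Euler operator r ∂_r + a -/

namespace LightCone

open MeasureTheory

variable {n : ℕ} {F F' : Type} [NormedAddCommGroup F] [NormedSpace ℝ F]
  [NormedAddCommGroup F'] [NormedSpace ℝ F']
  {N : ℕ∞} {q : ℤ} {T T' : ℝ}

/-- Bounds at the vertex extend to bounds on smaller punctured balls. -/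
theorem VertexClass.exists_bound {f : Euc n → F} (h : VertexClass N q T f) (hT' : T' < T) :
    ∃ C : ℝ, 0 ≤ C ∧ ∀ y ∈ coneRegion n T', ‖f y‖ ≤ C * ‖y‖ ^ q := by
  obtain ⟨C₁, hC₁⟩ := h.isBigO.bound
  rw [eventually_nhdsWithin_iff, Metric.eventually_nhds_iff] at hC₁
  obtain ⟨ε, hε, hb⟩ := hC₁
  -- Away from the vertex the bound comes from compactness, which is why T' < T is required.
  let K : Set (Euc n) := Metric.closedBall 0 T' ∩ {y | ε ≤ ‖y‖}
  have hK : IsCompact K :=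
    (isCompact_closedBall (0 : Euc n) T').inter_right (isClosed_le continuous_const continuous_norm)
  have hKT : K ⊆ coneRegion n T := fun y hy =>
    ⟨hε.trans_le hy.2, (by simpa using hy.1 : ‖y‖ ≤ T').trans_lt hT'⟩
  have hcont : ContinuousOn (fun y => ‖f y‖ * (‖y‖ ^ q)⁻¹) K := by
    refine ((h.continuousOn.mono hKT).norm).mul ?_
    intro y hy
    have h0 : ‖y‖ ≠ 0 := (hKT hy).1.ne'
    exact (((continuous_norm.continuousAt).zpow₀ q (Or.inl h0)).inv₀
      (zpow_ne_zero _ h0)).continuousWithinAt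
  obtain ⟨C₂, hC₂⟩ := hK.bddAbove_image hcont
  refine ⟨max (max C₁ C₂) 0, le_max_right _ _, fun y hy => ?_⟩
  have hpos : 0 < ‖y‖ ^ q := zpow_pos hy.1 _
  by_cases hyε : ‖y‖ < ε
  · have := hb (y := y) (by simpa using hyε) (ne_zero_of_mem hy)
    rw [Real.norm_of_nonneg hpos.le] at this
    exact this.trans (mul_le_mul_of_nonneg_right
      ((le_max_left _ _).trans (le_max_left _ _)) hpos.le)
  · have hyK : y ∈ K := ⟨by simpa using hy.2.le, not_lt.1 hyε⟩
    have := hC₂ ⟨y, hyK, rfl⟩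
    simp only at this
    rw [← div_eq_mul_inv, div_le_iff₀ hpos] at this
    exact this.trans (mul_le_mul_of_nonneg_right
      ((le_max_right _ _).trans (le_max_left _ _)) hpos.le)

/-- `∫₀¹ t^(a-1) f(ty) dt`, the solution of `(r ∂_r + a) v = f`. -/
noncomputable def radInt (a : ℝ) (f : Euc n → F) (y : Euc n) : F :=
  ∫ t in Ioc (0 : ℝ) 1, t ^ (a - 1) • f (t • y)

theorem integrableOn_rpow_Ioc {s : ℝ} (hs : 0 < s) :
    IntegrableOn (fun t : ℝ => t ^ (s - 1)) (Ioc 0 1) :=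
  (intervalIntegrable_iff_integrableOn_Ioc_of_le zero_le_one).1
    (intervalIntegral.intervalIntegrable_rpow' (by linarith))

theorem integral_rpow_Ioc {s : ℝ} (hs : 0 < s) : ∫ t in Ioc (0 : ℝ) 1, t ^ (s - 1) = 1 / s := by
  rw [← intervalIntegral.integral_of_le zero_le_one, integral_rpow (Or.inl (by linarith))]
  simp [hs.ne']

theorem aestronglyMeasurable_radInt {f : Euc n → F} (hf : ContinuousOn f (coneRegion n T)) (a : ℝ)
    {y : Euc n} (hy : y ∈ coneRegion n T) :
    AEStronglyMeasurable (fun t : ℝ => t ^ (a - 1) • f (t • y)) (volume.restrict (Ioc 0 1)) := by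
  refine ContinuousOn.aestronglyMeasurable ?_ measurableSet_Ioc
  refine ContinuousOn.smul ?_ ?_
  · intro t ht
    exact (Real.continuousAt_rpow_const _ _ (Or.inl ht.1.ne')).continuousWithinAt
  · exact hf.comp (by fun_prop) fun t ht => smul_mem_coneRegion hy ht.1 ht.2

/-- A bound homogeneous of degree q turns the integrand into a multiple of t^(a+q-1), integrable at
0 exactly when a + q > 0. This is the source of the condition on the exponent. -/
theorem norm_radInt_integrand_le {f : Euc n → F} {C : ℝ} {a : ℝ}
    (hC : ∀ y ∈ coneRegion n T, ‖f y‖ ≤ C * ‖y‖ ^ q) {y : Euc n} (hy : y ∈ coneRegion n T)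
    {t : ℝ} (ht : t ∈ Ioc (0 : ℝ) 1) :
    ‖t ^ (a - 1) • f (t • y)‖ ≤ C * ‖y‖ ^ q * t ^ (a + q - 1) := by
  have h1 := hC _ (smul_mem_coneRegion hy ht.1 ht.2)
  have h2 : (0 : ℝ) < t ^ (a - 1) := Real.rpow_pos_of_pos ht.1 _
  rw [norm_smul, Real.norm_of_nonneg h2.le]
  refine (mul_le_mul_of_nonneg_left h1 h2.le).trans (le_of_eq ?_)
  rw [norm_smul, Real.norm_of_nonneg ht.1.le, mul_zpow, ← Real.rpow_intCast t q,
    show a + q - 1 = (a - 1) + q by ring, Real.rpow_add ht.1]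
  ring

theorem integrableOn_radInt {f : Euc n → F} (hf : ContinuousOn f (coneRegion n T)) {C : ℝ} {a : ℝ}
    (haq : 0 < a + q) (hC : ∀ y ∈ coneRegion n T, ‖f y‖ ≤ C * ‖y‖ ^ q) {y : Euc n}
    (hy : y ∈ coneRegion n T) :
    IntegrableOn (fun t : ℝ => t ^ (a - 1) • f (t • y)) (Ioc 0 1) := by
  refine Integrable.mono' ((integrableOn_rpow_Ioc haq).const_mul (C * ‖y‖ ^ q))
    (aestronglyMeasurable_radInt hf a hy) ?_
  filter_upwards [ae_restrict_mem measurableSet_Ioc] with t ht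
  exact norm_radInt_integrand_le hC hy ht

theorem norm_radInt_le {f : Euc n → F} {C : ℝ} {a : ℝ}
    (haq : 0 < a + q) (hC : ∀ y ∈ coneRegion n T, ‖f y‖ ≤ C * ‖y‖ ^ q) {y : Euc n}
    (hy : y ∈ coneRegion n T) : ‖radInt a f y‖ ≤ C / (a + q) * ‖y‖ ^ q := by
  have h1 : ‖radInt a f y‖ ≤ ∫ t in Ioc (0 : ℝ) 1, C * ‖y‖ ^ q * t ^ (a + q - 1) := by
    refine norm_integral_le_of_norm_le ((integrableOn_rpow_Ioc haq).const_mul (C * ‖y‖ ^ q)) ?_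
    filter_upwards [ae_restrict_mem measurableSet_Ioc] with t ht
    exact norm_radInt_integrand_le hC hy ht
  rw [integral_const_mul, integral_rpow_Ioc haq] at h1
  refine h1.trans (le_of_eq (by ring))

theorem VertexClass.integrableOn_radInt {f : Euc n → F} (hf : VertexClass N q T f) {a : ℝ}
    (haq : 0 < a + q) {y : Euc n} (hy : y ∈ coneRegion n T) :
    IntegrableOn (fun t : ℝ => t ^ (a - 1) • f (t • y)) (Ioc 0 1) := by
  obtain ⟨T', h1, h2⟩ := exists_between hy.2
  obtain ⟨C, -, hC⟩ := hf.exists_bound h2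
  exact LightCone.integrableOn_radInt (hf.continuousOn.mono (coneRegion_mono h2.le)) haq hC
    ⟨hy.1, h1⟩

theorem eventually_zpow_norm_le {y : Euc n} (hy : y ≠ 0) (q : ℤ) :
    ∀ᶠ z in 𝓝 y, ‖z‖ ^ q < ‖y‖ ^ q + 1 := by
  have : ContinuousAt (fun z : Euc n => ‖z‖ ^ q) y :=
    continuous_norm.continuousAt.zpow₀ q (Or.inl (norm_ne_zero_iff.2 hy))
  exact this.eventually (gt_mem_nhds (by simp))

/-- Neighbourhoods on which the integrand of `radInt` is uniformly dominated. -/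
theorem VertexClass.exists_dominated {f : Euc n → F} (hf : VertexClass N q T f) (a : ℝ)
    {y : Euc n} (hy : y ∈ coneRegion n T) :
    ∃ C : ℝ, ∀ᶠ z in 𝓝 y, z ∈ coneRegion n T ∧ ∀ t ∈ Ioc (0 : ℝ) 1,
      ‖t ^ (a - 1) • f (t • z)‖ ≤ C * t ^ (a + q - 1) := by
  obtain ⟨T', h1, h2⟩ := exists_between hy.2
  obtain ⟨C, hC0, hC⟩ := hf.exists_bound h2
  refine ⟨C * (‖y‖ ^ q + 1), ?_⟩
  filter_upwards [eventually_zpow_norm_le (ne_zero_of_mem hy) q,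
    (isOpen_coneRegion n T').mem_nhds ⟨hy.1, h1⟩] with z hz hzT
  refine ⟨coneRegion_mono h2.le hzT, fun t ht => ?_⟩
  refine (norm_radInt_integrand_le hC hzT ht).trans ?_
  have := Real.rpow_nonneg ht.1.le (a + q - 1)
  gcongr

theorem VertexClass.continuousOn_radInt {f : Euc n → F} (hf : VertexClass N q T f) {a : ℝ}
    (haq : 0 < a + q) : ContinuousOn (radInt a f) (coneRegion n T) := by
  intro y hy
  obtain ⟨C, hC⟩ := hf.exists_dominated a hy
  refine ContinuousAt.continuousWithinAt ?_
  refine continuousAt_of_dominated (bound := fun t => C * t ^ (a + q - 1)) ?_ ?_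
    ((integrableOn_rpow_Ioc haq).const_mul C) ?_
  · filter_upwards [hC] with z hz
    exact aestronglyMeasurable_radInt hf.continuousOn a hz.1
  · filter_upwards [hC] with z hz
    filter_upwards [ae_restrict_mem measurableSet_Ioc] with t ht
    exact hz.2 t ht
  · filter_upwards [ae_restrict_mem measurableSet_Ioc] with t ht
    have h1 : ContinuousAt f (t • y) := hf.continuousOn.continuousAt
      ((isOpen_coneRegion n T).mem_nhds (smul_mem_coneRegion hy ht.1 ht.2))
    have h2 : ContinuousAt (fun z : Euc n => t • z) y := by fun_prop
    exact (ContinuousAt.comp (f := fun z : Euc n => t • z) h1 h2).const_smul _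

/-- Differentiating f(ty) in y brings out a factor t, so a becomes a + 1 while the weight of the
derivative is q - 1. The sum a + q is unchanged, and so is the power of t in the majorant. -/
theorem VertexClass.hasFDerivAt_radInt {f : Euc n → F} (hf : VertexClass N q T f) (hN : 1 ≤ N)
    {a : ℝ} (haq : 0 < a + q) {y : Euc n} (hy : y ∈ coneRegion n T) :
    HasFDerivAt (radInt a f) (radInt (a + 1) (_root_.fderiv ℝ f) y) y := by
  have hf' : VertexClass 0 (q - 1) T (_root_.fderiv ℝ f) :=
    VertexClass.fderiv (N := 0) (hf.mono_order (by simpa using hN))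
  obtain ⟨C, hC⟩ := hf'.exists_dominated (a + 1) hy
  have haq' : (a + 1) + ((q - 1 : ℤ) : ℝ) = a + q := by push_cast; ring
  rw [haq'] at hC
  refine hasFDerivAt_integral_of_dominated_of_fderiv_le (s := {z | _}) (𝕜 := ℝ) hC
    (bound := fun t => C * t ^ (a + q - 1))
    (F' := fun z t => t ^ (a + 1 - 1) • _root_.fderiv ℝ f (t • z)) ?_
    (hf.integrableOn_radInt haq hy) (aestronglyMeasurable_radInt hf'.continuousOn (a + 1) hy)
    ?_ ((integrableOn_rpow_Ioc haq).const_mul C) ?_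
  · filter_upwards [hC] with z hz
    exact aestronglyMeasurable_radInt hf.continuousOn a hz.1
  · filter_upwards [ae_restrict_mem measurableSet_Ioc] with t ht z hz
    exact hz.2 t ht
  · filter_upwards [ae_restrict_mem measurableSet_Ioc] with t ht z hz
    have h1 := (hf.differentiableAt hN (smul_mem_coneRegion hz.1 ht.1 ht.2)).hasFDerivAt
    have h2 : HasFDerivAt (fun z : Euc n => t • z) (t • ContinuousLinearMap.id ℝ (Euc n)) z :=
      (hasFDerivAt_id z).const_smul t
    refine ((h1.comp z h2).const_smul (t ^ (a - 1))).congr_fderiv ?_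
    ext v
    simp [smul_smul, Real.rpow_sub_one ht.1.ne', ht.1.ne']

theorem VertexClass.radInt [CompleteSpace F] {f : Euc n → F} (hf : VertexClass N q T f)
    (hT : 0 < T) {a : ℝ} (haq : 0 < a + q) : VertexClass N q T (radInt a f) := by
  refine of_forall_nat fun m hm => ?_
  replace hf := hf.mono_order hm
  clear hm
  have hO : ∀ {m : ℕ∞}, VertexClass m q T f →
      LightCone.radInt a f =O[𝓝[≠] 0] fun y : Euc n => ‖y‖ ^ q := by
    intro m hf
    obtain ⟨C, -, hC⟩ := hf.exists_bound (half_lt_self hT)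
    refine IsBigO.of_bound (C / (a + q)) ?_
    filter_upwards [eventually_mem_coneRegion (half_pos hT)] with y hy
    rw [Real.norm_of_nonneg (zpow_nonneg hy.1.le q)]
    exact norm_radInt_le haq hC hy
  induction m generalizing F a q with
  | zero => exact zero_order (hf.continuousOn_radInt haq) (hO hf)
  | succ m ih =>
    push_cast at hf ⊢
    have hd := fun y hy => hf.hasFDerivAt_radInt (by simp) haq (y := y) hy
    refine of_fderiv (fun y hy => (hd y hy).differentiableAt) (hO hf) ?_
    have haq' : (0 : ℝ) < (a + 1) + ((q - 1 : ℤ) : ℝ) := by push_cast; linarith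
    have h1 := ih (a := a + 1) haq' hf.fderiv ?_
    · exact h1.congr hT fun y hy => (hd y hy).fderiv
    · intro m hg
      obtain ⟨C, -, hC⟩ := hg.exists_bound (half_lt_self hT)
      refine IsBigO.of_bound (C / ((a + 1) + ((q - 1 : ℤ) : ℝ))) ?_
      filter_upwards [eventually_mem_coneRegion (half_pos hT)] with y hy
      rw [Real.norm_of_nonneg (zpow_nonneg hy.1.le _)]
      exact norm_radInt_le haq' hC hy

/-- `radInt a f` solves `(r ∂_r + a) v = f`. -/
theorem VertexClass.rad_radInt [CompleteSpace F] {f : Euc n → F} (hf : VertexClass N q T f)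
    (hN : 1 ≤ N) {a : ℝ} (haq : 0 < a + q) {y : Euc n} (hy : y ∈ coneRegion n T) :
    LightCone.rad (LightCone.radInt a f) y + a • LightCone.radInt a f y = f y := by
  have hf' : VertexClass 0 (q - 1) T (_root_.fderiv ℝ f) :=
    VertexClass.fderiv (N := 0) (hf.mono_order (by simpa using hN))
  have haq' : (0 : ℝ) < (a + 1) + ((q - 1 : ℤ) : ℝ) := by push_cast; linarith
  have hi1 := hf.integrableOn_radInt haq hy
  have hi2 := hf'.integrableOn_radInt haq' hy
  have hi3 : IntegrableOn (fun t : ℝ => t ^ (a + 1 - 1) • _root_.fderiv ℝ f (t • y) y)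
      (Ioc 0 1) := hi2.apply_continuousLinearMap y
  rw [LightCone.rad, (hf.hasFDerivAt_radInt hN haq hy).fderiv, LightCone.radInt,
    ContinuousLinearMap.integral_apply hi2, LightCone.radInt, ← integral_smul]
  have hi4 : IntegrableOn (fun t : ℝ => a • t ^ (a - 1) • f (t • y)) (Ioc 0 1) := hi1.smul a
  simp only [smul_apply]
  rw [← integral_add hi3 hi4, ← intervalIntegral.integral_of_le zero_le_one]
  -- The integrand is the t-derivative of t^a f(ty), whose limit at t = 0 vanishes because a + q >
  -- 0.
  have key := intervalIntegral.integral_eq_sub_of_hasDerivAt_of_tendsto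
    (f := fun t : ℝ => t ^ a • f (t • y))
    (f' := fun t : ℝ => t ^ (a + 1 - 1) • _root_.fderiv ℝ f (t • y) y
      + a • t ^ (a - 1) • f (t • y)) (a := 0) (b := 1) (fa := 0) (fb := f y) zero_lt_one ?_ ?_ ?_ ?_
  · rw [sub_zero] at key
    exact key
  · intro t ht
    have h1 := (hf.differentiableAt hN (smul_mem_coneRegion hy ht.1 ht.2.le)).hasFDerivAt
    have h2 : HasDerivAt (fun t : ℝ => t • y) y t := by simpa using (hasDerivAt_id t).smul_const y
    have h3 := h1.comp_hasDerivAt t h2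
    have h4 := Real.hasDerivAt_rpow_const (x := t) (p := a) (Or.inl ht.1.ne')
    refine (h4.smul h3).congr_deriv ?_
    simp [smul_smul]
  · exact (intervalIntegrable_iff_integrableOn_Ioc_of_le zero_le_one).2 (hi3.add hi4)
  · obtain ⟨T', h1, h2⟩ := exists_between hy.2
    obtain ⟨C, hC0, hC⟩ := hf.exists_bound h2
    have hlim : Tendsto (fun t : ℝ => C * ‖y‖ ^ q * t ^ (a + q)) (𝓝[>] 0) (𝓝 0) := by
      have : ContinuousAt (fun t : ℝ => t ^ (a + q)) 0 :=
        Real.continuousAt_rpow_const _ _ (Or.inr haq.le)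
      have := (this.tendsto.mono_left (nhdsWithin_le_nhds (s := Ioi 0))).const_mul (C * ‖y‖ ^ q)
      simpa [Real.zero_rpow haq.ne'] using this
    refine squeeze_zero_norm' ?_ hlim
    filter_upwards [Ioc_mem_nhdsGT zero_lt_one] with t ht
    have := norm_radInt_integrand_le (a := a + 1) hC ⟨hy.1, h1⟩ ht
    rwa [add_sub_cancel_right, show a + 1 + (q : ℝ) - 1 = a + q by ring] at this
  · have hcont : ContinuousAt (fun t : ℝ => t ^ a • f (t • y)) 1 := by
      have h1 : ContinuousAt f ((1 : ℝ) • y) := by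
        rw [one_smul]
        exact hf.continuousOn.continuousAt ((isOpen_coneRegion n T).mem_nhds hy)
      have h2 : ContinuousAt (fun t : ℝ => t • y) 1 := by fun_prop
      exact (Real.continuousAt_rpow_const _ _ (Or.inl one_ne_zero)).smul
        (ContinuousAt.comp (f := fun t : ℝ => t • y) h1 h2)
    have := hcont.tendsto.mono_left (nhdsWithin_le_nhds (s := Iio 1))
    simpa using this

/-- Linear conditions met by the source along the segment to the vertex pass to the solution. This
keeps solutions tangential to the spheres. -/
theorem VertexClass.map_radInt_eq_zero [CompleteSpace F] {f : Euc n → F}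
    (hf : VertexClass N q T f) {a : ℝ} (haq : 0 < a + q) {y : Euc n} (hy : y ∈ coneRegion n T)
    (L : F →L[ℝ] ℝ) (hL : ∀ t ∈ Ioc (0 : ℝ) 1, L (f (t • y)) = 0) :
    L (LightCone.radInt a f y) = 0 := by
  rw [LightCone.radInt, ← L.integral_comp_comm (hf.integrableOn_radInt haq hy)]
  refine setIntegral_eq_zero_of_forall_eq_zero fun t ht => ?_
  simp [hL t ht]

/-- The perturbed first order equation `(r ∂_r + a + b) v = f`. -/
theorem VertexClass.exists_solution [CompleteSpace F] {p : ℕ} (hp : 1 ≤ p) (hN : 1 ≤ N)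
    (hT : 0 < T) {b : Euc n → ℝ} (hb : VertexClass N p T b) {f : Euc n → F}
    (hf : VertexClass N q T f) {a : ℝ} (haq : 0 < a + q) :
    ∃ v : Euc n → F, VertexClass N q T v ∧
      (∀ y ∈ coneRegion n T, LightCone.rad v y + (a + b y) • v y = f y) ∧
      ∀ y ∈ coneRegion n T, ∀ L : F →L[ℝ] ℝ,
        (∀ t ∈ Ioc (0 : ℝ) 1, L (f (t • y)) = 0) → L (v y) = 0 := by
  have hp0 : (0 : ℝ) < 0 + (p : ℤ) := by rw [zero_add]; exact_mod_cast hp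
  -- Here rad B = b, so v = exp(-B) w, where w solves (rad + a) w = exp(B) f. Since B tends to 0,
  -- the exponentials have weight 0 and do not change the class.
  set B := LightCone.radInt 0 b with hB
  have hBc : VertexClass N p T B := hb.radInt hT hp0
  have hexp : ∀ c : ℝ, VertexClass N 0 T (fun y => Real.exp (c * B y)) := fun c =>
    VertexClass.comp (p := p) hT isOpen_univ (mem_univ 0) hp (f := B) (by simpa using hBc)
      (mapsTo_univ _ _) (Φ := fun x => Real.exp (c * x)) (by fun_prop)
  have hef : VertexClass N q T (fun y => Real.exp (1 * B y) • f y) :=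
    ((hexp 1).smul hf hT).mono_weight (by simp)
  set w := LightCone.radInt a (fun y => Real.exp (1 * B y) • f y) with hw
  have hwc : VertexClass N q T w := hef.radInt hT haq
  refine ⟨fun y => Real.exp ((-1) * B y) • w y,
    ((hexp (-1)).smul hwc hT).mono_weight (by simp), fun y hy => ?_, fun y hy L hL => ?_⟩
  · have h1 := hb.rad_radInt hN hp0 hy
    have h2 := hef.rad_radInt hN haq hy
    rw [← hB, zero_smul, add_zero] at h1
    rw [← hw] at h2
    have h3 := (hBc.differentiableAt hN hy).hasFDerivAt
    have h4 := (hwc.differentiableAt hN hy).hasFDerivAt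
    have h5 := ((h3.const_mul (-1)).exp).fun_smul h4
    rw [LightCone.rad, h5.fderiv]
    simp only [LightCone.rad] at h1 h2
    have h2' : _root_.fderiv ℝ w y y = Real.exp (1 * B y) • f y - a • w y := by
      rw [← h2]; abel
    simp only [add_apply, smul_apply,
      ContinuousLinearMap.smulRight_apply, h1, h2', smul_sub, smul_smul, ← Real.exp_add]
    simp only [neg_mul, one_mul, neg_add_cancel, Real.exp_zero, one_smul, smul_eq_mul]
    module
  · rw [map_smul, hef.map_radInt_eq_zero haq hy L fun t ht => ?_, smul_zero]
    rw [map_smul, hL t ht, smul_zero]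

end LightCone

namespace LightCone

variable {n : ℕ} {F : Type} [NormedAddCommGroup F] [NormedSpace ℝ F]
  {N : ℕ∞} {T : ℝ}

/-! ### First order equations along a ray -/

/-- The potential is `radInt 0 b` on the ray. It tends to 0 because p ≥ 1, so the integrating factor
exp β is harmless at the vertex. -/
theorem VertexClass.exists_ray_potential {p : ℕ} (hp : 1 ≤ p) (hN : 1 ≤ N) (hT : 0 < T)
    {b : Euc n → ℝ} (hb : VertexClass N p T b) {θ : Euc n} (hθ : ‖θ‖ = 1) :
    ∃ β : ℝ → ℝ, (∀ r ∈ Ioo 0 T, HasDerivAt β (r⁻¹ * b (r • θ)) r) ∧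
      Tendsto β (𝓝[>] 0) (𝓝 0) := by
  have hp0 : (0 : ℝ) < 0 + (p : ℤ) := by rw [zero_add]; exact_mod_cast hp
  have hB := hb.radInt hT hp0
  refine ⟨fun r => LightCone.radInt 0 b (r • θ), fun r hr => ?_,
    (hB.tendsto_zero hp).comp (tendsto_ray hθ)⟩
  have h1 := hasDerivAt_ray hr.1.ne' (hB.differentiableAt hN (ray_mem hθ hr))
  have h2 := hb.rad_radInt hN hp0 (ray_mem hθ hr)
  rw [zero_smul, add_zero] at h2
  rwa [h2] at h1

theorem hasDerivAt_integratingFactor {β b : ℝ → ℝ} {a r : ℝ} (hr : 0 < r)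
    (hβ : HasDerivAt β (r⁻¹ * b r) r) {f : ℝ → F} {f' : F} (hf : HasDerivAt f f' r) :
    HasDerivAt (fun r => (r ^ a * Real.exp (β r)) • f r)
      ((r ^ (a - 1) * Real.exp (β r)) • (r • f' + (a + b r) • f r)) r := by
  have h1 := ((Real.hasDerivAt_rpow_const (x := r) (p := a) (Or.inl hr.ne')).mul hβ.exp).smul hf
  refine h1.congr_deriv ?_
  have h2 : r ^ a = r ^ (a - 1) * r := by
    rw [Real.rpow_sub_one hr.ne']; field_simp
  simp only [Pi.mul_apply, h2]
  have h3 : r * r⁻¹ = 1 := mul_inv_cancel₀ hr.ne'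
  rw [smul_add, smul_smul, smul_smul]
  congr 2
  · ring
  · linear_combination (r ^ (a - 1) * Real.exp (β r) * b r) * h3

theorem ray_homogeneous {β b : ℝ → ℝ} {a : ℝ}
    (hβ : ∀ r ∈ Ioo 0 T, HasDerivAt β (r⁻¹ * b r) r) {f f' : ℝ → F}
    (hf : ∀ r ∈ Ioo 0 T, HasDerivAt f (f' r) r)
    (heq : ∀ r ∈ Ioo 0 T, r • f' r + (a + b r) • f r = 0) :
    ∃ c : F, ∀ r ∈ Ioo 0 T, f r = (r ^ (-a) * Real.exp (-β r)) • c := by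
  have hd : ∀ r ∈ Ioo 0 T, HasDerivAt (fun r => (r ^ a * Real.exp (β r)) • f r) 0 r := by
    intro r hr
    have := hasDerivAt_integratingFactor (a := a) hr.1 (hβ r hr) (hf r hr)
    rwa [heq r hr, smul_zero] at this
  rcases le_or_gt T 0 with hT | hT
  · exact ⟨0, fun r hr => absurd (hr.1.trans hr.2) (not_lt.2 hT)⟩
  have hconst : ∀ r ∈ Ioo 0 T, (r ^ a * Real.exp (β r)) • f r
      = ((T / 2) ^ a * Real.exp (β (T / 2))) • f (T / 2) := by
    intro r hr
    exact isOpen_Ioo.is_const_of_deriv_eq_zero (isPreconnected_Ioo)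
      (fun r hr => (hd r hr).differentiableAt.differentiableWithinAt)
      (fun r hr => (hd r hr).deriv) hr ⟨half_pos hT, half_lt_self hT⟩
  refine ⟨((T / 2) ^ a * Real.exp (β (T / 2))) • f (T / 2), fun r hr => ?_⟩
  rw [← hconst r hr, smul_smul]
  have h1 : r ^ (-a) * r ^ a = 1 := by rw [← Real.rpow_add hr.1]; simp
  have h2 : Real.exp (-β r) * Real.exp (β r) = 1 := by rw [← Real.exp_add]; simp
  rw [show r ^ (-a) * Real.exp (-β r) * (r ^ a * Real.exp (β r))
    = (r ^ (-a) * r ^ a) * (Real.exp (-β r) * Real.exp (β r)) by ring, h1, h2, one_mul, one_smul]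

/-- A nonzero homogeneous solution behaves like r^(-a), which does not tend to 0 when a ≥ 0. -/
theorem ray_homogeneous_eq_zero {β b : ℝ → ℝ} {a : ℝ} (ha : 0 ≤ a) (hβ0 : Tendsto β (𝓝[>] 0) (𝓝 0))
    (hβ : ∀ r ∈ Ioo 0 T, HasDerivAt β (r⁻¹ * b r) r) {f f' : ℝ → F}
    (hf : ∀ r ∈ Ioo 0 T, HasDerivAt f (f' r) r)
    (heq : ∀ r ∈ Ioo 0 T, r • f' r + (a + b r) • f r = 0)
    (hf0 : Tendsto f (𝓝[>] 0) (𝓝 0)) : ∀ r ∈ Ioo 0 T, f r = 0 := by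
  intro r hr
  have hT : 0 < T := hr.1.trans hr.2
  obtain ⟨c, hc⟩ := ray_homogeneous hβ hf heq
  have h1 : Tendsto (fun r => (r ^ a * Real.exp (β r)) • f r) (𝓝[>] 0)
      (𝓝 ((0 ^ a * Real.exp 0) • (0 : F))) := by
    refine (Tendsto.mul ?_ (Real.continuous_exp.continuousAt.tendsto.comp hβ0)).smul hf0
    exact (Real.continuousAt_rpow_const _ _ (Or.inr ha)).tendsto.mono_left nhdsWithin_le_nhds
  rw [smul_zero] at h1
  have h2 : Tendsto (fun r => (r ^ a * Real.exp (β r)) • f r) (𝓝[>] 0) (𝓝 c) := by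
    refine tendsto_const_nhds.congr' ?_
    filter_upwards [Ioo_mem_nhdsGT hT] with s hs
    rw [hc s hs, smul_smul]
    have h1 : s ^ (-a) * s ^ a = 1 := by rw [← Real.rpow_add hs.1]; simp
    have h2 : Real.exp (-β s) * Real.exp (β s) = 1 := by rw [← Real.exp_add]; simp
    rw [show s ^ a * Real.exp (β s) * (s ^ (-a) * Real.exp (-β s))
      = (s ^ (-a) * s ^ a) * (Real.exp (-β s) * Real.exp (β s)) by ring, h1, h2, one_mul, one_smul]
  rw [hc r hr, tendsto_nhds_unique h2 h1, smul_zero]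

/-- A function tending to zero at the vertex cannot have `(r ∂_r + a + b) f` bounded below by a
positive constant. -/
theorem ray_no_positive_source {β b : ℝ → ℝ} {a ε : ℝ} (ha : 0 < a) (hε : 0 < ε)
    (hβ0 : Tendsto β (𝓝[>] 0) (𝓝 0)) {f f' : ℝ → ℝ}
    (hev : ∀ᶠ r in 𝓝[>] 0, HasDerivAt β (r⁻¹ * b r) r ∧ HasDerivAt f (f' r) r ∧
      ε ≤ r * f' r + (a + b r) * f r)
    (hf0 : Tendsto f (𝓝[>] 0) (𝓝 0)) : False := by
  have hexp : Tendsto (fun r => Real.exp (β r)) (𝓝[>] 0) (𝓝 1) := by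
    have := Real.continuous_exp.continuousAt.tendsto.comp hβ0
    rwa [Real.exp_zero] at this
  have h1 := (hev.and (hexp.eventually (lt_mem_nhds (show (1 / 2 : ℝ) < 1 by norm_num))))
  obtain ⟨δ, hδ, hδs⟩ := mem_nhdsGT_iff_exists_Ioo_subset.1 h1
  have hδ : (0 : ℝ) < δ := hδ
  -- The subtracted term is the primitive of ½ ε r^(a-1), a lower bound for the derivative of the
  -- first term once exp β ≥ ½. Hence Φ increases from 0, so exp(β) f ≥ ε/(2a), against f → 0.
  set Φ : ℝ → ℝ := fun r => r ^ a * Real.exp (β r) * f r - ε / (2 * a) * r ^ a with hΦ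
  have hd : ∀ r ∈ Ioo 0 δ, HasDerivAt Φ
      (r ^ (a - 1) * Real.exp (β r) * (r * f' r + (a + b r) * f r)
        - ε / (2 * a) * (a * r ^ (a - 1))) r := by
    intro r hr
    obtain ⟨⟨hβr, hfr, -⟩, -⟩ := hδs hr
    exact (hasDerivAt_integratingFactor (a := a) hr.1 hβr hfr).sub
      ((Real.hasDerivAt_rpow_const (x := r) (p := a) (Or.inl hr.1.ne')).const_mul _)
  have hmono : MonotoneOn Φ (Ioo 0 δ) := by
    refine monotoneOn_of_deriv_nonneg (convex_Ioo _ _)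
      (fun r hr => (hd r hr).continuousAt.continuousWithinAt)
      (fun r hr => (hd r (interior_subset hr)).differentiableAt.differentiableWithinAt)
      fun r hr => ?_
    have hr := interior_subset hr
    rw [(hd r hr).deriv]
    obtain ⟨⟨-, -, h3⟩, h4⟩ := hδs hr
    have h5 : 0 < r ^ (a - 1) := Real.rpow_pos_of_pos hr.1 _
    have h6 : r ^ (a - 1) * (1 / 2) * ε
        ≤ r ^ (a - 1) * Real.exp (β r) * (r * f' r + (a + b r) * f r) := by
      have h4 : 1 / 2 ≤ Real.exp (β r) := le_of_lt h4
      gcongr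
    have h7 : ε / (2 * a) * (a * r ^ (a - 1)) = r ^ (a - 1) * (1 / 2) * ε := by
      field_simp
    linarith
  have hrpow : Tendsto (fun r : ℝ => r ^ a) (𝓝[>] 0) (𝓝 0) := by
    have := (Real.continuousAt_rpow_const (0 : ℝ) a (Or.inr ha.le)).tendsto.mono_left
      (nhdsWithin_le_nhds (s := Ioi 0))
    rwa [Real.zero_rpow ha.ne'] at this
  have hΦ0 : Tendsto Φ (𝓝[>] 0) (𝓝 0) := by
    have := ((hrpow.mul hexp).mul hf0).sub (hrpow.const_mul (ε / (2 * a)))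
    simpa using this
  have hpos : ∀ r ∈ Ioo 0 δ, 0 ≤ Φ r := by
    intro r hr
    refine le_of_tendsto hΦ0 ?_
    filter_upwards [Ioo_mem_nhdsGT hr.1] with s hs
    exact hmono ⟨hs.1, hs.2.trans hr.2⟩ hr hs.2.le
  have hlow : ∀ᶠ r in 𝓝[>] 0, ε / (2 * a) ≤ Real.exp (β r) * f r := by
    filter_upwards [Ioo_mem_nhdsGT hδ] with r hr
    have h5 : 0 < r ^ a := Real.rpow_pos_of_pos hr.1 _
    have h6 := hpos r hr
    simp only [hΦ] at h6
    by_contra! h7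
    nlinarith
  have := ge_of_tendsto (hexp.mul hf0) hlow
  have h8 : 0 < ε / (2 * a) := by positivity
  linarith

end LightCone

namespace LightCone

variable {n : ℕ} {F : Type} [NormedAddCommGroup F] [NormedSpace ℝ F] {T : ℝ}

/-! ### The cometric of a degenerate form -/

/-- The deviation of `G` from the round form. -/
noncomputable def dev (G : FormField n) : FormField n := fun y => G y - roundForm n y

/-- The nondegenerate form `G + dr²`. -/
noncomputable def gHat (G : FormField n) : FormField n := fun y => euclideanForm n + dev G y

/-- The inverse of `gHat G`. -/
noncomputable def gHatInv (G : FormField n) (y : Euc n) : (Euc n →L[ℝ] ℝ) →L[ℝ] Euc n :=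
  (gHat G y).inverse

/-- The cometric `g^{AB} ∂_A ∂_B` of a degenerate form. -/
noncomputable def cometric (G : FormField n) (y : Euc n) : (Euc n →L[ℝ] ℝ) →L[ℝ] Euc n :=
  gHatInv G y - (‖y‖ ^ 2)⁻¹ • (ContinuousLinearMap.apply ℝ ℝ y).smulRight y

/-- The standard basis. -/
noncomputable def bas (i : Fin n) : Euc n := EuclideanSpace.single i 1

/-- The dual of the standard basis. -/
noncomputable def cobas (i : Fin n) : Euc n →L[ℝ] ℝ := euclideanForm n (bas i)

/-- The trace of a bilinear map with respect to the cometric. -/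
noncomputable def trace (G : FormField n) (y : Euc n) (b : Euc n → Euc n → F) : F :=
  ∑ i, b (bas i) (cometric G y (cobas i))

theorem euclideanForm_apply (v w : Euc n) : euclideanForm n v w = inner ℝ v w := rfl

theorem sum_inner_bas (v : Euc n) : ∑ i, (inner ℝ (bas i) v : ℝ) • bas i = v := by
  have := (EuclideanSpace.basisFun (Fin n) ℝ).sum_repr' v
  simpa [bas] using this

theorem gHat_apply (G : FormField n) (y v w : Euc n) :
    gHat G y v w = G y v w + (‖y‖ ^ 2)⁻¹ * (inner ℝ y v * inner ℝ y w) := by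
  simp only [gHat, dev, add_apply, sub_apply, roundForm_apply, euclideanForm_apply]
  ring

theorem gHat_apply_of_inner_eq_zero (G : FormField n) {y v : Euc n} (hv : inner ℝ y v = 0)
    (w : Euc n) : gHat G y v w = G y v w := by
  simp [gHat_apply, hv]

theorem cometric_apply (G : FormField n) (y : Euc n) (φ : Euc n →L[ℝ] ℝ) :
    cometric G y φ = gHatInv G y φ - ((‖y‖ ^ 2)⁻¹ * φ y) • y := by
  simp [cometric, smul_smul]

section Degenerate

variable {G : FormField n} (hG : IsDegenerateForm T G) {y : Euc n} (hy : y ∈ coneRegion n T)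

include hG hy

theorem IsDegenerateForm.gHat_symm (v w : Euc n) : gHat G y v w = gHat G y w v := by
  rw [gHat_apply, gHat_apply, (hG y hy).1 v w]; ring

/-- Because G annihilates y, the completed form agrees with the Euclidean one in the radial slot:
y/r stays unit and orthogonal to the spheres. -/
theorem IsDegenerateForm.gHat_left (w : Euc n) : gHat G y y w = inner ℝ y w := by
  have h0 : ‖y‖ ≠ 0 := hy.1.ne'
  rw [gHat_apply, (hG y hy).2.1 w, real_inner_self_eq_norm_sq]
  field_simp
  simp

theorem IsDegenerateForm.gHat_right (v : Euc n) : gHat G y v y = inner ℝ y v := by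
  rw [hG.gHat_symm hy, hG.gHat_left hy]

theorem IsDegenerateForm.gHat_pos {v : Euc n} (hv : v ≠ 0) : 0 < gHat G y v v := by
  have h0 : 0 < ‖y‖ := hy.1
  rw [gHat_apply]
  have h1 : 0 ≤ (‖y‖ ^ 2)⁻¹ * (inner ℝ y v * inner ℝ y v) := by
    have := mul_self_nonneg (inner ℝ y v : ℝ)
    positivity
  by_cases h : ∀ c : ℝ, v ≠ c • y
  · linarith [(hG y hy).2.2 v h]
  · push Not at h
    obtain ⟨c, rfl⟩ := h
    have hc : c ≠ 0 := by rintro rfl; simp at hv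
    rw [map_smul, (hG y hy).1, (hG y hy).2.1, smul_zero, zero_add, real_inner_smul_right,
      real_inner_self_eq_norm_sq]
    have : 0 < c * ‖y‖ ^ 2 * (c * ‖y‖ ^ 2) := mul_self_pos.2 (by positivity)
    positivity

theorem IsDegenerateForm.exists_equiv :
    ∃ e : Euc n ≃L[ℝ] (Euc n →L[ℝ] ℝ), (e : Euc n →L[ℝ] Euc n →L[ℝ] ℝ) = gHat G y := by
  have hinj : Function.Injective (gHat G y : Euc n →ₗ[ℝ] Euc n →L[ℝ] ℝ) := by
    rw [injective_iff_map_eq_zero]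
    intro v hv
    by_contra hne
    have := hG.gHat_pos hy hne
    have h2 : gHat G y v = 0 := hv
    simp [h2] at this
  have hfin : Module.finrank ℝ (Euc n) = Module.finrank ℝ (Euc n →L[ℝ] ℝ) := by
    rw [← Subspace.dual_finrank_eq]
    exact (LinearMap.toContinuousLinearMap (𝕜 := ℝ) (E := Euc n) (F' := ℝ)).finrank_eq
  refine ⟨(LinearMap.linearEquivOfInjective _ hinj hfin).toContinuousLinearEquiv, ?_⟩
  ext v w
  simp

theorem IsDegenerateForm.gHatInv_gHat (v : Euc n) : gHatInv G y (gHat G y v) = v := by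
  obtain ⟨e, he⟩ := hG.exists_equiv hy
  rw [gHatInv, ← he, ContinuousLinearMap.inverse_equiv]
  simp

theorem IsDegenerateForm.gHat_gHatInv (φ : Euc n →L[ℝ] ℝ) : gHat G y (gHatInv G y φ) = φ := by
  obtain ⟨e, he⟩ := hG.exists_equiv hy
  rw [gHatInv, ← he, ContinuousLinearMap.inverse_equiv]
  simp

theorem IsDegenerateForm.inner_gHatInv (φ : Euc n →L[ℝ] ℝ) : inner ℝ y (gHatInv G y φ) = φ y := by
  rw [← hG.gHat_right hy, hG.gHat_gHatInv hy]

theorem IsDegenerateForm.inner_cometric (φ : Euc n →L[ℝ] ℝ) :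
    inner ℝ y (cometric G y φ) = 0 := by
  have h0 : ‖y‖ ≠ 0 := hy.1.ne'
  rw [cometric_apply, inner_sub_right, hG.inner_gHatInv hy, real_inner_smul_right,
    real_inner_self_eq_norm_sq]
  field_simp
  ring

theorem IsDegenerateForm.cometric_gHat (v : Euc n) :
    cometric G y (gHat G y v) = v - ((‖y‖ ^ 2)⁻¹ * inner ℝ y v) • y := by
  rw [cometric_apply, hG.gHatInv_gHat hy, hG.gHat_right hy]

theorem IsDegenerateForm.gHat_cometric (φ : Euc n →L[ℝ] ℝ) (w : Euc n) :
    gHat G y (cometric G y φ) w = φ w - (‖y‖ ^ 2)⁻¹ * φ y * inner ℝ y w := by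
  rw [cometric_apply, map_sub, map_smul, hG.gHat_gHatInv hy, sub_apply, smul_apply,
    hG.gHat_left hy, smul_eq_mul]

end Degenerate

/-! ### Frames of the tangent space of the spheres -/

theorem exists_coeff {y : Euc n} (hn : 2 ≤ n) (hy : y ≠ 0) {e : Fin (n - 1) → Euc n}
    (he : LinearIndependent ℝ e) (hye : ∀ A, inner ℝ y (e A) = 0) {w : Euc n}
    (hw : inner ℝ y w = 0) : ∃ c : Fin (n - 1) → ℝ, w = ∑ A, c A • e A := by
  have h1 : Submodule.span ℝ (Set.range e) ≤ (Submodule.span ℝ {y})ᗮ := by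
    rw [Submodule.span_le]
    rintro _ ⟨A, rfl⟩
    exact Submodule.mem_orthogonal_singleton_iff_inner_right.2 (hye A)
  have h2 : Module.finrank ℝ (Submodule.span ℝ (Set.range e))
      = Module.finrank ℝ (Submodule.span ℝ {y})ᗮ := by
    have h3 := Submodule.finrank_add_finrank_orthogonal (Submodule.span ℝ {y})
    rw [finrank_span_singleton hy, finrank_euclideanSpace_fin] at h3
    rw [finrank_span_eq_card he, Fintype.card_fin]
    omega
  have h4 := Submodule.eq_of_le_of_finrank_eq h1 h2
  have h5 : w ∈ Submodule.span ℝ (Set.range e) := by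
    rw [h4]; exact Submodule.mem_orthogonal_singleton_iff_inner_right.2 hw
  obtain ⟨c, hc⟩ := (Submodule.mem_span_range_iff_exists_fun ℝ).1 h5
  exact ⟨c, hc.symm⟩

/-- A frame of the tangent space at `y` of the sphere through `y`. -/
structure IsFrame (y : Euc n) (e : Fin (n - 1) → Euc n) : Prop where
  linearIndependent : LinearIndependent ℝ e
  inner_eq_zero : ∀ A, inner ℝ y (e A) = 0

/-- The matrix of `gHat G` in a frame. -/
noncomputable def frameMatrix (G : FormField n) (y : Euc n) (e : Fin (n - 1) → Euc n) :
    Matrix (Fin (n - 1)) (Fin (n - 1)) ℝ := Matrix.of fun C D => gHat G y (e C) (e D)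

section Frame

variable {G : FormField n} (hG : IsDegenerateForm T G) {y : Euc n} (hy : y ∈ coneRegion n T)
  {e : Fin (n - 1) → Euc n} (he : IsFrame y e)

include hG hy he

theorem IsFrame.isUnit_det : IsUnit (frameMatrix G y e).det := by
  rw [← Matrix.isUnit_iff_isUnit_det, ← Matrix.mulVec_injective_iff_isUnit]
  rw [← Matrix.coe_mulVecLin, injective_iff_map_eq_zero]
  intro c hc
  have h1 : ∀ A, gHat G y (e A) (∑ B, c B • e B) = 0 := by
    intro A
    have := congrFun hc A
    simp only [Matrix.mulVecLin_apply, Matrix.mulVec, dotProduct, frameMatrix, Matrix.of_apply,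
      Pi.zero_apply] at this
    rw [map_sum, ← this]
    refine Finset.sum_congr rfl fun B _ => ?_
    rw [map_smul, smul_eq_mul, mul_comm]
  have h2 : gHat G y (∑ B, c B • e B) (∑ B, c B • e B) = 0 := by
    have h3 : ∀ v, gHat G y (∑ B, c B • e B) v = ∑ A, c A * gHat G y (e A) v := fun v => by
      simp [map_sum, sum_apply]
    rw [h3]
    exact Finset.sum_eq_zero fun A _ => by rw [h1, mul_zero]
  have h3 : ∑ B, c B • e B = 0 := by
    by_contra hne
    exact (hG.gHat_pos hy hne).ne' h2
  ext A
  exact Fintype.linearIndependent_iff.1 he.linearIndependent c h3 A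

theorem IsFrame.inv_mul (A B : Fin (n - 1)) :
    ∑ C, (frameMatrix G y e)⁻¹ A C * gHat G y (e C) (e B) = if A = B then 1 else 0 := by
  have := congrFun (congrFun (Matrix.nonsing_inv_mul _ (he.isUnit_det hG hy)) A) B
  rwa [Matrix.mul_apply, Matrix.one_apply] at this

omit he in
theorem frameMatrix_inv_symm (A B : Fin (n - 1)) :
    (frameMatrix G y e)⁻¹ A B = (frameMatrix G y e)⁻¹ B A := by
  have h1 : (frameMatrix G y e).transpose = frameMatrix G y e := by
    ext C D
    simp [frameMatrix, hG.gHat_symm hy (e C) (e D)]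
  have h2 := Matrix.transpose_nonsing_inv (frameMatrix G y e)
  rw [h1] at h2
  exact (congrFun (congrFun h2 B) A)

theorem IsFrame.sum_dual_smul (hn : 2 ≤ n) {w : Euc n} (hw : inner ℝ y w = 0) :
    ∑ A, (∑ B, (frameMatrix G y e)⁻¹ A B * gHat G y (e B) w) • e A = w := by
  obtain ⟨c, hc⟩ := exists_coeff hn (ne_zero_of_mem hy) he.linearIndependent he.inner_eq_zero hw
  have h1 : ∀ A, ∑ B, (frameMatrix G y e)⁻¹ A B * gHat G y (e B) w = c A := by
    intro A
    have h2 : ∀ B, gHat G y (e B) w = ∑ C, c C * gHat G y (e B) (e C) := by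
      intro B
      rw [hc, map_sum]
      exact Finset.sum_congr rfl fun C _ => by rw [map_smul, smul_eq_mul]
    simp only [h2, Finset.mul_sum]
    rw [Finset.sum_comm]
    have h3 : ∀ C, ∑ B, (frameMatrix G y e)⁻¹ A B * (c C * gHat G y (e B) (e C))
        = c C * if A = C then 1 else 0 := by
      intro C
      rw [← he.inv_mul hG hy, Finset.mul_sum]
      exact Finset.sum_congr rfl fun B _ => by ring
    simp [h3]
  rw [Finset.sum_congr rfl fun A _ => by rw [h1 A]]
  exact hc.symm

/-- Shows that g^{AB} e_A e_B does not depend on the frame. Both sides are tangential, so it is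
enough to expand the right one in the frame. -/
theorem IsFrame.sum_eq_cometric (hn : 2 ≤ n) (φ : Euc n →L[ℝ] ℝ) :
    ∑ A, ∑ B, ((frameMatrix G y e)⁻¹ A B * φ (e A)) • e B = cometric G y φ := by
  have h1 : ∀ A, φ (e A) = gHat G y (e A) (cometric G y φ) := by
    intro A
    rw [hG.gHat_symm hy, hG.gHat_cometric hy, he.inner_eq_zero A]
    ring
  rw [Finset.sum_comm]
  conv_rhs => rw [← he.sum_dual_smul hG hy hn (hG.inner_cometric hy φ)]
  refine Finset.sum_congr rfl fun B _ => ?_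
  rw [← Finset.sum_smul]
  congr 1
  refine Finset.sum_congr rfl fun A _ => ?_
  rw [h1 A, frameMatrix_inv_symm hG hy A B]

/-- Contractions with g^{AB} become sums over a fixed basis of ℝⁿ, to which the calculus of vertex
classes applies. The values of b on radial vectors are irrelevant because the cometric is tangential
in both slots. -/
theorem IsFrame.sum_eq_trace (hn : 2 ≤ n) (b : Euc n →ₗ[ℝ] Euc n →ₗ[ℝ] F) :
    ∑ A, ∑ B, (frameMatrix G y e)⁻¹ A B • b (e A) (e B) = trace G y fun v w => b v w := by
  have h1 : ∀ i, b (bas i) (cometric G y (cobas i))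
      = ∑ A, ∑ B, ((frameMatrix G y e)⁻¹ A B * inner ℝ (bas i) (e A)) • b (bas i) (e B) := by
    intro i
    rw [← he.sum_eq_cometric hG hy hn]
    simp only [map_sum, map_smul, cobas, euclideanForm_apply]
  simp only [trace, h1]
  symm
  rw [Finset.sum_comm]
  refine Finset.sum_congr rfl fun A _ => ?_
  rw [Finset.sum_comm]
  refine Finset.sum_congr rfl fun B _ => ?_
  symm
  have h2 : b (e A) (e B) = ∑ i, (inner ℝ (bas i) (e A) : ℝ) • b (bas i) (e B) := by
    conv_lhs => rw [← sum_inner_bas (e A)]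
    simp only [map_sum, LinearMap.sum_apply, map_smul, LinearMap.smul_apply]
  simp only [h2, Finset.smul_sum, smul_smul]

end Frame

end LightCone

namespace LightCone

variable {n : ℕ} {F F' : Type} [NormedAddCommGroup F] [NormedSpace ℝ F]
  [NormedAddCommGroup F'] [NormedSpace ℝ F'] {T : ℝ}

/-! ### Partial derivatives in local coordinates -/

/-- The partial derivative `∂/∂x^A` of a vector-valued function. -/
noncomputable def pd {d : ℕ} (A : Fin d) (f : Euc d → F) (x : Euc d) : F :=
  fderiv ℝ f x (EuclideanSpace.single A 1)

section Pd

variable {d : ℕ} {A : Fin d} {x : Euc d}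

theorem pd_congr {f g : Euc d → F} (h : f =ᶠ[𝓝 x] g) : pd A f x = pd A g x := by
  rw [pd, h.fderiv_eq, pd]

theorem pd_add {f g : Euc d → F} (hf : DifferentiableAt ℝ f x) (hg : DifferentiableAt ℝ g x) :
    pd A (fun x => f x + g x) x = pd A f x + pd A g x := by
  simp [pd, fderiv_fun_add hf hg]

theorem pd_sum {ι : Type*} {s : Finset ι} {f : ι → Euc d → F}
    (hf : ∀ i ∈ s, DifferentiableAt ℝ (f i) x) :
    pd A (fun x => ∑ i ∈ s, f i x) x = ∑ i ∈ s, pd A (f i) x := by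
  simp [pd, fderiv_fun_sum hf]

theorem pd_clm_apply {c : Euc d → F →L[ℝ] F'} {u : Euc d → F} (hc : DifferentiableAt ℝ c x)
    (hu : DifferentiableAt ℝ u x) :
    pd A (fun x => c x (u x)) x = pd A c x (u x) + c x (pd A u x) := by
  simp [pd, fderiv_clm_apply hc hu, add_comm]

theorem pd_smul {c : Euc d → ℝ} {u : Euc d → F} (hc : DifferentiableAt ℝ c x)
    (hu : DifferentiableAt ℝ u x) :
    pd A (fun x => c x • u x) x = pd A c x • u x + c x • pd A u x := by
  simp [pd, fderiv_fun_smul hc hu, add_comm]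

end Pd

namespace SpherePatch

variable (P : SpherePatch n) {x : Euc (n - 1)} {r : ℝ}

/-- The point `y = r Θ(x)`. -/
noncomputable def pos (r : ℝ) (x : Euc (n - 1)) : Euc n := r • P.Θ x

/-- The coordinate vector `∂_A = r ∂Θ/∂x^A` at the point `y = r Θ(x)`. -/
noncomputable def frame (r : ℝ) (x : Euc (n - 1)) (A : Fin (n - 1)) : Euc n := r • P.dΘ x A

theorem contDiffAt_Θ (hx : x ∈ P.U) : ContDiffAt ℝ ∞ P.Θ x :=
  P.contDiffOn.contDiffAt (P.isOpen_U.mem_nhds hx)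

theorem contDiffAt_dΘ (hx : x ∈ P.U) (A : Fin (n - 1)) :
    ContDiffAt ℝ ∞ (fun x => P.dΘ x A) x :=
  ((P.contDiffAt_Θ hx).fderiv_right (m := ∞) (by simp)).clm_apply contDiffAt_const

theorem eventually_mem (hx : x ∈ P.U) : ∀ᶠ x' in 𝓝 x, x' ∈ P.U := P.isOpen_U.mem_nhds hx

theorem differentiableAt_pos (hx : x ∈ P.U) (r : ℝ) : DifferentiableAt ℝ (P.pos r) x :=
  ((P.contDiffAt_Θ hx).differentiableAt (by simp)).const_smul r

theorem differentiableAt_frame (hx : x ∈ P.U) (r : ℝ) (A : Fin (n - 1)) :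
    DifferentiableAt ℝ (fun x => P.frame r x A) x :=
  ((P.contDiffAt_dΘ hx A).differentiableAt (by simp)).const_smul r

theorem contDiffAt_frame (hx : x ∈ P.U) (r : ℝ) (A : Fin (n - 1)) :
    ContDiffAt ℝ ∞ (fun x => P.frame r x A) x :=
  (P.contDiffAt_dΘ hx A).const_smul r

theorem contDiffAt_pos (hx : x ∈ P.U) (r : ℝ) : ContDiffAt ℝ ∞ (P.pos r) x :=
  (P.contDiffAt_Θ hx).const_smul r

theorem pd_pos (hx : x ∈ P.U) (r : ℝ) (A : Fin (n - 1)) : pd A (P.pos r) x = P.frame r x A := by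
  have h := fderiv_fun_const_smul ((P.contDiffAt_Θ hx).differentiableAt (by simp)) r
  change fderiv ℝ (fun x => r • P.Θ x) x _ = _
  rw [h]
  rfl

theorem pd_comp_pos (hx : x ∈ P.U) {f : Euc n → F} (hf : DifferentiableAt ℝ f (P.pos r x))
    (A : Fin (n - 1)) :
    pd A (fun x => f (P.pos r x)) x = fderiv ℝ f (P.pos r x) (P.frame r x A) := by
  rw [pd, fderiv_fun_comp x hf (P.differentiableAt_pos hx r)]
  rw [← P.pd_pos hx]
  rfl

theorem differentiableAt_comp_pos (hx : x ∈ P.U) {f : Euc n → F}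
    (hf : DifferentiableAt ℝ f (P.pos r x)) : DifferentiableAt ℝ (fun x => f (P.pos r x)) x :=
  hf.comp x (P.differentiableAt_pos hx r)

theorem pd_frame_symm (hx : x ∈ P.U) (r : ℝ) (A B : Fin (n - 1)) :
    pd A (fun x => P.frame r x B) x = pd B (fun x => P.frame r x A) x := by
  have hs : IsSymmSndFDerivAt ℝ (P.pos r) x :=
    ((P.contDiffAt_pos hx r).of_le (m := 2) (by norm_cast)).isSymmSndFDerivAt (by simp)
  have hd : DifferentiableAt ℝ (fderiv ℝ (P.pos r)) x :=
    ((P.contDiffAt_pos hx r).fderiv_right (m := 1) (by norm_cast)).differentiableAt one_ne_zero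
  have key : ∀ A B, pd A (fun x => P.frame r x B) x
      = fderiv ℝ (fderiv ℝ (P.pos r)) x (EuclideanSpace.single A 1)
        (EuclideanSpace.single B 1) := by
    intro A B
    have h1 : (fun x => P.frame r x B) =ᶠ[𝓝 x]
        fun x => fderiv ℝ (P.pos r) x (EuclideanSpace.single B 1) := by
      filter_upwards [P.eventually_mem hx] with x' hx'
      exact (P.pd_pos hx' r B).symm
    rw [pd_congr h1, pd, fderiv_clm_apply hd (differentiableAt_const _)]
    simp
  rw [key, key]
  exact hs _ _

theorem inner_pos_frame (hx : x ∈ P.U) (A : Fin (n - 1)) :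
    inner ℝ (P.pos r x) (P.frame r x A) = 0 := by
  have h1 : (fun x => (inner ℝ (P.Θ x) (P.Θ x) : ℝ)) =ᶠ[𝓝 x] fun _ => 1 := by
    filter_upwards [P.eventually_mem hx] with x' hx'
    rw [real_inner_self_eq_norm_sq, P.norm_eq_one x' hx', one_pow]
  have hd : DifferentiableAt ℝ P.Θ x := (P.contDiffAt_Θ hx).differentiableAt (by simp)
  have h2 := congrArg (fun L => L (EuclideanSpace.single A 1)) (h1.fderiv_eq (𝕜 := ℝ))
  simp only [fderiv_inner_apply ℝ hd hd, fderiv_fun_const, Pi.zero_apply, zero_apply] at h2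
  rw [real_inner_comm] at h2
  have h3 : inner ℝ (P.Θ x) (P.dΘ x A) = 0 := by
    rw [dΘ, real_inner_comm]; linarith
  rw [pos, frame, real_inner_smul_left, real_inner_smul_right, h3]
  simp

/-- Derivative of ⟨y, e_B⟩ = 0, using ∂_A y = e_A. This is the second fundamental form of the
sphere. -/
theorem inner_pos_pd_frame (hx : x ∈ P.U) (A B : Fin (n - 1)) :
    inner ℝ (P.pos r x) (pd A (fun x => P.frame r x B) x)
      = - inner ℝ (P.frame r x A) (P.frame r x B) := by
  have h1 : (fun x => (inner ℝ (P.pos r x) (P.frame r x B) : ℝ)) =ᶠ[𝓝 x] fun _ => 0 := by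
    filter_upwards [P.eventually_mem hx] with x' hx'
    exact P.inner_pos_frame hx' B
  have h2 := congrArg (fun L => L (EuclideanSpace.single A 1)) (h1.fderiv_eq (𝕜 := ℝ))
  simp only [fderiv_inner_apply ℝ (P.differentiableAt_pos hx r) (P.differentiableAt_frame hx r B),
    fderiv_fun_const, Pi.zero_apply, zero_apply] at h2
  have h3 := P.pd_pos hx r A
  rw [pd] at h3
  rw [h3] at h2
  rw [pd]
  linarith

theorem norm_pos (hx : x ∈ P.U) (hr : 0 < r) : ‖P.pos r x‖ = r := by
  rw [pos, norm_smul, P.norm_eq_one x hx, Real.norm_of_nonneg hr.le, mul_one]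

theorem pos_mem (hx : x ∈ P.U) (hr : r ∈ Ioo 0 T) : P.pos r x ∈ coneRegion n T :=
  ray_mem (P.norm_eq_one x hx) hr

theorem isFrame (hx : x ∈ P.U) (hr : r ≠ 0) : IsFrame (P.pos r x) (P.frame r x) := by
  refine ⟨?_, fun A => P.inner_pos_frame hx A⟩
  rw [Fintype.linearIndependent_iff]
  intro c hc
  have h1 : fderiv ℝ P.Θ x (∑ A, c A • EuclideanSpace.single A 1) = 0 := by
    simp only [frame, dΘ, smul_comm _ r] at hc
    rw [← Finset.smul_sum, smul_eq_zero] at hc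
    simpa [map_sum] using hc.resolve_left hr
  have h2 := P.immersion x hx (h1.trans (map_zero _).symm)
  intro A
  have h3 := congrArg (fun v : Euc (n - 1) => v A) h2
  simpa [Finset.sum_apply, Pi.single_apply] using h3

section Form

variable {G : FormField n}

theorem form_eq (hx : x ∈ P.U) (A B : Fin (n - 1)) :
    P.form G A B r x = gHat G (P.pos r x) (P.frame r x A) (P.frame r x B) := by
  rw [gHat_apply_of_inner_eq_zero _ (P.inner_pos_frame hx A)]
  rfl

theorem gInv_form (hx : x ∈ P.U) (A B : Fin (n - 1)) :
    gInv (P.form G) A B r x = (frameMatrix G (P.pos r x) (P.frame r x))⁻¹ A B := by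
  have : (Matrix.of fun C D => P.form G C D r x) = frameMatrix G (P.pos r x) (P.frame r x) := by
    ext C D
    simp only [Matrix.of_apply, frameMatrix]
    exact P.form_eq hx C D
  rw [gInv, this]

variable (hn : 2 ≤ n) (hG : IsDegenerateForm T G) (hx : x ∈ P.U) (hr : r ∈ Ioo 0 T)

include hG hx hr

theorem gInv_symm (A B : Fin (n - 1)) :
    gInv (P.form G) A B r x = gInv (P.form G) B A r x := by
  rw [P.gInv_form hx, P.gInv_form hx, frameMatrix_inv_symm hG (P.pos_mem hx hr)]

theorem sum_gInv_mul (A B : Fin (n - 1)) :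
    ∑ C, gInv (P.form G) A C r x * P.form G C B r x = if A = B then 1 else 0 := by
  simp only [P.gInv_form hx, P.form_eq hx]
  exact (P.isFrame hx hr.1.ne').inv_mul hG (P.pos_mem hx hr) A B

include hn

theorem sum_gInv_eq_cometric (φ : Euc n →L[ℝ] ℝ) :
    ∑ A, ∑ B, (gInv (P.form G) A B r x * φ (P.frame r x B)) • P.frame r x A
      = cometric G (P.pos r x) φ := by
  rw [← (P.isFrame hx hr.1.ne').sum_eq_cometric hG (P.pos_mem hx hr) hn, Finset.sum_comm]
  refine Finset.sum_congr rfl fun A _ => Finset.sum_congr rfl fun B _ => ?_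
  rw [P.gInv_symm hG hx hr, P.gInv_form hx]

theorem sum_gInv_eq_trace (b : Euc n →ₗ[ℝ] Euc n →ₗ[ℝ] F) :
    ∑ A, ∑ B, gInv (P.form G) A B r x • b (P.frame r x A) (P.frame r x B)
      = trace G (P.pos r x) fun v w => b v w := by
  rw [← (P.isFrame hx hr.1.ne').sum_eq_trace hG (P.pos_mem hx hr) hn]
  simp only [P.gInv_form hx]

end Form

end SpherePatch

/-! ### The connection -/

/-- `½ (D_u h(v, w) + D_v h(u, w) - D_w h(u, v))`, where `h = dev G`. -/
noncomputable def kTen (G : FormField n) (y : Euc n) : Euc n →L[ℝ] Euc n →L[ℝ] Euc n →L[ℝ] ℝ :=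
  (1 / 2 : ℝ) • (fderiv ℝ (dev G) y + (fderiv ℝ (dev G) y).flip
    - (ContinuousLinearMap.flipₗᵢ ℝ (Euc n) (Euc n) ℝ).toContinuousLinearEquiv.toContinuousLinearMap.comp
        (fderiv ℝ (dev G) y).flip)

theorem kTen_apply (G : FormField n) (y u v w : Euc n) :
    kTen G y u v w = (1 / 2) * (fderiv ℝ (dev G) y u v w + fderiv ℝ (dev G) y v u w
      - fderiv ℝ (dev G) y w u v) := by
  simp [kTen]

/-- The difference of the Levi-Civita connections of `G` and of the round form. -/
noncomputable def cTen (G : FormField n) (y : Euc n) : Euc n →L[ℝ] Euc n →L[ℝ] Euc n :=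
  (ContinuousLinearMap.compL ℝ (Euc n) (Euc n →L[ℝ] ℝ) (Euc n) (cometric G y)).comp (kTen G y)

theorem cTen_apply (G : FormField n) (y u v : Euc n) :
    cTen G y u v = cometric G y (kTen G y u v) := rfl

/-- Minus the second fundamental form of the spheres. -/
noncomputable def zRound (y : Euc n) : Euc n →L[ℝ] Euc n →L[ℝ] Euc n :=
  (‖y‖ ^ 2)⁻¹ • (ContinuousLinearMap.compL ℝ (Euc n) ℝ (Euc n)
    (ContinuousLinearMap.toSpanSingleton ℝ y)).comp (euclideanForm n)

theorem zRound_apply (y u v : Euc n) : zRound y u v = ((‖y‖ ^ 2)⁻¹ * inner ℝ u v) • y := by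
  simp [zRound, smul_smul, euclideanForm_apply]

/-- The tensor with `∂_A e_B = Γ^C_{AB} e_C - zTen (e_A, e_B)` for coordinate frames. -/
noncomputable def zTen (G : FormField n) (y : Euc n) : Euc n →L[ℝ] Euc n →L[ℝ] Euc n :=
  cTen G y + zRound y

theorem fderiv_gHat (G : FormField n) (y : Euc n) : fderiv ℝ (gHat G) y = fderiv ℝ (dev G) y := by
  exact fderiv_const_add (𝕜 := ℝ) (E := Euc n) (F := Euc n →L[ℝ] Euc n →L[ℝ] ℝ) (f := dev G) _

theorem differentiableAt_gHat {G : FormField n} {y : Euc n} (h : DifferentiableAt ℝ (dev G) y) :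
    DifferentiableAt ℝ (gHat G) y := by
  exact DifferentiableAt.const_add (𝕜 := ℝ) (E := Euc n) (F := Euc n →L[ℝ] Euc n →L[ℝ] ℝ)
    (f := dev G) _ h

namespace SpherePatch

variable (P : SpherePatch n) {x : Euc (n - 1)} {r : ℝ} {G : FormField n}

theorem pa_form (hx : x ∈ P.U) (hd : DifferentiableAt ℝ (dev G) (P.pos r x))
    (A B D : Fin (n - 1)) :
    pa A (P.form G B D) r x
      = fderiv ℝ (dev G) (P.pos r x) (P.frame r x A) (P.frame r x B) (P.frame r x D)
        + gHat G (P.pos r x) (pd A (fun x => P.frame r x B) x) (P.frame r x D)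
        + gHat G (P.pos r x) (P.frame r x B) (pd A (fun x => P.frame r x D) x) := by
  have h1 : P.form G B D r =ᶠ[𝓝 x]
      fun x => gHat G (P.pos r x) (P.frame r x B) (P.frame r x D) := by
    filter_upwards [P.eventually_mem hx] with x' hx'
    exact P.form_eq hx' B D
  have hg := P.differentiableAt_comp_pos (f := gHat G) hx (differentiableAt_gHat hd)
  have hB := P.differentiableAt_frame hx r B
  have hD := P.differentiableAt_frame hx r D
  change pd A (P.form G B D r) x = _
  rw [pd_congr h1, pd_clm_apply (hg.clm_apply hB) hD, pd_clm_apply hg hB,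
    P.pd_comp_pos hx (differentiableAt_gHat hd), fderiv_gHat]
  simp

/-- The Gauss formula: `∂_A e_B = Γ^C_{AB} e_C - zTen (e_A, e_B)`. -/
theorem sum_christoffel (hn : 2 ≤ n) (hG : IsDegenerateForm T G) (hx : x ∈ P.U)
    (hr : r ∈ Ioo 0 T) (hd : DifferentiableAt ℝ (dev G) (P.pos r x)) (A B : Fin (n - 1)) :
    ∑ C, christoffel (P.form G) C A B r x • P.frame r x C
      = pd A (fun x => P.frame r x B) x
        + zTen G (P.pos r x) (P.frame r x A) (P.frame r x B) := by
  have hy := P.pos_mem hx hr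
  set y := P.pos r x with hydef
  -- Koszul formula: in ½(∂_A g_{BD} + ∂_B g_{AD} - ∂_D g_{AB}) the derivatives of the form give
  -- `kTen`. As ∂_A e_B is symmetric in A and B, the derivatives of the frame leave only the product
  -- of ∂_A e_B with e_D.
  set φ : Euc n →L[ℝ] ℝ := kTen G y (P.frame r x A) (P.frame r x B)
    + gHat G y (pd A (fun x => P.frame r x B) x) with hφ
  have h1 : ∀ C, christoffel (P.form G) C A B r x
      = ∑ D, gInv (P.form G) C D r x * φ (P.frame r x D) := by
    intro C
    rw [christoffel, Finset.mul_sum]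
    refine Finset.sum_congr rfl fun D _ => ?_
    rw [P.pa_form hx hd, P.pa_form hx hd, P.pa_form hx hd, ← hydef, hφ, add_apply, kTen_apply,
      P.pd_frame_symm hx r B A, P.pd_frame_symm hx r D A, P.pd_frame_symm hx r D B,
      hG.gHat_symm hy (pd A (fun x => P.frame r x D) x)]
    ring
  simp only [h1, Finset.sum_smul]
  -- The cometric removes from ∂_A e_B its radial part, which is -`zRound` (e_A, e_B).
  rw [P.sum_gInv_eq_cometric hn hG hx hr, ← hydef, hφ, map_add, hG.cometric_gHat hy,
    P.inner_pos_pd_frame hx, zTen, add_apply, add_apply, cTen_apply, zRound_apply]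
  module

end SpherePatch

end LightCone

namespace LightCone

variable {n : ℕ} {F F' : Type} [NormedAddCommGroup F] [NormedSpace ℝ F]
  [NormedAddCommGroup F'] [NormedSpace ℝ F'] {T : ℝ}

/-! ### The null second fundamental form -/

/-- `r χ_A^B - δ_A^B` as a field of endomorphisms. -/
noncomputable def nOp (G : FormField n) (y : Euc n) : Euc n →L[ℝ] Euc n :=
  (1 / 2 : ℝ) • (cometric G y).comp (rad (dev G) y)

/-- `r τ - (n - 1)`. -/
noncomputable def tHat (G : FormField n) (y : Euc n) : ℝ :=
  trace G y fun v w => (1 / 2) * rad (dev G) y v w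

/-- The trace of the square of `nOp G`. -/
noncomputable def sqHat (G : FormField n) (y : Euc n) : ℝ :=
  trace G y fun v w => (1 / 2) * rad (dev G) y (nOp G y v) w

/-- `r² g^{AB} s_{AB}`. -/
noncomputable def wHat (G : FormField n) (y : Euc n) : ℝ :=
  trace G y fun v w => inner ℝ v w

/-- `r (ν^0 ∂₁ν₀ - ½ (W_1 + τ))`. -/
noncomputable def kHat (G : FormField n) (ν₀ : Euc n → ℝ) (y : Euc n) : ℝ :=
  rad ν₀ y / ν₀ y - (1 / 2) * (-(ν₀ y * wHat G y) + ((n - 1 : ℕ) + tHat G y))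

theorem nOp_apply (G : FormField n) (y v : Euc n) :
    nOp G y v = (1 / 2 : ℝ) • cometric G y (rad (dev G) y v) := rfl

section Symmetry

variable {G : FormField n} (hG : IsDegenerateForm T G) {y : Euc n} (hy : y ∈ coneRegion n T)
  (hd : DifferentiableAt ℝ (dev G) y)

include hG hy

theorem IsDegenerateForm.dev_symm (v w : Euc n) : dev G y v w = dev G y w v := by
  have := hG.gHat_symm hy v w
  simp only [gHat, add_apply, euclideanForm_apply, real_inner_comm v w] at this
  linarith

theorem IsDegenerateForm.dev_left (w : Euc n) : dev G y y w = 0 := by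
  have := hG.gHat_left hy w
  simp only [gHat, add_apply, euclideanForm_apply] at this
  linarith

include hd

theorem IsDegenerateForm.fderiv_dev_symm (u v w : Euc n) :
    fderiv ℝ (dev G) y u v w = fderiv ℝ (dev G) y u w v := by
  have h : ∀ v w : Euc n, HasFDerivAt (fun z => dev G z v w)
      (((ContinuousLinearMap.apply ℝ ℝ w).comp
        (ContinuousLinearMap.apply ℝ (Euc n →L[ℝ] ℝ) v)).comp (fderiv ℝ (dev G) y)) y :=
    fun v w => ((ContinuousLinearMap.apply ℝ ℝ w).comp
      (ContinuousLinearMap.apply ℝ (Euc n →L[ℝ] ℝ) v)).hasFDerivAt.comp y hd.hasFDerivAt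
  have h2 : (fun z => dev G z v w) =ᶠ[𝓝 y] fun z => dev G z w v := by
    filter_upwards [(isOpen_coneRegion n T).mem_nhds hy] with z hz
    exact hG.dev_symm hz v w
  have h3 := (h v w).unique ((h w v).congr_of_eventuallyEq h2)
  exact congrArg (fun L => L u) h3

theorem IsDegenerateForm.rad_dev_symm (v w : Euc n) :
    rad (dev G) y v w = rad (dev G) y w v := hG.fderiv_dev_symm hy hd y v w

theorem IsDegenerateForm.rad_dev_left (w : Euc n) : rad (dev G) y y w = 0 := by
  have h1 := (hd.hasFDerivAt.clm_apply (hasFDerivAt_id y)).clm_apply (hasFDerivAt_const w y)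
  have h2 : (fun z => dev G z (id z) w) =ᶠ[𝓝 y] fun _ => 0 := by
    filter_upwards [(isOpen_coneRegion n T).mem_nhds hy] with z hz
    exact hG.dev_left hz w
  have h3 := h1.unique ((hasFDerivAt_const (0 : ℝ) y).congr_of_eventuallyEq h2)
  have h4 := congrArg (fun L => L y) h3
  simp only [add_apply, ContinuousLinearMap.comp_apply, ContinuousLinearMap.flip_apply,
    ContinuousLinearMap.id_apply, zero_apply, id_eq, map_zero, zero_add,
    hG.dev_left hy w] at h4
  exact h4

omit hd in
theorem IsDegenerateForm.gHat_nOp {w : Euc n} (hw : inner ℝ y w = 0) (v : Euc n) :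
    gHat G y (nOp G y v) w = (1 / 2) * rad (dev G) y v w := by
  rw [nOp_apply, map_smul, smul_apply, hG.gHat_cometric hy, hw, smul_eq_mul]
  ring

end Symmetry

theorem pr_eq_of_hasDerivAt {d : ℕ} {f : Fld d} {r f' : ℝ} {x : Euc d}
    (h : HasDerivAt (fun ρ => f ρ x) f' r) : pr f r x = f' := h.deriv

theorem pr_congr {d : ℕ} {f g : Fld d} {r : ℝ} {x : Euc d} (hr : r ∈ Ioo 0 T)
    (h : ∀ ρ ∈ Ioo 0 T, f ρ x = g ρ x) : pr f r x = pr g r x :=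
  EventuallyEq.deriv_eq (by filter_upwards [isOpen_Ioo.mem_nhds hr] with ρ hρ using h ρ hρ)

namespace SpherePatch

variable (P : SpherePatch n) {x : Euc (n - 1)} {r : ℝ} {G : FormField n}

theorem pr_scalar {f : Euc n → ℝ} (hr : 0 < r) (hf : DifferentiableAt ℝ f (P.pos r x)) :
    pr (P.scalar f) r x = r⁻¹ * rad f (P.pos r x) :=
  (hasDerivAt_ray hr.ne' hf).deriv

theorem pr_covector {ν : CovectorField n} (hr : 0 < r)
    (hν : DifferentiableAt ℝ ν (P.pos r x)) (A : Fin (n - 1)) :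
    pr (P.covector ν A) r x = r⁻¹ * (rad ν (P.pos r x) (P.frame r x A)
      + ν (P.pos r x) (P.frame r x A)) := by
  have h1 : HasDerivAt (fun ρ : ℝ => ν (ρ • P.Θ x)) (r⁻¹ • rad ν (P.pos r x)) r :=
    hasDerivAt_ray hr.ne' hν
  have h2 : HasDerivAt (fun ρ : ℝ => ρ • P.dΘ x A) (P.dΘ x A) r := by
    simpa using (hasDerivAt_id r).smul_const (P.dΘ x A)
  have h5 := h1.clm_apply h2
  refine (pr_eq_of_hasDerivAt h5).trans ?_
  have h3 : P.dΘ x A = r⁻¹ • P.frame r x A := by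
    rw [frame, smul_smul, inv_mul_cancel₀ hr.ne', one_smul]
  rw [show r • P.dΘ x A = P.frame r x A from rfl, h3]
  simp only [smul_apply, map_smul, smul_eq_mul]
  rw [pos]; ring

/-- `gHat G` and `dev G` differ by a constant form, so only `dev G` is differentiated. The term 2
g_{AB} comes from the two frame vectors, each linear in r. -/
theorem pr_form (hx : x ∈ P.U) (hr : 0 < r) (hd : DifferentiableAt ℝ (dev G) (P.pos r x))
    (A B : Fin (n - 1)) :
    pr (P.form G A B) r x = r⁻¹ * (rad (dev G) (P.pos r x) (P.frame r x A) (P.frame r x B)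
      + 2 * P.form G A B r x) := by
  have h1 : HasDerivAt (fun ρ : ℝ => gHat G (ρ • P.Θ x))
      (r⁻¹ • rad (dev G) (P.pos r x)) r := by
    have := hasDerivAt_ray (f := gHat G) hr.ne' (differentiableAt_gHat hd)
    rwa [rad, fderiv_gHat] at this
  have h2 : ∀ A, HasDerivAt (fun ρ : ℝ => ρ • P.dΘ x A) (P.dΘ x A) r := fun A => by
    simpa using (hasDerivAt_id r).smul_const (P.dΘ x A)
  have h3 : ∀ A, P.dΘ x A = r⁻¹ • P.frame r x A := fun A => by
    rw [frame, smul_smul, inv_mul_cancel₀ hr.ne', one_smul]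
  have h4 : (fun ρ => P.form G A B ρ x)
      = fun ρ => gHat G (ρ • P.Θ x) (ρ • P.dΘ x A) (ρ • P.dΘ x B) := by
    ext ρ; exact P.form_eq hx A B
  have h5 := (h1.clm_apply (h2 A)).clm_apply (h2 B)
  rw [← h4] at h5
  refine (pr_eq_of_hasDerivAt h5).trans ?_
  rw [P.form_eq hx, show r • P.dΘ x A = P.frame r x A from rfl,
    show r • P.dΘ x B = P.frame r x B from rfl, show r • P.Θ x = P.pos r x from rfl, h3 A, h3 B]
  simp only [smul_apply, map_smul, smul_eq_mul, add_apply]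
  ring

/-- The components of `nOp G` in the coordinate frame. -/
noncomputable def nCoef (G : FormField n) (A B : Fin (n - 1)) : Fld (n - 1) := fun r x =>
  ∑ C, gInv (P.form G) B C r x
    * ((1 / 2) * rad (dev G) (P.pos r x) (P.frame r x A) (P.frame r x C))

variable (hn : 2 ≤ n) (hG : IsDegenerateForm T G) (hx : x ∈ P.U) (hr : r ∈ Ioo 0 T)
  (hd : DifferentiableAt ℝ (dev G) (P.pos r x))

include hG hx hr hd

theorem chi_form (A B : Fin (n - 1)) :
    chi (P.form G) A B r x = r⁻¹ * ((if A = B then 1 else 0) + P.nCoef G A B r x) := by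
  have h1 : ∀ C, gInv (P.form G) B C r x * pr (P.form G A C) r x
      = r⁻¹ * (gInv (P.form G) B C r x
          * rad (dev G) (P.pos r x) (P.frame r x A) (P.frame r x C))
        + 2 * r⁻¹ * (gInv (P.form G) B C r x * P.form G C A r x) := by
    intro C
    rw [P.pr_form hx hr.1 hd, P.form_eq hx A C, P.form_eq hx C A,
      hG.gHat_symm (P.pos_mem hx hr) (P.frame r x C)]
    ring
  rw [chi]
  simp only [h1]
  rw [Finset.sum_add_distrib, ← Finset.mul_sum, ← Finset.mul_sum, P.sum_gInv_mul hG hx hr, nCoef]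
  have h2 : ∑ C, gInv (P.form G) B C r x
      * ((1 / 2) * rad (dev G) (P.pos r x) (P.frame r x A) (P.frame r x C))
      = (1 / 2) * ∑ C, gInv (P.form G) B C r x
        * rad (dev G) (P.pos r x) (P.frame r x A) (P.frame r x C) := by
    rw [Finset.mul_sum]
    exact Finset.sum_congr rfl fun C _ => by ring
  rw [h2]
  simp only [eq_comm (a := B) (b := A)]
  ring

include hn

omit hd in
theorem sum_nCoef (A : Fin (n - 1)) :
    ∑ B, P.nCoef G A B r x • P.frame r x B = nOp G (P.pos r x) (P.frame r x A) := by
  have := P.sum_gInv_eq_cometric hn hG hx hr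
    ((1 / 2 : ℝ) • rad (dev G) (P.pos r x) (P.frame r x A))
  rw [map_smul] at this
  rw [nOp_apply, ← this]
  refine Finset.sum_congr rfl fun B _ => ?_
  rw [nCoef, Finset.sum_smul]
  rfl

omit hd in
theorem sum_nCoef_self : ∑ A, P.nCoef G A A r x = tHat G (P.pos r x) := by
  have := P.sum_gInv_eq_trace hn hG hx hr (LinearMap.mk₂ ℝ
    (fun v w => (1 / 2) * rad (dev G) (P.pos r x) v w)
    (fun _ _ _ => by simp; ring) (fun _ _ _ => by simp; ring)
    (fun _ _ _ => by simp [map_add]; ring) (fun _ _ _ => by simp; ring))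
  simp only [LinearMap.mk₂_apply, smul_eq_mul] at this
  rw [tHat, ← this]
  rfl

omit hd in
theorem sum_nCoef_mul : ∑ A, ∑ B, P.nCoef G A B r x * P.nCoef G B A r x
    = sqHat G (P.pos r x) := by
  have := P.sum_gInv_eq_trace hn hG hx hr (LinearMap.mk₂ ℝ
    (fun v w => (1 / 2) * rad (dev G) (P.pos r x) (nOp G (P.pos r x) v) w)
    (fun _ _ _ => by simp; ring) (fun _ _ _ => by simp; ring)
    (fun _ _ _ => by simp [map_add]; ring) (fun _ _ _ => by simp; ring))
  simp only [LinearMap.mk₂_apply, smul_eq_mul] at this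
  rw [sqHat, ← this]
  refine Finset.sum_congr rfl fun A _ => ?_
  have h1 : ∀ D, rad (dev G) (P.pos r x) (nOp G (P.pos r x) (P.frame r x A)) (P.frame r x D)
      = ∑ B, P.nCoef G A B r x
        * rad (dev G) (P.pos r x) (P.frame r x B) (P.frame r x D) := by
    intro D
    rw [← P.sum_nCoef hn hG hx hr A, map_sum, sum_apply]
    simp
  simp only [h1, Finset.mul_sum]
  rw [Finset.sum_comm]
  refine Finset.sum_congr rfl fun B _ => ?_
  conv_lhs => rw [nCoef.eq_1 P G B A, Finset.mul_sum]
  exact Finset.sum_congr rfl fun D _ => by ring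

theorem tau_form : tau (P.form G) r x = r⁻¹ * ((n - 1 : ℕ) + tHat G (P.pos r x)) := by
  rw [tau]
  simp only [P.chi_form hG hx hr hd, if_true]
  rw [← Finset.mul_sum, Finset.sum_add_distrib, P.sum_nCoef_self hn hG hx hr]
  simp

theorem sum_chi_mul : ∑ A, ∑ B, chi (P.form G) A B r x * chi (P.form G) B A r x
    = r⁻¹ ^ 2 * ((n - 1 : ℕ) + 2 * tHat G (P.pos r x) + sqHat G (P.pos r x)) := by
  rw [← P.sum_nCoef_self hn hG hx hr, ← P.sum_nCoef_mul hn hG hx hr]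
  simp only [P.chi_form hG hx hr hd]
  have h1 : ∀ A B : Fin (n - 1), r⁻¹ * ((if A = B then 1 else 0) + P.nCoef G A B r x)
      * (r⁻¹ * ((if B = A then 1 else 0) + P.nCoef G B A r x))
      = (if A = B then r⁻¹ ^ 2 * (1 + 2 * P.nCoef G A A r x) else 0)
        + r⁻¹ ^ 2 * (P.nCoef G A B r x * P.nCoef G B A r x) := by
    intro A B
    by_cases h : A = B
    · subst h; simp; ring
    · simp [h, Ne.symm h]; ring
  simp only [h1, Finset.sum_add_distrib, Finset.sum_ite_eq, Finset.mem_univ, if_true,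
    ← Finset.mul_sum]
  simp
  ring

omit hd in
theorem Wzero_form : Wzero P.round (P.form G) r x = - (r⁻¹ * wHat G (P.pos r x)) := by
  have := P.sum_gInv_eq_trace hn hG hx hr (LinearMap.mk₂ ℝ
    (fun v w => (inner ℝ v w : ℝ))
    (fun _ _ _ => by simp [inner_add_left]) (fun _ _ _ => by simp [real_inner_smul_left])
    (fun _ _ _ => by simp [inner_add_right]) (fun _ _ _ => by simp [real_inner_smul_right]))
  simp only [LinearMap.mk₂_apply, smul_eq_mul] at this
  rw [wHat, ← this, Wzero, Finset.mul_sum, Finset.mul_sum, ← Finset.sum_neg_distrib]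
  refine Finset.sum_congr rfl fun A _ => ?_
  rw [Finset.mul_sum, Finset.mul_sum, ← Finset.sum_neg_distrib]
  refine Finset.sum_congr rfl fun B _ => ?_
  have := hr.1.ne'
  rw [frame, frame, real_inner_smul_left, real_inner_smul_right, round]
  field_simp

omit hG hx hd hr hn in
-- Orthogonality of the trace and trace-free parts of χ. As a result the first constraint involves
-- the shear only through the trace of χ².
theorem sigmaSq_add (g : Fin (n - 1) → Fin (n - 1) → Fld (n - 1)) (hn : 2 ≤ n) (r : ℝ)
    (x : Euc (n - 1)) :
    sigmaSq g r x + tau g r x ^ 2 / (n - 1 : ℕ)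
      = ∑ A, ∑ B, chi g A B r x * chi g B A r x := by
  have hd : ((n - 1 : ℕ) : ℝ) ≠ 0 := by
    have : n - 1 ≠ 0 := by omega
    exact_mod_cast this
  have h1 : ∀ A B : Fin (n - 1), sigma g A B r x * sigma g B A r x
      = chi g A B r x * chi g B A r x
        + if A = B then (tau g r x / (n - 1 : ℕ)) ^ 2
          - 2 * (tau g r x / (n - 1 : ℕ)) * chi g A A r x else 0 := by
    intro A B
    rw [sigma, sigma]
    by_cases h : A = B
    · subst h; simp; ring
    · simp [h, Ne.symm h]
  rw [sigmaSq]
  simp only [h1, Finset.sum_add_distrib, Finset.sum_ite_eq, Finset.mem_univ, if_true,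
    Finset.sum_sub_distrib, ← Finset.mul_sum]
  rw [show ∑ A, chi g A A r x = tau g r x from rfl]
  simp
  field_simp
  ring

variable {ν₀ : Euc n → ℝ}

theorem kappaOf_form (hν : DifferentiableAt ℝ ν₀ (P.pos r x)) :
    kappaOf P.round (P.form G) (P.scalar ν₀) r x = r⁻¹ * kHat G ν₀ (P.pos r x) := by
  rw [kappaOf, Wone, P.Wzero_form hn hG hx hr, P.tau_form hn hG hx hr hd, P.pr_scalar hr.1 hν,
    kHat, scalar, ← pos]
  ring

omit hd in
theorem pr_tau_form (hd : ∀ y ∈ coneRegion n T, DifferentiableAt ℝ (dev G) y)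
    (ht : DifferentiableAt ℝ (tHat G) (P.pos r x)) :
    pr (tau (P.form G)) r x
      = r⁻¹ ^ 2 * (rad (tHat G) (P.pos r x) - ((n - 1 : ℕ) + tHat G (P.pos r x))) := by
  have h1 := hasDerivAt_ray hr.1.ne' ht
  have h2 := (hasDerivAt_inv hr.1.ne').mul (h1.const_add ((n - 1 : ℕ) : ℝ))
  rw [pr_congr (g := fun ρ x => ρ⁻¹ * ((n - 1 : ℕ) + tHat G (P.pos ρ x))) hr fun ρ hρ =>
    P.tau_form hn hG hx hρ (hd _ (P.pos_mem hx hρ))]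
  refine (pr_eq_of_hasDerivAt h2).trans ?_
  simp only [pos, smul_eq_mul]
  have := hr.1.ne'
  field_simp
  ring

omit hd in
-- The Minkowski values cancel: -r²∂₁τ contributes n - 1 and -r² tr χ² contributes -(n - 1). The
-- remaining source terms vanish at the vertex.
theorem C1_form (hd : ∀ y ∈ coneRegion n T, DifferentiableAt ℝ (dev G) y)
    (ht : DifferentiableAt ℝ (tHat G) (P.pos r x)) (hν : DifferentiableAt ℝ ν₀ (P.pos r x)) :
    C1 P.round (P.form G) (P.scalar ν₀) r x
      = r⁻¹ ^ 2 * (kHat G ν₀ (P.pos r x) * ((n - 1 : ℕ) + tHat G (P.pos r x))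
        - (rad (tHat G) (P.pos r x) + tHat G (P.pos r x) + sqHat G (P.pos r x))) := by
  have hd' := hd _ (P.pos_mem hx hr)
  have h1 := P.kappaOf_form hn hG hx hr hd' hν
  have h2 := sigmaSq_add (P.form G) hn r x
  rw [P.sum_chi_mul hn hG hx hr hd'] at h2
  rw [kappaOf] at h1
  rw [C1, h1, P.pr_tau_form hn hG hx hr hd ht, sub_sub, h2, P.tau_form hn hG hx hr hd']
  ring

end SpherePatch

end LightCone

namespace LightCone

variable {n : ℕ} {F F' : Type} [NormedAddCommGroup F] [NormedSpace ℝ F]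
  [NormedAddCommGroup F'] [NormedSpace ℝ F'] {T : ℝ}

/-! ### Divergences and curvature -/

/-- The covector `r ∇_B χ_A^B`. -/
noncomputable def divN (G : FormField n) (y : Euc n) : Euc n →L[ℝ] ℝ :=
  trace G y fun v w => (gHat G y w).comp
    (fderiv ℝ (nOp G) y v + (zTen G y v).comp (nOp G y) - (nOp G y).comp (zTen G y v))

/-- The divergence `g^{AB} ∇_A ξ_B` of a covector field. -/
noncomputable def divXi (G : FormField n) (ξ : CovectorField n) (y : Euc n) : ℝ :=
  trace G y fun v w => fderiv ℝ ξ y v w - ξ y (zTen G y v w)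

/-- The contribution of `cTen` to the Riemann tensor. -/
noncomputable def riemC (G : FormField n) (y u v w : Euc n) : Euc n :=
  fderiv ℝ (cTen G) y u v w - fderiv ℝ (cTen G) y v u w + cTen G y u (zTen G y v w)
    - cTen G y v (zTen G y u w)

/-- The contribution of `cTen` to the scalar curvature. -/
noncomputable def scalC (G : FormField n) (y : Euc n) : ℝ :=
  trace G y fun v w => trace G y fun v' w' => gHat G y w' (riemC G y v' v w)

/-- The vector `g^{AB} cTen(e_A, e_B)`. -/
noncomputable def trC (G : FormField n) (y : Euc n) : Euc n :=
  trace G y fun v w => cTen G y v w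

/-- Cramer's rule: the entries of the inverse are quotients of polynomials in the entries. -/
theorem contDiffAt_matrix_inv {d : ℕ} {m : WithTop ℕ∞} {M : Euc d → Matrix (Fin d) (Fin d) ℝ}
    {x : Euc d} (hM : ∀ A B, ContDiffAt ℝ m (fun x => M x A B) x) (hdet : IsUnit (M x).det)
    (A B : Fin d) : ContDiffAt ℝ m (fun x => (M x)⁻¹ A B) x := by
  have hdetc : ∀ {M : Euc d → Matrix (Fin d) (Fin d) ℝ},
      (∀ A B, ContDiffAt ℝ m (fun x => M x A B) x) → ContDiffAt ℝ m (fun x => (M x).det) x := by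
    intro M hM
    simp only [Matrix.det_apply]
    refine ContDiffAt.sum fun σ _ => ?_
    exact (contDiffAt_prod fun i _ => hM _ _).const_smul _
  have h1 : ∀ x, (M x)⁻¹ A B = ((M x).det)⁻¹ * ((M x).updateRow B (Pi.single A 1)).det := by
    intro x
    rw [Matrix.inv_def, Matrix.smul_apply, Ring.inverse_eq_inv', smul_eq_mul,
      Matrix.adjugate_apply]
  simp only [h1]
  refine ((hdetc hM).inv hdet.ne_zero).mul (hdetc fun C D => ?_)
  simp only [Matrix.updateRow_apply]
  by_cases h : C = B
  · simp only [h, if_true]; exact contDiffAt_const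
  · simp only [h, if_false]; exact hM C D

namespace SpherePatch

variable (P : SpherePatch n) {x : Euc (n - 1)} {r : ℝ} {G : FormField n}

theorem pd_nCoef_aux {d : ℕ} {c : Fin d → Euc d → ℝ} {e : Fin d → Euc d → F} {x : Euc d}
    (hc : ∀ B, DifferentiableAt ℝ (c B) x) (he : ∀ B, DifferentiableAt ℝ (e B) x) (C : Fin d) :
    pd C (fun x => ∑ B, c B x • e B x) x
      = ∑ B, pd C (c B) x • e B x + ∑ B, c B x • pd C (e B) x := by
  rw [pd_sum fun B _ => (hc B).fun_smul (he B), ← Finset.sum_add_distrib]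
  exact Finset.sum_congr rfl fun B _ => pd_smul (hc B) (he B)

theorem contDiffAt_form {m : WithTop ℕ∞} (hm : m ≤ ∞) (hx : x ∈ P.U)
    (hc : ContDiffAt ℝ m (dev G) (P.pos r x)) (A B : Fin (n - 1)) :
    ContDiffAt ℝ m (P.form G A B r) x := by
  have h0 : ContDiffAt ℝ m (gHat G) (P.pos r x) := contDiffAt_const.add hc
  have h1 : ContDiffAt ℝ m (fun x => gHat G (P.pos r x)) x :=
    h0.comp x ((P.contDiffAt_pos hx r).of_le hm)
  have h2 : ContDiffAt ℝ m (fun x => gHat G (P.pos r x) (P.frame r x A) (P.frame r x B)) x :=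
    (h1.clm_apply ((P.contDiffAt_frame hx r A).of_le hm)).clm_apply
      ((P.contDiffAt_frame hx r B).of_le hm)
  refine h2.congr_of_eventuallyEq ?_
  filter_upwards [P.eventually_mem hx] with x' hx'
  exact P.form_eq hx' A B

section

variable (hG : IsDegenerateForm T G) (hx : x ∈ P.U) (hr : r ∈ Ioo 0 T)

include hG hx hr

theorem contDiffAt_gInv {m : WithTop ℕ∞} (hm : m ≤ ∞)
    (hc : ContDiffAt ℝ m (dev G) (P.pos r x)) (A B : Fin (n - 1)) :
    ContDiffAt ℝ m (gInv (P.form G) A B r) x := by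
  refine contDiffAt_matrix_inv (M := fun x => Matrix.of fun C D => P.form G C D r x)
    (fun A B => P.contDiffAt_form hm hx hc A B) ?_ A B
  have : (Matrix.of fun C D => P.form G C D r x) = frameMatrix G (P.pos r x) (P.frame r x) := by
    ext C D
    exact P.form_eq hx C D
  simp only [this]
  exact (P.isFrame hx hr.1.ne').isUnit_det hG (P.pos_mem hx hr)

theorem differentiableAt_christoffel (hc : ContDiffAt ℝ 2 (dev G) (P.pos r x))
    (C A B : Fin (n - 1)) : DifferentiableAt ℝ (christoffel (P.form G) C A B r) x := by
  have h1 : ∀ A B D : Fin (n - 1), ContDiffAt ℝ 1 (pa A (P.form G B D) r) x := fun A B D =>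
    ((P.contDiffAt_form (m := 2) (by norm_cast) hx hc B D).fderiv_right (m := 1)
      (by norm_num)).clm_apply contDiffAt_const
  have h2 : ContDiffAt ℝ 1 (christoffel (P.form G) C A B r) x := by
    refine contDiffAt_const.mul (ContDiffAt.sum fun D _ => ?_)
    exact (P.contDiffAt_gInv hG hx hr (by norm_cast) (hc.of_le (by norm_num)) C D).mul
      (((h1 A B D).add (h1 B A D)).sub (h1 D A B))
  exact h2.differentiableAt one_ne_zero

theorem differentiableAt_nCoef (hd : ContDiffAt ℝ 1 (dev G) (P.pos r x))
    (hR : DifferentiableAt ℝ (rad (dev G)) (P.pos r x)) (A B : Fin (n - 1)) :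
    DifferentiableAt ℝ (P.nCoef G A B r) x := by
  refine DifferentiableAt.fun_sum fun C _ => ?_
  have h1 := (P.contDiffAt_gInv hG hx hr (by norm_cast) hd B C).differentiableAt one_ne_zero
  have h2 := (P.differentiableAt_comp_pos hx hR).clm_apply (P.differentiableAt_frame hx r A)
  exact h1.mul ((h2.clm_apply (P.differentiableAt_frame hx r C)).const_mul (1 / 2))

omit hG hx hr in
theorem christoffel_symm (hx : x ∈ P.U) (hG : IsDegenerateForm T G) (hr : r ∈ Ioo 0 T)
    (C A B : Fin (n - 1)) :
    christoffel (P.form G) C A B r x = christoffel (P.form G) C B A r x := by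
  have h1 : ∀ D : Fin (n - 1), pa D (P.form G A B) r x = pa D (P.form G B A) r x := by
    intro D
    refine pd_congr ?_
    filter_upwards [P.eventually_mem hx] with x' hx'
    rw [P.form_eq hx', P.form_eq hx', hG.gHat_symm (P.pos_mem hx' hr)]
  rw [christoffel, christoffel]
  congr 1
  refine Finset.sum_congr rfl fun D _ => ?_
  rw [h1 D]
  ring

variable (hn : 2 ≤ n)

include hn

omit hn in
theorem sum_gInv_coef (c : Fin (n - 1) → ℝ) (A : Fin (n - 1)) :
    ∑ D, gInv (P.form G) A D r x * gHat G (P.pos r x) (P.frame r x D)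
      (∑ B, c B • P.frame r x B) = c A := by
  have h1 : ∀ D, gInv (P.form G) A D r x * gHat G (P.pos r x) (P.frame r x D)
      (∑ B, c B • P.frame r x B)
      = ∑ B, c B * (gInv (P.form G) A D r x * P.form G D B r x) := by
    intro D
    rw [map_sum, Finset.mul_sum]
    refine Finset.sum_congr rfl fun B _ => ?_
    rw [map_smul, P.form_eq hx, smul_eq_mul]
    ring
  simp only [h1]
  rw [Finset.sum_comm]
  simp only [← Finset.mul_sum, P.sum_gInv_mul hG hx hr]
  simp

/-- The identity part of χ is parallel, so only `nOp G` contributes. Its covariant derivative is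
obtained by differentiating the expansion of nOp(e_A) in the frame and replacing each ∂_C e_B by the
Gauss formula. -/
theorem divChi_form (hd : ∀ y ∈ coneRegion n T, DifferentiableAt ℝ (dev G) y)
    (hc : ContDiffAt ℝ 2 (dev G) (P.pos r x))
    (hR : DifferentiableAt ℝ (rad (dev G)) (P.pos r x))
    (hN : DifferentiableAt ℝ (nOp G) (P.pos r x)) (A : Fin (n - 1)) :
    divChi (P.form G) A r x = r⁻¹ * divN G (P.pos r x) (P.frame r x A) := by
  set y := P.pos r x with hydef
  have hy : y ∈ coneRegion n T := P.pos_mem hx hr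
  have hd' := hd _ hy
  have hGam := fun A B => P.sum_christoffel hn hG hx hr hd' A B
  have hdn := fun A B => P.differentiableAt_nCoef hG hx hr (hc.of_le (by norm_num)) hR A B
  have hdf := fun B => P.differentiableAt_frame hx r B
  have hdN : DifferentiableAt ℝ (fun x => nOp G (P.pos r x)) x :=
    P.differentiableAt_comp_pos hx hN
  set V : Fin (n - 1) → Euc n := fun C => fderiv ℝ (nOp G) y (P.frame r x C) (P.frame r x A)
    + zTen G y (P.frame r x C) (nOp G y (P.frame r x A))
    - nOp G y (zTen G y (P.frame r x C) (P.frame r x A)) with hV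
  set v : Fin (n - 1) → Fin (n - 1) → ℝ := fun C B => pa C (P.nCoef G A B) r x
    + ∑ D, (christoffel (P.form G) B C D r x * P.nCoef G A D r x
      - christoffel (P.form G) D C A r x * P.nCoef G D B r x) with hv
  have key : ∀ C, ∑ B, v C B • P.frame r x B = V C := by
    intro C
    have h1 : pd C (fun x => ∑ B, P.nCoef G A B r x • P.frame r x B) x
        = pd C (fun x => nOp G (P.pos r x) (P.frame r x A)) x := by
      refine pd_congr ?_
      filter_upwards [P.eventually_mem hx] with x' hx'
      exact P.sum_nCoef hn hG hx' hr A
    rw [pd_nCoef_aux (c := fun B x => P.nCoef G A B r x) (e := fun B x => P.frame r x B)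
      (fun B => hdn A B) hdf, pd_clm_apply hdN (hdf A), P.pd_comp_pos hx hN] at h1
    have h2 : ∀ B, pd C (fun x => P.frame r x B) x
        = ∑ D, christoffel (P.form G) D C B r x • P.frame r x D
          - zTen G y (P.frame r x C) (P.frame r x B) := fun B => by rw [hGam]; abel
    simp only [h2, map_sub, map_sum, map_smul, ← P.sum_nCoef hn hG hx hr, smul_sub] at h1
    have h3 : zTen G y (P.frame r x C) (nOp G y (P.frame r x A))
        = ∑ B, P.nCoef G A B r x • zTen G y (P.frame r x C) (P.frame r x B) := by
      rw [hydef, ← P.sum_nCoef hn hG hx hr A, map_sum]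
      exact Finset.sum_congr rfl fun B _ => map_smul _ _ _
    have h4 : ∑ B, v C B • P.frame r x B
        = ∑ B, pd C (P.nCoef G A B r) x • P.frame r x B
          + ∑ B, P.nCoef G A B r x • ∑ D, christoffel (P.form G) D C B r x • P.frame r x D
          - ∑ D, christoffel (P.form G) D C A r x •
            ∑ B, P.nCoef G D B r x • P.frame r x B := by
      simp only [hv, add_smul, Finset.sum_smul, sub_smul, Finset.sum_add_distrib,
        Finset.sum_sub_distrib, Finset.smul_sum, smul_smul]
      rw [← add_sub_assoc]
      congr 1
      · congr 1
        rw [Finset.sum_comm]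
        exact Finset.sum_congr rfl fun B _ => Finset.sum_congr rfl fun D _ => by rw [mul_comm]
      · rw [Finset.sum_comm]
    rw [h4, hV]
    simp only [h3]
    rw [Finset.sum_sub_distrib, ← hydef] at h1
    rw [← sub_eq_zero] at h1 ⊢
    rw [← h1]
    abel
  have hchi : ∀ B C : Fin (n - 1), pa C (chi (P.form G) A B) r x
      = r⁻¹ * pa C (P.nCoef G A B) r x := by
    intro B C
    have h1 : (fun x => chi (P.form G) A B r x)
        =ᶠ[𝓝 x] fun x => r⁻¹ * ((if A = B then 1 else 0) + P.nCoef G A B r x) := by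
      filter_upwards [P.eventually_mem hx] with x' hx'
      exact P.chi_form hG hx' hr (hd _ (P.pos_mem hx' hr)) A B
    change pd C (fun x => chi (P.form G) A B r x) x = r⁻¹ * pd C (P.nCoef G A B r) x
    rw [pd_congr h1, pd, fderiv_const_mul ((hdn A B).const_add _), fderiv_const_add]
    rfl
  -- The two Christoffel terms produced by the identity part of χ are both the contraction Γ^B_{BA},
  -- with opposite signs.
  have h5 : divChi (P.form G) A r x = r⁻¹ * ∑ C, v C C := by
    rw [divChi, Finset.mul_sum]
    simp only [hchi, P.chi_form hG hx hr hd', hv, mul_add, Finset.sum_add_distrib]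
    congr 1
    trans ∑ B, ∑ C, (r⁻¹ * (christoffel (P.form G) B B C r x * P.nCoef G A C r x
            - christoffel (P.form G) C B A r x * P.nCoef G C B r x)
          + ((if A = C then r⁻¹ * christoffel (P.form G) B B C r x else 0)
            - (if C = B then r⁻¹ * christoffel (P.form G) C B A r x else 0)))
    · refine Finset.sum_congr rfl fun B _ => Finset.sum_congr rfl fun C _ => ?_
      split_ifs <;> ring
    · simp only [Finset.sum_add_distrib, Finset.sum_sub_distrib, Finset.mul_sum,
        Finset.sum_ite_eq, Finset.sum_ite_eq', Finset.mem_univ, if_true, mul_sub]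
      simp
  rw [h5]
  congr 1
  have h7 : ∀ C, v C C = ∑ D, gInv (P.form G) C D r x * gHat G y (P.frame r x D) (V C) := by
    intro C
    rw [← key C, hydef, P.sum_gInv_coef hG hx hr]
  have h8 := P.sum_gInv_eq_trace hn hG hx hr (LinearMap.mk₂ ℝ
    (fun v w => (gHat G y w).comp
      (fderiv ℝ (nOp G) y v + (zTen G y v).comp (nOp G y) - (nOp G y).comp (zTen G y v)))
    (fun _ _ _ => by ext; simp; ring) (fun _ _ _ => by ext; simp; ring)
    (fun _ _ _ => by ext; simp; ring) (fun _ _ _ => by ext; simp; ring))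
  simp only [LinearMap.mk₂_apply] at h8
  rw [divN, ← h8]
  simp only [h7, sum_apply, smul_apply, smul_eq_mul]
  rfl

theorem divXi_form (hd : DifferentiableAt ℝ (dev G) (P.pos r x)) {ξ : CovectorField n}
    (hξ : DifferentiableAt ℝ ξ (P.pos r x)) :
    ∑ A, ∑ B, gInv (P.form G) A B r x * (pa A (P.covector ξ B) r x
        - ∑ C, christoffel (P.form G) C A B r x * P.covector ξ C r x)
      = divXi G ξ (P.pos r x) := by
  have h8 := P.sum_gInv_eq_trace hn hG hx hr (LinearMap.mk₂ ℝ
    (fun v w => fderiv ℝ ξ (P.pos r x) v w - ξ (P.pos r x) (zTen G (P.pos r x) v w))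
    (fun _ _ _ => by simp; ring) (fun _ _ _ => by simp; ring)
    (fun _ _ _ => by simp; ring) (fun _ _ _ => by simp; ring))
  simp only [LinearMap.mk₂_apply, smul_eq_mul] at h8
  rw [divXi, ← h8]
  refine Finset.sum_congr rfl fun A _ => Finset.sum_congr rfl fun B _ => ?_
  congr 1
  have h1 : pa A (P.covector ξ B) r x = fderiv ℝ ξ (P.pos r x) (P.frame r x A) (P.frame r x B)
      + ξ (P.pos r x) (pd A (fun x => P.frame r x B) x) := by
    change pd A (fun x => ξ (P.pos r x) (P.frame r x B)) x = _
    rw [pd_clm_apply (P.differentiableAt_comp_pos hx hξ) (P.differentiableAt_frame hx r B),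
      P.pd_comp_pos hx hξ]
  have h2 : ∑ C, christoffel (P.form G) C A B r x * P.covector ξ C r x
      = ξ (P.pos r x) (∑ C, christoffel (P.form G) C A B r x • P.frame r x C) := by
    rw [map_sum]
    exact Finset.sum_congr rfl fun C _ => by rw [map_smul]; rfl
  rw [h1, h2, P.sum_christoffel hn hG hx hr hd, map_add]
  ring

end

end SpherePatch

end LightCone

namespace LightCone

variable {n : ℕ} {F F' : Type} [NormedAddCommGroup F] [NormedSpace ℝ F]
  [NormedAddCommGroup F'] [NormedSpace ℝ F'] {T : ℝ}

/-! ### The scalar curvature -/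

theorem pd_pd_symm {d : ℕ} {f : Euc d → F} {x : Euc d} (hf : ContDiffAt ℝ 2 f x) (A B : Fin d) :
    pd A (fun x => pd B f x) x = pd B (fun x => pd A f x) x := by
  have hs : IsSymmSndFDerivAt ℝ f x := hf.isSymmSndFDerivAt (by simp)
  have hd : DifferentiableAt ℝ (fderiv ℝ f) x :=
    (hf.fderiv_right (m := 1) (by norm_cast)).differentiableAt one_ne_zero
  have key : ∀ A B, pd A (fun x => pd B f x) x
      = fderiv ℝ (fderiv ℝ f) x (EuclideanSpace.single A 1) (EuclideanSpace.single B 1) := by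
    intro A B
    simp only [pd]
    rw [fderiv_clm_apply hd (differentiableAt_const _)]
    simp
  rw [key, key]
  exact hs _ _

theorem differentiableAt_pd {d : ℕ} {f : Euc d → F} {x : Euc d} (hf : ContDiffAt ℝ 2 f x)
    (A : Fin d) : DifferentiableAt ℝ (fun x => pd A f x) x :=
  ((hf.fderiv_right (m := 1) (by norm_cast)).differentiableAt one_ne_zero).clm_apply
    (differentiableAt_const _)

/-- For tangential u the derivative of r⁻² vanishes, and only the vector y in `zRound` is
differentiated. This term yields the curvature of the round sphere. -/
theorem hasFDerivAt_zRound {y : Euc n} (hy : y ≠ 0) : DifferentiableAt ℝ zRound y ∧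
    ∀ u v w, inner ℝ y u = 0 → fderiv ℝ zRound y u v w = ((‖y‖ ^ 2)⁻¹ * inner ℝ v w) • u := by
  have h1 : HasFDerivAt (fun y : Euc n => (‖y‖ ^ 2)⁻¹) (-((‖y‖ ^ 2) ^ 2)⁻¹ •
      (2 • innerSL ℝ y)) y := by
    have h := (hasStrictFDerivAt_norm_sq y).hasFDerivAt
    have h0 : ‖y‖ ^ 2 ≠ 0 := by simpa using hy
    exact (hasDerivAt_inv h0).comp_hasFDerivAt y h
  let Φ : Euc n →L[ℝ] Euc n →L[ℝ] Euc n →L[ℝ] Euc n := LinearMap.toContinuousLinearMap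
    { toFun := fun y => (ContinuousLinearMap.compL ℝ (Euc n) ℝ (Euc n)
        (ContinuousLinearMap.toSpanSingleton ℝ y)).comp (euclideanForm n)
      map_add' := fun a b => by ext; simp
      map_smul' := fun a b => by ext; simp; ring }
  have h2 : zRound = fun y : Euc n => (‖y‖ ^ 2)⁻¹ • Φ y := rfl
  have h3 := h1.fun_smul (Φ.hasFDerivAt (x := y))
  rw [← h2] at h3
  refine ⟨h3.differentiableAt, fun u v w hu => ?_⟩
  rw [h3.fderiv]
  have h4 : Φ u v w = (inner ℝ v w : ℝ) • u := by
    simp [Φ, euclideanForm_apply]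
  simp [hu, h4, smul_smul]

namespace SpherePatch

variable (P : SpherePatch n) {x : Euc (n - 1)} {r : ℝ} {G : FormField n}
  (hG : IsDegenerateForm T G) (hx : x ∈ P.U) (hr : r ∈ Ioo 0 T)
  (hc : ContDiffAt ℝ 2 (dev G) (P.pos r x))
  (hn : 2 ≤ n)

/-- The components of the Riemann tensor. -/
noncomputable def riem (G : FormField n) (D A B E : Fin (n - 1)) (r : ℝ) (x : Euc (n - 1)) : ℝ :=
  pa D (christoffel (P.form G) E A B) r x - pa A (christoffel (P.form G) E D B) r x
    + ∑ C, (christoffel (P.form G) C A B r x * christoffel (P.form G) E D C r x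
      - christoffel (P.form G) C D B r x * christoffel (P.form G) E A C r x)

include hG hx hr hc hn

/-- Derivative of the Gauss formula. Antisymmetrisation in D and A will remove the second
derivatives of the frame. -/
theorem pd_sum_christoffel (hd : ∀ y ∈ coneRegion n T, DifferentiableAt ℝ (dev G) y)
    (hC : DifferentiableAt ℝ (cTen G) (P.pos r x)) (D A B : Fin (n - 1)) :
    ∑ E, (pa D (christoffel (P.form G) E A B) r x
        + ∑ C, christoffel (P.form G) C A B r x * christoffel (P.form G) E D C r x)
        • P.frame r x E
      - zTen G (P.pos r x) (P.frame r x D)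
          (∑ C, christoffel (P.form G) C A B r x • P.frame r x C)
    = pd D (fun x => pd A (fun x => P.frame r x B) x) x
      + fderiv ℝ (zTen G) (P.pos r x) (P.frame r x D) (P.frame r x A) (P.frame r x B)
      + zTen G (P.pos r x) (pd D (fun x => P.frame r x A) x) (P.frame r x B)
      + zTen G (P.pos r x) (P.frame r x A) (pd D (fun x => P.frame r x B) x) := by
  have hy : P.pos r x ∈ coneRegion n T := P.pos_mem hx hr
  have hz : DifferentiableAt ℝ (zTen G) (P.pos r x) :=
    hC.add (hasFDerivAt_zRound (ne_zero_of_mem hy)).1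
  have hdf := fun B => P.differentiableAt_frame hx r B
  have hzx : DifferentiableAt ℝ (fun x => zTen G (P.pos r x)) x := P.differentiableAt_comp_pos hx hz
  have hdp : DifferentiableAt ℝ (fun x => pd A (fun x => P.frame r x B) x) x :=
    differentiableAt_pd ((P.contDiffAt_frame hx r B).of_le (by norm_cast)) A
  have h1 : pd D (fun x => ∑ C, christoffel (P.form G) C A B r x • P.frame r x C) x
      = pd D (fun x => pd A (fun x => P.frame r x B) x
        + zTen G (P.pos r x) (P.frame r x A) (P.frame r x B)) x := by
    refine pd_congr ?_
    filter_upwards [P.eventually_mem hx] with x' hx'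
    exact P.sum_christoffel hn hG hx' hr (hd _ (P.pos_mem hx' hr)) A B
  have h2 : ∀ C, pd D (fun x => P.frame r x C) x
      = ∑ E, christoffel (P.form G) E D C r x • P.frame r x E
        - zTen G (P.pos r x) (P.frame r x D) (P.frame r x C) := fun C => by
    rw [P.sum_christoffel hn hG hx hr (hd _ hy)]; abel
  rw [pd_nCoef_aux (c := fun C x => christoffel (P.form G) C A B r x)
    (e := fun B x => P.frame r x B) (fun C => P.differentiableAt_christoffel hG hx hr hc C A B) hdf,
    pd_add hdp ((hzx.clm_apply (hdf A)).clm_apply (hdf B)),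
    pd_clm_apply (hzx.clm_apply (hdf A)) (hdf B), pd_clm_apply hzx (hdf A),
    P.pd_comp_pos hx hz] at h1
  have h3 : ∑ C, christoffel (P.form G) C A B r x • pd D (fun x => P.frame r x C) x
      = ∑ E, (∑ C, christoffel (P.form G) C A B r x * christoffel (P.form G) E D C r x)
        • P.frame r x E
        - zTen G (P.pos r x) (P.frame r x D)
          (∑ C, christoffel (P.form G) C A B r x • P.frame r x C) := by
    simp only [h2, smul_sub, Finset.sum_sub_distrib, Finset.smul_sum, smul_smul, map_sum, map_smul,
      Finset.sum_smul]
    rw [Finset.sum_comm]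
  rw [h3, add_apply] at h1
  simp only [add_smul, Finset.sum_add_distrib]
  rw [add_sub_assoc]
  refine h1.trans ?_
  abel

/-- Gauss equation: antisymmetrise the differentiated Gauss formula, in which second derivatives of
the frame commute. The coefficient c need not be known, because the radial term disappears when
paired with a tangential vector. -/
theorem sum_riem (hd : ∀ y ∈ coneRegion n T, DifferentiableAt ℝ (dev G) y)
    (hC : DifferentiableAt ℝ (cTen G) (P.pos r x)) (D A B : Fin (n - 1)) :
    ∃ c : ℝ, ∑ E, P.riem G D A B E r x • P.frame r x E
      = riemC G (P.pos r x) (P.frame r x D) (P.frame r x A) (P.frame r x B)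
        + (r⁻¹ ^ 2 * inner ℝ (P.frame r x A) (P.frame r x B)) • P.frame r x D
        - (r⁻¹ ^ 2 * inner ℝ (P.frame r x D) (P.frame r x B)) • P.frame r x A
        + c • P.pos r x := by
  have hy : P.pos r x ∈ coneRegion n T := P.pos_mem hx hr
  have hz0 := hasFDerivAt_zRound (ne_zero_of_mem hy)
  have h1 := P.pd_sum_christoffel hG hx hr hc hn hd hC D A B
  have h2 := P.pd_sum_christoffel hG hx hr hc hn hd hC A D B
  have h3 := pd_pd_symm (f := fun x => P.frame r x B)
    ((P.contDiffAt_frame hx r B).of_le (by norm_cast)) D A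
  have h4 := P.pd_frame_symm hx r D A
  have h5 : ∀ u v w, inner ℝ (P.pos r x) u = 0 → fderiv ℝ (zTen G) (P.pos r x) u v w
      = fderiv ℝ (cTen G) (P.pos r x) u v w + (r⁻¹ ^ 2 * inner ℝ v w) • u := by
    intro u v w hu
    have : fderiv ℝ (zTen G) (P.pos r x) = fderiv ℝ (cTen G) (P.pos r x)
        + fderiv ℝ zRound (P.pos r x) := fderiv_add hC hz0.1
    rw [this, add_apply, add_apply, add_apply, hz0.2 u v w hu, P.norm_pos hx hr.1, inv_pow]
  rw [h5 _ _ _ (P.inner_pos_frame hx D)] at h1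
  rw [h5 _ _ _ (P.inner_pos_frame hx A)] at h2
  have h6 := P.sum_christoffel hn hG hx hr (hd _ hy)
  rw [h6] at h1 h2
  have h7 : ∑ E, P.riem G D A B E r x • P.frame r x E
      = ∑ E, (pa D (christoffel (P.form G) E A B) r x
        + ∑ C, christoffel (P.form G) C A B r x * christoffel (P.form G) E D C r x)
        • P.frame r x E
      - ∑ E, (pa A (christoffel (P.form G) E D B) r x
        + ∑ C, christoffel (P.form G) C D B r x * christoffel (P.form G) E A C r x)
        • P.frame r x E := by
    rw [← Finset.sum_sub_distrib]
    refine Finset.sum_congr rfl fun E _ => ?_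
    rw [← sub_smul, riem, Finset.sum_sub_distrib]
    congr 1
    ring
  have hz : ∀ u v, zTen G (P.pos r x) u v = cTen G (P.pos r x) u v
      + ((‖P.pos r x‖ ^ 2)⁻¹ * inner ℝ u v) • P.pos r x := fun u v => by
    rw [zTen, add_apply, add_apply, zRound_apply]
  rw [h7, sub_eq_iff_eq_add.mp h1, sub_eq_iff_eq_add.mp h2, h3, h4]
  -- The radial remainder comes from the outer `zRound` in the iterated terms zTen(e_D, zTen(e_A,
  -- e_B)).
  refine ⟨(‖P.pos r x‖ ^ 2)⁻¹ * inner ℝ (P.frame r x D)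
      (zTen G (P.pos r x) (P.frame r x A) (P.frame r x B))
    - (‖P.pos r x‖ ^ 2)⁻¹ * inner ℝ (P.frame r x A)
      (zTen G (P.pos r x) (P.frame r x D) (P.frame r x B)), ?_⟩
  simp only [map_add, riemC]
  rw [hz _ (zTen G (P.pos r x) (P.frame r x A) (P.frame r x B)),
    hz _ (zTen G (P.pos r x) (P.frame r x D) (P.frame r x B))]
  module

omit hc in
theorem sum_gInv_inner : ∑ A, ∑ B, gInv (P.form G) A B r x
    * inner ℝ (P.frame r x A) (P.frame r x B) = wHat G (P.pos r x) := by
  have := P.sum_gInv_eq_trace hn hG hx hr (LinearMap.mk₂ ℝ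
    (fun v w => (inner ℝ v w : ℝ))
    (fun _ _ _ => by simp [inner_add_left]) (fun _ _ _ => by simp [real_inner_smul_left])
    (fun _ _ _ => by simp [inner_add_right]) (fun _ _ _ => by simp [real_inner_smul_right]))
  rw [wHat]
  simpa only [LinearMap.mk₂_apply, smul_eq_mul] using this

theorem ricci_form (hd : ∀ y ∈ coneRegion n T, DifferentiableAt ℝ (dev G) y)
    (hC : DifferentiableAt ℝ (cTen G) (P.pos r x)) (A B : Fin (n - 1)) :
    ricci (P.form G) A B r x = trace G (P.pos r x) (fun v' w' => gHat G (P.pos r x) w'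
        (riemC G (P.pos r x) v' (P.frame r x A) (P.frame r x B)))
      + r⁻¹ ^ 2 * ((n - 1 : ℕ) - 1) * inner ℝ (P.frame r x A) (P.frame r x B) := by
  have hy : P.pos r x ∈ coneRegion n T := P.pos_mem hx hr
  have h1 : ricci (P.form G) A B r x = ∑ D, P.riem G D A B D r x := by
    simp only [ricci, riem, Finset.sum_add_distrib, Finset.sum_sub_distrib]
    congr 1
    · congr 1
      refine Finset.sum_congr rfl fun D _ => ?_
      refine pd_congr ?_
      filter_upwards [P.eventually_mem hx] with x' hx'
      exact P.christoffel_symm hx' hG hr D B D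
    · congr 1
      · rw [Finset.sum_comm]
        refine Finset.sum_congr rfl fun C _ => Finset.sum_congr rfl fun D _ => ?_
        rw [P.christoffel_symm hx hG hr C D]
      · refine Finset.sum_congr rfl fun C _ => Finset.sum_congr rfl fun D _ => ?_
        rw [P.christoffel_symm hx hG hr D B, mul_comm]
  have h2 : ∀ D, P.riem G D A B D r x = ∑ E, gInv (P.form G) D E r x
      * (gHat G (P.pos r x) (P.frame r x E)
          (riemC G (P.pos r x) (P.frame r x D) (P.frame r x A) (P.frame r x B))
        + r⁻¹ ^ 2 * inner ℝ (P.frame r x A) (P.frame r x B) * P.form G E D r x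
        - r⁻¹ ^ 2 * inner ℝ (P.frame r x D) (P.frame r x B) * P.form G E A r x) := by
    intro D
    obtain ⟨c, hc'⟩ := P.sum_riem hG hx hr hc hn hd hC D A B
    rw [← P.sum_gInv_coef hG hx hr (fun E => P.riem G D A B E r x) D, hc']
    refine Finset.sum_congr rfl fun E _ => ?_
    rw [map_add, map_sub, map_add, map_smul, map_smul, map_smul, hG.gHat_right hy,
      P.inner_pos_frame hx, P.form_eq hx, P.form_eq hx]
    simp only [smul_eq_mul, mul_zero, add_zero]
  have h3 := P.sum_gInv_eq_trace hn hG hx hr (LinearMap.mk₂ ℝ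
    (fun v' w' => gHat G (P.pos r x) w'
      (riemC G (P.pos r x) v' (P.frame r x A) (P.frame r x B)))
    (fun _ _ _ => by simp [riemC]; ring) (fun _ _ _ => by simp [riemC]; ring)
    (fun _ _ _ => by simp) (fun _ _ _ => by simp))
  simp only [LinearMap.mk₂_apply, smul_eq_mul] at h3
  rw [h1, ← h3]
  -- In the constant curvature part the sum over D gives n - 1 from the first term and removes 1
  -- through the Kronecker delta.
  have h4 : ∀ D, P.riem G D A B D r x = ∑ E, gInv (P.form G) D E r x
      * gHat G (P.pos r x) (P.frame r x E)
          (riemC G (P.pos r x) (P.frame r x D) (P.frame r x A) (P.frame r x B))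
      + (r⁻¹ ^ 2 * inner ℝ (P.frame r x A) (P.frame r x B)
        - if D = A then r⁻¹ ^ 2 * inner ℝ (P.frame r x D) (P.frame r x B) else 0) := by
    intro D
    have h5 := P.sum_gInv_mul hG hx hr D A
    have h6 := P.sum_gInv_mul hG hx hr D D
    rw [if_pos rfl] at h6
    rw [h2]
    have h7 : (if D = A then r⁻¹ ^ 2 * inner ℝ (P.frame r x D) (P.frame r x B) else 0)
        = r⁻¹ ^ 2 * inner ℝ (P.frame r x D) (P.frame r x B)
          * ∑ E, gInv (P.form G) D E r x * P.form G E A r x := by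
      rw [h5]; split_ifs <;> simp
    rw [h7]
    conv_rhs => rw [← mul_one (r⁻¹ ^ 2 * inner ℝ (P.frame r x A) (P.frame r x B)), ← h6]
    rw [Finset.mul_sum, Finset.mul_sum, ← Finset.sum_sub_distrib, ← Finset.sum_add_distrib]
    exact Finset.sum_congr rfl fun E _ => by ring
  simp only [h4, Finset.sum_add_distrib, Finset.sum_sub_distrib, Finset.sum_ite_eq',
    Finset.mem_univ, if_true]
  simp
  ring

theorem scalarCurvature_form (hd : ∀ y ∈ coneRegion n T, DifferentiableAt ℝ (dev G) y)
    (hC : DifferentiableAt ℝ (cTen G) (P.pos r x)) :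
    scalarCurvature (P.form G) r x
      = scalC G (P.pos r x) + r⁻¹ ^ 2 * ((n - 1 : ℕ) - 1) * wHat G (P.pos r x) := by
  have h3 := P.sum_gInv_eq_trace hn hG hx hr (LinearMap.mk₂ ℝ
    (fun v w => trace G (P.pos r x) fun v' w' => gHat G (P.pos r x) w'
      (riemC G (P.pos r x) v' v w))
    (fun _ _ _ => by
      simp only [trace, ← Finset.sum_add_distrib]
      exact Finset.sum_congr rfl fun i _ => by simp [riemC]; ring)
    (fun _ _ _ => by
      simp only [trace, Finset.smul_sum]
      exact Finset.sum_congr rfl fun i _ => by simp [riemC]; ring)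
    (fun _ _ _ => by
      simp only [trace, ← Finset.sum_add_distrib]
      exact Finset.sum_congr rfl fun i _ => by simp [riemC]; ring)
    (fun _ _ _ => by
      simp only [trace, Finset.smul_sum]
      exact Finset.sum_congr rfl fun i _ => by simp [riemC]; ring))
  simp only [LinearMap.mk₂_apply, smul_eq_mul] at h3
  rw [scalarCurvature, scalC, ← h3, ← P.sum_gInv_inner hG hx hr hn]
  simp only [P.ricci_form hG hx hr hc hn hd hC, mul_add, Finset.sum_add_distrib]
  congr 1
  simp only [Finset.mul_sum]
  exact Finset.sum_congr rfl fun A _ => Finset.sum_congr rfl fun B _ => by ring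

end SpherePatch

end LightCone

namespace LightCone

variable {n : ℕ} {F F' : Type} [NormedAddCommGroup F] [NormedSpace ℝ F]
  [NormedAddCommGroup F'] [NormedSpace ℝ F'] {T : ℝ}

/-! ### The round metric -/

theorem isDegenerateForm_roundForm (n : ℕ) (T : ℝ) : IsDegenerateForm T (roundForm n) := by
  intro y hy
  have h0 : ‖y‖ ≠ 0 := hy.1.ne'
  refine ⟨fun v w => ?_, fun v => ?_, fun v hv => ?_⟩
  · rw [roundForm_apply, roundForm_apply, real_inner_comm v w]
    ring
  · rw [roundForm_apply, real_inner_self_eq_norm_sq]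
    field_simp
    ring
  · have h1 : v - ((‖y‖ ^ 2)⁻¹ * inner ℝ y v) • y ≠ 0 := fun h =>
      hv _ (sub_eq_zero.mp h)
    have h2 : roundForm n y v v = ‖v - ((‖y‖ ^ 2)⁻¹ * inner ℝ y v) • y‖ ^ 2 := by
      rw [roundForm_apply, norm_sub_sq_real, real_inner_self_eq_norm_sq, real_inner_smul_right,
        norm_smul, mul_pow, Real.norm_eq_abs, sq_abs, real_inner_comm y v]
      field_simp
      ring
    rw [h2]
    exact pow_pos (norm_pos_iff.mpr h1) 2

theorem dev_roundForm (n : ℕ) : dev (roundForm n) = 0 := by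
  ext y : 1
  simp [dev]

theorem cTen_roundForm (y : Euc n) : cTen (roundForm n) y = 0 := by
  have : fderiv ℝ (dev (roundForm n)) y = 0 := by
    rw [dev_roundForm]
    exact fderiv_const_apply (0 : Euc n →L[ℝ] Euc n →L[ℝ] ℝ)
  ext u v : 2
  rw [cTen_apply, show kTen (roundForm n) y u v = 0 by ext w; simp [kTen_apply, this]]
  simp

/-- The vector field `ξ^A ∂_A` of the wave-map gauge, as a covector field. -/
noncomputable def xiHat (G : FormField n) (ν₀ : Euc n → ℝ) (ν : CovectorField n) :
    CovectorField n := fun y =>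
  ‖y‖⁻¹ • gHat G y (-(2 / ν₀ y) • rad (fun y => gHatInv G y (ν y)) y
    - wHat G y • gHatInv G y (ν y) - ‖y‖ • trC G y)

/-- The component `g^{11}` of the inverse metric. -/
noncomputable def gam (G : FormField n) (ν₀ : Euc n → ℝ) (ν : CovectorField n) (g₀₀ : Euc n → ℝ)
    (y : Euc n) : ℝ :=
  (1 / ν₀ y) ^ 2 * (-g₀₀ y + ν y (gHatInv G y (ν y)))

/-- The function `r (∂₁ + κ + τ / 2) g^{11} + r W^1`. -/
noncomputable def bet (G : FormField n) (ν₀ : Euc n → ℝ) (ν : CovectorField n) (g₀₀ : Euc n → ℝ)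
    (y : Euc n) : ℝ :=
  rad (gam G ν₀ ν g₀₀) y
    + (kHat G ν₀ y + (1 / 2) * ((n - 1 : ℕ) + tHat G y)) * gam G ν₀ ν g₀₀ y - wHat G y

namespace SpherePatch

variable (P : SpherePatch n) {x : Euc (n - 1)} {r : ℝ} {G : FormField n}

theorem christoffel_round (hx : x ∈ P.U) (C A B : Fin (n - 1)) (r : ℝ) :
    christoffel P.round C A B r x = christoffel (P.form (roundForm n)) C A B 1 x := by
  have h1 : ∀ x ∈ P.U, ∀ A B, P.form (roundForm n) A B 1 x = P.round A B r x := by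
    intro x hx A B
    have h2 := P.inner_pos_frame (r := 1) hx A
    simp only [pos, frame, one_smul] at h2
    simp only [form, one_smul, roundForm_apply, h2, round]
    simp
  have h2 : ∀ A B C, pa A (P.form (roundForm n) B C) 1 x = pa A (P.round B C) r x := by
    intro A B C
    refine pd_congr ?_
    filter_upwards [P.eventually_mem hx] with x' hx'
    exact h1 x' hx' B C
  simp only [christoffel, gInv, h1 x hx, h2]

section

variable (hG : IsDegenerateForm T G) (hx : x ∈ P.U) (hr : r ∈ Ioo 0 T)
  (hd : DifferentiableAt ℝ (dev G) (P.pos r x)) (hn : 2 ≤ n)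

include hG hx hr hd hn

/-- The Gauss formulas of G and of the round metric share ∂_A e_B and `zRound`, so only the
difference tensor of the two connections remains. -/
theorem sum_christoffel_sub (A B : Fin (n - 1)) :
    ∑ C, (christoffel (P.form G) C A B r x - christoffel P.round C A B r x) • P.frame r x C
      = cTen G (P.pos r x) (P.frame r x A) (P.frame r x B) := by
  have h1 := P.sum_christoffel hn hG hx hr hd A B
  have h2 := P.sum_christoffel (r := 1) (T := 2) hn (isDegenerateForm_roundForm n 2) hx
    (by norm_num) (by rw [dev_roundForm]; exact differentiableAt_const _) A B
  have h3 : ∀ A, P.frame r x A = r • P.frame 1 x A := fun A => by simp [frame]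
  have h4 : ∑ C, christoffel P.round C A B r x • P.frame r x C
      = r • ∑ C, christoffel (P.form (roundForm n)) C A B 1 x • P.frame 1 x C := by
    rw [Finset.smul_sum]
    refine Finset.sum_congr rfl fun C _ => ?_
    rw [P.christoffel_round hx, h3, smul_comm]
  have h5 : pd A (fun x => P.frame r x B) x = r • pd A (fun x => P.frame 1 x B) x := by
    have : (fun x => P.frame r x B) = fun x => r • P.frame 1 x B := by
      ext x : 1
      simp [frame]
    rw [this, pd, fderiv_fun_const_smul (P.differentiableAt_frame hx 1 B)]
    rfl
  have hr0 := hr.1.ne'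
  simp only [sub_smul, Finset.sum_sub_distrib]
  rw [h4, h2, h1, h5, zTen, zTen, add_apply, add_apply, add_apply, add_apply, cTen_roundForm,
    zRound_apply, zRound_apply, P.norm_pos hx hr.1, P.norm_pos hx one_pos, h3 A, h3 B,
    real_inner_smul_left, real_inner_smul_right, show P.pos r x = r • P.pos 1 x by simp [pos],
    smul_add, smul_smul, zero_apply, zero_apply, zero_add, smul_smul]
  have : r * ((1 ^ 2)⁻¹ * inner ℝ (P.frame 1 x A) (P.frame 1 x B))
      = (r ^ 2)⁻¹ * (r * (r * inner ℝ (P.frame 1 x A) (P.frame 1 x B))) * r := by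
    field_simp
  rw [this]
  simp

variable {ν₀ : Euc n → ℝ} {ν : CovectorField n} {g₀₀ : Euc n → ℝ}

omit hd in
theorem sum_nuUp (hν : ν (P.pos r x) (P.pos r x) = 0) :
    ∑ A, nuUp (P.form G) (P.covector ν) A r x • P.frame r x A
      = gHatInv G (P.pos r x) (ν (P.pos r x)) := by
  have h := P.sum_gInv_eq_cometric hn hG hx hr (ν (P.pos r x))
  rw [cometric_apply, hν, mul_zero, zero_smul, sub_zero] at h
  rw [← h]
  refine Finset.sum_congr rfl fun A _ => ?_
  rw [nuUp, Finset.sum_smul]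
  rfl

omit hd in
theorem gInv11_form (hν : ν (P.pos r x) (P.pos r x) = 0) :
    gInv11 (P.form G) (P.scalar ν₀) (P.covector ν) (P.scalar g₀₀) r x
      = gam G ν₀ ν g₀₀ (P.pos r x) := by
  have h1 : ∑ A, nuUp (P.form G) (P.covector ν) A r x * P.covector ν A r x
      = ν (P.pos r x) (gHatInv G (P.pos r x) (ν (P.pos r x))) := by
    rw [← P.sum_nuUp hG hx hr hn hν, map_sum]
    exact Finset.sum_congr rfl fun A _ => by rw [map_smul]; rfl
  rw [gInv11, h1]
  rfl

/-- With ν = `gHat` (m), the radial derivative of ν contains that of the form applied to m, which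
cancels against the same term in 4 ν_B χ_A^B. The undifferentiated terms add up to -2 + 4 - 2 = 0,
the last one from W^A, so only rad m, the W₁ term and the difference of connections survive. -/
theorem xi_form (hν₀ : ν₀ (P.pos r x) ≠ 0) (hν : ∀ y ∈ coneRegion n T, ν y y = 0)
    (hdν : DifferentiableAt ℝ ν (P.pos r x))
    (hm : DifferentiableAt ℝ (fun y => gHatInv G y (ν y)) (P.pos r x)) (A : Fin (n - 1)) :
    xi P.round (P.form G) (P.scalar ν₀) (P.covector ν) A r x
      = P.covector (xiHat G ν₀ ν) A r x := by
  have hy : P.pos r x ∈ coneRegion n T := P.pos_mem hx hr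
  have hr0 := hr.1.ne'
  set y := P.pos r x with hydef
  set m := gHatInv G y (ν y) with hmdef
  have hmy : inner ℝ y m = 0 := by rw [hmdef, hG.inner_gHatInv hy, hν y hy]
  -- the derivative of `ν`
  have h1 : rad ν y = rad (dev G) y m + gHat G y (rad (fun y => gHatInv G y (ν y)) y) := by
    have h2 : ν =ᶠ[𝓝 y] fun y => gHat G y (gHatInv G y (ν y)) := by
      filter_upwards [(isOpen_coneRegion n T).mem_nhds hy] with z hz
      rw [hG.gHat_gHatInv hz]
    have h3 : fderiv ℝ ν y y = fderiv ℝ (fun y => gHat G y (gHatInv G y (ν y))) y y := by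
      rw [h2.fderiv_eq]
    rw [fderiv_clm_apply (differentiableAt_gHat hd) hm, fderiv_gHat] at h3
    rw [rad, h3]
    simp only [add_apply, ContinuousLinearMap.comp_apply, ContinuousLinearMap.flip_apply]
    rw [add_comm]
    rfl
  have h2 : ∑ B, P.covector ν B r x * chi (P.form G) A B r x
      = r⁻¹ * (ν y (P.frame r x A) + (1 / 2) * rad (dev G) y m (P.frame r x A)) := by
    have h3 : ∑ B, P.covector ν B r x * chi (P.form G) A B r x
        = r⁻¹ * (ν y (P.frame r x A) + ν y (∑ B, P.nCoef G A B r x • P.frame r x B)) := by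
      have : ∀ B, P.covector ν B r x * chi (P.form G) A B r x
          = r⁻¹ * ((if A = B then P.covector ν B r x else 0)
            + P.nCoef G A B r x * P.covector ν B r x) := by
        intro B
        rw [P.chi_form hG hx hr hd]
        split_ifs <;> ring
      simp only [this, ← Finset.mul_sum, Finset.sum_add_distrib, Finset.sum_ite_eq,
        Finset.mem_univ, if_true]
      rw [map_sum]
      simp only [map_smul, smul_eq_mul]
      rfl
    rw [h3, P.sum_nCoef hn hG hx hr, ← hydef]
    congr 2
    rw [← hG.gHat_gHatInv hy (ν y), ← hmdef, hG.gHat_symm hy, hG.gHat_nOp hy hmy,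
      hG.rad_dev_symm hy hd]
  have h3 : ∑ B, P.form G A B r x * nuUp (P.form G) (P.covector ν) B r x
      = ν y (P.frame r x A) := by
    have : ν y (P.frame r x A) = gHat G y (P.frame r x A) m := by
      rw [hG.gHat_symm hy, hmdef, hG.gHat_gHatInv hy]
    rw [this, hmdef, ← P.sum_nuUp hG hx hr hn (hν y hy), map_sum]
    refine Finset.sum_congr rfl fun B _ => ?_
    rw [map_smul, ← P.form_eq hx, smul_eq_mul, mul_comm]
  have h4 : ∑ B, P.form G A B r x * (∑ C, ∑ D, gInv (P.form G) C D r x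
        * christoffel P.round B C D r x)
      - ∑ B, P.form G A B r x * (∑ C, ∑ D, gInv (P.form G) C D r x
        * christoffel (P.form G) B C D r x) = - gHat G y (P.frame r x A) (trC G y) := by
    have h5 := P.sum_gInv_eq_trace hn hG hx hr (LinearMap.mk₂ ℝ
      (fun v w => cTen G y v w)
      (fun _ _ _ => by simp) (fun _ _ _ => by simp) (fun _ _ _ => by simp) (fun _ _ _ => by simp))
    simp only [LinearMap.mk₂_apply] at h5
    rw [show trC G y = _ from h5.symm, ← Finset.sum_sub_distrib, map_sum, ← Finset.sum_neg_distrib]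
    have h6 : ∀ C D, gHat G y (P.frame r x A)
        (gInv (P.form G) C D r x • cTen G y (P.frame r x C) (P.frame r x D))
        = ∑ B, P.form G A B r x * (gInv (P.form G) C D r x * christoffel (P.form G) B C D r x
          - gInv (P.form G) C D r x * christoffel P.round B C D r x) := by
      intro C D
      rw [map_smul, show cTen G y (P.frame r x C) (P.frame r x D) = _ from
        (P.sum_christoffel_sub hG hx hr hd hn C D).symm, map_sum, Finset.smul_sum]
      refine Finset.sum_congr rfl fun B _ => ?_
      rw [map_smul, ← P.form_eq hx, smul_eq_mul, smul_eq_mul]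
      ring
    simp only [map_sum, h6]
    simp only [mul_sub, Finset.sum_sub_distrib, Finset.mul_sum, Finset.sum_neg_distrib]
    rw [neg_sub]
    congr 1
    · rw [Finset.sum_comm]
      refine Finset.sum_congr rfl fun C _ => ?_
      rw [Finset.sum_comm]
    · rw [Finset.sum_comm]
      refine Finset.sum_congr rfl fun C _ => ?_
      rw [Finset.sum_comm]
  have h5 : ∑ B, P.form G A B r x * Wang P.round (P.form G) (P.scalar ν₀) (P.covector ν) B r x
      = - (2 / r) * (1 / ν₀ y) * ν y (P.frame r x A)
        + ∑ B, P.form G A B r x * (∑ C, ∑ D, gInv (P.form G) C D r x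
          * christoffel P.round B C D r x) := by
    rw [← h3, Finset.mul_sum, ← Finset.sum_add_distrib]
    refine Finset.sum_congr rfl fun B _ => ?_
    rw [Wang, show P.scalar ν₀ r x = ν₀ y from rfl]
    ring
  have h6 : P.covector (xiHat G ν₀ ν) A r x
      = r⁻¹ * (-(2 / ν₀ y) * gHat G y (rad (fun y => gHatInv G y (ν y)) y) (P.frame r x A)
        - wHat G y * ν y (P.frame r x A) - r * gHat G y (P.frame r x A) (trC G y)) := by
    rw [hG.gHat_symm hy (P.frame r x A)]
    change xiHat G ν₀ ν y (P.frame r x A) = _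
    rw [xiHat, hydef, P.norm_pos hx hr.1, ← hydef, ← hmdef]
    simp only [map_sub, map_smul, smul_apply, sub_apply, smul_eq_mul]
    rw [hmdef, hG.gHat_gHatInv hy]
  rw [h6, xi, h5, h2, P.pr_covector hr.1 hdν, ← hydef, h1, Wone, P.Wzero_form hn hG hx hr, ← hydef,
    show P.scalar ν₀ r x = ν₀ y from rfl, show P.covector ν A r x = ν y (P.frame r x A) from rfl,
    add_sub_assoc, add_sub_assoc, h4, add_apply]
  field_simp
  ring

end

end SpherePatch

end LightCone

/-! ### The constraint operators in coordinates and as tensor fields -/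

namespace LightCone

variable {n : ℕ} {F F' : Type} [NormedAddCommGroup F] [NormedSpace ℝ F]
  [NormedAddCommGroup F'] [NormedSpace ℝ F'] {T : ℝ}

/-- The second constraint as a covector field: the left hand side is `-2 r 𝒞_A`. -/
noncomputable def caHat (G : FormField n) (ν₀ : Euc n → ℝ) (ν : CovectorField n) :
    CovectorField n := fun y =>
  rad (xiHat G ν₀ ν) y + (1 + ((n - 1 : ℕ) + tHat G y)) • xiHat G ν₀ ν y - (2 : ℝ) • divN G y
    + (2 : ℝ) • fderiv ℝ (fun y => tHat G y + kHat G ν₀ y) y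

/-- The third constraint: `-2 r² ν^0 𝒞₀`. -/
noncomputable def c0Hat (G : FormField n) (ν₀ : Euc n → ℝ) (ν : CovectorField n)
    (g₀₀ : Euc n → ℝ) (y : Euc n) : ℝ :=
  2 * (rad (bet G ν₀ ν g₀₀) y
      + (kHat G ν₀ y - 1 + ((n - 1 : ℕ) + tHat G y)) * bet G ν₀ ν g₀₀ y)
    + (‖y‖ ^ 2 * scalC G y + ((n - 1 : ℕ) - 1) * wHat G y
      - (1 / 2) * ‖y‖ ^ 2 * xiHat G ν₀ ν y (cometric G y (xiHat G ν₀ ν y))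
      + ‖y‖ ^ 2 * divXi G (xiHat G ν₀ ν) y)

/-- `f` is differentiable at the points of the cone. -/
def DiffOn (T : ℝ) (f : Euc n → F) : Prop := ∀ y ∈ coneRegion n T, DifferentiableAt ℝ f y

theorem DiffOn.of_contDiffOn {f : Euc n → F} {N : WithTop ℕ∞} (hN : 1 ≤ N)
    (h : ContDiffOn ℝ N f (coneRegion n T)) : DiffOn T f := fun _ hy =>
  (h.contDiffAt ((isOpen_coneRegion n T).mem_nhds hy)).differentiableAt
    (by intro h0; simp [h0] at hN)

namespace SpherePatch

variable (P : SpherePatch n) {x : Euc (n - 1)} {r : ℝ} {G : FormField n}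
  (hG : IsDegenerateForm T G) (hx : x ∈ P.U) (hr : r ∈ Ioo 0 T) (hn : 2 ≤ n)
  (hc : ContDiffOn ℝ 2 (dev G) (coneRegion n T))
  {ν₀ : Euc n → ℝ} {ν : CovectorField n} {g₀₀ : Euc n → ℝ}
  (hν₀ : ∀ y ∈ coneRegion n T, ν₀ y ≠ 0) (hν : ∀ y ∈ coneRegion n T, ν y y = 0)
  (hdν₀ : DiffOn T ν₀) (hdν : DiffOn T ν) (hm : DiffOn T fun y => gHatInv G y (ν y))
  (hξ : DiffOn T (xiHat G ν₀ ν)) (hR : DiffOn T (rad (dev G))) (hN : DiffOn T (nOp G))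
  (ht : DiffOn T (tHat G)) (hk : DiffOn T (kHat G ν₀)) (hw : DiffOn T (wHat G))
  (hC : DiffOn T (cTen G)) (hγ : DiffOn T (gam G ν₀ ν g₀₀)) (hβ : DiffOn T (bet G ν₀ ν g₀₀))

include hG hx hr hn hc

theorem CA_form (hν₀ : ∀ y ∈ coneRegion n T, ν₀ y ≠ 0) (hν : ∀ y ∈ coneRegion n T, ν y y = 0)
    (hdν₀ : DiffOn T ν₀) (hdν : DiffOn T ν) (hm : DiffOn T fun y => gHatInv G y (ν y))
    (hξ : DiffOn T (xiHat G ν₀ ν)) (hR : DiffOn T (rad (dev G))) (hN : DiffOn T (nOp G))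
    (ht : DiffOn T (tHat G)) (hk : DiffOn T (kHat G ν₀)) (A : Fin (n - 1)) :
    CA P.round (P.form G) (P.scalar ν₀) (P.covector ν) A r x
      = -(1 / 2) * r⁻¹ * caHat G ν₀ ν (P.pos r x) (P.frame r x A) := by
  have hy : P.pos r x ∈ coneRegion n T := P.pos_mem hx hr
  have hd : DiffOn T (dev G) := DiffOn.of_contDiffOn (by norm_num) hc
  have hxi : ∀ ρ ∈ Ioo 0 T, xi P.round (P.form G) (P.scalar ν₀) (P.covector ν) A ρ x
      = P.covector (xiHat G ν₀ ν) A ρ x := fun ρ hρ => by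
    have h := P.pos_mem hx hρ
    exact P.xi_form hG hx hρ (hd _ h) hn (hν₀ _ h) hν (hdν _ h) (hm _ h) A
  -- The differentiated scalar τ - W₁ + 2ν⁰∂₁ν₀ equals 2(τ + κ̂), that is 2 r⁻¹ (n - 1 + `tHat` +
  -- `kHat`).
  have h1 : pa A (fun r' x' => tau (P.form G) r' x' - Wone P.round (P.form G) (P.scalar ν₀) r' x'
        + 2 * (1 / P.scalar ν₀ r' x') * pr (P.scalar ν₀) r' x') r x
      = 2 * r⁻¹ * fderiv ℝ (fun y => tHat G y + kHat G ν₀ y) (P.pos r x) (P.frame r x A) := by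
    have h2 : (fun x' => tau (P.form G) r x' - Wone P.round (P.form G) (P.scalar ν₀) r x'
        + 2 * (1 / P.scalar ν₀ r x') * pr (P.scalar ν₀) r x')
        =ᶠ[𝓝 x] fun x' => 2 * r⁻¹ * ((n - 1 : ℕ)
          + (fun y => tHat G y + kHat G ν₀ y) (P.pos r x')) := by
      filter_upwards [P.eventually_mem hx] with x' hx'
      have h := P.pos_mem hx' hr
      have h3 := P.kappaOf_form hn hG hx' hr (hd _ h) (hdν₀ _ h)
      have h4 := P.tau_form hn hG hx' hr (hd _ h)
      rw [kappaOf] at h3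
      linear_combination 2 * h3 + 2 * h4
    change pd A (fun x' => tau (P.form G) r x' - Wone P.round (P.form G) (P.scalar ν₀) r x'
        + 2 * (1 / P.scalar ν₀ r x') * pr (P.scalar ν₀) r x') x = _
    have h5 : DifferentiableAt ℝ (fun y => tHat G y + kHat G ν₀ y) (P.pos r x) :=
      (ht _ hy).add (hk _ hy)
    have h6 := P.differentiableAt_comp_pos hx h5
    rw [pd_congr h2, pd, fderiv_const_mul (h6.const_add _), fderiv_const_add, smul_apply,
      smul_eq_mul]
    congr 1
    exact P.pd_comp_pos hx h5 A
  rw [CA, h1, pr_congr hr hxi, hxi r hr, P.pr_covector hr.1 (hξ _ hy),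
    P.tau_form hn hG hx hr (hd _ hy), P.divChi_form hG hx hr hn hd
      (hc.contDiffAt ((isOpen_coneRegion n T).mem_nhds hy)) (hR _ hy) (hN _ hy) A,
    show P.covector (xiHat G ν₀ ν) A r x = xiHat G ν₀ ν (P.pos r x) (P.frame r x A) from rfl,
    caHat]
  simp only [add_apply, sub_apply, smul_apply, smul_eq_mul]
  ring

theorem prk_form (hdν₀ : DiffOn T ν₀) {f : Euc n → ℝ} (hf : DifferentiableAt ℝ f (P.pos r x))
    {φ : Fld (n - 1)} (hφ : ∀ ρ ∈ Ioo 0 T, φ ρ x = f (P.pos ρ x)) :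
    prk P.round (P.form G) (P.scalar ν₀) φ r x
      = r⁻¹ * (rad f (P.pos r x) + kHat G ν₀ (P.pos r x) * f (P.pos r x)) := by
  have hy : P.pos r x ∈ coneRegion n T := P.pos_mem hx hr
  have hd : DiffOn T (dev G) := DiffOn.of_contDiffOn (by norm_num) hc
  rw [prk, pr_congr (g := P.scalar f) hr hφ, P.pr_scalar hr.1 hf, hφ r hr,
    P.kappaOf_form hn hG hx hr (hd _ hy) (hdν₀ _ hy)]
  ring

theorem prk_form' (hdν₀ : DiffOn T ν₀) {f : Euc n → ℝ} (hf : DifferentiableAt ℝ f (P.pos r x))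
    {φ : Fld (n - 1)} (hφ : ∀ ρ ∈ Ioo 0 T, φ ρ x = ρ⁻¹ * f (P.pos ρ x)) :
    prk P.round (P.form G) (P.scalar ν₀) φ r x
      = r⁻¹ ^ 2 * (rad f (P.pos r x) + (kHat G ν₀ (P.pos r x) - 1) * f (P.pos r x)) := by
  have hy : P.pos r x ∈ coneRegion n T := P.pos_mem hx hr
  have hd : DiffOn T (dev G) := DiffOn.of_contDiffOn (by norm_num) hc
  have h1 := hasDerivAt_ray hr.1.ne' hf
  have h2 := (hasDerivAt_inv hr.1.ne').mul h1
  have h3 : pr φ r x = r⁻¹ ^ 2 * (rad f (P.pos r x) - f (P.pos r x)) := by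
    rw [pr_congr (g := fun ρ x => ρ⁻¹ * f (P.pos ρ x)) hr hφ]
    refine (pr_eq_of_hasDerivAt h2).trans ?_
    simp only [pos, smul_eq_mul]
    have := hr.1.ne'
    field_simp
    ring
  rw [prk, h3, hφ r hr, P.kappaOf_form hn hG hx hr (hd _ hy) (hdν₀ _ hy)]
  ring

/-- The second order operator factors: 2(∂₁ + κ̂ + τ)(∂₁ + κ̂ + τ/2) expands to 2(∂₁ + κ̂)² + 3τ(∂₁
+ κ̂) + ∂₁τ + τ². The gauge term 2(∂₁ + κ̂ + τ)W^1 has the same left factor, whence the quantity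
`bet`; the -1 next to `kHat` comes from differentiating its prefactor r⁻¹. -/
theorem C0_form (hν₀ : ∀ y ∈ coneRegion n T, ν₀ y ≠ 0) (hν : ∀ y ∈ coneRegion n T, ν y y = 0)
    (hdν₀ : DiffOn T ν₀) (hdν : DiffOn T ν) (hm : DiffOn T fun y => gHatInv G y (ν y))
    (hξ : DiffOn T (xiHat G ν₀ ν)) (ht : DiffOn T (tHat G)) (hk : DiffOn T (kHat G ν₀))
    (hw : DiffOn T (wHat G)) (hC : DiffOn T (cTen G))
    (hγ : DiffOn T (gam G ν₀ ν g₀₀)) (hγ' : DiffOn T (rad (gam G ν₀ ν g₀₀))) :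
    C0 P.round (P.form G) (P.scalar ν₀) (P.covector ν) (P.scalar g₀₀) r x
      = -(ν₀ (P.pos r x) / 2) * r⁻¹ ^ 2 * c0Hat G ν₀ ν g₀₀ (P.pos r x) := by
  have hy : P.pos r x ∈ coneRegion n T := P.pos_mem hx hr
  have hd : DiffOn T (dev G) := DiffOn.of_contDiffOn (by norm_num) hc
  have hxi : ∀ A, ∀ x ∈ P.U, xi P.round (P.form G) (P.scalar ν₀) (P.covector ν) A r x
      = P.covector (xiHat G ν₀ ν) A r x := fun A x hx => by
    have h := P.pos_mem hx hr
    exact P.xi_form hG hx hr (hd _ h) hn (hν₀ _ h) hν (hdν _ h) (hm _ h) A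
  have hpxi : ∀ A B, pa A (xi P.round (P.form G) (P.scalar ν₀) (P.covector ν) B) r x
      = pa A (P.covector (xiHat G ν₀ ν) B) r x := fun A B => by
    refine pd_congr ?_
    filter_upwards [P.eventually_mem hx] with x' hx'
    exact hxi B x' hx'
  have hgam : ∀ ρ ∈ Ioo 0 T,
      gInv11 (P.form G) (P.scalar ν₀) (P.covector ν) (P.scalar g₀₀) ρ x
        = gam G ν₀ ν g₀₀ (P.pos ρ x) := fun ρ hρ =>
    P.gInv11_form hG hx hρ hn (hν _ (P.pos_mem hx hρ))
  have hp1 : ∀ ρ ∈ Ioo 0 T, prk P.round (P.form G) (P.scalar ν₀)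
      (gInv11 (P.form G) (P.scalar ν₀) (P.covector ν) (P.scalar g₀₀)) ρ x
      = ρ⁻¹ * (rad (gam G ν₀ ν g₀₀) + kHat G ν₀ * gam G ν₀ ν g₀₀) (P.pos ρ x) :=
    fun ρ hρ => P.prk_form hG hx hρ hn hc hdν₀ (hγ _ (P.pos_mem hx hρ)) hgam
  have hp2 := P.prk_form' hG hx hr hn hc hdν₀
    ((hγ' _ hy).add ((hk _ hy).mul (hγ _ hy))) hp1
  have hp3 := P.prk_form' (φ := Wzero P.round (P.form G)) hG hx hr hn hc hdν₀
    ((hw _ hy).neg) fun ρ hρ => by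
      rw [P.Wzero_form hn hG hx hρ]
      simp
  have hdiv := P.divXi_form hG hx hr hn (hd _ hy) (hξ _ hy)
  have hsq : ∑ A, ∑ B, gInv (P.form G) A B r x * P.covector (xiHat G ν₀ ν) A r x
      * P.covector (xiHat G ν₀ ν) B r x
      = xiHat G ν₀ ν (P.pos r x) (cometric G (P.pos r x) (xiHat G ν₀ ν (P.pos r x))) := by
    rw [← P.sum_gInv_eq_cometric hn hG hx hr, map_sum]
    refine Finset.sum_congr rfl fun A _ => ?_
    rw [map_sum]
    refine Finset.sum_congr rfl fun B _ => ?_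
    rw [map_smul, smul_eq_mul]
    change gInv (P.form G) A B r x * xiHat G ν₀ ν (P.pos r x) (P.frame r x A)
      * xiHat G ν₀ ν (P.pos r x) (P.frame r x B) = _
    ring
  have hbet : rad (bet G ν₀ ν g₀₀) (P.pos r x)
      = rad (rad (gam G ν₀ ν g₀₀) + kHat G ν₀ * gam G ν₀ ν g₀₀) (P.pos r x)
        + (1 / 2) * (rad (tHat G) (P.pos r x) * gam G ν₀ ν g₀₀ (P.pos r x)
          + ((n - 1 : ℕ) + tHat G (P.pos r x)) * rad (gam G ν₀ ν g₀₀) (P.pos r x))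
        - rad (wHat G) (P.pos r x) := by
    have e1 : bet G ν₀ ν g₀₀ = fun y => (rad (gam G ν₀ ν g₀₀) + kHat G ν₀ * gam G ν₀ ν g₀₀) y
        + (1 / 2) * (((n - 1 : ℕ) + tHat G y) * gam G ν₀ ν g₀₀ y) - wHat G y := by
      ext y; rw [bet, Pi.add_apply, Pi.mul_apply]; ring
    have d1 : HasFDerivAt (rad (gam G ν₀ ν g₀₀) + kHat G ν₀ * gam G ν₀ ν g₀₀) _ _ :=
      ((hγ' _ hy).add ((hk _ hy).mul (hγ _ hy))).hasFDerivAt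
    have d2 := (((ht _ hy).hasFDerivAt.const_add ((n - 1 : ℕ) : ℝ)).mul
      (hγ _ hy).hasFDerivAt).const_mul (1 / 2)
    have d3 := (d1.add d2).sub (hw _ hy).hasFDerivAt
    rw [e1, rad]
    erw [d3.fderiv]
    simp only [add_apply, sub_apply, smul_apply, smul_eq_mul]
    rw [← rad, ← rad, ← rad, ← rad]
    ring
  have hneg : rad (-wHat G) (P.pos r x) = - rad (wHat G) (P.pos r x) := by
    rw [rad, fderiv_neg]; rfl
  have hτ := P.tau_form hn hG hx hr (hd _ hy)
  rw [C0, hp2, hp1 r hr, hp3, hgam r hr, P.pr_tau_form hn hG hx hr hd (ht _ hy), hτ,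
    P.Wzero_form hn hG hx hr, P.scalarCurvature_form hG hx hr
      (hc.contDiffAt ((isOpen_coneRegion n T).mem_nhds hy)) hn hd (hC _ hy)]
  simp only [hxi _ x hx, hpxi]
  rw [hdiv, hsq, c0Hat, hbet, bet, P.norm_pos hx hr.1, hneg,
    show P.scalar ν₀ r x = ν₀ (P.pos r x) from rfl]
  simp only [Pi.neg_apply, Pi.add_apply, Pi.mul_apply]
  have := hr.1.ne'
  field_simp
  ring

end SpherePatch

end LightCone

namespace LightCone

variable {n : ℕ} {F F' : Type} [NormedAddCommGroup F] [NormedSpace ℝ F]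
  [NormedAddCommGroup F'] [NormedSpace ℝ F'] {T : ℝ}

/-! ### Existence of local coordinates -/

/-- Central projection onto the sphere of the hyperplane tangent at θ. The smooth left inverse z ↦
π(z)/⟨θ, z⟩ gives both injectivity and the immersion property. -/
theorem exists_spherePatch (hn : 2 ≤ n) {θ : Euc n} (hθ : ‖θ‖ = 1) :
    ∃ P : SpherePatch n, ∃ x ∈ P.U, P.Θ x = θ := by
  have hθ0 : θ ≠ 0 := by
    intro h
    simp [h] at hθ
  have hθθ : inner ℝ θ θ = (1 : ℝ) := by rw [real_inner_self_eq_norm_sq, hθ, one_pow]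
  have : Fact (Module.finrank ℝ (Euc n) = (n - 1) + 1) := ⟨by
    rw [finrank_euclideanSpace_fin]; omega⟩
  let b := OrthonormalBasis.fromOrthogonalSpanSingleton (𝕜 := ℝ) (n - 1) hθ0
  let ι : Euc (n - 1) →L[ℝ] Euc n :=
    (ℝ ∙ θ)ᗮ.subtypeL.comp (b.repr.symm.toContinuousLinearEquiv : Euc (n - 1) →L[ℝ] (ℝ ∙ θ)ᗮ)
  let π : Euc n →L[ℝ] Euc (n - 1) :=
    (b.repr.toContinuousLinearEquiv : (ℝ ∙ θ)ᗮ →L[ℝ] Euc (n - 1)).comp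
      ((ℝ ∙ θ)ᗮ.orthogonalProjectionOnto)
  have hθι : ∀ x, inner ℝ θ (ι x) = (0 : ℝ) := fun x =>
    (Submodule.mem_orthogonal_singleton_iff_inner_right.mp (b.repr.symm x).2)
  have hπι : ∀ x, π (ι x) = x := fun x => by
    simp [π, ι]
  have hπθ : π θ = 0 := by
    have h : (ℝ ∙ θ)ᗮ.orthogonalProjectionOnto θ = 0 :=
      Submodule.orthogonalProjectionOnto_orthogonal_apply_eq_zero (Submodule.mem_span_singleton_self θ)
    simp [π, h]
  have hz : ∀ x, inner ℝ θ (θ + ι x) = (1 : ℝ) := fun x => by rw [inner_add_right, hθι, hθθ, add_zero]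
  have hz0 : ∀ x, θ + ι x ≠ 0 := fun x h => by
    have := hz x
    rw [h, inner_zero_right] at this
    exact zero_ne_one this
  let Θ : Euc (n - 1) → Euc n := fun x => ‖θ + ι x‖⁻¹ • (θ + ι x)
  have hΘ : ContDiff ℝ ∞ Θ := by
    have h1 : ContDiff ℝ ∞ fun x => θ + ι x := contDiff_const.add ι.contDiff
    exact ((h1.norm ℝ hz0).inv fun x => norm_ne_zero_iff.mpr (hz0 x)).smul h1
  have hinner : ∀ x, inner ℝ θ (Θ x) = ‖θ + ι x‖⁻¹ := fun x => by
    rw [real_inner_smul_right, hz, mul_one]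
  have hleft : ∀ x, (inner ℝ θ (Θ x))⁻¹ • π (Θ x) = x := fun x => by
    have h0 := norm_ne_zero_iff.mpr (hz0 x)
    rw [hinner, inv_inv, map_smul, smul_smul, mul_inv_cancel₀ h0, one_smul, map_add, hπθ, hπι,
      zero_add]
  refine ⟨⟨univ, isOpen_univ, Θ, hΘ.contDiffOn, fun x _ => ?_, fun x _ x' _ h => ?_,
    fun x _ => ?_⟩, 0, mem_univ _, ?_⟩
  · rw [norm_smul, norm_inv, norm_norm, inv_mul_cancel₀ (norm_ne_zero_iff.mpr (hz0 x))]
  · rw [← hleft x, ← hleft x', h]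
  · have h0 : inner ℝ θ (Θ x) ≠ (0 : ℝ) := by
      rw [hinner]
      exact inv_ne_zero (norm_ne_zero_iff.mpr (hz0 x))
    have h1 : DifferentiableAt ℝ (fun z : Euc n => (inner ℝ θ z : ℝ)⁻¹ • π z) (Θ x) :=
      (((innerSL ℝ θ).differentiableAt).inv h0).smul π.differentiableAt
    have h2 : DifferentiableAt ℝ Θ x := hΘ.contDiffAt.differentiableAt (by simp)
    have h3 : (fun z : Euc n => (inner ℝ θ z : ℝ)⁻¹ • π z) ∘ Θ = id := funext hleft
    have h4 := fderiv_comp x h1 h2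
    rw [h3, fderiv_id] at h4
    intro u v huv
    have h5 := congrArg (fun L => L u) h4
    have h6 := congrArg (fun L => L v) h4
    simp only [ContinuousLinearMap.comp_apply, ContinuousLinearMap.id_apply] at h5 h6
    rw [h5, h6, huv]
  · change ‖θ + ι 0‖⁻¹ • (θ + ι 0) = θ
    rw [map_zero, add_zero, hθ, inv_one, one_smul]

theorem SpherePatch.exists_pos_eq (hn : 2 ≤ n) {y : Euc n} (hy : y ∈ coneRegion n T) :
    ∃ P : SpherePatch n, ∃ x ∈ P.U, ‖y‖ ∈ Ioo 0 T ∧ P.pos ‖y‖ x = y := by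
  have h0 : ‖y‖ ≠ 0 := hy.1.ne'
  obtain ⟨P, x, hx, h⟩ := exists_spherePatch (n := n) hn (θ := ‖y‖⁻¹ • y)
    (by rw [norm_smul, norm_inv, norm_norm, inv_mul_cancel₀ h0])
  exact ⟨P, x, hx, hy, by rw [SpherePatch.pos, h, smul_smul, mul_inv_cancel₀ h0, one_smul]⟩

/-! ### The constraints as equations for fields on the cone -/

section Constraints

variable {G : FormField n} (hG : IsDegenerateForm T G) (hn : 2 ≤ n) {ν₀ κ g₀₀ : Euc n → ℝ}
  {ν : CovectorField n}

include hG hn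

/-- Every point lies in some patch, so the equations in all local coordinates amount to one equation
on the cone. -/
theorem firstConstraint_iff (hd : DiffOn T (dev G)) (ht : DiffOn T (tHat G)) (hν : DiffOn T ν₀) :
    FirstConstraint T G ν₀ ↔ ∀ y ∈ coneRegion n T, kHat G ν₀ y * ((n - 1 : ℕ) + tHat G y)
      = rad (tHat G) y + tHat G y + sqHat G y := by
  constructor
  · intro h y hy
    obtain ⟨P, x, hx, hr, hp⟩ := SpherePatch.exists_pos_eq hn hy
    have h1 := h P _ hr x hx
    rw [P.C1_form hn hG hx hr hd (ht _ (P.pos_mem hx hr)) (hν _ (P.pos_mem hx hr)), hp] at h1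
    have h2 : ‖y‖⁻¹ ^ 2 ≠ 0 := pow_ne_zero 2 (inv_ne_zero hr.1.ne')
    exact sub_eq_zero.mp ((mul_eq_zero.mp h1).resolve_left h2)
  · intro h P r hr x hx
    rw [P.C1_form hn hG hx hr hd (ht _ (P.pos_mem hx hr)) (hν _ (P.pos_mem hx hr)),
      h _ (P.pos_mem hx hr), sub_self, mul_zero]

theorem nuZeroEquation_iff (hd : DiffOn T (dev G)) (hν : DiffOn T ν₀)
    (hν₀ : ∀ y ∈ coneRegion n T, ν₀ y ≠ 0) :
    NuZeroEquation T G κ ν₀ ↔ ∀ y ∈ coneRegion n T, kHat G ν₀ y = ‖y‖ * κ y := by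
  have key : ∀ (P : SpherePatch n) {r} (_ : r ∈ Ioo 0 T) {x} (_ : x ∈ P.U),
      pr (P.scalar ν₀) r x
        - ((1 / 2) * (Wone P.round (P.form G) (P.scalar ν₀) r x + tau (P.form G) r x)
          * P.scalar ν₀ r x + P.scalar κ r x * P.scalar ν₀ r x)
      = ν₀ (P.pos r x) * r⁻¹ * (kHat G ν₀ (P.pos r x) - r * κ (P.pos r x)) := by
    intro P r hr x hx
    have hy := P.pos_mem hx hr
    have h1 := P.kappaOf_form hn hG hx hr (hd _ hy) (hν _ hy)
    have h0 := hν₀ _ hy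
    have hr0 := hr.1.ne'
    rw [mul_sub, mul_assoc (ν₀ _), ← h1, kappaOf, show P.scalar ν₀ r x = ν₀ (P.pos r x) from rfl,
      show P.scalar κ r x = κ (P.pos r x) from rfl]
    field_simp
    ring
  constructor
  · intro h y hy
    obtain ⟨P, x, hx, hr, hp⟩ := SpherePatch.exists_pos_eq hn hy
    have h1 := key P hr hx
    rw [h P _ hr x hx, sub_self, hp] at h1
    exact sub_eq_zero.mp ((mul_eq_zero.mp h1.symm).resolve_left
      (mul_ne_zero (hν₀ _ hy) (inv_ne_zero hr.1.ne')))
  · intro h P r hr x hx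
    have h1 := key P hr hx
    have h2 := h _ (P.pos_mem hx hr)
    rw [P.norm_pos hx hr.1] at h2
    rw [h2, sub_self, mul_zero] at h1
    exact sub_eq_zero.mp h1

variable (hc : ContDiffOn ℝ 2 (dev G) (coneRegion n T))

include hc

/-- Frames span the tangent space of the sphere only, so the radial component of the covector is
left free. -/
theorem secondConstraint_iff (hν₀ : ∀ y ∈ coneRegion n T, ν₀ y ≠ 0)
    (hν : ∀ y ∈ coneRegion n T, ν y y = 0)
    (hdν₀ : DiffOn T ν₀) (hdν : DiffOn T ν) (hm : DiffOn T fun y => gHatInv G y (ν y))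
    (hξ : DiffOn T (xiHat G ν₀ ν)) (hR : DiffOn T (rad (dev G))) (hN : DiffOn T (nOp G))
    (ht : DiffOn T (tHat G)) (hk : DiffOn T (kHat G ν₀)) :
    SecondConstraint T G ν₀ ν ↔
      ∀ y ∈ coneRegion n T, ∀ v, inner ℝ y v = 0 → caHat G ν₀ ν y v = 0 := by
  constructor
  · intro h y hy v hv
    obtain ⟨P, x, hx, hr, hp⟩ := SpherePatch.exists_pos_eq hn hy
    have h1 : ∀ A, caHat G ν₀ ν y (P.frame ‖y‖ x A) = 0 := by
      intro A
      have h2 := h P _ hr x hx A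
      rw [P.CA_form hG hx hr hn hc hν₀ hν hdν₀ hdν hm hξ hR hN ht hk, hp] at h2
      have h3 : -(1 / 2) * ‖y‖⁻¹ ≠ 0 := mul_ne_zero (by norm_num) (inv_ne_zero hr.1.ne')
      exact (mul_eq_zero.mp h2).resolve_left h3
    have hf := P.isFrame hx hr.1.ne'
    rw [hp] at hf
    obtain ⟨c, rfl⟩ := exists_coeff hn (ne_zero_of_mem hy) hf.linearIndependent hf.inner_eq_zero hv
    simp [map_sum, h1]
  · intro h P r hr x hx A
    rw [P.CA_form hG hx hr hn hc hν₀ hν hdν₀ hdν hm hξ hR hN ht hk,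
      h _ (P.pos_mem hx hr) _ (P.inner_pos_frame hx A), mul_zero]

theorem thirdConstraint_iff (hν₀ : ∀ y ∈ coneRegion n T, ν₀ y ≠ 0)
    (hν : ∀ y ∈ coneRegion n T, ν y y = 0)
    (hdν₀ : DiffOn T ν₀) (hdν : DiffOn T ν) (hm : DiffOn T fun y => gHatInv G y (ν y))
    (hξ : DiffOn T (xiHat G ν₀ ν)) (ht : DiffOn T (tHat G)) (hk : DiffOn T (kHat G ν₀))
    (hw : DiffOn T (wHat G)) (hC : DiffOn T (cTen G))
    (hγ : DiffOn T (gam G ν₀ ν g₀₀)) (hγ' : DiffOn T (rad (gam G ν₀ ν g₀₀))) :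
    ThirdConstraint T G ν₀ ν g₀₀ ↔ ∀ y ∈ coneRegion n T, c0Hat G ν₀ ν g₀₀ y = 0 := by
  constructor
  · intro h y hy
    obtain ⟨P, x, hx, hr, hp⟩ := SpherePatch.exists_pos_eq hn hy
    have h2 := h P _ hr x hx
    rw [P.C0_form hG hx hr hn hc hν₀ hν hdν₀ hdν hm hξ ht hk hw hC hγ hγ', hp] at h2
    have h3 : -(ν₀ y / 2) * ‖y‖⁻¹ ^ 2 ≠ 0 :=
      mul_ne_zero (neg_ne_zero.mpr (div_ne_zero (hν₀ y hy) two_ne_zero))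
        (pow_ne_zero 2 (inv_ne_zero hr.1.ne'))
    exact (mul_eq_zero.mp h2).resolve_left h3
  · intro h P r hr x hx
    rw [P.C0_form hG hx hr hn hc hν₀ hν hdν₀ hdν hm hξ ht hk hw hC hγ hγ',
      h _ (P.pos_mem hx hr), mul_zero]

end Constraints

end LightCone

namespace LightCone

variable {n : ℕ} {F F' F'' : Type} [NormedAddCommGroup F] [NormedSpace ℝ F]
  [NormedAddCommGroup F'] [NormedSpace ℝ F'] [NormedAddCommGroup F''] [NormedSpace ℝ F'']
  {T : ℝ} {N : ℕ∞} {q : ℤ} {p : ℕ}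

/-! ### Regularity of the fields built from an admissible form -/

/-- The musical isomorphism of Euclidean space. -/
noncomputable def euclideanEquiv (n : ℕ) : Euc n ≃L[ℝ] (Euc n →L[ℝ] ℝ) :=
  (InnerProductSpace.toDual ℝ (Euc n)).toContinuousLinearEquiv

theorem coe_euclideanEquiv (n : ℕ) :
    (euclideanEquiv n : Euc n →L[ℝ] Euc n →L[ℝ] ℝ) = euclideanForm n := by
  ext v w : 2
  rfl

theorem euclideanEquiv_symm_cobas (i : Fin n) : (euclideanEquiv n).symm (cobas i) = bas i := by
  rw [ContinuousLinearEquiv.symm_apply_eq, cobas, ← coe_euclideanEquiv]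
  rfl

/-- The form `y ⊗ y / r²`. -/
noncomputable def radial (y : Euc n) : (Euc n →L[ℝ] ℝ) →L[ℝ] Euc n :=
  (‖y‖ ^ 2)⁻¹ • (ContinuousLinearMap.apply ℝ ℝ y).smulRight y

theorem radial_apply (y : Euc n) (φ : Euc n →L[ℝ] ℝ) :
    radial y φ = ((‖y‖ ^ 2)⁻¹ * φ y) • y := by
  simp [radial, smul_smul]

theorem VertexClass.inv_norm_sq (hT : 0 < T) :
    VertexClass N (-2) T (fun y : Euc n => (‖y‖ ^ 2)⁻¹) := by
  refine (((VertexClass.inv_norm hT).mul (VertexClass.inv_norm hT) hT).congr hT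
    fun y _ => ?_).mono_weight (by norm_num)
  rw [← mul_inv, sq]

theorem vertexClass_radial (hT : 0 < T) : VertexClass N 0 T (radial (n := n)) := by
  have h1 : VertexClass N 1 T (fun y : Euc n => ContinuousLinearMap.apply ℝ ℝ y) :=
    VertexClass.id.clm (ContinuousLinearMap.apply ℝ ℝ) hT
  have h2 := (h1.bilin (ContinuousLinearMap.smulRightL ℝ (Euc n →L[ℝ] ℝ) (Euc n))
    VertexClass.id hT)
  exact ((VertexClass.inv_norm_sq hT).smul h2 hT).mono_weight (by norm_num)

theorem vertexClass_roundForm (hT : 0 < T) : VertexClass N 0 T (roundForm n) := by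
  have h1 : VertexClass N 1 T (fun y : Euc n => euclideanForm n y) :=
    VertexClass.id.clm (euclideanForm n) hT
  have h2 := h1.bilin (ContinuousLinearMap.smulRightL ℝ (Euc n) (Euc n →L[ℝ] ℝ)) h1 hT
  exact (VertexClass.const (euclideanForm n)).sub
    (((VertexClass.inv_norm_sq hT).smul h2 hT).mono_weight (by norm_num)) hT

section

variable {G : FormField n} (hG : IsDegenerateForm T G) (hT : 0 < T) (hp : 1 ≤ p)

theorem vertexClass_gHat (hT : 0 < T) (hh : VertexClass N p T (dev G)) :
    VertexClass N 0 T (gHat G) :=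
  (VertexClass.const (euclideanForm n)).add (hh.mono_weight (by positivity)) hT

include hG

theorem contDiffOn_gHatInv {m : WithTop ℕ∞} (hc : ContDiffOn ℝ m (dev G) (coneRegion n T)) :
    ContDiffOn ℝ m (gHatInv G) (coneRegion n T) := by
  intro y hy
  obtain ⟨e, he⟩ := hG.exists_equiv hy
  have h1 : ContDiffWithinAt ℝ m (gHat G) (coneRegion n T) y :=
    (contDiffOn_const.add hc) y hy
  have h2 : ContDiffAt ℝ m ContinuousLinearMap.inverse (gHat G y) := by
    rw [← he]
    exact contDiffAt_map_inverse e
  exact h2.comp_contDiffWithinAt y h1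

include hT

/-- Inversion is smooth on the open set of invertible maps, where `gHat G` stays; at the vertex it
tends to the Euclidean form. -/
theorem vertexClass_gHatInv_sub (hp : 1 ≤ p) (hh : VertexClass N p T (dev G)) :
    VertexClass N p T (fun y => gHatInv G y - (euclideanEquiv n).symm) := by
  let U : Set (Euc n →L[ℝ] Euc n →L[ℝ] ℝ) :=
    Set.range ((↑) : (Euc n ≃L[ℝ] (Euc n →L[ℝ] ℝ)) → (Euc n →L[ℝ] Euc n →L[ℝ] ℝ))
  have hU : IsOpen U := ContinuousLinearEquiv.isOpen
  have hc : euclideanForm n ∈ U := ⟨_, coe_euclideanEquiv n⟩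
  have h1 : VertexClass N p T (fun y => gHat G y - euclideanForm n) :=
    hh.congr hT fun y _ => by simp [gHat]
  have h2 : ContDiffOn ℝ ∞ (ContinuousLinearMap.inverse :
      (Euc n →L[ℝ] Euc n →L[ℝ] ℝ) → ((Euc n →L[ℝ] ℝ) →L[ℝ] Euc n)) U := by
    rintro _ ⟨e, rfl⟩
    exact (contDiffAt_map_inverse e).contDiffWithinAt
  have h3 := VertexClass.comp_sub_const hT hU hc hp h1 (fun y hy => hG.exists_equiv hy) h2
  rw [← coe_euclideanEquiv] at h3
  simp only [ContinuousLinearMap.inverse_equiv] at h3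
  exact h3

theorem vertexClass_gHatInv (hp : 1 ≤ p) (hh : VertexClass N p T (dev G)) :
    VertexClass N 0 T (gHatInv G) := by
  have h := ((vertexClass_gHatInv_sub hG hT hp hh).mono_weight (q' := 0) (by positivity)).add
    (VertexClass.const ((euclideanEquiv n).symm : (Euc n →L[ℝ] ℝ) →L[ℝ] Euc n)) hT
  exact h.congr hT fun y _ => by simp

theorem vertexClass_cometric (hp : 1 ≤ p) (hh : VertexClass N p T (dev G)) :
    VertexClass N 0 T (cometric G) :=
  (vertexClass_gHatInv hG hT hp hh).sub (vertexClass_radial hT) hT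

/-- The second slot is filled with the cometric, a field of weight 0 rather than a constant, so the
hypothesis ranges over all such fields. -/
theorem vertexClass_trace (hp : 1 ≤ p) (hh : VertexClass N p T (dev G))
    {b : Euc n → Euc n → Euc n → F}
    (hb : ∀ v : Euc n, ∀ w : Euc n → Euc n, VertexClass N 0 T w →
      VertexClass N q T fun y => b y v (w y)) :
    VertexClass N q T (fun y => trace G y (b y)) :=
  VertexClass.sum _ (fun i _ => hb (bas i) _
    (((vertexClass_cometric hG hT hp hh).clm_apply (VertexClass.const (cobas i)) hT).mono_weight
      (by simp))) hT

theorem vertexClass_wHat (hp : 1 ≤ p) (hh : VertexClass N p T (dev G)) (hn : 2 ≤ n) :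
    VertexClass N p T (fun y => wHat G y - (n - 1 : ℕ)) := by
  -- The Euclidean inverse has trace n, and the radial part takes away 1.
  have h1 : ∀ y ∈ coneRegion n T, wHat G y - (n - 1 : ℕ)
      = ∑ i, inner ℝ (bas i) ((gHatInv G y - (euclideanEquiv n).symm) (cobas i)) := by
    intro y hy
    have h0 : ‖y‖ ≠ 0 := hy.1.ne'
    have h2 : ∑ i : Fin n, (inner ℝ (bas i) (radial y (cobas i)) : ℝ) = 1 := by
      have h3 : ∀ i : Fin n, (inner ℝ (bas i) (radial y (cobas i)) : ℝ)
          = (‖y‖ ^ 2)⁻¹ * (inner ℝ (bas i) y * inner ℝ (bas i) y) := by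
        intro i
        rw [radial_apply, real_inner_smul_right, cobas, euclideanForm_apply]
        ring
      have h4 := congrArg (fun z => (inner ℝ z y : ℝ)) (sum_inner_bas y)
      simp only [sum_inner, real_inner_smul_left, real_inner_self_eq_norm_sq] at h4
      simp only [h3, ← Finset.mul_sum]
      rw [h4, inv_mul_cancel₀ (pow_ne_zero 2 h0)]
    have h5 : ∑ i : Fin n, (inner ℝ (bas i) ((euclideanEquiv n).symm (cobas i)) : ℝ) = n := by
      simp [euclideanEquiv_symm_cobas, bas]
    have h6 : wHat G y = ∑ i, (inner ℝ (bas i) (gHatInv G y (cobas i)) : ℝ)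
        - ∑ i : Fin n, (inner ℝ (bas i) (radial y (cobas i)) : ℝ) := by
      change ∑ i, (inner ℝ (bas i) (cometric G y (cobas i)) : ℝ) = _
      rw [← Finset.sum_sub_distrib]
      refine Finset.sum_congr rfl fun i _ => ?_
      rw [← inner_sub_right]
      rfl
    have h7 : ∑ i : Fin n, (inner ℝ (bas i)
        ((gHatInv G y - (euclideanEquiv n).symm) (cobas i)) : ℝ)
        = ∑ i : Fin n, (inner ℝ (bas i) (gHatInv G y (cobas i)) : ℝ)
          - ∑ i : Fin n, (inner ℝ (bas i) ((euclideanEquiv n).symm (cobas i)) : ℝ) := by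
      rw [← Finset.sum_sub_distrib]
      refine Finset.sum_congr rfl fun i _ => ?_
      rw [← inner_sub_right]
      rfl
    rw [h6, h2, h7, h5]
    rw [Nat.cast_sub (by omega)]
    push_cast
    ring
  have h2 : ∀ i ∈ (Finset.univ : Finset (Fin n)), VertexClass N p T (fun y =>
      (inner ℝ (bas i) ((gHatInv G y - (euclideanEquiv n).symm) (cobas i)) : ℝ)) := fun i _ => by
    have h2 := (vertexClass_gHatInv_sub hG hT hp hh).clm_apply (VertexClass.const (cobas i)) hT
    exact (h2.clm (innerSL ℝ (bas i)) hT).mono_weight (by simp)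
  exact (VertexClass.sum _ h2 hT).congr hT h1

theorem vertexClass_nOp (hp : 1 ≤ p) (hh : VertexClass (N + 1) p T (dev G)) :
    VertexClass N p T (nOp G) := by
  have h1 := vertexClass_cometric hG hT hp (hh.mono_order (N' := N) le_self_add)
  exact ((h1.clm_comp (hh.rad hT) hT).const_smul (1 / 2) hT).mono_weight (by simp)

theorem vertexClass_tHat (hp : 1 ≤ p) (hh : VertexClass (N + 1) p T (dev G)) :
    VertexClass N p T (tHat G) := by
  refine vertexClass_trace hG hT hp (hh.mono_order le_self_add) fun v w hw => ?_
  have h1 := ((hh.rad hT).clm_apply (VertexClass.const v) hT).clm_apply hw hT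
  exact (h1.const_smul (1 / 2) hT).mono_weight (by simp)

theorem vertexClass_sqHat (hp : 1 ≤ p) (hh : VertexClass (N + 1) p T (dev G)) :
    VertexClass N p T (sqHat G) := by
  refine vertexClass_trace hG hT hp (hh.mono_order le_self_add) fun v w hw => ?_
  have h0 := (vertexClass_nOp hG hT hp hh).clm_apply (VertexClass.const v) hT
  have h1 := ((hh.rad hT).clm_apply h0 hT).clm_apply hw hT
  exact (h1.const_smul (1 / 2) hT).mono_weight (by simp)

theorem vertexClass_cTen (hp : 1 ≤ p) (hh : VertexClass (N + 1) p T (dev G)) :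
    VertexClass N (p - 1) T (cTen G) := by
  have h0 := hh.fderiv
  let L : (Euc n →L[ℝ] Euc n →L[ℝ] Euc n →L[ℝ] ℝ) →L[ℝ] (Euc n →L[ℝ] Euc n →L[ℝ] Euc n →L[ℝ] ℝ) :=
    (ContinuousLinearMap.flipₗᵢ ℝ (Euc n) (Euc n)
      (Euc n →L[ℝ] ℝ)).toContinuousLinearEquiv.toContinuousLinearMap
  let L' : (Euc n →L[ℝ] Euc n →L[ℝ] Euc n →L[ℝ] ℝ) →L[ℝ] (Euc n →L[ℝ] Euc n →L[ℝ] Euc n →L[ℝ] ℝ) :=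
    ContinuousLinearMap.compL ℝ (Euc n) (Euc n →L[ℝ] Euc n →L[ℝ] ℝ) (Euc n →L[ℝ] Euc n →L[ℝ] ℝ)
      (ContinuousLinearMap.flipₗᵢ ℝ (Euc n) (Euc n)
        ℝ).toContinuousLinearEquiv.toContinuousLinearMap
  have h1 : VertexClass N (p - 1) T (kTen G) := by
    have h2 := h0.clm L hT
    have h3 := h2.clm L' hT
    exact ((h0.add h2 hT).sub h3 hT).const_smul (1 / 2) hT
  have h4 := (vertexClass_cometric hG hT hp (hh.mono_order (N' := N) le_self_add)).clm
    (ContinuousLinearMap.compL ℝ (Euc n) (Euc n →L[ℝ] ℝ) (Euc n)) hT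
  exact (h4.clm_comp h1 hT).mono_weight (by simp)

omit hG in
theorem vertexClass_zRound : VertexClass N (-1) T (zRound (n := n)) := by
  let L : Euc n →L[ℝ] Euc n →L[ℝ] Euc n →L[ℝ] Euc n := LinearMap.toContinuousLinearMap
    { toFun := fun y => (ContinuousLinearMap.compL ℝ (Euc n) ℝ (Euc n)
        (ContinuousLinearMap.toSpanSingleton ℝ y)).comp (euclideanForm n)
      map_add' := fun a b => by ext; simp
      map_smul' := fun a b => by ext; simp; ring }
  exact ((VertexClass.inv_norm_sq hT).smul (VertexClass.id.clm L hT) hT).mono_weight (by norm_num)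

theorem vertexClass_zTen (hp : 1 ≤ p) (hh : VertexClass (N + 1) p T (dev G)) :
    VertexClass N (-1) T (zTen G) :=
  ((vertexClass_cTen hG hT hp hh).mono_weight (by omega)).add (vertexClass_zRound hT) hT

theorem vertexClass_trC (hp : 1 ≤ p) (hh : VertexClass (N + 1) p T (dev G)) :
    VertexClass N (p - 1) T (trC G) := by
  refine vertexClass_trace hG hT hp (hh.mono_order le_self_add) fun v w hw => ?_
  exact (((vertexClass_cTen hG hT hp hh).clm_apply (VertexClass.const v) hT).clm_apply hw
    hT).mono_weight (by simp)

/-- One derivative is spent on `nOp` and one on its divergence. The products with `zTen`, of weight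
-1, have the same weight p - 1 as the derivative of `nOp`. -/
theorem vertexClass_divN (hp : 1 ≤ p) (hh : VertexClass (N + 2) p T (dev G)) :
    VertexClass N (p - 1) T (divN G) := by
  have hh' : VertexClass (N + 1 + 1) p T (dev G) := by
    rwa [add_assoc, one_add_one_eq_two]
  have hh1 : VertexClass (N + 1) p T (dev G) := hh'.mono_order le_self_add
  have hN := vertexClass_nOp hG hT hp hh'
  have hZ := vertexClass_zTen hG hT hp hh1
  refine vertexClass_trace hG hT hp (hh1.mono_order le_self_add) fun v w hw => ?_
  have h1 := (vertexClass_gHat hT (hh1.mono_order (N' := N) le_self_add)).clm_apply hw hT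
  have hN' := hN.mono_order (N' := N) le_self_add
  have hZv := hZ.clm_apply (VertexClass.const v) hT
  have h2 := (hN.fderiv.clm_apply (VertexClass.const v) hT).mono_weight (q' := p - 1) (by simp)
  have h3 := (hZv.clm_comp hN' hT).mono_weight (q' := p - 1) (by omega)
  have h4 := (hN'.clm_comp hZv hT).mono_weight (q' := p - 1) (by omega)
  exact (h1.clm_comp ((h2.add h3 hT).sub h4 hT) hT).mono_weight (by simp)

/-- Both the derivative of `cTen` and its products with `zTen` have weight at least p - 2: `zTen` is
only O(1/r), because of its round part. -/
theorem vertexClass_scalC (hp : 1 ≤ p) (hh : VertexClass (N + 2) p T (dev G)) :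
    VertexClass N (p - 2) T (scalC G) := by
  have hh' : VertexClass (N + 1 + 1) p T (dev G) := by
    rwa [add_assoc, one_add_one_eq_two]
  have hh1 : VertexClass (N + 1) p T (dev G) := hh'.mono_order le_self_add
  have hh0 : VertexClass N p T (dev G) := hh1.mono_order le_self_add
  have hC := vertexClass_cTen hG hT hp hh'
  have hC' := hC.mono_order (N' := N) le_self_add
  have hZ := vertexClass_zTen hG hT hp hh1
  refine vertexClass_trace hG hT hp hh0 fun v w hw => ?_
  refine vertexClass_trace hG hT hp hh0 fun v' w' hw' => ?_
  have h1 := (vertexClass_gHat hT hh0).clm_apply hw' hT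
  have c := fun v : Euc n => VertexClass.const (n := n) (N := N) (T := T) v
  have h2 := (((hC.fderiv.clm_apply (c v') hT).clm_apply (c v) hT).clm_apply hw hT).mono_weight
    (q' := p - 2) (by omega)
  have h3 := (((hC.fderiv.clm_apply (c v) hT).clm_apply (c v') hT).clm_apply hw hT).mono_weight
    (q' := p - 2) (by omega)
  have h4 := ((hC'.clm_apply (c v') hT).clm_apply ((hZ.clm_apply (c v) hT).clm_apply hw hT)
    hT).mono_weight (q' := p - 2) (by omega)
  have h5 := ((hC'.clm_apply (c v) hT).clm_apply ((hZ.clm_apply (c v') hT).clm_apply hw hT)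
    hT).mono_weight (q' := p - 2) (by omega)
  exact (h1.clm_apply ((((h2.sub h3 hT).add h4 hT).sub h5 hT)) hT).mono_weight (by simp)

theorem vertexClass_divXi (hp : 1 ≤ p) (hh : VertexClass (N + 1) p T (dev G))
    {ξ : CovectorField n} (hξ : VertexClass (N + 1) (p - 1) T ξ) :
    VertexClass N (p - 2) T (divXi G ξ) := by
  have hh0 : VertexClass N p T (dev G) := hh.mono_order le_self_add
  have hZ := vertexClass_zTen hG hT hp hh
  refine vertexClass_trace hG hT hp hh0 fun v w hw => ?_
  have c := fun v : Euc n => VertexClass.const (n := n) (N := N) (T := T) v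
  have h2 := ((hξ.fderiv.clm_apply (c v) hT).clm_apply hw hT).mono_weight (q' := p - 2) (by omega)
  have h3 := ((hξ.mono_order (N' := N) le_self_add).clm_apply
    ((hZ.clm_apply (c v) hT).clm_apply hw hT) hT).mono_weight (q' := p - 2) (by omega)
  exact h2.sub h3 hT

end

end LightCone

namespace LightCone

variable {n : ℕ} {F F' F'' : Type} [NormedAddCommGroup F] [NormedSpace ℝ F]
  [NormedAddCommGroup F'] [NormedSpace ℝ F'] [NormedAddCommGroup F''] [NormedSpace ℝ F'']
  {T : ℝ} {N : ℕ∞} {q : ℤ} {p : ℕ}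

/-! ### Existence for a prescribed degenerate form -/

theorem exists_radius (hT : 0 < T) {P : Euc n → Prop} (h : ∀ᶠ y in 𝓝[≠] (0 : Euc n), P y) :
    ∃ T' : ℝ, 0 < T' ∧ T' ≤ T ∧ ∀ y ∈ coneRegion n T', P y := by
  rw [eventually_nhdsWithin_iff, Metric.eventually_nhds_iff] at h
  obtain ⟨ε, hε, h⟩ := h
  exact ⟨min ε T, lt_min hε hT, min_le_right _ _, fun y hy =>
    h (by simpa using hy.2.trans_le (min_le_left _ _)) (ne_zero_of_mem hy)⟩

theorem rad_congr {f g : Euc n → F} (h : EqOn f g (coneRegion n T)) {y : Euc n}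
    (hy : y ∈ coneRegion n T) : rad f y = rad g y := by
  have : f =ᶠ[𝓝 y] g := by
    filter_upwards [(isOpen_coneRegion n T).mem_nhds hy] with z hz using h hz
  rw [rad, this.fderiv_eq, rad]

theorem rad_const_add (c : F) (f : Euc n → F) (y : Euc n) : rad (fun y => c + f y) y = rad f y := by
  rw [rad, fderiv_const_add, rad]

theorem rad_mul {f g : Euc n → ℝ} {y : Euc n} (hf : DifferentiableAt ℝ f y)
    (hg : DifferentiableAt ℝ g y) :
    rad (fun y => f y * g y) y = rad f y * g y + f y * rad g y := by
  rw [rad, fderiv_fun_mul hf hg]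
  simp only [add_apply, smul_apply, smul_eq_mul, rad]
  ring

theorem rad_inv {f : Euc n → ℝ} {y : Euc n} (hf : DifferentiableAt ℝ f y) (h0 : f y ≠ 0) :
    rad (fun y => (f y)⁻¹) y = - rad f y / f y ^ 2 := by
  have h := (hasDerivAt_inv h0).comp_hasFDerivAt y hf.hasFDerivAt
  rw [rad, show (fun y => (f y)⁻¹) = Inv.inv ∘ f from rfl, h.fderiv, smul_apply, smul_eq_mul, ← rad]
  ring

theorem VertexClass.diffOn {f : Euc n → F} (h : VertexClass N q T f) (hN : 1 ≤ N) : DiffOn T f :=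
  fun _ hy => h.differentiableAt hN hy

theorem VertexClass.inv_add {c : ℝ} (hc : 0 < c) (hT : 0 < T) (hp : 1 ≤ p) {f : Euc n → ℝ}
    (hf : VertexClass N p T f) (hpos : ∀ y ∈ coneRegion n T, 0 < c + f y) :
    VertexClass N p T (fun y => (c + f y)⁻¹ - c⁻¹) := by
  have h := VertexClass.comp_sub_const (U := {s : ℝ | 0 < c + s}) (c := 0)
    (Φ := fun s : ℝ => (c + s)⁻¹) hT (isOpen_lt continuous_const (by fun_prop)) (by simpa using hc)
    hp (f := f) (hf.congr hT fun y _ => sub_zero _) hpos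
    (ContDiffOn.inv (contDiffOn_const.add contDiffOn_id) fun s hs => ne_of_gt hs)
  simpa using h

theorem VertexClass.inv_add' {c : ℝ} (hc : 0 < c) (hT : 0 < T) (hp : 1 ≤ p) {f : Euc n → ℝ}
    (hf : VertexClass N p T f) (hpos : ∀ y ∈ coneRegion n T, 0 < c + f y) :
    VertexClass N 0 T (fun y => (c + f y)⁻¹) :=
  (((hf.inv_add hc hT hp hpos).mono_weight (q' := 0) (by positivity)).add
    (VertexClass.const c⁻¹) hT).congr hT fun y _ => by simp

/-- The value of `kHat` prescribed by the first constraint. -/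
noncomputable def alp (G : FormField n) (y : Euc n) : ℝ :=
  (rad (tHat G) y + tHat G y + sqHat G y) / ((n - 1 : ℕ) + tHat G y)

section

variable {G : FormField n} (hG : IsDegenerateForm T G) (hT : 0 < T) (hp : 1 ≤ p) (hn : 2 ≤ n)
  {ν₀ : Euc n → ℝ} {ν : CovectorField n}

theorem dim_pos (hn : 2 ≤ n) : 0 < ((n - 1 : ℕ) : ℝ) := by
  have : 0 < n - 1 := by omega
  exact_mod_cast this

include hG hT hp hn

theorem vertexClass_alp (hh : VertexClass (N + 2) p T (dev G))
    (hpos : ∀ y ∈ coneRegion n T, 0 < ((n - 1 : ℕ) : ℝ) + tHat G y) :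
    VertexClass N p T (alp G) := by
  have hh' : VertexClass (N + 1 + 1) p T (dev G) := by
    rwa [add_assoc, one_add_one_eq_two]
  have ht := vertexClass_tHat hG hT hp hh'
  have hs := (vertexClass_sqHat hG hT hp hh').mono_order (N' := N) le_self_add
  have ht' := ht.mono_order (N' := N) le_self_add
  exact (((((ht.rad hT).add ht' hT).add hs hT).mul (ht'.inv_add' (dim_pos hn) hT hp hpos)
    hT).mono_weight (by simp)).congr hT fun y _ => div_eq_mul_inv _ _

/-- `kHat` = α is a Bernoulli equation for ν₀, linear in 1/ν₀ = 1 + v: rad v + ((n-1)/2 + α + ½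
tHat) v = ½(wHat - (n-1)) - α - ½ tHat. The radius is reduced so that 1 + v stays positive. -/
theorem exists_nuZero (hN : 1 ≤ N) (hh : VertexClass (N + 2) p T (dev G))
    (hpos : ∀ y ∈ coneRegion n T, 0 < ((n - 1 : ℕ) : ℝ) + tHat G y) :
    ∃ T' : ℝ, 0 < T' ∧ T' ≤ T ∧ ∃ ν₀ : Euc n → ℝ, VertexClass N p T' (fun y => ν₀ y - 1) ∧
      (∀ y ∈ coneRegion n T', 0 < ν₀ y) ∧ ∀ y ∈ coneRegion n T', kHat G ν₀ y = alp G y := by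
  have hα := vertexClass_alp hG hT hp hn hh hpos
  have ht : VertexClass N p T (tHat G) :=
    vertexClass_tHat hG hT hp (hh.mono_order (add_le_add_right (by norm_num) N))
  have hw := vertexClass_wHat hG hT hp (hh.mono_order (N' := N) le_self_add) hn
  have hb := hα.add (ht.const_smul (1 / 2) hT) hT
  have hf := ((hw.const_smul (1 / 2) hT).sub hα hT).sub (ht.const_smul (1 / 2) hT) hT
  obtain ⟨v, hv, hv1, -⟩ := VertexClass.exists_solution hp hN hT hb hf
    (a := ((n - 1 : ℕ) : ℝ) / 2) (by have := dim_pos hn; positivity)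
  obtain ⟨T', hT', hTT, hv2⟩ := exists_radius hT
    ((hv.tendsto_zero hp).eventually (lt_mem_nhds (show (-1 : ℝ) < 0 by norm_num)))
  have hpos' : ∀ y ∈ coneRegion n T', 0 < 1 + v y := fun y hy => by linarith [hv2 y hy]
  have hv' := hv.mono_radius hTT
  refine ⟨T', hT', hTT, fun y => (1 + v y)⁻¹, ?_, fun y hy => inv_pos.mpr (hpos' y hy), ?_⟩
  · simpa using hv'.inv_add one_pos hT' hp hpos'
  · intro y hy
    have h0 := (hpos' y hy).ne'
    have hy' := coneRegion_mono hTT hy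
    have hd : DifferentiableAt ℝ v y := hv.differentiableAt hN hy'
    have h1 := hv1 y hy'
    simp only [smul_eq_mul] at h1
    rw [kHat, rad_inv (hd.const_add 1) h0, rad_const_add]
    have h2 : rad v y = 1 / 2 * (wHat G y - (n - 1 : ℕ)) - alp G y - 1 / 2 * tHat G y
        - ((n - 1 : ℕ) / 2 + (alp G y + 1 / 2 * tHat G y)) * v y := by linarith
    rw [h2]
    field_simp
    ring

theorem vertexClass_mul_wHat (hh : VertexClass N p T (dev G))
    (hν₀ : VertexClass N p T (fun y => ν₀ y - 1)) :
    VertexClass N p T (fun y => (1 / 2 : ℝ) * (ν₀ y * wHat G y - (n - 1 : ℕ))) := by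
  have hw := vertexClass_wHat hG hT hp hh hn
  have h1 := (((hν₀.mul hw hT).mono_weight (q' := p) (by omega)).add
    ((hν₀.const_smul ((n - 1 : ℕ) : ℝ) hT).add hw hT) hT).const_smul (1 / 2) hT
  refine h1.congr hT fun y _ => ?_
  simp only [smul_eq_mul]
  ring

/-- Two linear equations in succession: the constraint, for ξ, with exponent n and weight p - 1; and
the definition of ξ, for the vector m dual to ν, with exponent (n-1)/2 and weight p. -/
theorem exists_nu (hh : VertexClass (N + 3) p T (dev G))
    (hν₀ : VertexClass (N + 2) p T (fun y => ν₀ y - 1))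
    (hν₀0 : ∀ y ∈ coneRegion n T, 0 < ν₀ y) (hk : VertexClass (N + 2) p T (kHat G ν₀)) :
    ∃ ν : CovectorField n, (∀ y ∈ coneRegion n T, ν y y = 0) ∧ VertexClass (N + 1) p T ν ∧
      VertexClass (N + 1) (p - 1) T (xiHat G ν₀ ν) ∧
      ∀ y ∈ coneRegion n T, ∀ v, inner ℝ y v = 0 → caHat G ν₀ ν y v = 0 := by
  have hd := dim_pos hn
  have e3 : N + 3 = N + 1 + 2 := by rw [add_assoc]; norm_num
  have e3' : N + 3 = N + 2 + 1 := by rw [add_assoc]; norm_num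
  have e2 : N + 2 = N + 1 + 1 := by rw [add_assoc]; norm_num
  have hh1 : VertexClass (N + 1) p T (dev G) := hh.mono_order (by rw [e3]; exact le_self_add)
  have hh2 : VertexClass (N + 2) p T (dev G) := hh.mono_order (by rw [e3']; exact le_self_add)
  have ht := vertexClass_tHat hG hT hp (e3' ▸ hh)
  have hdN := vertexClass_divN hG hT hp (e3 ▸ hh)
  have hgi := vertexClass_gHatInv hG hT hp hh1
  have hS := (hdN.const_smul 2 hT).sub (((e2 ▸ ht.add hk hT).fderiv).const_smul 2 hT) hT
  -- The constraint concerns tangential vectors only. Composing the source with the projection along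
  -- y makes it vanish on y, and the solution Ξ inherits this.
  have hpi : VertexClass (N + 1) 0 T (fun y : Euc n => ContinuousLinearMap.id ℝ (Euc n)
      - (radial y).comp (euclideanForm n)) :=
    (VertexClass.const _).sub (((vertexClass_radial hT).clm_comp (VertexClass.const _)
      hT).mono_weight (by simp)) hT
  have hpiv : ∀ y v : Euc n, inner ℝ y v = 0 → (ContinuousLinearMap.id ℝ (Euc n)
      - (radial y).comp (euclideanForm n)) v = v := fun y v hv => by
    simp [radial_apply, euclideanForm_apply, real_inner_comm, hv]
  have hpiy : ∀ y : Euc n, y ≠ 0 → (ContinuousLinearMap.id ℝ (Euc n)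
      - (radial y).comp (euclideanForm n)) y = 0 := fun y hy => by
    have : ‖y‖ ^ 2 ≠ 0 := by simpa using hy
    simp [radial_apply, euclideanForm_apply, this]
  have hN1 : (1 : ℕ∞) ≤ N + 1 := le_add_self
  obtain ⟨Ξ, hΞ, hΞ1, hΞ2⟩ := VertexClass.exists_solution (q := p - 1) hp hN1 hT
    (ht.mono_order (N' := N + 1) (by rw [e2]; exact le_self_add))
    ((hS.clm_comp hpi hT).mono_weight (q' := p - 1) (by simp))
    (a := 1 + ((n - 1 : ℕ) : ℝ)) (by
      have : (1 : ℝ) ≤ p := by exact_mod_cast hp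
      push_cast
      linarith)
  have hΞy : ∀ y ∈ coneRegion n T, Ξ y y = 0 := fun y hy => by
    refine hΞ2 y hy (ContinuousLinearMap.apply ℝ ℝ y) fun t ht => ?_
    have h1 := hpiy (t • y) (smul_ne_zero ht.1.ne' (ne_zero_of_mem hy))
    rw [map_smul] at h1
    have h2 := (smul_eq_zero.mp h1).resolve_left ht.1.ne'
    rw [ContinuousLinearMap.apply_apply, ContinuousLinearMap.comp_apply, h2, map_zero]
  have htr := vertexClass_trC hG hT hp (e2 ▸ hh2)
  have hνc : VertexClass (N + 1) 0 T ν₀ :=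
    (((hν₀.mono_order (N' := N + 1) (by rw [e2]; exact le_self_add)).mono_weight
      (q' := 0) (by positivity)).add (VertexClass.const 1) hT).congr hT fun y _ => by simp
  have hf := ((hνc.smul ((VertexClass.norm hT).smul ((hgi.clm_apply hΞ hT).add
    (htr.mono_weight (q' := 0 + (p - 1)) (by simp)) hT) hT) hT).const_smul (-(1 / 2)) hT).mono_weight
      (q' := p) (by omega)
  -- This is the relation `xiHat` = Ξ solved for rad m: multiplying by -ν₀/2 gives the coefficient ½
  -- ν₀ wHat, whose value at the vertex is (n-1)/2.
  obtain ⟨m, hm, hm1, hm2⟩ := VertexClass.exists_solution hp hN1 hT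
    (vertexClass_mul_wHat hG hT hp hn hh1
      (hν₀.mono_order (by rw [e2]; exact le_self_add))) hf
    (a := ((n - 1 : ℕ) : ℝ) / 2) (by positivity)
  have hmy : ∀ y ∈ coneRegion n T, inner ℝ y (m y) = 0 := fun y hy => by
    refine hm2 y hy (innerSL ℝ y) fun t ht => ?_
    have hty := smul_mem_coneRegion hy ht.1 ht.2
    have h1 : inner ℝ (t • y) (gHatInv G (t • y) (Ξ (t • y)) + trC G (t • y)) = 0 := by
      rw [inner_add_right, hG.inner_gHatInv hty, hΞy _ hty, trC, trace, inner_sum, zero_add]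
      exact Finset.sum_eq_zero fun i _ => by rw [cTen_apply, hG.inner_cometric hty]
    rw [real_inner_smul_left] at h1
    have h2 := (mul_eq_zero.mp h1).resolve_left ht.1.ne'
    simp only [innerSL_apply_apply, real_inner_smul_right]
    rw [h2]
    simp
  have hνm : EqOn (fun y => gHatInv G y (gHat G y (m y))) m (coneRegion n T) :=
    fun y hy => hG.gHatInv_gHat hy _
  have hξ : EqOn (xiHat G ν₀ fun y => gHat G y (m y)) Ξ (coneRegion n T) := fun y hy => by
    have h0 := (hν₀0 y hy).ne'
    have hr : ‖y‖ ≠ 0 := hy.1.ne'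
    have h1 := hm1 y hy
    have h2 : rad m y = -(1 / 2 : ℝ) • ν₀ y • ‖y‖ • (gHatInv G y (Ξ y) + trC G y)
        - ((n - 1 : ℕ) / 2 + 1 / 2 * (ν₀ y * wHat G y - (n - 1 : ℕ)) : ℝ) • m y := by
      rw [← h1]; abel
    have h3 : -(2 / ν₀ y) • rad m y - wHat G y • m y - ‖y‖ • trC G y
        = ‖y‖ • gHatInv G y (Ξ y) := by
      rw [h2]
      match_scalars <;> field_simp <;> ring
    rw [xiHat, rad_congr hνm hy, show gHatInv G y (gHat G y (m y)) = m y from hνm hy, h3, map_smul,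
      hG.gHat_gHatInv hy, smul_smul, inv_mul_cancel₀ hr, one_smul]
  refine ⟨fun y => gHat G y (m y), fun y hy => ?_, ?_, hΞ.congr hT hξ, fun y hy v hv => ?_⟩
  · rw [hG.gHat_right hy, hmy y hy]
  · exact ((vertexClass_gHat hT hh1).clm_apply hm hT).mono_weight (by simp)
  · have h1 := hΞ1 y hy
    have h2 := congrArg (fun L => L v) h1
    simp only [add_apply, smul_apply, ContinuousLinearMap.comp_apply, hpiv y v hv, sub_apply] at h2
    rw [caHat, rad_congr hξ hy, hξ hy]
    simp only [add_apply, smul_apply, sub_apply]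
    have h3 : fderiv ℝ (fun y => tHat G y + kHat G ν₀ y) y v
        = fderiv ℝ (fun y => tHat G y + kHat G ν₀ y) y v := rfl
    rw [← add_assoc, sub_add, ← h2]
    abel

end

end LightCone

/-! ### Existence for the third constraint, and the complete solution -/

namespace LightCone

variable {n : ℕ} {F F' F'' : Type} [NormedAddCommGroup F] [NormedSpace ℝ F]
  [NormedAddCommGroup F'] [NormedSpace ℝ F'] [NormedAddCommGroup F''] [NormedSpace ℝ F'']
  {T : ℝ} {N : ℕ∞} {q : ℤ} {p : ℕ}

section

variable {G : FormField n} (hG : IsDegenerateForm T G) (hT : 0 < T) (hp : 1 ≤ p) (hn : 2 ≤ n)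
  {ν₀ : Euc n → ℝ} {ν : CovectorField n}

include hG hT hp hn

/-- At the vertex g^{11} → 1, `bet` → -(n-1)/2 and the source S → (n-2)(n-1). These values satisfy
the equation 2(n-2)`bet` + S = 0, so the deviations η and ζ solve linear equations whose sources
have weight p. The exponent n - 2 may be 0, but n - 2 + p > 0. -/
theorem exists_gZeroZero (hN : 1 ≤ N) (hh : VertexClass (N + 2) p T (dev G))
    (hν₀ : VertexClass N p T (fun y => ν₀ y - 1)) (hν₀0 : ∀ y ∈ coneRegion n T, 0 < ν₀ y)
    (hk : VertexClass N p T (kHat G ν₀)) (hν : VertexClass N p T ν)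
    (hξ : VertexClass (N + 1) (p - 1) T (xiHat G ν₀ ν)) :
    ∃ g₀₀ : Euc n → ℝ, VertexClass N p T (fun y => g₀₀ y + 1) ∧
      ∀ y ∈ coneRegion n T, c0Hat G ν₀ ν g₀₀ y = 0 := by
  have hd := dim_pos hn
  have hd1 : (1 : ℝ) ≤ ((n - 1 : ℕ) : ℝ) := by
    have : 1 ≤ n - 1 := by omega
    exact_mod_cast this
  have e2 : N + 2 = N + 1 + 1 := by rw [add_assoc]; norm_num
  have hh1 : VertexClass (N + 1) p T (dev G) := hh.mono_order (by rw [e2]; exact le_self_add)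
  have hh0 : VertexClass N p T (dev G) := hh1.mono_order le_self_add
  have ht := vertexClass_tHat hG hT hp hh1
  have hw := vertexClass_wHat hG hT hp hh0 hn
  have hgi := vertexClass_gHatInv hG hT hp hh0
  have hco := vertexClass_cometric hG hT hp hh0
  have hsc := vertexClass_scalC hG hT hp hh
  have hdiv := vertexClass_divXi hG hT hp hh1 hξ
  have hξ0 := hξ.mono_order (N' := N) le_self_add
  have hn2 : VertexClass N 2 T (fun y : Euc n => ‖y‖ ^ 2) := VertexClass.norm_sq hT
  set S : Euc n → ℝ := fun y => ‖y‖ ^ 2 * scalC G y + ((n - 1 : ℕ) - 1) * wHat G y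
      - (1 / 2) * ‖y‖ ^ 2 * xiHat G ν₀ ν y (cometric G y (xiHat G ν₀ ν y))
      + ‖y‖ ^ 2 * divXi G (xiHat G ν₀ ν) y with hSdef
  have hS : VertexClass N p T (fun y => S y - ((n - 1 : ℕ) - 1) * (n - 1 : ℕ)) := by
    have h1 := (hn2.mul hsc hT).mono_weight (q' := p) (by omega)
    have h2 := hw.const_smul (((n - 1 : ℕ) : ℝ) - 1) hT
    have h3 := ((hn2.mul (hξ0.clm_apply (hco.clm_apply hξ0 hT) hT) hT).const_smul (1 / 2)
      hT).mono_weight (q' := p) (by omega)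
    have h4 := (hn2.mul hdiv hT).mono_weight (q' := p) (by omega)
    refine (((h1.add h2 hT).sub h3 hT).add h4 hT).congr hT fun y _ => ?_
    simp only [hSdef, smul_eq_mul]
    ring
  have hkt := hk.add ht hT
  obtain ⟨η, hη, hη1, -⟩ := VertexClass.exists_solution hp hN hT hkt
    ((hkt.const_smul (((n - 1 : ℕ) : ℝ) / 2) hT).sub (hS.const_smul (1 / 2) hT) hT)
    (a := ((n - 1 : ℕ) : ℝ) - 1) (by
      have : (1 : ℝ) ≤ p := by exact_mod_cast hp
      push_cast
      linarith)
  have hkt2 := hk.add (ht.const_smul (1 / 2) hT) hT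
  obtain ⟨ζ, hζ, hζ1, -⟩ := VertexClass.exists_solution hp hN hT hkt2
    ((hη.add hw hT).sub hkt2 hT) (a := ((n - 1 : ℕ) : ℝ) / 2) (by positivity)
  -- The candidate for g₀₀ is the definition of g^{11} solved for g₀₀, with g^{11} = 1 + ζ.
  have hγ : EqOn (gam G ν₀ ν fun y => -(ν₀ y ^ 2 * (1 + ζ y)) + ν y (gHatInv G y (ν y)))
      (fun y => 1 + ζ y) (coneRegion n T) := fun y hy => by
    have := (hν₀0 y hy).ne'
    simp only [gam]
    field_simp
    ring
  have hβ : EqOn (bet G ν₀ ν fun y => -(ν₀ y ^ 2 * (1 + ζ y)) + ν y (gHatInv G y (ν y)))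
      (fun y => -(((n - 1 : ℕ) : ℝ) / 2) + η y) (coneRegion n T) := fun y hy => by
    have h1 := hζ1 y hy
    simp only [smul_eq_mul] at h1
    rw [bet, rad_congr hγ hy, hγ hy, rad_const_add]
    linarith
  refine ⟨fun y => -(ν₀ y ^ 2 * (1 + ζ y)) + ν y (gHatInv G y (ν y)), ?_, fun y hy => ?_⟩
  · have h1 := (hν.clm_apply (hgi.clm_apply hν hT) hT).mono_weight (q' := p) (by omega)
    have h2 := (hν₀.mul hν₀ hT).mono_weight (q' := p) (by omega)
    have h3 := h2.add (hν₀.const_smul 2 hT) hT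
    have h4 := (h3.mul hζ hT).mono_weight (q' := p) (by omega)
    refine (h1.sub ((h3.add h4 hT).add hζ hT) hT).congr hT fun y _ => ?_
    simp only [smul_eq_mul]
    ring
  · have h1 := hη1 y hy
    simp only [smul_eq_mul] at h1
    rw [c0Hat, rad_congr hβ hy, hβ hy, rad_const_add]
    have h2 : ‖y‖ ^ 2 * scalC G y + ((n - 1 : ℕ) - 1) * wHat G y
      - (1 / 2) * ‖y‖ ^ 2 * xiHat G ν₀ ν y (cometric G y (xiHat G ν₀ ν y))
      + ‖y‖ ^ 2 * divXi G (xiHat G ν₀ ν) y = S y := rfl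
    rw [h2]
    linear_combination 2 * h1

end

/-- The data constructed from a prescribed degenerate form, with the properties used to compare
them with other solutions. -/
structure IsSolution (k : ℕ∞) (p : ℕ) (T : ℝ) (G : FormField n) (ν₀ : Euc n → ℝ)
    (ν : CovectorField n) (g₀₀ : Euc n → ℝ) : Prop where
  coefficients : IsAdmissibleCoefficients k p T ν₀ ν g₀₀
  dim_add_tHat_pos : ∀ y ∈ coneRegion n T, 0 < ((n - 1 : ℕ) : ℝ) + tHat G y
  kHat_eq : ∀ y ∈ coneRegion n T, kHat G ν₀ y = alp G y
  vertexClass_alp : VertexClass (k + 2) p T (alp G)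
  vertexClass_xiHat : VertexClass (k + 1) (p - 1) T (xiHat G ν₀ ν)
  caHat_eq : ∀ y ∈ coneRegion n T, ∀ v, inner ℝ y v = 0 → caHat G ν₀ ν y v = 0
  c0Hat_eq : ∀ y ∈ coneRegion n T, c0Hat G ν₀ ν g₀₀ y = 0

theorem IsDegenerateForm.mono {G : FormField n} {T' : ℝ} (hG : IsDegenerateForm T G) (h : T' ≤ T) :
    IsDegenerateForm T' G := fun y hy => hG y (coneRegion_mono h hy)

/-- Bookkeeping of derivatives: from k + 4 for the form, `tHat` is k + 3, `alp` and ν₀ are k + 2, ξ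
and ν are k + 1, and g₀₀ is k. The first reduction of the radius keeps rτ = n - 1 + `tHat` positive,
so that 𝒞₁ can be solved for `kHat`. -/
theorem exists_isSolution (hn : 2 ≤ n) {k : ℕ∞} (hk : 2 ≤ k) (hp : 1 ≤ p) (hT : 0 < T)
    {G : FormField n} (hG : IsAdmissibleForm (k + 4) p T G) :
    ∃ T' : ℝ, 0 < T' ∧ T' ≤ T ∧ ∃ (ν₀ : Euc n → ℝ) (ν : CovectorField n) (g₀₀ : Euc n → ℝ),
      IsSolution k p T' G ν₀ ν g₀₀ := by
  obtain ⟨hG, hh⟩ := hG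
  replace hh : VertexClass (k + 4) p T (dev G) := hh
  have hd := dim_pos hn
  have hk1 : (1 : ℕ∞) ≤ k := le_trans (by norm_num) hk
  have ht : VertexClass (k + 3) p T (tHat G) := vertexClass_tHat hG hT hp (by
    rwa [add_assoc, show (3 : ℕ∞) + 1 = 4 by norm_num])
  obtain ⟨T₁, hT₁, hTT₁, hpos⟩ := exists_radius hT
    ((ht.tendsto_zero hp).eventually (lt_mem_nhds (neg_lt_zero.mpr hd)))
  have hpos₁ : ∀ y ∈ coneRegion n T₁, 0 < ((n - 1 : ℕ) : ℝ) + tHat G y := fun y hy => by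
    linarith [hpos y hy]
  have hh₁ : VertexClass (k + 2 + 2) p T₁ (dev G) := by
    rw [add_assoc, show (2 : ℕ∞) + 2 = 4 by norm_num]
    exact hh.mono_radius hTT₁
  obtain ⟨T', hT', hTT', ν₀, hν₀, hν₀0, hkH⟩ := exists_nuZero (hG.mono hTT₁) hT₁ hp hn
    (le_add_right hk1) hh₁ hpos₁
  have hG' := (hG.mono hTT₁).mono hTT'
  have hpos' : ∀ y ∈ coneRegion n T', 0 < ((n - 1 : ℕ) : ℝ) + tHat G y := fun y hy =>
    hpos₁ y (coneRegion_mono hTT' hy)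
  have hh' := hh₁.mono_radius hTT'
  have hα := vertexClass_alp hG' hT' hp hn hh' hpos'
  have hkc : VertexClass (k + 2) p T' (kHat G ν₀) := hα.congr hT' hkH
  have hh3 : VertexClass (k + 3) p T' (dev G) := hh'.mono_order (by
    rw [add_assoc]
    gcongr
    norm_num)
  have hh2 : VertexClass (k + 2) p T' (dev G) := hh'.mono_order le_self_add
  obtain ⟨ν, hνy, hν, hξ, hCA⟩ := exists_nu hG' hT' hp hn hh3 hν₀ hν₀0 hkc
  have hν₀k := hν₀.mono_order (N' := k) le_self_add
  have hνk := hν.mono_order (N' := k) le_self_add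
  obtain ⟨g₀₀, hg, hC0⟩ := exists_gZeroZero hG' hT' hp hn hk1 hh2 hν₀k hν₀0
    (hkc.mono_order le_self_add) hνk hξ
  exact ⟨T', hT', hTT'.trans hTT₁, ν₀, ν, g₀₀, ⟨hν₀0, hν₀k, hνy, hνk, hg⟩, hpos', hkH, hα, hξ,
    hCA, hC0⟩

end LightCone

namespace LightCone

variable {n : ℕ} {F F' F'' : Type} [NormedAddCommGroup F] [NormedSpace ℝ F]
  [NormedAddCommGroup F'] [NormedSpace ℝ F'] [NormedAddCommGroup F''] [NormedSpace ℝ F'']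
  {T : ℝ} {N : ℕ∞} {q : ℤ} {p : ℕ}

/-! ### Uniqueness along the rays -/

theorem exists_ray (y : Euc n) (hy : y ∈ coneRegion n T) :
    ∃ θ : Euc n, ‖θ‖ = 1 ∧ ‖y‖ ∈ Ioo 0 T ∧ ‖y‖ • θ = y := by
  have h0 : ‖y‖ ≠ 0 := hy.1.ne'
  exact ⟨‖y‖⁻¹ • y, by rw [norm_smul, norm_inv, norm_norm, inv_mul_cancel₀ h0], hy,
    by rw [smul_smul, mul_inv_cancel₀ h0, one_smul]⟩

theorem DiffOn.hasDerivAt_ray {f : Euc n → F} (hf : DiffOn T f) {θ : Euc n} (hθ : ‖θ‖ = 1) {r : ℝ}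
    (hr : r ∈ Ioo 0 T) :
    HasDerivAt (fun ρ : ℝ => f (ρ • θ)) (r⁻¹ • rad f (r • θ)) r :=
  LightCone.hasDerivAt_ray hr.1.ne' (hf _ (ray_mem hθ hr))

theorem eq_zero_of_rad_homogeneous (hp : 1 ≤ p) (hN : 1 ≤ N) (hT : 0 < T) {b : Euc n → ℝ}
    (hb : VertexClass N p T b) {a : ℝ} (ha : 0 ≤ a) {δ : Euc n → F} (hδ : DiffOn T δ)
    {θ : Euc n} (hθ : ‖θ‖ = 1)
    (heq : ∀ r ∈ Ioo 0 T, rad δ (r • θ) + (a + b (r • θ)) • δ (r • θ) = 0)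
    (hlim : Tendsto (fun r : ℝ => δ (r • θ)) (𝓝[>] 0) (𝓝 0)) :
    ∀ r ∈ Ioo 0 T, δ (r • θ) = 0 := by
  obtain ⟨β, hβ, hβ0⟩ := hb.exists_ray_potential hp hN hT hθ
  refine ray_homogeneous_eq_zero (b := fun r => b (r • θ)) ha hβ0 hβ
    (fun r hr => hδ.hasDerivAt_ray hθ hr) (fun r hr => ?_) hlim
  rw [smul_smul, mul_inv_cancel₀ hr.1.ne', one_smul, heq r hr]

theorem eventually_le_rpow_mul {ψ : ℝ → ℝ} {L a : ℝ} (hL : 0 < L) (ha : 0 ≤ a)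
    (hψ : Tendsto ψ (𝓝[>] 0) (𝓝 L)) : ∀ᶠ r in 𝓝[>] 0, L / 2 ≤ r ^ (-a) * ψ r := by
  filter_upwards [hψ.eventually (lt_mem_nhds (half_lt_self hL)),
    Ioo_mem_nhdsGT (show (0 : ℝ) < 1 by norm_num)] with r hr hr1
  have h1 : 1 ≤ r ^ (-a) := Real.one_le_rpow_of_pos_of_le_one_of_nonpos hr1.1 hr1.2.le (by linarith)
  nlinarith

/-- If `rad δ = - (a + b) δ` and `rad h + (a' + b') h = w(δ)` with a weight `w` which is positive
in the direction of `δ`, then `δ = 0` provided `h → 0`. -/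
theorem ray_source_eq_zero (hp : 1 ≤ p) (hN : 1 ≤ N) (hT : 0 < T) {b b' : Euc n → ℝ}
    (hb : VertexClass N p T b) (hb' : VertexClass N p T b') {a a' : ℝ} (ha' : 0 < a')
    {δ : Euc n → F} (hδ : DiffOn T δ) {θ : Euc n} (hθ : ‖θ‖ = 1)
    (heq : ∀ r ∈ Ioo 0 T, rad δ (r • θ) + (a + b (r • θ)) • δ (r • θ) = 0)
    {μ : Euc n → F'} (hμ : DiffOn T μ) (w : ℝ → F →L[ℝ] F') (P : F →L[ℝ] F' →L[ℝ] ℝ)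
    {s : ℝ} (hs : s ≤ a)
    (heq' : ∀ r ∈ Ioo 0 T, rad μ (r • θ) + (a' + b' (r • θ)) • μ (r • θ)
      = r ^ s • w r (δ (r • θ))) {w₀ : F →L[ℝ] F'} (hw : Tendsto w (𝓝[>] 0) (𝓝 w₀))
    (hpos : ∀ c, c ≠ 0 → 0 < P c (w₀ c))
    (hlim : Tendsto (fun r : ℝ => μ (r • θ)) (𝓝[>] 0) (𝓝 0)) :
    ∀ r ∈ Ioo 0 T, δ (r • θ) = 0 := by
  obtain ⟨β, hβ, hβ0⟩ := hb.exists_ray_potential hp hN hT hθ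
  obtain ⟨β', hβ', hβ0'⟩ := hb'.exists_ray_potential hp hN hT hθ
  obtain ⟨c, hc⟩ := ray_homogeneous (b := fun r => b (r • θ)) (a := a) hβ
    (fun r hr => hδ.hasDerivAt_ray hθ hr) (fun r hr => by
      rw [smul_smul, mul_inv_cancel₀ hr.1.ne', one_smul, heq r hr])
  by_cases hc0 : c = 0
  · intro r hr
    rw [hc r hr, hc0, smul_zero]
  exfalso
  have hL := hpos c hc0
  -- Here δ = r^(-a) exp(-β) c exactly. Pairing the equation for μ with P c gives a scalar source
  -- r^(s-a) ψ(r) with ψ → P c (w₀ c) > 0, and s ≤ a keeps it above half that limit.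
  have hψ : Tendsto (fun r => Real.exp (-β r) * P c (w r c)) (𝓝[>] 0) (𝓝 (P c (w₀ c))) := by
    have h1 : Tendsto (fun r => Real.exp (-β r)) (𝓝[>] 0) (𝓝 1) := by
      have := (Real.continuous_exp.tendsto _).comp hβ0.neg
      simpa [Function.comp_def] using this
    have h2 : Tendsto (fun r => P c (w r c)) (𝓝[>] 0) (𝓝 (P c (w₀ c))) :=
      ((P c).continuous.tendsto _).comp
        (((ContinuousLinearMap.apply ℝ F' c).continuous.tendsto w₀).comp hw)
    simpa using h1.mul h2
  refine ray_no_positive_source (b := fun r => b' (r • θ)) (a := a') (ε := P c (w₀ c) / 2) ha'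
    (by positivity) hβ0' (f := fun r => P c (μ (r • θ)))
    (f' := fun r => P c (r⁻¹ • rad μ (r • θ))) ?_ ?_
  · filter_upwards [eventually_le_rpow_mul hL (sub_nonneg.mpr hs) hψ, Ioo_mem_nhdsGT hT]
      with r hr hrT
    refine ⟨hβ' r hrT, (P c).hasFDerivAt.comp_hasDerivAt r (hμ.hasDerivAt_ray hθ hrT), ?_⟩
    have h1 : r * P c (r⁻¹ • rad μ (r • θ)) + (a' + b' (r • θ)) * P c (μ (r • θ))
        = P c (rad μ (r • θ) + (a' + b' (r • θ)) • μ (r • θ)) := by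
      rw [map_smul, map_add, map_smul, smul_eq_mul, smul_eq_mul, ← mul_assoc,
        mul_inv_cancel₀ hrT.1.ne', one_mul]
    rw [h1, heq' r hrT, hc r hrT]
    simp only [map_smul, smul_eq_mul]
    refine hr.trans (le_of_eq ?_)
    rw [neg_sub, sub_eq_add_neg, Real.rpow_add hrT.1]
    ring
  · have := ((P c).continuous.tendsto _).comp hlim
    simpa [Function.comp_def] using this

section

variable {G : FormField n} (hG : IsDegenerateForm T G) (hT : 0 < T) (hp : 1 ≤ p) (hn : 2 ≤ n)
  {ν₀ ν₀' g₀₀ g₀₀' : Euc n → ℝ} {ν ν' : CovectorField n}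

theorem rad_add {f g : Euc n → F} {y : Euc n} (hf : DifferentiableAt ℝ f y)
    (hg : DifferentiableAt ℝ g y) : rad (fun y => f y + g y) y = rad f y + rad g y := by
  rw [rad, fderiv_fun_add hf hg]; rfl

theorem rad_sub {f g : Euc n → F} {y : Euc n} (hf : DifferentiableAt ℝ f y)
    (hg : DifferentiableAt ℝ g y) : rad (fun y => f y - g y) y = rad f y - rad g y := by
  rw [rad, fderiv_fun_sub hf hg]; rfl

include hT hp hn in
-- For the reciprocals 1/ν₀ the relation is linear with coefficients independent of ν₀, so their
-- difference solves a homogeneous equation with exponent (n-1)/2.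
theorem nuZero_unique (hN : 1 ≤ N) (ht : VertexClass N p T (tHat G))
    (hk : VertexClass N p T (kHat G ν₀))
    (hν : ∀ y ∈ coneRegion n T, ν₀ y ≠ 0) (hν' : ∀ y ∈ coneRegion n T, ν₀' y ≠ 0)
    (hd : DiffOn T ν₀) (hd' : DiffOn T ν₀')
    (hl : ∀ θ : Euc n, ‖θ‖ = 1 → Tendsto (fun r : ℝ => ν₀ (r • θ)) (𝓝[>] 0) (𝓝 1))
    (hl' : ∀ θ : Euc n, ‖θ‖ = 1 → Tendsto (fun r : ℝ => ν₀' (r • θ)) (𝓝[>] 0) (𝓝 1))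
    (h : ∀ y ∈ coneRegion n T, kHat G ν₀' y = kHat G ν₀ y) :
    EqOn ν₀' ν₀ (coneRegion n T) := by
  have hd0 := dim_pos hn
  have hdi : ∀ {f : Euc n → ℝ}, DiffOn T f → (∀ y ∈ coneRegion n T, f y ≠ 0) →
      DiffOn T fun y => (f y)⁻¹ := fun hf h0 y hy => (hf y hy).inv (h0 y hy)
  have hδ : DiffOn T fun y => (ν₀' y)⁻¹ - (ν₀ y)⁻¹ := fun y hy =>
    (hdi hd' hν' y hy).sub (hdi hd hν y hy)
  intro y hy
  obtain ⟨θ, hθ, hr, hyθ⟩ := exists_ray y hy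
  have key := eq_zero_of_rad_homogeneous hp hN hT (hk.add (ht.const_smul (1 / 2) hT) hT)
    (a := ((n - 1 : ℕ) : ℝ) / 2) (by positivity) hδ hθ (fun r hr => ?_) ?_ _ hr
  · rw [hyθ, sub_eq_zero] at key
    exact inv_injective key
  · have hy' := ray_mem hθ hr
    rw [rad_sub (hdi hd' hν' _ hy') (hdi hd hν _ hy'), rad_inv (hd' _ hy') (hν' _ hy'),
      rad_inv (hd _ hy') (hν _ hy')]
    have h1 := h _ hy'
    have e : ∀ {f : Euc n → ℝ} {y}, f y ≠ 0 → rad f y / f y ^ 2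
        = (f y)⁻¹ * (kHat G f y + (1 / 2) * ((n - 1 : ℕ) + tHat G y)) - wHat G y / 2 := by
      intro f y h0
      rw [kHat]
      field_simp
      ring
    rw [neg_div, neg_div, e (hν _ hy'), e (hν' _ hy'), h1, smul_eq_mul, smul_eq_mul]
    ring
  · have := ((hl' θ hθ).inv₀ one_ne_zero).sub ((hl θ hθ).inv₀ one_ne_zero)
    simpa using this

theorem contDiffOn_rad {f : Euc n → F} {m : ℕ} (hf : ContDiffOn ℝ (m + 1 : ℕ) f (coneRegion n T)) :
    ContDiffOn ℝ m (rad f) (coneRegion n T) :=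
  ((((contDiffOn_succ_iff_fderiv_of_isOpen (isOpen_coneRegion n T)).1
    (by exact_mod_cast hf)).2.2).clm_apply contDiffOn_id)

include hG in
theorem IsDegenerateForm.inner_trC {y : Euc n} (hy : y ∈ coneRegion n T) :
    inner ℝ y (trC G y) = 0 := by
  rw [trC, trace, inner_sum]
  exact Finset.sum_eq_zero fun i _ => by rw [cTen_apply, hG.inner_cometric hy]

include hG in
theorem xiHat_radial (hν : ∀ y ∈ coneRegion n T, ν y y = 0)
    (hm : DiffOn T fun y => gHatInv G y (ν y)) {y : Euc n} (hy : y ∈ coneRegion n T) :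
    xiHat G ν₀ ν y y = 0 := by
  -- Differentiating ⟨y, m⟩ = 0 along the ray shows that rad m is tangential too.
  have h1 : inner ℝ y (rad (fun y => gHatInv G y (ν y)) y) = 0 := by
    have h2 : (fun y => (inner ℝ y (gHatInv G y (ν y)) : ℝ)) =ᶠ[𝓝 y] fun _ => 0 := by
      filter_upwards [(isOpen_coneRegion n T).mem_nhds hy] with z hz
      rw [hG.inner_gHatInv hz, hν z hz]
    have h3 := congrArg (fun L => L y) (h2.fderiv_eq (𝕜 := ℝ))
    simp only [fderiv_inner_apply ℝ differentiableAt_fun_id (hm y hy), fderiv_fun_const, Pi.zero_apply,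
      zero_apply, fderiv_fun_id, ContinuousLinearMap.id_apply] at h3
    rw [hG.inner_gHatInv hy, hν y hy, add_zero] at h3
    exact h3
  rw [xiHat, smul_apply, hG.gHat_right hy, inner_sub_right, inner_sub_right, real_inner_smul_right,
    real_inner_smul_right, real_inner_smul_right, h1, hG.inner_gHatInv hy, hν y hy,
    hG.inner_trC hy]
  simp

theorem DiffOn.xiHat (hν : ∀ y ∈ coneRegion n T, ν₀ y ≠ 0) (hdν : DiffOn T ν₀)
    (hm : ContDiffOn ℝ 2 (fun y => gHatInv G y (ν y)) (coneRegion n T)) (hd : DiffOn T (dev G))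
    (hw : DiffOn T (wHat G)) (htr : DiffOn T (trC G)) : DiffOn T (xiHat G ν₀ ν) := by
  intro y hy
  have h0 : DifferentiableAt ℝ (fun y : Euc n => ‖y‖) y :=
    (contDiffAt_norm ℝ (ne_zero_of_mem hy)).differentiableAt one_ne_zero
  have h1 : DiffOn T (rad fun y => gHatInv G y (ν y)) :=
    DiffOn.of_contDiffOn (N := (1 : ℕ)) (by norm_num) (contDiffOn_rad (by exact_mod_cast hm))
  have h2 : DiffOn T fun y => gHatInv G y (ν y) := DiffOn.of_contDiffOn (by norm_num) hm
  have h3 : DifferentiableAt ℝ (fun y => -(2 / ν₀ y)) y :=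
    (((hdν y hy).fun_inv (hν y hy)).const_mul 2).neg
  exact (h0.inv hy.1.ne').smul ((differentiableAt_gHat (hd y hy)).clm_apply
    (((h3.smul (h1 y hy)).sub ((hw y hy).smul (h2 y hy))).sub (h0.smul (htr y hy))))

end

end LightCone

/-! ### Uniqueness among C² coefficients with the vertex limits -/

namespace LightCone

variable {n : ℕ} {F F' F'' : Type} [NormedAddCommGroup F] [NormedSpace ℝ F]
  [NormedAddCommGroup F'] [NormedSpace ℝ F'] [NormedAddCommGroup F''] [NormedSpace ℝ F'']
  {T : ℝ} {N : ℕ∞} {q : ℤ} {p : ℕ}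

theorem VertexClass.tendsto_ray {f : Euc n → F} (h : VertexClass N p T f) (hp : 1 ≤ p) {θ : Euc n}
    (hθ : ‖θ‖ = 1) : Tendsto (fun r : ℝ => f (r • θ)) (𝓝[>] 0) (𝓝 0) :=
  (h.tendsto_zero hp).comp (LightCone.tendsto_ray hθ)

theorem VertexClass.tendsto_ray_sub {f : Euc n → F} {c : F}
    (h : VertexClass N p T fun y => f y - c) (hp : 1 ≤ p) {θ : Euc n}
    (hθ : ‖θ‖ = 1) : Tendsto (fun r : ℝ => f (r • θ)) (𝓝[>] 0) (𝓝 c) := by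
  simpa using (h.tendsto_ray hp hθ).add_const c

theorem VertexClass.contDiffOn_nat {f : Euc n → F} (h : VertexClass N q T f) (m : ℕ)
    (hm : (m : ℕ∞) ≤ N) : ContDiffOn ℝ m f (coneRegion n T) :=
  h.1.of_le (by exact_mod_cast hm)

theorem DiffOn.congr {f g : Euc n → F} (hf : DiffOn T f) (h : EqOn g f (coneRegion n T)) :
    DiffOn T g := fun y hy =>
  (hf y hy).congr_of_eventuallyEq (by
    filter_upwards [(isOpen_coneRegion n T).mem_nhds hy] with z hz using h hz)

section

variable {k : ℕ∞} {G : FormField n} (hG : IsDegenerateForm T G)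
  (hh : VertexClass (k + 4) p T (dev G)) (hT : 0 < T) (hp : 1 ≤ p) (hn : 2 ≤ n) (hk : 2 ≤ k)
  {ν₀ ν₀' g₀₀ g₀₀' : Euc n → ℝ} {ν ν' : CovectorField n}

theorem diffOn_dev (hh : VertexClass (k + 4) p T (dev G)) : DiffOn T (dev G) :=
  hh.diffOn (le_add_left (by norm_num))

include hh

theorem vertexClass_dev_two : VertexClass (1 + 1) p T (dev G) :=
  hh.mono_order (le_add_left (by norm_num))

theorem vertexClass_dev_one : VertexClass 1 p T (dev G) :=
  hh.mono_order (le_add_left (by norm_num))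

include hT in
theorem diffOn_rad_dev : DiffOn T (rad (dev G)) :=
  ((vertexClass_dev_two hh).rad hT).diffOn le_rfl

include hG hT hp

theorem diffOn_nOp : DiffOn T (nOp G) :=
  (vertexClass_nOp hG hT hp (vertexClass_dev_two hh)).diffOn le_rfl

theorem diffOn_tHat : DiffOn T (tHat G) :=
  (vertexClass_tHat hG hT hp (vertexClass_dev_two hh)).diffOn le_rfl

theorem diffOn_cTen : DiffOn T (cTen G) :=
  (vertexClass_cTen hG hT hp (vertexClass_dev_two hh)).diffOn le_rfl

theorem diffOn_trC : DiffOn T (trC G) :=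
  (vertexClass_trC hG hT hp (vertexClass_dev_two hh)).diffOn le_rfl

include hn in
theorem diffOn_wHat : DiffOn T (wHat G) := by
  have h := (vertexClass_wHat hG hT hp (vertexClass_dev_one hh) hn).diffOn le_rfl
  refine DiffOn.congr (f := fun y => (wHat G y - (n - 1 : ℕ)) + (n - 1 : ℕ))
    (fun y hy => (h y hy).add_const _) fun y _ => by simp

include hk

omit hT hp hk in
theorem contDiffOn_gHatInv_apply (hν : ContDiffOn ℝ 2 ν (coneRegion n T)) :
    ContDiffOn ℝ 2 (fun y => gHatInv G y (ν y)) (coneRegion n T) :=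
  (contDiffOn_gHatInv hG ((hh.mono_order (N' := 2) (le_add_left (by norm_num))).1)).clm_apply hν

variable (sol : IsSolution k p T G ν₀ ν g₀₀)

omit hh hG hT hp in
include sol in
theorem IsSolution.contDiffOn_nu : ContDiffOn ℝ 2 ν (coneRegion n T) :=
  sol.coefficients.nu.contDiffOn_nat 2 hk

omit hh hG hT hp in
include sol in
theorem IsSolution.contDiffOn_nuZero : ContDiffOn ℝ 2 ν₀ (coneRegion n T) :=
  ((sol.coefficients.nuZero.contDiffOn_nat 2 hk).add (contDiffOn_const (c := (1 : ℝ)))).congr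
    fun y _ => by simp

omit hh hG hT hp in
include sol in
theorem IsSolution.contDiffOn_gZeroZero : ContDiffOn ℝ 2 g₀₀ (coneRegion n T) :=
  ((sol.coefficients.gZeroZero.contDiffOn_nat 2 hk).sub (contDiffOn_const (c := (1 : ℝ)))).congr
    fun y _ => by simp

omit hh hG hT hp in
include sol in
theorem IsSolution.diffOn_nuZero : DiffOn T ν₀ :=
  DiffOn.of_contDiffOn (by norm_num) (sol.contDiffOn_nuZero hk)

omit hh hG hp hk in
include sol hT in
theorem IsSolution.vertexClass_kHat : VertexClass 1 p T (kHat G ν₀) :=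
  (sol.vertexClass_alp.mono_order (le_add_left (by norm_num))).congr hT sol.kHat_eq

omit hh hG hp hk in
include sol hT in
theorem IsSolution.diffOn_kHat : DiffOn T (kHat G ν₀) :=
  (sol.vertexClass_kHat hT).diffOn le_rfl

omit hh hG hT hp hk in
include sol in
theorem IsSolution.nuZero_ne_zero : ∀ y ∈ coneRegion n T, ν₀ y ≠ 0 := fun y hy =>
  (sol.coefficients.nuZero_pos y hy).ne'

include sol

include hn in
theorem IsSolution.diffOn_xiHat (hν : ContDiffOn ℝ 2 ν' (coneRegion n T)) :
    DiffOn T (xiHat G ν₀ ν') :=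
  DiffOn.xiHat sol.nuZero_ne_zero (sol.diffOn_nuZero hk)
    (contDiffOn_gHatInv_apply hG hh hν) (diffOn_dev hh) (diffOn_wHat hG hh hT hp hn)
    (diffOn_trC hG hh hT hp)

omit hT hp in
theorem IsSolution.contDiffOn_gam (hg : ContDiffOn ℝ 2 g₀₀' (coneRegion n T)) :
    ContDiffOn ℝ 2 (gam G ν₀ ν g₀₀') (coneRegion n T) := by
  have h1 := (contDiffOn_const (c := (1 : ℝ))).div (sol.contDiffOn_nuZero hk) sol.nuZero_ne_zero
  exact (h1.pow 2).mul (hg.neg.add ((sol.contDiffOn_nu hk).clm_apply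
    (contDiffOn_gHatInv_apply hG hh (sol.contDiffOn_nu hk))))

omit hT hp in
theorem IsSolution.diffOn_rad_gam (hg : ContDiffOn ℝ 2 g₀₀' (coneRegion n T)) :
    DiffOn T (rad (gam G ν₀ ν g₀₀')) :=
  DiffOn.of_contDiffOn (N := (1 : ℕ)) (by norm_num)
    (contDiffOn_rad (by exact_mod_cast sol.contDiffOn_gam hG hh hk hg))

include hn

omit hk in
theorem IsSolution.firstConstraint_iff {ν₀' : Euc n → ℝ} (hd : DiffOn T ν₀') :
    FirstConstraint T G ν₀' ↔ ∀ y ∈ coneRegion n T, kHat G ν₀' y = kHat G ν₀ y := by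
  rw [LightCone.firstConstraint_iff hG hn (diffOn_dev hh) (diffOn_tHat hG hh hT hp) hd]
  refine forall₂_congr fun y hy => ?_
  rw [sol.kHat_eq y hy, alp, eq_div_iff (sol.dim_add_tHat_pos y hy).ne']

theorem IsSolution.firstConstraint : FirstConstraint T G ν₀ :=
  (sol.firstConstraint_iff hG hh hT hp hn (sol.diffOn_nuZero hk)).2 fun _ _ => rfl

theorem IsSolution.secondConstraint_iff (hν : ∀ y ∈ coneRegion n T, ν' y y = 0)
    (hν' : ContDiffOn ℝ 2 ν' (coneRegion n T)) : SecondConstraint T G ν₀ ν' ↔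
      ∀ y ∈ coneRegion n T, ∀ v, inner ℝ y v = 0 → caHat G ν₀ ν' y v = 0 :=
  LightCone.secondConstraint_iff hG hn (hh.contDiffOn_nat 2 (le_add_left (by norm_num)))
    sol.nuZero_ne_zero hν (sol.diffOn_nuZero hk) (DiffOn.of_contDiffOn (by norm_num) hν')
    (DiffOn.of_contDiffOn (by norm_num) (contDiffOn_gHatInv_apply hG hh hν'))
    (sol.diffOn_xiHat hG hh hT hp hn hk hν') (diffOn_rad_dev hh hT) (diffOn_nOp hG hh hT hp)
    (diffOn_tHat hG hh hT hp) (sol.diffOn_kHat hT)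

theorem IsSolution.thirdConstraint_iff (hg : ContDiffOn ℝ 2 g₀₀' (coneRegion n T)) :
    ThirdConstraint T G ν₀ ν g₀₀' ↔ ∀ y ∈ coneRegion n T, c0Hat G ν₀ ν g₀₀' y = 0 :=
  LightCone.thirdConstraint_iff hG hn (hh.contDiffOn_nat 2 (le_add_left (by norm_num)))
    sol.nuZero_ne_zero sol.coefficients.nu_radial (sol.diffOn_nuZero hk)
    (DiffOn.of_contDiffOn (by norm_num) (sol.contDiffOn_nu hk))
    (DiffOn.of_contDiffOn (by norm_num)
      (contDiffOn_gHatInv_apply hG hh (sol.contDiffOn_nu hk)))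
    (sol.diffOn_xiHat hG hh hT hp hn hk (sol.contDiffOn_nu hk))
    (diffOn_tHat hG hh hT hp) (sol.diffOn_kHat hT) (diffOn_wHat hG hh hT hp hn)
    (diffOn_cTen hG hh hT hp)
    (DiffOn.of_contDiffOn (by norm_num) (sol.contDiffOn_gam hG hh hk hg))
    (sol.diffOn_rad_gam hG hh hk hg)

theorem IsSolution.nuZero_unique (hν : NuZeroLimit T ν₀') (h : FirstConstraint T G ν₀') :
    EqOn ν₀' ν₀ (coneRegion n T) := by
  have hd : DiffOn T ν₀' := DiffOn.of_contDiffOn (by norm_num) hν.contDiffOn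
  exact LightCone.nuZero_unique hT hp hn le_rfl
    (vertexClass_tHat hG hT hp (vertexClass_dev_two hh)) (sol.vertexClass_kHat hT)
    sol.nuZero_ne_zero hν.ne_zero (sol.diffOn_nuZero hk) hd
    (fun θ hθ => sol.coefficients.nuZero.tendsto_ray_sub hp hθ) hν.tendsto
    ((sol.firstConstraint_iff hG hh hT hp hn hd).1 h)

/-- Nothing is known about the limit of ξ, which contains ∂₁ν. The difference δ of the two ξ is
r^(-n) exp(-β) c; if c were not 0, it would enter the equation for the difference μ of the dual
vectors as a source of size r^(1-n), against μ → 0. Hence δ = 0, and μ then solves a homogeneous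
equation. -/
theorem IsSolution.nu_unique (hν : NuLimit T ν') (h : SecondConstraint T G ν₀ ν') :
    EqOn ν' ν (coneRegion n T) := by
  have hd0 := dim_pos hn
  rw [sol.secondConstraint_iff hG hh hT hp hn hk hν.radial hν.contDiffOn] at h
  have hm' := contDiffOn_gHatInv_apply hG hh hν.contDiffOn
  have hm := contDiffOn_gHatInv_apply hG hh (sol.contDiffOn_nu hk)
  have hdm' : DiffOn T _ := DiffOn.of_contDiffOn (by norm_num) hm'
  have hdm : DiffOn T _ := DiffOn.of_contDiffOn (by norm_num) hm
  have hx' := sol.diffOn_xiHat hG hh hT hp hn hk hν.contDiffOn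
  have hx := sol.diffOn_xiHat hG hh hT hp hn hk (sol.contDiffOn_nu hk)
  set δ : CovectorField n := fun y => xiHat G ν₀ ν' y - xiHat G ν₀ ν y with hδdef
  set μ : Euc n → Euc n := fun y => gHatInv G y (ν' y) - gHatInv G y (ν y) with hμdef
  have hδ : DiffOn T δ := fun y hy => (hx' y hy).sub (hx y hy)
  have hμ : DiffOn T μ := fun y hy => (hdm' y hy).sub (hdm y hy)
  have ht := vertexClass_tHat hG hT hp (vertexClass_dev_two hh)
  have hw := vertexClass_mul_wHat hG hT hp hn (vertexClass_dev_one hh)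
    (sol.coefficients.nuZero.mono_order (N' := 1) (le_trans (by norm_num) hk))
  have hδy : ∀ y ∈ coneRegion n T, δ y y = 0 := fun y hy => by
    rw [hδdef]
    simp only [sub_apply]
    rw [xiHat_radial hG hν.radial hdm' hy, xiHat_radial hG sol.coefficients.nu_radial hdm hy,
      sub_zero]
  have hrδy : ∀ y ∈ coneRegion n T, rad δ y y = 0 := fun y hy => by
    have h2 : (fun y => δ y y) =ᶠ[𝓝 y] fun _ => 0 := by
      filter_upwards [(isOpen_coneRegion n T).mem_nhds hy] with z hz using hδy z hz
    have h3 := congrArg (fun L => L y) (h2.fderiv_eq (𝕜 := ℝ))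
    simp only [fderiv_clm_apply (hδ y hy) differentiableAt_fun_id, fderiv_fun_const,
      Pi.zero_apply, zero_apply, fderiv_fun_id, add_apply, ContinuousLinearMap.comp_apply,
      ContinuousLinearMap.id_apply, ContinuousLinearMap.flip_apply, hδy y hy, zero_add] at h3
    exact h3
  -- The constraint gives this on tangential vectors. On y both terms vanish, because δ(y) = 0 along
  -- the whole ray.
  have heq : ∀ y ∈ coneRegion n T,
      rad δ y + (1 + ((n - 1 : ℕ) : ℝ) + tHat G y) • δ y = 0 := by
    intro y hy
    have h1 : ∀ v, inner ℝ y v = 0 →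
        (rad δ y + (1 + ((n - 1 : ℕ) : ℝ) + tHat G y) • δ y) v = 0 := by
      intro v hv
      have h1 := h y hy v hv
      have h2 := sol.caHat_eq y hy v hv
      rw [caHat] at h1 h2
      rw [hδdef, rad_sub (hx' y hy) (hx y hy)]
      simp only [add_apply, sub_apply, smul_apply, smul_eq_mul] at h1 h2 ⊢
      linear_combination h1 - h2
    ext v
    have h2 := h1 (v - ((‖y‖ ^ 2)⁻¹ * inner ℝ y v) • y) (by
      have hr : ‖y‖ ≠ 0 := hy.1.ne'
      rw [inner_sub_right, real_inner_smul_right, real_inner_self_eq_norm_sq]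
      field_simp
      ring)
    rw [map_sub, map_smul] at h2
    have h3 : (rad δ y + (1 + ((n - 1 : ℕ) : ℝ) + tHat G y) • δ y) y = 0 := by
      rw [add_apply, smul_apply, hδy y hy, hrδy y hy]
      simp
    rw [h3, smul_zero, sub_zero] at h2
    rw [h2]
    rfl
  have heq' : ∀ y ∈ coneRegion n T,
      rad μ y + (((n - 1 : ℕ) : ℝ) / 2 + 1 / 2 * (ν₀ y * wHat G y - (n - 1 : ℕ))) • μ y
        = ‖y‖ • (-(ν₀ y / 2) • gHatInv G y (δ y)) := by
    intro y hy
    have h0 := sol.nuZero_ne_zero y hy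
    have hr : ‖y‖ ≠ 0 := hy.1.ne'
    have e : ∀ ν : CovectorField n, rad (fun y => gHatInv G y (ν y)) y
        = ‖y‖ • (-(ν₀ y / 2) • gHatInv G y (xiHat G ν₀ ν y))
          - ((ν₀ y / 2) * wHat G y) • gHatInv G y (ν y) - ((ν₀ y / 2) * ‖y‖) • trC G y := by
      intro ν
      rw [xiHat, map_smul, hG.gHatInv_gHat hy]
      match_scalars <;> field_simp <;> ring
    rw [hμdef, rad_sub (hdm' y hy) (hdm y hy), e, e, hδdef, map_sub]
    match_scalars <;> ring
  have hmlim : ∀ {ν : CovectorField n} {θ : Euc n}, ‖θ‖ = 1 →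
      Tendsto (fun r : ℝ => ν (r • θ)) (𝓝[>] 0) (𝓝 0) →
      Tendsto (fun r : ℝ => gHatInv G (r • θ) (ν (r • θ))) (𝓝[>] 0) (𝓝 0) := by
    intro ν θ hθ hν
    have h1 := (vertexClass_gHatInv_sub hG hT hp (vertexClass_dev_one hh)).tendsto_ray_sub hp hθ
    have h2 : Continuous fun x : ((Euc n →L[ℝ] ℝ) →L[ℝ] Euc n) × (Euc n →L[ℝ] ℝ) => x.1 x.2 :=
      isBoundedBilinearMap_apply.continuous
    have := (h2.tendsto _).comp (h1.prodMk_nhds hν)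
    simpa [Function.comp_def] using this
  intro y hy
  obtain ⟨θ, hθ, hr, hyθ⟩ := exists_ray y hy
  have hμlim : Tendsto (fun r : ℝ => μ (r • θ)) (𝓝[>] 0) (𝓝 0) := by
    have := (hmlim hθ (hν.tendsto θ hθ)).sub
      (hmlim hθ (sol.coefficients.nu.tendsto_ray hp hθ))
    simpa using this
  -- The weight tends to -½ times the Euclidean identification of covectors with vectors. The sign
  -- is compensated by taking P = -id, so that the pairing with c is ½|c|².
  have key1 : ∀ r ∈ Ioo 0 T, δ (r • θ) = 0 := by
    refine ray_source_eq_zero hp le_rfl hT ht hw (a := 1 + ((n - 1 : ℕ) : ℝ))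
      (a' := ((n - 1 : ℕ) : ℝ) / 2) (by positivity) hδ hθ
      (fun r hr => heq _ (ray_mem hθ hr)) hμ
      (fun r => -(ν₀ (r • θ) / 2) • gHatInv G (r • θ)) (-ContinuousLinearMap.id ℝ _) (s := 1)
      (by linarith) (fun r hr => ?_)
      (w₀ := (-(1 / 2) : ℝ) • ((euclideanEquiv n).symm : (Euc n →L[ℝ] ℝ) →L[ℝ] Euc n))
      ?_ ?_ hμlim
    · rw [heq' _ (ray_mem hθ hr), norm_smul, hθ, mul_one, Real.norm_of_nonneg hr.1.le,
        Real.rpow_one]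
      rfl
    · have h1 := (vertexClass_gHatInv_sub hG hT hp (vertexClass_dev_one hh)).tendsto_ray_sub hp hθ
      have h2 := sol.coefficients.nuZero.tendsto_ray_sub hp hθ
      exact ((h2.div_const 2).neg).smul h1
    · intro c hc
      obtain ⟨v, rfl⟩ := (euclideanEquiv n).surjective c
      have hv : v ≠ 0 := fun h0 => hc (by rw [h0, map_zero])
      have h1 : (euclideanEquiv n v) v = inner ℝ v v := rfl
      have h2 : 0 < ‖v‖ := norm_pos_iff.mpr hv
      simp [h1]
      positivity
  have key2 := eq_zero_of_rad_homogeneous hp le_rfl hT hw (a := ((n - 1 : ℕ) : ℝ) / 2)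
    (by positivity) hμ hθ (fun r hr => by
      rw [heq' _ (ray_mem hθ hr), key1 r hr]; simp) hμlim _ hr
  rw [hyθ, hμdef, sub_eq_zero] at key2
  have h3 := congrArg (gHat G y) key2
  rwa [hG.gHat_gHatInv hy, hG.gHat_gHatInv hy] at h3

/-- Same mechanism: `bet` contains ∂₁g₀₀ and has no prescribed limit, but a nonzero difference
r^(-(n-2)) exp(-β) c would be a source bounded away from 0 in the equation for g^{11}. Here s = 0 ≤
n - 2 uses n ≥ 2. -/
theorem IsSolution.gZeroZero_unique (hg : GZeroZeroLimit T g₀₀')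
    (h : ThirdConstraint T G ν₀ ν g₀₀') : EqOn g₀₀' g₀₀ (coneRegion n T) := by
  have hd0 := dim_pos hn
  have hd1 : (1 : ℝ) ≤ ((n - 1 : ℕ) : ℝ) := by
    have : 1 ≤ n - 1 := by omega
    exact_mod_cast this
  rw [sol.thirdConstraint_iff hG hh hT hp hn hk hg.contDiffOn] at h
  have hgc := sol.contDiffOn_gZeroZero hk
  have hγd : ∀ {g : Euc n → ℝ}, ContDiffOn ℝ 2 g (coneRegion n T) → DiffOn T (gam G ν₀ ν g) :=
    fun hg => DiffOn.of_contDiffOn (by norm_num) (sol.contDiffOn_gam hG hh hk hg)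
  have hβd : ∀ {g : Euc n → ℝ}, ContDiffOn ℝ 2 g (coneRegion n T) → DiffOn T (bet G ν₀ ν g) :=
    fun hg y hy => (((sol.diffOn_rad_gam hG hh hk hg y hy).add
      (((sol.diffOn_kHat hT y hy).add (((diffOn_tHat hG hh hT hp y hy).const_add _).const_mul
        (1 / 2))).mul (hγd hg y hy))).sub (diffOn_wHat hG hh hT hp hn y hy))
  set δ : Euc n → ℝ := fun y => bet G ν₀ ν g₀₀' y - bet G ν₀ ν g₀₀ y with hδdef
  set μ : Euc n → ℝ := fun y => gam G ν₀ ν g₀₀' y - gam G ν₀ ν g₀₀ y with hμdef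
  have hδ : DiffOn T δ := fun y hy => (hβd hg.contDiffOn y hy).sub (hβd hgc y hy)
  have hμ : DiffOn T μ := fun y hy => (hγd hg.contDiffOn y hy).sub (hγd hgc y hy)
  have ht := vertexClass_tHat hG hT hp (vertexClass_dev_two hh)
  have hkc := sol.vertexClass_kHat hT
  have heq : ∀ y ∈ coneRegion n T,
      rad δ y + (((n - 1 : ℕ) : ℝ) - 1 + (kHat G ν₀ y + tHat G y)) • δ y = 0 := by
    intro y hy
    have h1 := h y hy
    have h2 := sol.c0Hat_eq y hy
    rw [c0Hat] at h1 h2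
    rw [hδdef, rad_sub (hβd hg.contDiffOn y hy) (hβd hgc y hy), smul_eq_mul]
    linear_combination (1 / 2) * (h1 - h2)
  have heq' : ∀ y ∈ coneRegion n T,
      rad μ y + (((n - 1 : ℕ) : ℝ) / 2 + (kHat G ν₀ y + (1 / 2 : ℝ) • tHat G y)) • μ y = δ y := by
    intro y hy
    rw [hμdef, rad_sub (hγd hg.contDiffOn y hy) (hγd hgc y hy), smul_eq_mul, hδdef]
    simp only [bet, smul_eq_mul]
    ring
  have hγlim : ∀ {g : Euc n → ℝ} {θ : Euc n}, ‖θ‖ = 1 →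
      Tendsto (fun r : ℝ => g (r • θ)) (𝓝[>] 0) (𝓝 (-1)) →
      Tendsto (fun r : ℝ => gam G ν₀ ν g (r • θ)) (𝓝[>] 0) (𝓝 1) := by
    intro g θ hθ hg
    have h1 := sol.coefficients.nuZero.tendsto_ray_sub hp hθ
    have h2 : VertexClass 1 p T (fun y => ν y (gHatInv G y (ν y))) := by
      have hν := sol.coefficients.nu.mono_order (N' := 1) (le_trans (by norm_num) hk)
      exact (hν.clm_apply ((vertexClass_gHatInv hG hT hp (vertexClass_dev_one hh)).clm_apply hν hT)
        hT).mono_weight (by omega)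
    have := (((tendsto_const_nhds (x := (1 : ℝ))).div h1 one_ne_zero).pow 2).mul
      (hg.neg.add (h2.tendsto_ray hp hθ))
    simpa [gam] using this
  intro y hy
  obtain ⟨θ, hθ, hr, hyθ⟩ := exists_ray y hy
  have hμlim : Tendsto (fun r : ℝ => μ (r • θ)) (𝓝[>] 0) (𝓝 0) := by
    have := (hγlim hθ (hg.tendsto θ hθ)).sub
      (hγlim hθ ((sol.coefficients.gZeroZero.congr hT
        (g := fun y => g₀₀ y - (-1)) fun y _ => by ring).tendsto_ray_sub hp hθ))
    simpa using this
  have hb' := hkc.add (ht.const_smul (1 / 2) hT) hT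
  have key1 : ∀ r ∈ Ioo 0 T, δ (r • θ) = 0 := by
    refine ray_source_eq_zero hp le_rfl hT (hkc.add ht hT) hb' (a := ((n - 1 : ℕ) : ℝ) - 1)
      (a' := ((n - 1 : ℕ) : ℝ) / 2) (by positivity) hδ hθ
      (fun r hr => heq _ (ray_mem hθ hr)) hμ
      (fun r => ContinuousLinearMap.id ℝ ℝ) (ContinuousLinearMap.mul ℝ ℝ) (s := 0)
      (by linarith) (fun r hr => ?_) (w₀ := ContinuousLinearMap.id ℝ ℝ)
      tendsto_const_nhds (fun c hc => by simpa using mul_self_pos.mpr hc) hμlim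
    rw [heq' _ (ray_mem hθ hr), Real.rpow_zero, one_smul]
    rfl
  have key2 := eq_zero_of_rad_homogeneous hp le_rfl hT hb' (a := ((n - 1 : ℕ) : ℝ) / 2)
    (by positivity) hμ hθ (fun r hr => by
      rw [heq' _ (ray_mem hθ hr), key1 r hr]) hμlim _ hr
  rw [hyθ, hμdef, sub_eq_zero] at key2
  have h0 := sol.nuZero_ne_zero y hy
  simp only [gam] at key2
  have h4 := mul_left_cancel₀ (pow_ne_zero 2 (one_div_ne_zero h0)) key2
  linarith

end

end LightCone

namespace LightCone

variable {n : ℕ} {F F' F'' : Type} [NormedAddCommGroup F] [NormedSpace ℝ F]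
  [NormedAddCommGroup F'] [NormedSpace ℝ F'] [NormedAddCommGroup F''] [NormedSpace ℝ F'']
  {T : ℝ} {N : ℕ∞} {q : ℤ} {p : ℕ}

/-! ### Conformal changes of a degenerate form -/

theorem roundForm_smul {t : ℝ} (ht : t ≠ 0) (y : Euc n) : roundForm n (t • y) = roundForm n y := by
  ext v w
  simp only [roundForm_apply, norm_smul, real_inner_smul_left, mul_pow, Real.norm_eq_abs, sq_abs]
  field_simp

theorem differentiableAt_roundForm {y : Euc n} (hy : y ≠ 0) :
    DifferentiableAt ℝ (roundForm n) y :=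
  (vertexClass_roundForm (N := 1) (T := ‖y‖ + 1) (by positivity)).differentiableAt le_rfl
    ⟨norm_pos_iff.mpr hy, by linarith⟩

/-- The round form, in the coordinates y, is homogeneous of degree 0. -/
theorem rad_roundForm {y : Euc n} (hy : y ≠ 0) : rad (roundForm n) y = 0 := by
  have h0 : ‖y‖ ≠ 0 := norm_ne_zero_iff.mpr hy
  have h1 : ‖y‖ • (‖y‖⁻¹ • y) = y := by rw [smul_smul, mul_inv_cancel₀ h0, one_smul]
  have h2 := hasDerivAt_ray (f := roundForm n) (θ := ‖y‖⁻¹ • y) h0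
    (by rw [h1]; exact differentiableAt_roundForm hy)
  have h3 : (fun ρ : ℝ => roundForm n (ρ • ‖y‖⁻¹ • y)) =ᶠ[𝓝 ‖y‖] fun _ => roundForm n y := by
    filter_upwards [isOpen_ne.mem_nhds h0] with ρ hρ
    rw [smul_smul, roundForm_smul (mul_ne_zero hρ (inv_ne_zero h0))]
  have h4 := h2.unique ((hasDerivAt_const _ _).congr_of_eventuallyEq h3)
  rw [h1] at h4
  exact (smul_eq_zero.mp h4).resolve_left (inv_ne_zero h0)

section

variable {G G' : FormField n} (hG : IsDegenerateForm T G) {c : Euc n → ℝ}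
  (hc : ∀ y ∈ coneRegion n T, 0 < c y) (hGG' : ∀ y ∈ coneRegion n T, G' y = c y • G y)

include hG in
theorem cometric_form {y : Euc n} (hy : y ∈ coneRegion n T) (v : Euc n) :
    cometric G y (G y v) = v - ((‖y‖ ^ 2)⁻¹ * inner ℝ y v) • y := by
  have h1 : G y v = gHat G y v - ((‖y‖ ^ 2)⁻¹ * inner ℝ y v) • gHat G y y := by
    ext w
    rw [sub_apply, smul_apply, hG.gHat_left hy, gHat_apply, smul_eq_mul]
    ring
  have h2 : ‖y‖ ^ 2 ≠ 0 := pow_ne_zero 2 hy.1.ne'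
  rw [h1, map_sub, map_smul, hG.cometric_gHat hy, hG.cometric_gHat hy, real_inner_self_eq_norm_sq,
    inv_mul_cancel₀ h2, one_smul, sub_self, smul_zero, sub_zero]

include hG in
theorem form_cometric {y : Euc n} (hy : y ∈ coneRegion n T) (φ : Euc n →L[ℝ] ℝ) (v : Euc n) :
    G y v (cometric G y φ) = φ v - (‖y‖ ^ 2)⁻¹ * φ y * inner ℝ y v := by
  have h := hG.gHat_cometric hy φ v
  rw [hG.gHat_symm hy, gHat_apply, hG.inner_cometric hy] at h
  linarith

include hG in
theorem trace_form {y : Euc n} (hy : y ∈ coneRegion n T) (A : Euc n →L[ℝ] Euc n) :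
    trace G y (fun v w => G y (A v) w) = ∑ i, inner ℝ (bas i) (A (bas i))
      - (‖y‖ ^ 2)⁻¹ * inner ℝ y (A y) := by
  rw [trace]
  simp only [form_cometric hG hy]
  rw [Finset.sum_sub_distrib]
  congr 1
  have h1 := congrArg A (sum_inner_bas y)
  rw [map_sum] at h1
  conv_rhs => rw [← h1, inner_sum, Finset.mul_sum]
  refine Finset.sum_congr rfl fun i _ => ?_
  rw [map_smul, real_inner_smul_right, cobas, euclideanForm_apply]
  ring

include hG in
theorem trace_form_self (hn : 2 ≤ n) {y : Euc n} (hy : y ∈ coneRegion n T) :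
    trace G y (fun v w => G y v w) = (n - 1 : ℕ) := by
  have h := trace_form hG hy (ContinuousLinearMap.id ℝ (Euc n))
  simp only [ContinuousLinearMap.id_apply] at h
  have h2 : ‖y‖ ^ 2 ≠ 0 := pow_ne_zero 2 hy.1.ne'
  rw [h, real_inner_self_eq_norm_sq, inv_mul_cancel₀ h2, Nat.cast_sub (by omega)]
  simp [bas]

include hG hc hGG'

theorem IsDegenerateForm.of_conformal : IsDegenerateForm T G' := by
  intro y hy
  obtain ⟨h1, h2, h3⟩ := hG y hy
  rw [hGG' y hy]
  refine ⟨fun v w => ?_, fun v => ?_, fun v hv => ?_⟩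
  · simp only [smul_apply, h1 v w]
  · simp only [smul_apply, h2 v, smul_zero]
  · exact mul_pos (hc y hy) (h3 v hv)

/-- `gHat` is not conformally covariant, because of the term dr². The two sides are therefore
compared after applying `gHat G'`. -/
theorem cometric_conformal {y : Euc n} (hy : y ∈ coneRegion n T) (φ : Euc n →L[ℝ] ℝ) :
    cometric G' y φ = (c y)⁻¹ • cometric G y φ := by
  have hG' := hG.of_conformal hc hGG'
  have h0 := (hc y hy).ne'
  have h1 : gHat G' y (cometric G' y φ) = gHat G' y ((c y)⁻¹ • cometric G y φ) := by
    ext w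
    rw [hG'.gHat_cometric hy, hG'.gHat_symm hy, map_smul, gHat_apply, hGG' y hy,
      hG.inner_cometric hy]
    simp only [smul_apply, form_cometric hG hy, smul_eq_mul]
    field_simp
    ring
  have h2 := congrArg (gHatInv G' y) h1
  rwa [hG'.gHatInv_gHat hy, hG'.gHatInv_gHat hy] at h2

theorem trace_conformal {y : Euc n} (hy : y ∈ coneRegion n T) {b : Euc n → Euc n →L[ℝ] F} :
    trace G' y (fun v w => b v w) = (c y)⁻¹ • trace G y (fun v w => b v w) := by
  rw [trace, trace, Finset.smul_sum]
  refine Finset.sum_congr rfl fun i _ => ?_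
  rw [cometric_conformal hG hc hGG' hy, map_smul]

variable (hcd : DiffOn T c) (hd : DiffOn T (dev G))

include hcd hd

omit hG hc in
theorem rad_dev_conformal {y : Euc n} (hy : y ∈ coneRegion n T) :
    rad (dev G') y = rad c y • G y + c y • rad (dev G) y := by
  have hr := differentiableAt_roundForm (ne_zero_of_mem hy)
  have h1 : EqOn (dev G') (fun y => c y • (dev G y + roundForm n y) - roundForm n y)
      (coneRegion n T) := fun y hy => by
    simp only [dev, hGG' y hy]
    abel_nf
  have h2 : DifferentiableAt ℝ (fun y => dev G y + roundForm n y) y := (hd y hy).add hr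
  have h3 : rad (fun y => c y • (dev G y + roundForm n y)) y
      = rad c y • (dev G y + roundForm n y) + c y • rad (fun y => dev G y + roundForm n y) y := by
    rw [rad, fderiv_fun_smul (hcd y hy) h2, add_comm]
    rfl
  rw [rad_congr h1 hy, rad_sub ((hcd y hy).fun_smul h2) hr, h3, rad_add (hd y hy) hr,
    rad_roundForm (ne_zero_of_mem hy)]
  simp [dev]

/-- A conformal change adds to `nOp` half the logarithmic derivative of the factor times the
tangential projection; the shear is unchanged. -/
theorem nOp_conformal {y : Euc n} (hy : y ∈ coneRegion n T) (v : Euc n) :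
    nOp G' y v = nOp G y v
      + (rad c y / (2 * c y)) • (v - ((‖y‖ ^ 2)⁻¹ * inner ℝ y v) • y) := by
  have h0 := (hc y hy).ne'
  rw [nOp_apply, nOp_apply, rad_dev_conformal hGG' hcd hd hy,
    cometric_conformal hG hc hGG' hy, add_apply, smul_apply, smul_apply, map_add, map_smul,
    map_smul, cometric_form hG hy]
  match_scalars <;> field_simp

theorem tHat_conformal (hn : 2 ≤ n) {y : Euc n} (hy : y ∈ coneRegion n T) :
    tHat G' y = tHat G y + (n - 1 : ℕ) * (rad c y / (2 * c y)) := by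
  have h0 := (hc y hy).ne'
  have h1 := trace_conformal hG hc hGG' hy (b := fun v => (1 / 2 : ℝ) • rad (dev G') y v)
  have h2 := trace_form_self hG hn hy
  simp only [smul_apply, smul_eq_mul] at h1
  rw [tHat, tHat, h1, rad_dev_conformal hGG' hcd hd hy, ← h2]
  simp only [trace, add_apply, smul_apply, smul_eq_mul, Finset.sum_mul, Finset.mul_sum,
    ← Finset.sum_add_distrib]
  refine Finset.sum_congr rfl fun i _ => ?_
  field_simp
  ring

theorem sqHat_conformal (hn : 2 ≤ n) {y : Euc n} (hy : y ∈ coneRegion n T) :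
    sqHat G' y = sqHat G y + 2 * (rad c y / (2 * c y)) * tHat G y
      + (n - 1 : ℕ) * (rad c y / (2 * c y)) ^ 2 := by
  have h0 := (hc y hy).ne'
  have h1 := trace_conformal hG hc hGG' hy
    (b := fun v => (1 / 2 : ℝ) • rad (dev G') y (nOp G' y v))
  have h2 := trace_form_self hG hn hy
  simp only [smul_apply, smul_eq_mul] at h1
  have hN : ∀ v w, inner ℝ y w = 0 → G y (nOp G y v) w = (1 / 2) * rad (dev G) y v w := by
    intro v w hw
    have h3 := hG.gHat_nOp hy hw v
    rw [hG.gHat_symm hy, gHat_apply_of_inner_eq_zero G hw] at h3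
    rw [(hG y hy).1, h3]
  have hGy := (hG y hy).2.1
  have hry := hG.rad_dev_left hy (hd y hy)
  rw [sqHat, sqHat, tHat, h1, rad_dev_conformal hGG' hcd hd hy, ← h2]
  simp only [trace, nOp_conformal hG hc hGG' hcd hd hy, add_apply, smul_apply, smul_eq_mul,
    map_add, map_smul, map_sub, sub_apply, hGy, hry, mul_zero,
    hN _ _ (hG.inner_cometric hy _)]
  simp only [Finset.sum_mul, Finset.mul_sum, ← Finset.sum_add_distrib]
  refine Finset.sum_congr rfl fun i _ => ?_
  field_simp
  ring

end

end LightCone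

namespace LightCone

variable {n : ℕ} {F F' F'' : Type} [NormedAddCommGroup F] [NormedSpace ℝ F]
  [NormedAddCommGroup F'] [NormedSpace ℝ F'] [NormedAddCommGroup F''] [NormedSpace ℝ F'']
  {T : ℝ} {N : ℕ∞} {q : ℤ} {p : ℕ}

/-! ### Restriction of fields to the segments ending at the vertex -/

open scoped Classical in
/-- The path `s ↦ s^(2j-1) f(s² y)`, an element of the Banach space of continuous paths. -/
noncomputable def pathLift (j : ℕ) (f : Euc n → F) (y : Euc n) : C(unitInterval, F) :=
  -- The default value 0 is not reached for f of class (N, q) with 1 ≤ j + q and y in the cone. The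
  -- exponent -1 for j = 0 is what dt/t leaves after t = s²; the square makes the path vanish at s =
  -- 0 already when q = 1.
  if h : Continuous fun s : unitInterval => (s : ℝ) ^ (2 * (j : ℤ) - 1) • f ((s : ℝ) ^ 2 • y) then
    ⟨_, h⟩ else 0

theorem sq_smul_mem_coneRegion {y : Euc n} (hy : y ∈ coneRegion n T) {s : unitInterval}
    (hs : s ≠ 0) : (s : ℝ) ^ 2 • y ∈ coneRegion n T :=
  smul_mem_coneRegion hy (pow_pos (unitInterval.pos_iff_ne_zero.2 hs) 2)
    (pow_le_one₀ s.2.1 s.2.2)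

/-- The total power of s is 2(j + q) - 1, at least 1. -/
theorem norm_pathLift_apply_le {f : Euc n → F} {C : ℝ} (hC0 : 0 ≤ C)
    (hC : ∀ y ∈ coneRegion n T, ‖f y‖ ≤ C * ‖y‖ ^ q) {j : ℕ} (hjq : 1 ≤ j + q) {y : Euc n}
    (hy : y ∈ coneRegion n T) (s : unitInterval) :
    ‖(s : ℝ) ^ (2 * (j : ℤ) - 1) • f ((s : ℝ) ^ 2 • y)‖ ≤ C * (s * ‖y‖ ^ q) := by
  by_cases hs : s = 0
  · subst hs
    simp [zero_zpow _ (show 2 * (j : ℤ) - 1 ≠ 0 by omega)]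
  have h0 : (0 : ℝ) < s := unitInterval.pos_iff_ne_zero.2 hs
  have h1 := hC _ (sq_smul_mem_coneRegion hy hs)
  rw [norm_smul, Real.norm_of_nonneg (zpow_nonneg h0.le _)]
  rw [norm_smul, Real.norm_of_nonneg (by positivity), mul_zpow, ← zpow_natCast (s : ℝ) 2, ← zpow_mul,
    zpow_natCast] at h1
  have h2 : (s : ℝ) ^ (2 * (j : ℤ) - 1) * (s : ℝ) ^ (((2 : ℕ) : ℤ) * q) ≤ s := by
    rw [← zpow_add₀ h0.ne']
    calc (s : ℝ) ^ (2 * (j : ℤ) - 1 + ((2 : ℕ) : ℤ) * q) ≤ (s : ℝ) ^ (1 : ℤ) :=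
          zpow_le_zpow_right_of_le_one₀ h0 s.2.2 (by push_cast; omega)
      _ = s := zpow_one _
  calc (s : ℝ) ^ (2 * (j : ℤ) - 1) * ‖f ((s : ℝ) ^ 2 • y)‖
      ≤ (s : ℝ) ^ (2 * (j : ℤ) - 1) * (C * ((s : ℝ) ^ (((2 : ℕ) : ℤ) * q) * ‖y‖ ^ q)) := by gcongr
    _ = C * (((s : ℝ) ^ (2 * (j : ℤ) - 1) * (s : ℝ) ^ (((2 : ℕ) : ℤ) * q)) * ‖y‖ ^ q) := by ring
    _ ≤ _ := by gcongr

theorem VertexClass.continuous_path {f : Euc n → F} (hf : VertexClass N q T f) {j : ℕ}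
    (hjq : 1 ≤ j + q) :
    Continuous fun x : coneRegion n T × unitInterval =>
      (x.2 : ℝ) ^ (2 * (j : ℤ) - 1) • f ((x.2 : ℝ) ^ 2 • (x.1 : Euc n)) := by
  rw [continuous_iff_continuousAt]
  rintro ⟨⟨y, hy⟩, s⟩
  by_cases hs : s = 0
  · subst hs
    obtain ⟨T', h1, h2⟩ := exists_between hy.2
    obtain ⟨C, hC0, hC⟩ := hf.exists_bound h2
    have h3 : ContinuousAt (fun x : coneRegion n T × unitInterval =>
        C * ((x.2 : ℝ) * ‖(x.1 : Euc n)‖ ^ q)) (⟨y, hy⟩, 0) := by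
      refine continuousAt_const.mul (ContinuousAt.mul (by fun_prop) ?_)
      exact ContinuousAt.zpow₀ (by fun_prop) q (Or.inl hy.1.ne')
    have h4 : ∀ᶠ x : coneRegion n T × unitInterval in 𝓝 (⟨y, hy⟩, 0),
        (x.1 : Euc n) ∈ coneRegion n T' := by
      have : ContinuousAt (fun x : coneRegion n T × unitInterval => (x.1 : Euc n))
        (⟨y, hy⟩, 0) := by fun_prop
      exact this.eventually ((isOpen_coneRegion n T').mem_nhds ⟨hy.1, h1⟩)
    rw [ContinuousAt]
    have h5 : ((0 : unitInterval) : ℝ) ^ (2 * (j : ℤ) - 1) = 0 :=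
      zero_zpow _ (show 2 * (j : ℤ) - 1 ≠ 0 by omega)
    simp only [h5, zero_smul]
    refine squeeze_zero_norm' (a := fun x : coneRegion n T × unitInterval =>
        C * ((x.2 : ℝ) * ‖(x.1 : Euc n)‖ ^ q)) ?_ (by simpa [ContinuousAt] using h3)
    filter_upwards [h4] with x hx
    exact norm_pathLift_apply_le hC0 hC hjq hx x.2
  · have h0 : (s : ℝ) ≠ 0 := unitInterval.coe_ne_zero.2 hs
    refine ContinuousAt.smul (ContinuousAt.zpow₀ (by fun_prop) _ (Or.inl h0)) ?_
    refine ContinuousAt.comp (g := f) ?_ (by fun_prop)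
    exact hf.continuousOn.continuousAt
      ((isOpen_coneRegion n T).mem_nhds (sq_smul_mem_coneRegion hy hs))

theorem VertexClass.pathLift_apply {f : Euc n → F} (hf : VertexClass N q T f) {j : ℕ}
    (hjq : 1 ≤ j + q) {y : Euc n} (hy : y ∈ coneRegion n T) (s : unitInterval) :
    pathLift j f y s = (s : ℝ) ^ (2 * (j : ℤ) - 1) • f ((s : ℝ) ^ 2 • y) := by
  have h : Continuous fun s : unitInterval =>
      (s : ℝ) ^ (2 * (j : ℤ) - 1) • f ((s : ℝ) ^ 2 • y) :=
    (hf.continuous_path hjq).comp (Continuous.prodMk_right (⟨y, hy⟩ : coneRegion n T))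
  rw [pathLift, dif_pos h]
  rfl

theorem VertexClass.continuousOn_pathLift {f : Euc n → F} (hf : VertexClass N q T f) {j : ℕ}
    (hjq : 1 ≤ j + q) : ContinuousOn (pathLift j f) (coneRegion n T) := by
  rw [continuousOn_iff_continuous_domRestrict]
  convert (ContinuousMap.curry ⟨_, hf.continuous_path hjq⟩).continuous using 1
  ext y s
  simp [hf.pathLift_apply hjq y.2]

theorem VertexClass.isBigO_pathLift {f : Euc n → F} (hf : VertexClass N q T f) (hT : 0 < T) {j : ℕ}
    (hjq : 1 ≤ j + q) : pathLift j f =O[𝓝[≠] 0] fun y : Euc n => ‖y‖ ^ q := by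
  obtain ⟨C, hC0, hC⟩ := hf.exists_bound (half_lt_self hT)
  refine IsBigO.of_bound C ?_
  filter_upwards [eventually_mem_coneRegion (half_pos hT)] with y hy
  have hq := zpow_nonneg (norm_nonneg y) q
  rw [Real.norm_of_nonneg hq, ContinuousMap.norm_le _ (by positivity)]
  intro s
  rw [hf.pathLift_apply hjq (coneRegion_mono (half_le_self hT.le) hy)]
  refine (norm_pathLift_apply_le hC0 hC hjq hy s).trans ?_
  gcongr
  exact mul_le_of_le_one_left hq s.2.2

/-- A path of linear maps, as a linear map to paths. -/
noncomputable def pathFlip (n : ℕ) (F : Type) [NormedAddCommGroup F] [NormedSpace ℝ F] :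
    C(unitInterval, Euc n →L[ℝ] F) →L[ℝ] Euc n →L[ℝ] C(unitInterval, F) :=
  LinearMap.mkContinuous₂
    (LinearMap.mk₂ ℝ (fun (g : C(unitInterval, Euc n →L[ℝ] F)) (v : Euc n) =>
      (⟨fun s => g s v, g.continuous.clm_apply continuous_const⟩ : C(unitInterval, F)))
      (fun _ _ _ => by ext; simp) (fun _ _ _ => by ext; simp) (fun _ _ _ => by ext; simp)
      (fun _ _ _ => by ext; simp)) 1 (fun g v => by
    rw [ContinuousMap.norm_le _ (by positivity), one_mul]
    intro s
    exact ((g s).le_opNorm v).trans (by gcongr; exact g.norm_coe_le_norm s))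

@[simp] theorem pathFlip_apply (g : C(unitInterval, Euc n →L[ℝ] F)) (v : Euc n)
    (s : unitInterval) : pathFlip n F g v s = g s v := rfl

/-- Differentiating f(s²y) brings out s², so j becomes j + 1 while the weight drops to q - 1, and j
+ q is unchanged. Uniformity in s comes from the mean value inequality and the continuity of the
lifted derivative in the supremum norm. -/
theorem VertexClass.hasFDerivAt_pathLift {f : Euc n → F} (hf : VertexClass N q T f) (hN : 1 ≤ N)
    {j : ℕ} (hjq : 1 ≤ j + q) {y : Euc n} (hy : y ∈ coneRegion n T) :
    HasFDerivAt (pathLift j f) (pathFlip n F (pathLift (j + 1) (_root_.fderiv ℝ f) y)) y := by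
  have hf' : VertexClass 0 (q - 1) T (_root_.fderiv ℝ f) :=
    VertexClass.fderiv (N := 0) (hf.mono_order (by simpa using hN))
  have hjq' : 1 ≤ ((j + 1 : ℕ) : ℤ) + (q - 1) := by push_cast; omega
  refine .of_isLittleO (isLittleO_iff.2 fun ε hε => ?_)
  have h1 := (hf'.continuousOn_pathLift hjq').continuousAt
    ((isOpen_coneRegion n T).mem_nhds hy)
  obtain ⟨δ, hδ, hδε⟩ := Metric.eventually_nhds_iff_ball.1
    ((h1.eventually (Metric.closedBall_mem_nhds _ hε)).and
      ((isOpen_coneRegion n T).mem_nhds hy))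
  filter_upwards [Metric.ball_mem_nhds y hδ] with z hz
  rw [ContinuousMap.norm_le _ (by positivity)]
  intro s
  rw [ContinuousMap.sub_apply, ContinuousMap.sub_apply, hf.pathLift_apply hjq hy,
    hf.pathLift_apply hjq (hδε z hz).2, pathFlip_apply]
  refine (convex_ball y δ).norm_image_sub_le_of_norm_hasFDerivWithin_le'
    (f := fun z => (s : ℝ) ^ (2 * (j : ℤ) - 1) • f ((s : ℝ) ^ 2 • z))
    (f' := fun z => pathLift (j + 1) (_root_.fderiv ℝ f) z s) (fun w hw => ?_) (fun w hw => ?_)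
    (Metric.mem_ball_self hδ) hz
  · refine HasFDerivAt.hasFDerivWithinAt ?_
    rw [hf'.pathLift_apply hjq' (hδε w hw).2]
    by_cases hs : s = 0
    · subst hs
      simp only [Set.Icc.coe_zero, zero_zpow _ (show 2 * (j : ℤ) - 1 ≠ 0 by omega),
        zero_zpow _ (show 2 * ((j + 1 : ℕ) : ℤ) - 1 ≠ 0 by omega), zero_smul]
      exact hasFDerivAt_const _ _
    · have h0 : (s : ℝ) ≠ 0 := unitInterval.coe_ne_zero.2 hs
      have h2 := (hf.differentiableAt hN (sq_smul_mem_coneRegion (hδε w hw).2 hs)).hasFDerivAt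
      have h3 : HasFDerivAt (fun z : Euc n => (s : ℝ) ^ 2 • z)
          ((s : ℝ) ^ 2 • ContinuousLinearMap.id ℝ (Euc n)) w :=
        ((s : ℝ) ^ 2 • ContinuousLinearMap.id ℝ (Euc n)).hasFDerivAt
      refine ((h2.comp w h3).const_smul ((s : ℝ) ^ (2 * (j : ℤ) - 1))).congr_fderiv ?_
      ext v
      have h4 : (s : ℝ) ^ (2 * ((j + 1 : ℕ) : ℤ) - 1) = (s : ℝ) ^ (2 * (j : ℤ) - 1) * s ^ 2 := by
        rw [← zpow_natCast (s : ℝ) 2, ← zpow_add₀ h0]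
        congr 1
        push_cast
        ring
      rw [h4]
      simp [smul_smul]
  · have h2 := (hδε w hw).1
    rw [dist_eq_norm] at h2
    exact (ContinuousMap.norm_coe_le_norm (pathLift (j + 1) (_root_.fderiv ℝ f) w
      - pathLift (j + 1) (_root_.fderiv ℝ f) y) s).trans h2

theorem VertexClass.pathLift {f : Euc n → F} (hf : VertexClass N q T f) (hT : 0 < T) {j : ℕ}
    (hjq : 1 ≤ j + q) : VertexClass N q T (pathLift j f) := by
  refine of_forall_nat fun m hm => ?_
  replace hf := hf.mono_order hm
  clear hm
  induction m generalizing F j q with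
  | zero => exact zero_order (hf.continuousOn_pathLift hjq) (hf.isBigO_pathLift hT hjq)
  | succ m ih =>
    push_cast at hf ⊢
    have hd := fun y hy => hf.hasFDerivAt_pathLift (by simp) hjq (y := y) hy
    refine of_fderiv (fun y hy => (hd y hy).differentiableAt) (hf.isBigO_pathLift hT hjq) ?_
    have h1 := ih (j := j + 1) (by push_cast; omega) hf.fderiv
    exact (h1.clm (pathFlip n F) hT).congr hT fun y hy => (hd y hy).fderiv

/-! ### Averages along the segments -/

/-- The operator `g ↦ (s ↦ ∫₀¹ w(σ) g(σ s) dσ)` on continuous paths. -/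
noncomputable def pathMean (w : C(unitInterval, ℝ)) :
    C(unitInterval, ℝ) →L[ℝ] C(unitInterval, ℝ) :=
  LinearMap.mkContinuous
    { toFun := fun g => ⟨fun s => ∫ σ : unitInterval, w σ * g (σ * s), by
        have := continuous_parametric_integral_of_continuous (μ := MeasureTheory.volume)
          (f := fun s σ : unitInterval => w σ * g (σ * s)) (by fun_prop) isCompact_univ
        simpa using this⟩
      map_add' := fun g g' => by
        ext s
        simp only [ContinuousMap.coe_mk, ContinuousMap.add_apply, mul_add]
        exact MeasureTheory.integral_add
          (Continuous.integrable_of_hasCompactSupport (by fun_prop) (.of_compactSpace _))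
          (Continuous.integrable_of_hasCompactSupport (by fun_prop) (.of_compactSpace _))
      map_smul' := fun c g => by
        ext s
        simp only [ContinuousMap.coe_mk, ContinuousMap.smul_apply, smul_eq_mul, RingHom.id_apply,
          ← MeasureTheory.integral_const_mul]
        congr 1
        ext σ
        ring }
    ‖w‖ fun g => by
      rw [ContinuousMap.norm_le _ (by positivity)]
      intro s
      refine (MeasureTheory.norm_integral_le_of_norm_le_const (C := ‖w‖ * ‖g‖)
        (.of_forall fun σ => ?_)).trans (by simp)
      rw [norm_mul]
      gcongr
      · exact w.norm_coe_le_norm σ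
      · exact g.norm_coe_le_norm _

/-- Substitution t = σ², with Jacobian 2σ. -/
theorem radInt_eq_integral_unitInterval (a : ℝ) (f : Euc n → ℝ) (y : Euc n) :
    radInt a f y = ∫ σ : unitInterval,
      2 * (σ : ℝ) * (((σ : ℝ) ^ 2) ^ (a - 1) * f ((σ : ℝ) ^ 2 • y)) := by
  have h1 : (fun s : ℝ => s ^ 2) '' Ioc 0 1 = Ioc 0 1 := by
    ext x
    constructor
    · rintro ⟨s, hs, rfl⟩
      exact ⟨pow_pos hs.1 2, pow_le_one₀ hs.1.le hs.2⟩
    · intro hx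
      exact ⟨√x, ⟨Real.sqrt_pos.2 hx.1, Real.sqrt_le_one.2 hx.2⟩, Real.sq_sqrt hx.1.le⟩
  have h2 := MeasureTheory.integral_image_eq_integral_abs_deriv_smul (s := Ioc (0 : ℝ) 1)
    measurableSet_Ioc (f := fun s => s ^ 2) (f' := fun s => 2 * s)
    (fun s _ => by simpa using (hasDerivAt_pow 2 s).hasDerivWithinAt)
    (fun s hs s' hs' h => (pow_left_inj₀ hs.1.le hs'.1.le two_ne_zero).1 h)
    (fun t => t ^ (a - 1) * f (t • y))
  rw [h1] at h2
  rw [radInt]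
  simp only [smul_eq_mul] at h2 ⊢
  rw [h2, MeasureTheory.setIntegral_congr_fun measurableSet_Ioc
    (g := fun s => 2 * s * ((s ^ 2) ^ (a - 1) * f (s ^ 2 • y)))
    (fun s hs => by simp only [abs_of_pos (mul_pos two_pos hs.1)]),
    ← MeasureTheory.integral_Icc_eq_integral_Ioc]
  exact (MeasureTheory.integral_subtype measurableSet_Icc _).symm

end LightCone

namespace LightCone

variable {n : ℕ} {F F' F'' : Type} [NormedAddCommGroup F] [NormedSpace ℝ F]
  [NormedAddCommGroup F'] [NormedSpace ℝ F'] [NormedAddCommGroup F''] [NormedSpace ℝ F'']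
  {T : ℝ} {N : ℕ∞} {q : ℤ} {p : ℕ}

/-! ### Restriction of fields to the segments ending at the vertex -/
/-! ### A linear system with a regular singularity at the vertex -/

/-- The identity path. -/
def pathId : C(unitInterval, ℝ) := ⟨fun s => (s : ℝ), by fun_prop⟩

@[simp] theorem pathId_apply (s : unitInterval) : pathId s = s := rfl

/-- The path of the restriction of a function with value `1` at the vertex. -/
noncomputable def pathOne (e : Euc n → ℝ) (y : Euc n) : C(unitInterval, ℝ) :=
  -- `pathLift 0` carries a factor 1/s, which `pathId` removes.
  1 + pathId * pathLift 0 (fun y => e y - 1) y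

/-- The operator `φ ↦ J₀ (c J₁ (e φ))` on paths. -/
noncomputable def pathOp (c e : Euc n → ℝ) (y : Euc n) :
    C(unitInterval, ℝ) →L[ℝ] C(unitInterval, ℝ) :=
  -- After t = σ² the kernel of `radInt 0` is 2/σ. At s²y the lift of c supplies c/(σs), so the mean
  -- has weight 2 and an outer factor s is left over; the kernel of `radInt 1` is 2ρ, hence `2 *
  -- pathId`.
  (ContinuousLinearMap.mul ℝ C(unitInterval, ℝ) pathId).comp
    ((pathMean 2).comp ((ContinuousLinearMap.mul ℝ C(unitInterval, ℝ) (pathLift 0 c y)).comp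
      ((pathMean (2 * pathId)).comp
        (ContinuousLinearMap.mul ℝ C(unitInterval, ℝ) (pathOne e y)))))

section

variable {c e : Euc n → ℝ} (hp : 1 ≤ p) (hc : VertexClass N p T c)
  (he : VertexClass N p T fun y => e y - 1)

include hp he in
theorem pathOne_apply {y : Euc n} (hy : y ∈ coneRegion n T) {s : unitInterval} (hs : s ≠ 0) :
    pathOne e y s = e ((s : ℝ) ^ 2 • y) := by
  have h := he.pathLift_apply (j := 0) (by push_cast; omega) hy s
  have h0 : (s : ℝ) ≠ 0 := unitInterval.coe_ne_zero.2 hs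
  simp only [pathOne, ContinuousMap.add_apply, ContinuousMap.mul_apply, ContinuousMap.one_apply,
    pathId_apply, h]
  simp only [Nat.cast_zero, mul_zero, zero_sub, zpow_neg_one, smul_eq_mul]
  field_simp
  ring

theorem sq_smul_sq_smul (s s' : unitInterval) (y : Euc n) :
    (s : ℝ) ^ 2 • (s' : ℝ) ^ 2 • y = ((s * s' : unitInterval) : ℝ) ^ 2 • y := by
  rw [smul_smul, Set.Icc.coe_mul, mul_pow]

include hp he in
theorem pathOne_scale {y : Euc n} (hy : y ∈ coneRegion n T) {s₀ : unitInterval} (hs₀ : s₀ ≠ 0)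
    {s : unitInterval} : pathOne e ((s₀ : ℝ) ^ 2 • y) s = pathOne e y (s * s₀) := by
  by_cases hs : s = 0
  · simp [hs, pathOne]
  · rw [pathOne_apply hp he (sq_smul_mem_coneRegion hy hs₀) hs,
      pathOne_apply hp he hy (mul_ne_zero hs hs₀), sq_smul_sq_smul]

include hp hc in
theorem pathLift_scale {y : Euc n} (hy : y ∈ coneRegion n T) {s₀ : unitInterval} (hs₀ : s₀ ≠ 0)
    (s : unitInterval) : pathLift 0 c ((s₀ : ℝ) ^ 2 • y) s = s₀ * pathLift 0 c y (s * s₀) := by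
  have h0 : (s₀ : ℝ) ≠ 0 := unitInterval.coe_ne_zero.2 hs₀
  rw [hc.pathLift_apply (j := 0) (by push_cast; omega) hy,
    hc.pathLift_apply (j := 0) (by push_cast; omega) (sq_smul_mem_coneRegion hy hs₀),
    sq_smul_sq_smul]
  simp only [Nat.cast_zero, mul_zero, zero_sub, zpow_neg_one, smul_eq_mul, Set.Icc.coe_mul]
  field_simp

theorem pathOp_apply (c e : Euc n → ℝ) (y : Euc n) (g : C(unitInterval, ℝ)) (s : unitInterval) :
    pathOp c e y g s = s * ∫ σ : unitInterval, 2 * (pathLift 0 c y (σ * s)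
      * ∫ ρ : unitInterval, 2 * (ρ : ℝ) * (pathOne e y (ρ * (σ * s)) * g (ρ * (σ * s)))) := rfl

include hp hc he in
-- The path of a field at s₀² y is its path at y reparametrised by s ↦ s s₀. Covariance of the
-- operator under this change lets the solutions found at different points of a ray fit together.
theorem pathOp_scale {y : Euc n} (hy : y ∈ coneRegion n T) {s₀ : unitInterval} (hs₀ : s₀ ≠ 0)
    {g g₀ : C(unitInterval, ℝ)} (hg : ∀ s, g₀ s = g (s * s₀)) (s : unitInterval) :
    pathOp c e ((s₀ : ℝ) ^ 2 • y) g₀ s = pathOp c e y g (s * s₀) := by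
  simp only [pathOp_apply, pathLift_scale hp hc hy hs₀, pathOne_scale hp he hy hs₀, hg, mul_assoc,
    Set.Icc.coe_mul]
  simp only [mul_left_comm _ (s₀ : ℝ), MeasureTheory.integral_const_mul]

include hp hc he in
theorem vertexClass_pathOp (hT : 0 < T) : VertexClass N p T (pathOp c e) := by
  have h1 : VertexClass N 0 T (pathOne e) := by
    have h2 := he.pathLift hT (j := 0) (by push_cast; omega)
    have h3 := (h2.clm (ContinuousLinearMap.mul ℝ C(unitInterval, ℝ) pathId) hT).mono_weight
      (q' := 0) (by positivity)
    exact (VertexClass.const 1).add h3 hT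
  have h2 := h1.clm (ContinuousLinearMap.mul ℝ C(unitInterval, ℝ)) hT
  have h3 := (hc.pathLift hT (j := 0) (by push_cast; omega)).clm
    (ContinuousLinearMap.mul ℝ C(unitInterval, ℝ)) hT
  have h4 := h2.clm (ContinuousLinearMap.compL ℝ C(unitInterval, ℝ) C(unitInterval, ℝ)
    C(unitInterval, ℝ) (pathMean (2 * pathId))) hT
  have h5 := ((h3.clm_comp h4 hT).clm (ContinuousLinearMap.compL ℝ C(unitInterval, ℝ)
    C(unitInterval, ℝ) C(unitInterval, ℝ) (pathMean 2)) hT).clm (ContinuousLinearMap.compL ℝ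
    C(unitInterval, ℝ) C(unitInterval, ℝ) C(unitInterval, ℝ)
    (ContinuousLinearMap.mul ℝ C(unitInterval, ℝ) pathId)) hT
  rw [add_zero] at h5
  exact h5

include hp hc he in
-- For each y the equation (1 + A_y) ψ_y = 1 is solved by inversion in the algebra of bounded
-- operators on continuous paths. A_y is of class (N, p) in y, so its norm is below 1 near the
-- vertex, and smoothness of the inversion puts ψ - 1 in the same class. The required function is
-- φ(y) = ψ_y(1).
theorem exists_linear_system (hT : 0 < T) :
    ∃ T' : ℝ, 0 < T' ∧ T' ≤ T ∧ ∃ φ : Euc n → ℝ, VertexClass N p T' (fun y => φ y - 1) ∧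
      ∀ y ∈ coneRegion n T',
        φ y = 1 - radInt 0 (fun y => c y * radInt 1 (fun y => e y * φ y) y) y := by
  have hA := vertexClass_pathOp hp hc he hT
  obtain ⟨T', hT', hTT', hA1⟩ := exists_radius hT
    ((hA.tendsto_zero hp).eventually (Metric.ball_mem_nhds 0 one_pos))
  have hunit : ∀ A ∈ Metric.ball (0 : C(unitInterval, ℝ) →L[ℝ] C(unitInterval, ℝ)) 1,
      IsUnit (1 + A) := fun A hAm => by
    have := isUnit_one_sub_of_norm_lt_one (x := -A) (by simpa using hAm)
    simpa using this
  set ψ : Euc n → C(unitInterval, ℝ) := fun y => Ring.inverse (1 + pathOp c e y) 1 with hψ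
  have hψ1 : ∀ y ∈ coneRegion n T', ψ y + pathOp c e y (ψ y) = 1 := fun y hy => by
    have := Ring.mul_inverse_cancel _ (hunit _ (hA1 y hy))
    simpa using congrArg (fun L => L (1 : C(unitInterval, ℝ))) this
  -- The rescaled path solves the equation at s₀² y, which has only one solution. Hence ψ_y(s) =
  -- φ(s²y) for s ≠ 0, which turns the equation for paths into one for φ.
  have hψs : ∀ y ∈ coneRegion n T', ∀ s₀ : unitInterval, s₀ ≠ 0 → ∀ s,
      ψ ((s₀ : ℝ) ^ 2 • y) s = ψ y (s * s₀) := by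
    intro y hy s₀ hs₀ s
    set g : C(unitInterval, ℝ) := ⟨fun s => ψ y (s * s₀), by fun_prop⟩ with hg
    have h1 : g + pathOp c e ((s₀ : ℝ) ^ 2 • y) g = 1 := by
      ext s
      have := congrArg (fun f => f (s * s₀)) (hψ1 y hy)
      rw [ContinuousMap.add_apply, pathOp_scale hp hc he (coneRegion_mono hTT' hy) hs₀
        (g := ψ y) fun s => rfl]
      simpa [hg] using this
    have hy' := sq_smul_mem_coneRegion hy hs₀
    have h2 := Ring.inverse_mul_cancel _ (hunit _ (hA1 _ hy'))
    have h3 : ((1 : C(unitInterval, ℝ) →L[ℝ] C(unitInterval, ℝ)) + pathOp c e ((s₀ : ℝ) ^ 2 • y)) g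
        = 1 := h1
    have h4 := congrArg (fun f => Ring.inverse (1 + pathOp c e ((s₀ : ℝ) ^ 2 • y)) f) h3
    simp only [← mul_apply_eq_comp, h2] at h4
    exact (congrArg (fun f => f s) h4).symm
  have hψc : VertexClass N p T' (fun y => ψ y - 1) := by
    have h1 := VertexClass.comp_sub_const (U := Metric.ball 0 1) (c := 0)
      (Φ := fun A : C(unitInterval, ℝ) →L[ℝ] C(unitInterval, ℝ) => Ring.inverse (1 + A)) hT'
      Metric.isOpen_ball (Metric.mem_ball_self one_pos) hp (f := pathOp c e)
      (by simpa using hA.mono_radius hTT') hA1 fun A hAm => by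
        obtain ⟨u, hu⟩ := hunit A hAm
        refine ContDiffAt.contDiffWithinAt (ContDiffAt.comp A (g := Ring.inverse) ?_ (by fun_prop))
        rw [← hu]
        exact contDiffAt_ringInverse ℝ u
    refine (h1.clm (ContinuousLinearMap.apply ℝ C(unitInterval, ℝ) 1) hT').congr hT' fun y _ => ?_
    simp [hψ]
  refine ⟨T', hT', hTT', fun y => ψ y 1, (hψc.clm (ContinuousMap.evalCLM ℝ 1) hT').congr hT'
    fun y _ => by simp, fun y hy => ?_⟩
  have hy0 := coneRegion_mono hTT' hy
  have h1 := congrArg (fun f => f 1) (hψ1 y hy)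
  simp only [ContinuousMap.add_apply, ContinuousMap.one_apply] at h1
  have h2 : ∀ σ : unitInterval, σ ≠ 0 → radInt 1 (fun y => e y * ψ y 1) ((σ : ℝ) ^ 2 • y)
      = ∫ ρ : unitInterval, 2 * (ρ : ℝ) * (pathOne e y (ρ * σ) * ψ y (ρ * σ)) := by
    intro σ hσ
    rw [radInt_eq_integral_unitInterval]
    congr 1
    ext ρ
    by_cases hρ : ρ = 0
    · simp [hρ]
    · rw [sq_smul_sq_smul, pathOne_apply hp he hy0 (mul_ne_zero hρ hσ),
        hψs y hy _ (mul_ne_zero hρ hσ), one_mul, sub_self, Real.rpow_zero, one_mul]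
  have h3 : radInt 0 (fun y => c y * radInt 1 (fun y => e y * ψ y 1) y) y
      = pathOp c e y (ψ y) 1 := by
    rw [radInt_eq_integral_unitInterval, pathOp_apply]
    simp only [mul_one, Set.Icc.coe_one, one_mul]
    congr 1
    ext σ
    by_cases hσ : σ = 0
    · simp [hσ, hc.pathLift_apply (j := 0) (by push_cast; omega) hy0]
    · have h0 : (σ : ℝ) ≠ 0 := unitInterval.coe_ne_zero.2 hσ
      rw [h2 σ hσ, hc.pathLift_apply (j := 0) (by push_cast; omega) hy0, zero_sub,
        Real.rpow_neg_one]
      simp only [Nat.cast_zero, mul_zero, zero_sub, zpow_neg_one, smul_eq_mul]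
      field_simp
  rw [h3]
  linarith

end

end LightCone

namespace LightCone

variable {n : ℕ} {F F' F'' : Type} [NormedAddCommGroup F] [NormedSpace ℝ F]
  [NormedAddCommGroup F'] [NormedSpace ℝ F'] [NormedAddCommGroup F''] [NormedSpace ℝ F'']
  {T : ℝ} {N : ℕ∞} {q : ℤ} {p : ℕ}

/-! ### Restriction of fields to the segments ending at the vertex -/
/-! ### The conformal factor -/

theorem VertexClass.of_sub_const {f : Euc n → F} {c : F} (h : VertexClass N p T fun y => f y - c)
    (hT : 0 < T) : VertexClass N 0 T f := by
  simpa using (h.mono_weight (q' := 0) (by positivity)).add (VertexClass.const c) hT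

theorem VertexClass.mul_sub_one {f g : Euc n → ℝ} (hf : VertexClass N p T fun y => f y - 1)
    (hg : VertexClass N p T fun y => g y - 1) (hT : 0 < T) :
    VertexClass N p T fun y => f y * g y - 1 := by
  have h1 := (hf.mul hg hT).mono_weight (q' := p) (by omega)
  refine ((h1.add hf hT).add hg hT).congr hT fun y _ => ?_
  ring

theorem VertexClass.exp_sub_one (hT : 0 < T) (hp : 1 ≤ p) {f : Euc n → ℝ}
    (hf : VertexClass N p T f) : VertexClass N p T fun y => Real.exp (f y) - 1 := by
  simpa using VertexClass.comp_sub_const (c := 0) (Φ := Real.exp) hT isOpen_univ (mem_univ _) hp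
    (f := f) (by simpa using hf) (mapsTo_univ _ _) (Real.contDiff_exp.contDiffOn)

theorem rad_exp {f : Euc n → ℝ} {y : Euc n} (hf : DifferentiableAt ℝ f y) :
    rad (fun y => Real.exp (f y)) y = Real.exp (f y) * rad f y := by
  rw [rad, hf.hasFDerivAt.exp.fderiv, smul_apply, smul_eq_mul, ← rad]

theorem rad_neg (f : Euc n → ℝ) (y : Euc n) : rad (fun y => - f y) y = - rad f y := by
  rw [rad, fderiv_fun_neg, neg_apply, rad]

theorem rad_const_mul {f : Euc n → ℝ} {y : Euc n} (hf : DifferentiableAt ℝ f y) (c : ℝ) :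
    rad (fun y => c * f y) y = c * rad f y := by
  rw [rad, fderiv_const_mul hf, smul_apply, smul_eq_mul, ← rad]

/-- `radInt 1` fixes constants, as ∫₀¹ dt = 1. -/
theorem VertexClass.radInt_one_sub_one {f : Euc n → ℝ} (hf : VertexClass N p T fun y => f y - 1)
    (hT : 0 < T) : VertexClass N p T fun y => LightCone.radInt 1 f y - 1 := by
  have ha : (0 : ℝ) < 1 + ((p : ℤ) : ℝ) := by push_cast; positivity
  refine (hf.radInt hT ha).congr hT fun y hy => ?_
  have h1 := hf.integrableOn_radInt ha hy
  have h2 := integrableOn_rpow_Ioc one_pos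
  have h3 := MeasureTheory.integral_add h1 h2
  rw [integral_rpow_Ioc one_pos] at h3
  simp only [LightCone.radInt, sub_self, Real.rpow_zero, one_smul, div_one, sub_add_cancel] at h3 ⊢
  linarith

/-- The Raychaudhuri equation, with prescribed shear and prescribed parametrization of the rays,
can be solved near the vertex. -/
theorem exists_conformal_factor (hp : 1 ≤ p) (hN : 1 ≤ N) (hT : 0 < T) {t q κ : Euc n → ℝ}
    (ht : VertexClass N p T t) (hq : VertexClass N p T q) (hκ : VertexClass N p T κ) :
    ∃ T' : ℝ, 0 < T' ∧ T' ≤ T ∧ ∃ ζ s : Euc n → ℝ, VertexClass N p T' (fun y => ζ y - 1) ∧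
      DiffOn T' s ∧ ∀ y ∈ coneRegion n T', 0 < ζ y ∧ rad ζ y = (s y - t y) * ζ y ∧
        rad s y + s y + q y + s y ^ 2 = κ y * (1 + s y) := by
  have hp0 : (0 : ℝ) < 0 + (p : ℤ) := by rw [zero_add]; exact_mod_cast hp
  have hK := hκ.radInt hT hp0
  have hB := ht.radInt hT hp0
  have hrK := fun y hy => hκ.rad_radInt hN hp0 (y := y) hy
  have hrB := fun y hy => ht.rad_radInt hN hp0 (y := y) hy
  -- The Riccati equation is linearised by 1 + s = χ/λ with rad λ = χ - λ and rad χ = κχ - qλ. Since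
  -- rad K = κ, the function φ = exp(-K) χ satisfies rad φ = -exp(-K) q λ, where λ = `radInt 1 χ`,
  -- which is the integral equation solved above. Since rad B = t, the factor ζ = exp(-B) λ
  -- satisfies rad ζ = (s - t) ζ.
  set K := radInt 0 κ
  set B := radInt 0 t
  simp only [zero_smul, add_zero] at hrK hrB
  have he := hK.exp_sub_one hT hp
  have hb := (hB.neg hT).exp_sub_one hT hp
  have hc : VertexClass N p T fun y => Real.exp (-K y) * q y :=
    ((((hK.neg hT).exp_sub_one hT hp).of_sub_const hT).mul hq hT).mono_weight (by omega)
  obtain ⟨T₁, hT₁, hTT₁, φ, hφ, hφ1⟩ := exists_linear_system hp hc he hT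
  have hχ := (he.mono_radius hTT₁).mul_sub_one hφ hT₁
  set χ : Euc n → ℝ := fun y => Real.exp (K y) * φ y with hχdef
  have hlam := hχ.radInt_one_sub_one hT₁
  have hrlam := fun y hy => (hχ.of_sub_const hT₁).rad_radInt hN (a := 1) (by norm_num) (y := y) hy
  set lam := radInt 1 χ
  have hcl : VertexClass N p T₁ fun y => Real.exp (-K y) * q y * lam y :=
    ((hc.mono_radius hTT₁).mul (hlam.of_sub_const hT₁) hT₁).mono_weight (by omega)
  have hrcl := fun y hy => hcl.rad_radInt hN hp0 (y := y) hy
  have hdcl := (hcl.radInt hT₁ hp0).diffOn hN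
  obtain ⟨T', hT', hTT', hpos⟩ := exists_radius hT₁
    ((hlam.tendsto_zero hp).eventually (lt_mem_nhds (neg_lt_zero.mpr one_pos)))
  have hpos' : ∀ y ∈ coneRegion n T', 0 < lam y := fun y hy => by linarith [hpos y hy]
  have hdK := hK.diffOn hN
  have hdB := hB.diffOn hN
  have hdlam := (hlam.of_sub_const hT₁).diffOn hN
  have hdφ := (hφ.of_sub_const hT₁).diffOn hN
  have hdχ := (hχ.of_sub_const hT₁).diffOn hN
  have hdinv : ∀ y ∈ coneRegion n T', DifferentiableAt ℝ (fun y => (lam y)⁻¹) y := fun y hy =>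
    (hdlam y (coneRegion_mono hTT' hy)).inv (hpos' y hy).ne'
  have hds : DiffOn T' fun y => χ y * (lam y)⁻¹ - 1 := fun y hy =>
    ((hdχ y (coneRegion_mono hTT' hy)).mul (hdinv y hy)).sub_const 1
  refine ⟨T', hT', hTT'.trans hTT₁, fun y => Real.exp (-B y) * lam y,
    fun y => χ y * (lam y)⁻¹ - 1,
    (hb.mono_radius (hTT'.trans hTT₁)).mul_sub_one (hlam.mono_radius hTT') hT', hds,
    fun y hy => ?_⟩
  have hy1 := coneRegion_mono hTT' hy
  have hy0 := coneRegion_mono hTT₁ hy1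
  have hl := (hpos' y hy).ne'
  have e1 : rad lam y = χ y - lam y := by
    have := hrlam y hy1
    rw [one_smul] at this
    linarith
  have e2 : rad φ y = - (Real.exp (-K y) * q y * lam y) := by
    have h1 := rad_congr (f := φ) (g := fun y => 1 + - radInt 0 (fun y =>
      Real.exp (-K y) * q y * lam y) y) (fun y hy => by rw [hφ1 y hy, sub_eq_add_neg]) hy1
    have h2 := hrcl y hy1
    rw [zero_smul, add_zero] at h2
    rw [h1, rad_const_add, rad_neg, h2]
  have e3 : rad χ y = κ y * χ y - q y * lam y := by
    have h1 : Real.exp (K y) * Real.exp (-K y) = 1 := by rw [← Real.exp_add]; simp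
    rw [hχdef, rad_mul (hdK y hy0).exp (hdφ y hy1), rad_exp (hdK y hy0), hrK y hy0, e2]
    linear_combination (-(q y * lam y)) * h1
  refine ⟨mul_pos (Real.exp_pos _) (hpos' y hy), ?_, ?_⟩
  · rw [rad_mul (hdB y hy0).fun_neg.exp (hdlam y hy1), rad_exp (hdB y hy0).fun_neg, rad_neg, hrB y hy0, e1]
    field_simp
    ring
  · rw [rad_sub ((hdχ y hy1).fun_mul (hdinv y hy)) (differentiableAt_const _),
      rad_mul (hdχ y hy1) (hdinv y hy), rad_inv (hdlam y hy1) hl, e1, e3]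
    simp only [rad, fderiv_fun_const, Pi.zero_apply, zero_apply, sub_zero]
    field_simp
    ring

/-- With d = n - 1, take t = tHat/d and q = (sqHat - tHat²/d)/d for the given form; q is the
normalised squared shear, invariant under conformal changes. For G = ζ² G₀ one finds tHat = d s, and
the first constraint becomes the Riccati equation for s. One derivative is lost, since t and q
contain the radial derivative of G₀. -/
theorem exists_conformal_form (hn : 2 ≤ n) (hp : 1 ≤ p) (hN : 1 ≤ N) (hT : 0 < T)
    {G₀ : FormField n} (hG₀ : IsAdmissibleForm (N + 1) p T G₀) {κ : Euc n → ℝ}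
    (hκ : VertexClass N p T κ) :
    ∃ T' : ℝ, 0 < T' ∧ T' ≤ T ∧ ∃ G : FormField n, IsAdmissibleForm N p T' G ∧
      Conformal T' G₀ G ∧ ∀ y ∈ coneRegion n T',
        κ y * ((n - 1 : ℕ) + tHat G y) = rad (tHat G) y + tHat G y + sqHat G y := by
  obtain ⟨hG, hh⟩ := hG₀
  replace hh : VertexClass (N + 1) p T (dev G₀) := hh
  have hd := (dim_pos hn).ne'
  have ht := vertexClass_tHat hG hT hp hh
  have hs := vertexClass_sqHat hG hT hp hh
  obtain ⟨T', hT', hTT', ζ, s, hζ, hsd, h⟩ := exists_conformal_factor hp hN hT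
    (ht.const_smul ((n - 1 : ℕ) : ℝ)⁻¹ hT)
    ((hs.sub ((((ht.mul ht hT).mono_weight (q' := p) (by omega))).const_smul
      ((n - 1 : ℕ) : ℝ)⁻¹ hT) hT).const_smul ((n - 1 : ℕ) : ℝ)⁻¹ hT) hκ
  simp only [smul_eq_mul] at h
  have hG' := hG.mono hTT'
  have hh0 : VertexClass N p T' (dev G₀) := (hh.mono_radius hTT').mono_order le_self_add
  have hdd := hh0.diffOn hN
  have hζ2 := hζ.mul_sub_one hζ hT'
  have hζd := (hζ.of_sub_const hT').diffOn hN
  have hcd := (hζ2.of_sub_const hT').diffOn hN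
  have hc : ∀ y ∈ coneRegion n T', 0 < ζ y * ζ y := fun y hy => mul_pos (h y hy).1 (h y hy).1
  set G : FormField n := fun y => (ζ y * ζ y) • G₀ y with hGdef
  have hGG : ∀ y ∈ coneRegion n T', G y = (ζ y * ζ y) • G₀ y := fun _ _ => rfl
  have hrc : ∀ y ∈ coneRegion n T', rad (fun y => ζ y * ζ y) y / (2 * (ζ y * ζ y))
      = s y - ((n - 1 : ℕ) : ℝ)⁻¹ * tHat G₀ y := fun y hy => by
    obtain ⟨h1, h2, -⟩ := h y hy
    rw [rad_mul (hζd y hy) (hζd y hy), h2]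
    field_simp
    ring
  have htG : EqOn (tHat G) (fun y => (n - 1 : ℕ) * s y) (coneRegion n T') := fun y hy => by
    rw [tHat_conformal hG' hc hGG hcd hdd hn hy, hrc y hy]
    field_simp
    ring
  refine ⟨T', hT', hTT', G, ⟨hG'.of_conformal hc hGG, ?_⟩, fun y hy => ⟨_, hc y hy, rfl⟩,
    fun y hy => ?_⟩
  · have h1 := ((hζ2.of_sub_const hT').smul hh0 hT').mono_weight (q' := p) (by omega)
    have h2 := (hζ2.smul (vertexClass_roundForm hT') hT').mono_weight (q' := p) (by omega)
    refine (h1.add h2 hT').congr hT' fun y _ => ?_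
    simp only [hGdef, dev]
    module
  · obtain ⟨h1, h2, h3⟩ := h y hy
    rw [rad_congr htG hy, htG hy, rad_const_mul (hsd y hy),
      sqHat_conformal hG' hc hGG hcd hdd hn hy, hrc y hy]
    have h4 : κ y * (((n - 1 : ℕ) : ℝ) + (n - 1 : ℕ) * s y)
        = (n - 1 : ℕ) * (κ y * (1 + s y)) := by ring
    rw [h4, ← h3]
    field_simp
    ring

/-- A conformal factor that solves the difference of two Raychaudhuri equations and tends to `1`
at the vertex is `1`. -/
theorem conformal_factor_eq_one (hp : 1 ≤ p) (hN : 1 ≤ N) (hT : 0 < T) {b c : Euc n → ℝ}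
    (hb : VertexClass N p T b) (hc : ∀ y ∈ coneRegion n T, 0 < c y)
    (hcd : ContDiffOn ℝ 2 c (coneRegion n T))
    (h : ∀ y ∈ coneRegion n T, rad (fun y => rad c y / (2 * c y)) y
      + (1 + b y) * (rad c y / (2 * c y)) + (rad c y / (2 * c y)) ^ 2 = 0)
    (hlim : ∀ θ : Euc n, ‖θ‖ = 1 → Tendsto (fun r : ℝ => c (r • θ)) (𝓝[>] 0) (𝓝 1)) :
    ∀ y ∈ coneRegion n T, c y = 1 := by
  have hcd' : DiffOn T c := DiffOn.of_contDiffOn (by norm_num) hcd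
  have hrd : DiffOn T (rad c) := DiffOn.of_contDiffOn (N := (1 : ℕ)) (by norm_num)
    (contDiffOn_rad (by exact_mod_cast hcd))
  have hσd : DiffOn T fun y => rad c y / (2 * c y) := fun y hy =>
    by
    have h0 : 2 * c y ≠ 0 := mul_ne_zero two_ne_zero (hc y hy).ne'
    simp only [div_eq_mul_inv]
    exact (hrd y hy).fun_mul (((hcd' y hy).const_mul 2).fun_inv h0)
  -- With σ = ½ rad log c, the square root w = √c satisfies rad w = σw. The product z = σw then
  -- solves the linear homogeneous equation rad z + (1 + b) z = 0, the quadratic term being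
  -- absorbed.
  set w : Euc n → ℝ := fun y => √(c y) with hw
  have hw0 : ∀ y ∈ coneRegion n T, 0 < w y := fun y hy => Real.sqrt_pos.2 (hc y hy)
  have hwd : DiffOn T w := fun y hy => (hcd' y hy).sqrt (hc y hy).ne'
  set σ : Euc n → ℝ := fun y => rad c y / (2 * c y) with hσ
  have hrw : ∀ y ∈ coneRegion n T, rad w y = σ y * w y := fun y hy => by
    have h1 := (hcd' y hy).hasFDerivAt.sqrt (hc y hy).ne'
    have h2 := Real.sq_sqrt (hc y hy).le
    have h3 := (hw0 y hy).ne'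
    simp only [hw] at h3
    rw [rad, h1.fderiv, smul_apply, smul_eq_mul, ← rad]
    have h4 : 1 / (2 * √(c y)) * rad c y = rad c y / (2 * √(c y) ^ 2) * √(c y) := by field_simp
    rw [h4, h2]
  have hzd : DiffOn T fun y => σ y * w y := fun y hy => (hσd y hy).mul (hwd y hy)
  have hz : ∀ y ∈ coneRegion n T,
      rad (fun y => σ y * w y) y + (1 + b y) • (σ y * w y) = 0 := fun y hy => by
    rw [rad_mul (hσd y hy) (hwd y hy), hrw y hy, smul_eq_mul]
    linear_combination (w y) * h y hy
  have hμd : DiffOn T fun y => w y - 1 := fun y hy => (hwd y hy).sub_const 1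
  have hrμ : ∀ y ∈ coneRegion n T, rad (fun y => w y - 1) y = σ y * w y := fun y hy => by
    rw [← hrw y hy, rad, fderiv_sub_const, rad]
  intro y hy
  obtain ⟨θ, hθ, hr, hyθ⟩ := exists_ray y hy
  have hμ0 : Tendsto (fun r : ℝ => w (r • θ) - 1) (𝓝[>] 0) (𝓝 0) := by
    have := ((Real.continuous_sqrt.tendsto 1).comp (hlim θ hθ)).sub_const 1
    simpa [Function.comp_def] using this
  obtain ⟨β, hβ, hβ0⟩ := hb.exists_ray_potential hp hN hT hθ
  obtain ⟨C, hC⟩ := ray_homogeneous (b := fun r => b (r • θ)) (a := 1) hβ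
    (fun r hr => hzd.hasDerivAt_ray hθ hr) (fun r hr => by
      rw [smul_smul, mul_inv_cancel₀ hr.1.ne', one_smul, hz _ (ray_mem hθ hr)])
  have hC0 : C = 0 := by
    by_contra hC0
    have hL : 0 < C ^ 2 := by positivity
    have hψ : Tendsto (fun r => Real.exp (-β r) * C ^ 2) (𝓝[>] 0) (𝓝 (C ^ 2)) := by
      have := ((Real.continuous_exp.tendsto _).comp hβ0.neg).mul_const (C ^ 2)
      simpa [Function.comp_def] using this
    have hCμ : Tendsto (fun r : ℝ => C * (w (r • θ) - 1)) (𝓝[>] 0) (𝓝 0) := by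
      simpa using hμ0.const_mul C
    -- The equation rad(w - 1) = z has exponent 0, while a positive one is needed, so C(w - 1) is
    -- added to both sides. It is eventually above -C²/4, whereas Cz is eventually at least C²/2;
    -- the constant C²/4 is the difference.
    refine ray_no_positive_source (β := fun _ => 0) (b := fun _ => 0) (a := 1) (ε := C ^ 2 / 4)
      one_pos (by positivity) tendsto_const_nhds (f := fun r => C * (w (r • θ) - 1))
      (f' := fun r => C * (r⁻¹ • rad (fun y => w y - 1) (r • θ))) ?_ hCμ
    filter_upwards [eventually_le_rpow_mul hL zero_le_one hψ, Ioo_mem_nhdsGT hT,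
      hCμ.eventually (lt_mem_nhds (show -(C ^ 2 / 4) < 0 by linarith))] with r h1 hrT h2
    refine ⟨by simpa using hasDerivAt_const r (0 : ℝ),
      (hμd.hasDerivAt_ray hθ hrT).const_mul C, ?_⟩
    have h3 := hC r hrT
    rw [hrμ _ (ray_mem hθ hrT), h3, smul_eq_mul, smul_eq_mul]
    have h4 := hrT.1.ne'
    have h5 : r * (C * (r⁻¹ * (r ^ (-1 : ℝ) * Real.exp (-β r) * C)))
        = r ^ (-1 : ℝ) * (Real.exp (-β r) * C ^ 2) := by
      field_simp
    rw [h5]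
    linarith
  -- With C = 0, the function w - 1 is constant along the ray, and its limit at the vertex is 0.
  have key := eq_zero_of_rad_homogeneous hp hN hT (b := fun _ => 0) VertexClass.zero
    (a := 0) le_rfl hμd hθ (fun r hr => ?_) hμ0 _ hr
  · rw [hyθ] at key
    have h1 : √(c y) = 1 := by simpa [hw, sub_eq_zero] using key
    rw [← Real.sq_sqrt (hc y hy).le, h1, one_pow]
  · rw [hrμ _ (ray_mem hθ hr)]
    have h3 := hC r hr
    rw [hC0, smul_zero] at h3
    rw [h3]
    simp

end LightCone

namespace LightCone

variable {n : ℕ} {F F' F'' : Type} [NormedAddCommGroup F] [NormedSpace ℝ F]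
  [NormedAddCommGroup F'] [NormedSpace ℝ F'] [NormedAddCommGroup F''] [NormedSpace ℝ F'']
  {T : ℝ} {N : ℕ∞} {q : ℤ} {p : ℕ}

/-! ### Restriction of fields to the segments ending at the vertex -/
/-! ### The solutions on smaller cones -/

theorem IsAdmissibleForm.mono {G : FormField n} {T' : ℝ} (h : IsAdmissibleForm N p T G)
    (hT : T' ≤ T) : IsAdmissibleForm N p T' G :=
  ⟨h.1.mono hT, h.2.mono_radius hT⟩

theorem Conformal.mono {G G' : FormField n} {T' : ℝ} (h : Conformal T G G') (hT : T' ≤ T) :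
    Conformal T' G G' := fun y hy => h y (coneRegion_mono hT hy)

theorem Conformal.symm {G G' : FormField n} (h : Conformal T G G') : Conformal T G' G := by
  intro y hy
  obtain ⟨c, hc, h⟩ := h y hy
  exact ⟨c⁻¹, inv_pos.2 hc, by rw [h, smul_smul, inv_mul_cancel₀ hc.ne', one_smul]⟩

theorem Conformal.trans {G G' G'' : FormField n} (h : Conformal T G G') (h' : Conformal T G' G'') :
    Conformal T G G'' := by
  intro y hy
  obtain ⟨c, hc, h⟩ := h y hy
  obtain ⟨c', hc', h'⟩ := h' y hy
  exact ⟨c' * c, mul_pos hc' hc, by rw [h', h, smul_smul]⟩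

section

variable {k : ℕ∞} {G : FormField n} {ν₀ g₀₀ : Euc n → ℝ} {ν : CovectorField n}

theorem IsSolution.mono (sol : IsSolution k p T G ν₀ ν g₀₀) {T' : ℝ} (h : T' ≤ T) :
    IsSolution k p T' G ν₀ ν g₀₀ where
  coefficients :=
    ⟨fun y hy => sol.coefficients.nuZero_pos y (coneRegion_mono h hy),
      sol.coefficients.nuZero.mono_radius h,
      fun y hy => sol.coefficients.nu_radial y (coneRegion_mono h hy),
      sol.coefficients.nu.mono_radius h, sol.coefficients.gZeroZero.mono_radius h⟩
  dim_add_tHat_pos y hy := sol.dim_add_tHat_pos y (coneRegion_mono h hy)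
  kHat_eq y hy := sol.kHat_eq y (coneRegion_mono h hy)
  vertexClass_alp := sol.vertexClass_alp.mono_radius h
  vertexClass_xiHat := sol.vertexClass_xiHat.mono_radius h
  caHat_eq y hy := sol.caHat_eq y (coneRegion_mono h hy)
  c0Hat_eq y hy := sol.c0Hat_eq y (coneRegion_mono h hy)

variable (hG : IsAdmissibleForm (k + 4) p T G) (hT : 0 < T) (hp : 1 ≤ p) (hn : 2 ≤ n)
  (hk : 2 ≤ k) (sol : IsSolution k p T G ν₀ ν g₀₀)

include hG hT hp hn hk sol

theorem IsSolution.secondConstraint : SecondConstraint T G ν₀ ν :=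
  (sol.secondConstraint_iff hG.1 hG.2 hT hp hn hk sol.coefficients.nu_radial
    (sol.contDiffOn_nu hk)).2 sol.caHat_eq

theorem IsSolution.thirdConstraint : ThirdConstraint T G ν₀ ν g₀₀ :=
  (sol.thirdConstraint_iff hG.1 hG.2 hT hp hn hk (sol.contDiffOn_gZeroZero hk)).2 sol.c0Hat_eq

omit hT in
theorem IsSolution.determineNuAndGZeroZero : DetermineNuAndGZeroZero T G ν₀ ν g₀₀ :=
  fun _ hT' hTT' =>
    ⟨fun _ hν h => (sol.mono hTT').nu_unique (hG.mono hTT').1 (hG.mono hTT').2 hT' hp hn hk hν h,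
      fun _ hg h => (sol.mono hTT').gZeroZero_unique (hG.mono hTT').1 (hG.mono hTT').2 hT' hp hn hk
        hg h⟩

end

/-! ### Uniqueness in a conformal class -/

theorem exists_unit_orthogonal (hn : 2 ≤ n) (θ : Euc n) :
    ∃ w : Euc n, ‖w‖ = 1 ∧ inner ℝ θ w = 0 := by
  have h1 : 1 < Module.finrank ℝ (Euc n) := by
    rw [finrank_euclideanSpace_fin]
    omega
  obtain ⟨v, hv, hv0⟩ := Submodule.exists_mem_ne_zero_of_ne_bot (p := (ℝ ∙ θ)ᗮ) fun h => by
    have h2 := Submodule.finrank_add_finrank_orthogonal (ℝ ∙ θ)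
    rw [h, finrank_bot] at h2
    have h3 := finrank_span_le_card (R := ℝ) ({θ} : Set (Euc n))
    simp only [Set.toFinset_singleton, Finset.card_singleton] at h3
    omega
  refine ⟨‖v‖⁻¹ • v, norm_smul_inv_norm hv0, ?_⟩
  rw [real_inner_smul_right, Submodule.mem_orthogonal_singleton_iff_inner_right.1 hv, mul_zero]

theorem kHat_congr {G G' : FormField n} (h : EqOn G' G (coneRegion n T)) (ν₀ : Euc n → ℝ)
    {y : Euc n} (hy : y ∈ coneRegion n T) : kHat G' ν₀ y = kHat G ν₀ y := by
  have h1 : rad (dev G') y = rad (dev G) y :=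
    rad_congr (fun y hy => by rw [dev, h hy, dev]) hy
  have h2 : cometric G' y = cometric G y := by
    simp only [cometric, gHatInv, gHat, dev, h hy]
  simp only [kHat, tHat, wHat, trace, h1, h2]

theorem tendsto_form_apply {G : FormField n} {θ w : Euc n} (hw : ‖w‖ = 1) (hθw : inner ℝ θ w = 0)
    (h : Tendsto (fun r : ℝ => G (r • θ) - roundForm n (r • θ)) (𝓝[>] 0) (𝓝 0)) :
    Tendsto (fun r : ℝ => G (r • θ) w w) (𝓝[>] 0) (𝓝 1) := by
  have h1 := (((ContinuousLinearMap.apply ℝ ℝ w).comp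
    (ContinuousLinearMap.apply ℝ (Euc n →L[ℝ] ℝ) w)).continuous.tendsto 0).comp h
  have h2 := h1.add_const 1
  simp only [map_zero, zero_add] at h2
  refine h2.congr fun r => ?_
  simp [roundForm_apply, real_inner_smul_left, hθw, hw]

/-- Subtracting the first constraints of G and G' = cG, which have the same `kHat`, leaves for ½ rad
log c a Riccati equation without source. The vertex limits force c → 1. -/
theorem conformal_unique (hn : 2 ≤ n) (hp : 1 ≤ p) (hT : 0 < T) {k : ℕ∞} {G G' : FormField n}
    (hG : IsAdmissibleForm (k + 4) p T G) (hG' : FormLimit T G') (hGG' : Conformal T G G')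
    {κ ν₀ : Euc n → ℝ} (hκ : VertexClass (k + 4) p T κ)
    (hR : ∀ y ∈ coneRegion n T,
      κ y * ((n - 1 : ℕ) + tHat G y) = rad (tHat G) y + tHat G y + sqHat G y)
    (hν : DiffOn T ν₀) (hkν : ∀ y ∈ coneRegion n T, kHat G' ν₀ y = κ y)
    (h1 : FirstConstraint T G' ν₀) : EqOn G' G (coneRegion n T) := by
  obtain ⟨hG, hh⟩ := hG
  replace hh : VertexClass (k + 4) p T (dev G) := hh
  have hd := (dim_pos hn).ne'
  have ht := vertexClass_tHat hG hT hp (vertexClass_dev_two hh)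
  have htd := diffOn_tHat hG hh hT hp
  set c : Euc n → ℝ := fun y => ((n - 1 : ℕ) : ℝ)⁻¹ * trace G y (fun v w => G' y v w) with hcdef
  -- Conformality provides only pointwise factors. The trace of G' with respect to G, divided by n -
  -- 1, recovers the factor as a C² function.
  have hc' : ∀ y ∈ coneRegion n T, 0 < c y ∧ G' y = c y • G y := fun y hy => by
    obtain ⟨a, ha, h⟩ := hGG' y hy
    have h2 : c y = a := by
      have h3 := trace_form_self hG hn hy
      simp only [hcdef, h, trace, smul_apply, smul_eq_mul, ← Finset.mul_sum] at h3 ⊢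
      rw [h3]
      field_simp
    rw [h2]
    exact ⟨ha, h⟩
  have hc := fun y hy => (hc' y hy).1
  have hcG := fun y hy => (hc' y hy).2
  have hc2 : ContDiffOn ℝ 2 c (coneRegion n T) := by
    refine contDiffOn_const.mul (ContDiffOn.sum fun i _ => ?_)
    have h2 := (vertexClass_cometric hG hT hp hh).contDiffOn_nat 2 (le_add_left (by norm_num))
    exact (hG'.contDiffOn.clm_apply contDiffOn_const).clm_apply (h2.clm_apply contDiffOn_const)
  have hcd : DiffOn T c := DiffOn.of_contDiffOn (by norm_num) hc2
  have hdd := diffOn_dev hh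
  have hσd : DiffOn T fun y => rad c y / (2 * c y) := fun y hy => by
    have h0 : 2 * c y ≠ 0 := mul_ne_zero two_ne_zero (hc y hy).ne'
    have hrd : DiffOn T (rad c) := DiffOn.of_contDiffOn (N := (1 : ℕ)) (by norm_num)
      (contDiffOn_rad (by exact_mod_cast hc2))
    simp only [div_eq_mul_inv]
    exact (hrd y hy).fun_mul (((hcd y hy).const_mul 2).fun_inv h0)
  have ht' : EqOn (tHat G') (fun y => tHat G y + (n - 1 : ℕ) * (rad c y / (2 * c y)))
      (coneRegion n T) := fun y hy => tHat_conformal hG hc hcG hcd hdd hn hy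
  have htd' : DiffOn T (tHat G') :=
    DiffOn.congr (fun y hy => (htd y hy).fun_add ((hσd y hy).const_mul _)) ht'
  have hdd' : DiffOn T (dev G') := fun y hy =>
    (DiffOn.of_contDiffOn (N := 2) (by norm_num) hG'.contDiffOn y hy).sub
      (differentiableAt_roundForm (ne_zero_of_mem hy))
  rw [firstConstraint_iff hG'.degenerate hn hdd' htd' hν] at h1
  have hb := ((ht.const_smul (2 * ((n - 1 : ℕ) : ℝ)⁻¹) hT).sub
    (hκ.mono_order (N' := 1) (le_add_left (by norm_num))) hT)
  have hone := conformal_factor_eq_one hp le_rfl hT hb hc hc2 (fun y hy => ?_) fun θ hθ => ?_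
  · intro y hy
    rw [hcG y hy, hone y hy, one_smul]
  · have h2 := h1 y hy
    have h3 := hR y hy
    rw [hkν y hy, rad_congr ht' hy, ht' hy, sqHat_conformal hG hc hcG hcd hdd hn hy,
      rad_add (htd y hy) ((hσd y hy).const_mul _), rad_const_mul (hσd y hy)] at h2
    have h4 : ((n - 1 : ℕ) : ℝ) * ((n - 1 : ℕ) : ℝ)⁻¹ = 1 := mul_inv_cancel₀ hd
    refine mul_left_cancel₀ hd ?_
    simp only [smul_eq_mul]
    linear_combination h3 - h2 + 2 * tHat G y * (rad c y / (2 * c y)) * h4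
  -- On a fixed unit vector orthogonal to the ray both forms tend to 1, hence so does their ratio.
  · obtain ⟨w, hw, hθw⟩ := exists_unit_orthogonal hn θ
    have h2 := tendsto_form_apply hw hθw (hG'.tendsto θ hθ)
    have h3 := tendsto_form_apply hw hθw (hh.tendsto_ray hp hθ)
    have h4 := h2.div h3 one_ne_zero
    rw [div_one] at h4
    refine h4.congr' ?_
    filter_upwards [Ioo_mem_nhdsGT hT, h3.eventually_ne one_ne_zero] with r hr h0
    rw [Pi.div_apply, hcG _ (ray_mem hθ hr), smul_apply, smul_apply, smul_eq_mul,
      mul_div_cancel_right₀ _ h0]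

end LightCone

/-! ### Assembly of the two parts of the theorem -/

theorem mainTheorem5 (n : ℕ) (hn : 2 ≤ n) (k : ℕ∞) (hk : 2 ≤ k) (p : ℕ) (hp : 1 ≤ p)
    (T₀ : ℝ) (hT₀ : 0 < T₀) :
    -- prescribed degenerate form
    (∀ G : LightCone.FormField n, LightCone.IsAdmissibleForm (k + 4) p T₀ G →
      ∃ T : ℝ, 0 < T ∧ T ≤ T₀ ∧
        ∃ (ν₀ : LightCone.Euc n → ℝ) (ν : LightCone.CovectorField n) (g₀₀ : LightCone.Euc n → ℝ),
          LightCone.IsAdmissibleCoefficients k p T ν₀ ν g₀₀ ∧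
          LightCone.FirstConstraint T G ν₀ ∧
          LightCone.SecondConstraint T G ν₀ ν ∧
          LightCone.ThirdConstraint T G ν₀ ν g₀₀ ∧
          (∀ T' : ℝ, 0 < T' → T' ≤ T → ∀ ν₀' : LightCone.Euc n → ℝ,
            LightCone.NuZeroLimit T' ν₀' → LightCone.FirstConstraint T' G ν₀' →
              Set.EqOn ν₀' ν₀ (LightCone.coneRegion n T')) ∧
          LightCone.DetermineNuAndGZeroZero T G ν₀ ν g₀₀) ∧
    -- prescribed conformal class and function `κ`
    (∀ (γ : LightCone.FormField n) (κ : LightCone.Euc n → ℝ),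
      LightCone.IsConformallyAdmissible (k + 5) p T₀ γ →
      LightCone.VertexClass (k + 4) ((p : ℤ) - 1) T₀ κ →
      ∃ T : ℝ, 0 < T ∧ T ≤ T₀ ∧
        ∃ (G : LightCone.FormField n) (ν₀ : LightCone.Euc n → ℝ)
          (ν : LightCone.CovectorField n) (g₀₀ : LightCone.Euc n → ℝ),
          LightCone.IsAdmissibleForm (k + 4) p T G ∧
          LightCone.Conformal T γ G ∧
          LightCone.IsAdmissibleCoefficients k p T ν₀ ν g₀₀ ∧
          LightCone.NuZeroEquation T G κ ν₀ ∧
          LightCone.FirstConstraint T G ν₀ ∧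
          LightCone.SecondConstraint T G ν₀ ν ∧
          LightCone.ThirdConstraint T G ν₀ ν g₀₀ ∧
          (∀ T' : ℝ, 0 < T' → T' ≤ T →
            ∀ (γ' G' : LightCone.FormField n) (ν₀' : LightCone.Euc n → ℝ),
              LightCone.Conformal T' γ γ' → LightCone.Conformal T' γ' G' →
              LightCone.FormLimit T' G' → LightCone.NuZeroLimit T' ν₀' →
              LightCone.NuZeroEquation T' G' κ ν₀' → LightCone.FirstConstraint T' G' ν₀' →
                Set.EqOn G' G (LightCone.coneRegion n T') ∧
                Set.EqOn ν₀' ν₀ (LightCone.coneRegion n T')) ∧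
          LightCone.DetermineNuAndGZeroZero T G ν₀ ν g₀₀) := by
  refine ⟨fun G hG => ?_, fun γ κ hγ hκ => ?_⟩
  · obtain ⟨T, hT, hTT, ν₀, ν, g₀₀, sol⟩ := LightCone.exists_isSolution hn hk hp hT₀ hG
    have hG' := hG.mono hTT
    exact ⟨T, hT, hTT, ν₀, ν, g₀₀, sol.coefficients,
      sol.firstConstraint hG'.1 hG'.2 hT hp hn hk, sol.secondConstraint hG' hT hp hn hk,
      sol.thirdConstraint hG' hT hp hn hk, fun T' hT' hTT' ν₀' hν h =>
        (sol.mono hTT').nuZero_unique (hG'.mono hTT').1 (hG'.mono hTT').2 hT' hp hn hk hν h,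
      sol.determineNuAndGZeroZero hG' hp hn hk⟩
  · obtain ⟨G₀, hG₀, hγ₀⟩ := hγ
    -- `kHat` is r times the function prescribed by κ, and the factor r raises the weight from p - 1
    -- to p.
    have hκ' : LightCone.VertexClass (k + 4) p T₀ fun y : LightCone.Euc n => ‖y‖ * κ y :=
      ((LightCone.VertexClass.norm hT₀).mul hκ hT₀).mono_weight (by omega)
    have hk4 : (1 : ℕ∞) ≤ k + 4 := le_add_left (by norm_num)
    -- The conformal factor costs one derivative, which is why k + 5 is assumed for the conformal
    -- class.
    obtain ⟨T₁, hT₁, hTT₁, G, hG, hGG, hR⟩ := LightCone.exists_conformal_form hn hp hk4 hT₀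
      (by rwa [add_assoc, show (4 : ℕ∞) + 1 = 5 by norm_num]) hκ'
    obtain ⟨T, hT, hTT, ν₀, ν, g₀₀, sol⟩ := LightCone.exists_isSolution hn hk hp hT₁ hG
    have hG' := hG.mono hTT
    have hγG : LightCone.Conformal T γ G :=
      (hγ₀.mono (hTT.trans hTT₁)).trans (hGG.mono hTT)
    -- G was built so that `alp G` = rκ. The ν₀ given by 𝒞₁ for this G therefore satisfies the
    -- prescribed equation automatically.
    have hkH : ∀ y ∈ LightCone.coneRegion n T, LightCone.kHat G ν₀ y = ‖y‖ * κ y :=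
      fun y hy => by
        rw [sol.kHat_eq y hy, LightCone.alp, ← hR y (LightCone.coneRegion_mono hTT hy),
          mul_div_cancel_right₀ _ (sol.dim_add_tHat_pos y hy).ne']
    refine ⟨T, hT, hTT.trans hTT₁, G, ν₀, ν, g₀₀, hG', hγG, sol.coefficients,
      (LightCone.nuZeroEquation_iff hG'.1 hn (LightCone.diffOn_dev hG'.2) (sol.diffOn_nuZero hk)
        sol.nuZero_ne_zero).2 hkH,
      sol.firstConstraint hG'.1 hG'.2 hT hp hn hk, sol.secondConstraint hG' hT hp hn hk,
      sol.thirdConstraint hG' hT hp hn hk, ?_, sol.determineNuAndGZeroZero hG' hp hn hk⟩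
    intro T' hT' hTT' γ' G' ν₀' hγγ' hγG' hGl hνl hνeq h1
    have hGT := hG'.mono hTT'
    have hνd : LightCone.DiffOn T' ν₀' :=
      LightCone.DiffOn.of_contDiffOn (by norm_num) hνl.contDiffOn
    have hGd : LightCone.DiffOn T' (LightCone.dev G') := fun y hy =>
      (LightCone.DiffOn.of_contDiffOn (N := 2) (by norm_num) hGl.contDiffOn y hy).sub
        (LightCone.differentiableAt_roundForm (LightCone.ne_zero_of_mem hy))
    rw [LightCone.nuZeroEquation_iff hGl.degenerate hn hGd hνd hνl.ne_zero] at hνeq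
    -- The forms must be identified before ν₀' and ν₀ can be compared as solutions of the same
    -- equation.
    have hEq := LightCone.conformal_unique hn hp hT' hGT hGl
      (((hγG.mono hTT').symm.trans hγγ').trans hγG')
      (hκ'.mono_radius ((hTT'.trans hTT).trans hTT₁))
      (fun y hy => hR y (LightCone.coneRegion_mono (hTT'.trans hTT) hy)) hνd hνeq h1
    refine ⟨hEq, (sol.mono hTT').nuZero_unique hGT.1 hGT.2 hT' hp hn hk hνl ?_⟩
    refine ((sol.mono hTT').firstConstraint_iff hGT.1 hGT.2 hT' hp hn hνd).2 fun y hy => ?_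
    rw [← LightCone.kHat_congr hEq ν₀' hy, hνeq y hy,
      hkH y (LightCone.coneRegion_mono hTT' hy)]
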